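/- For $v=(v_1,v_2)\in\mathbf R^2$ put $v^\perp=(v_2,-v_1)$. For real $s\ge 0$ let $W^{s,\infty}(\mathbf R^2)$ be the usual Sobolev space (weak derivatives up to order $\lfloor s\rfloor$ are bounded and, if $s$ is not an integer, those of order $\lfloor s\rfloor$ are Hölder continuous of exponent $s-\lfloor s\rfloor$). Let $s\ge 1$ be real, and let $b\in C^\infty(\mathbf R^2)\cap W^{2,\infty}(\mathbf R^2)$ satisfy $\inf b=b_->0$; if $s>2$, assume moreover $b\in W^{s,\infty}(\mathbf R^2)$. Let $\rho_0\in W^{s-1,\infty}(\mathbf R^2)$, $\rho_0\ge 0$, and let $u_0\in W^{s,\infty}(\mathbf R^2)$ be a vector field. Define $$T^*=\big(\|u_0\|_{L^\infty}\,\|\nabla\log b\|_{L^\infty}\big)^{-1}\in\,]0,+\infty]\qquad(1/0=+\infty).$$ Then for every $0<T<T^*$ there is $\varepsilon_T>0$ such that for all $0<\varepsilon\le\varepsilon_T$ the following holds. (Existence) There is $(\rho_\varepsilon,u_\varepsilon)\in L^\infty([0,T],W^{s-1,\infty}(\mathbf R^2)\times W^{s,\infty}(\mathbf R^2))$ which solves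 on $[0,T]\times\mathbf R^2$, in the sense of distributions, the pressureless Euler system $$\partial_t\rho+\nabla\cdot(\rho u)=0,\qquad \partial_t(\rho u)+\nabla\cdot(\rho u\otimes u)=\frac b\varepsilon\,\rho u^\perp,\qquad \rho(0)=\rho_0,\quad (\rho u)(0)=\rho_0u_0,$$ as well as the velocity equation $$\partial_t u+(u\cdot\nabla)u=\frac b\varepsilon u^\perp,\qquad u(0)=u_0,$$ which determines the velocity also in vacuum. (Uniqueness) It is the only pair in this space (up to equality almost everywhere) that satisfies the continuity equation and the velocity equation, with these initial data. If $\rho_0>0$ almost everywhere, it is also the only pair in this space that satisfies the Euler system alone. (No uniform bound) Unless $u_0=0$ or $\nabla b=0$ at almost every point of $\mathbf R^2$, for every $\sigma>0$ (in particular for $\sigma=s$) and every $\delta\in(0,\varepsilon_T]$ the family $(u_\varepsilon)_{0<\varepsilon\le\delta}$ is not bounded in $L^\infty([0,T],W^{\sigma,\infty}(\mathbf R^2))$; hence $(\rho_\varepsilon,u_\varepsilon)$ is not uniformly bounded in $L^\infty([0,T],W^{s-1,\infty}\times W^{s,\infty})$. -/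

import Mathlib

open MeasureTheory Set
open scoped ContDiff ENNReal

noncomputable section

/-- The plane `ℝ²` with its Euclidean norm. -/
abbrev Plane : Type := EuclideanSpace ℝ (Fin 2)

/-- The `i`-th vector of the canonical basis of the plane. -/
def basisVec (i : Fin 2) : Plane := EuclideanSpace.single i (1 : ℝ)

/-- The rotated vector `v^⊥ = (v₂, -v₁)`. -/
def perp (v : Plane) : Plane := !₂[v 1, -(v 0)]

/-- `g` is the weak (distributional) derivative of `f` in the direction `v`:
`∫ (∂_v φ) f = - ∫ φ g` for every real test function `φ ∈ C_c^∞(ℝ²)`. -/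
def IsWeakDeriv {F : Type*} [NormedAddCommGroup F] [NormedSpace ℝ F]
    (v : Plane) (f g : Plane → F) : Prop :=
  LocallyIntegrable f volume ∧ LocallyIntegrable g volume ∧
    ∀ φ : Plane → ℝ, ContDiff ℝ ∞ φ → HasCompactSupport φ →
      ∫ x, (fderiv ℝ φ x v) • f x = - ∫ x, φ x • g x

/-- `WBoundAux θ M k f` : the norm of `f` in `W^{k+θ,∞}(ℝ²)` is at most `M`, where `k` is an integer
and `0 ≤ θ < 1`. All weak derivatives of order at most `k` are bounded by `M` almost
everywhere, and if `θ > 0` those of order `k` are Hölder continuous of exponent `θ` with constant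
`M` (almost everywhere). -/
def WBoundAux {F : Type*} [NormedAddCommGroup F] [NormedSpace ℝ F] (θ M : ℝ) :
    ℕ → (Plane → F) → Prop
  | 0, f =>
      AEStronglyMeasurable f volume ∧ (∀ᵐ x, ‖f x‖ ≤ M) ∧
        (0 < θ → ∀ᵐ p : Plane × Plane ∂(volume.prod volume),
          ‖f p.1 - f p.2‖ ≤ M * ‖p.1 - p.2‖ ^ θ)
  | k + 1, f =>
      AEStronglyMeasurable f volume ∧ (∀ᵐ x, ‖f x‖ ≤ M) ∧
        ∀ i : Fin 2, ∃ g : Plane → F, IsWeakDeriv (basisVec i) f g ∧ WBoundAux θ M k g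

/-- `‖f‖_{W^{s,∞}(ℝ²)} ≤ M`, for a real `s ≥ 0`. -/
def WBound {F : Type*} [NormedAddCommGroup F] [NormedSpace ℝ F] (s M : ℝ) (f : Plane → F) : Prop :=
  WBoundAux (Int.fract s) M ⌊s⌋₊ f

/-- `f ∈ W^{s,∞}(ℝ²)`, for a real `s ≥ 0`. -/
def MemW {F : Type*} [NormedAddCommGroup F] [NormedSpace ℝ F] (s : ℝ) (f : Plane → F) : Prop :=
  ∃ M : ℝ, WBound s M f

/-- Lebesgue measure on the space-time slab `[0,T] × ℝ²`. -/
def slab (T : ℝ) : Measure (ℝ × Plane) := (volume.restrict (Icc 0 T)).prod volume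

/-- The norm of `f` in `L^∞([0,T], W^{s,∞}(ℝ²))` is at most `M`. -/
def LinftyWBound {F : Type*} [NormedAddCommGroup F] [NormedSpace ℝ F] (T s M : ℝ)
    (f : ℝ → Plane → F) : Prop :=
  AEStronglyMeasurable (fun p : ℝ × Plane => f p.1 p.2) (slab T) ∧
    ∀ᵐ t ∂(volume.restrict (Icc 0 T)), WBound s M (f t)

/-- `f ∈ L^∞([0,T], W^{s,∞}(ℝ²))`. -/
def MemLinftyW {F : Type*} [NormedAddCommGroup F] [NormedSpace ℝ F] (T s : ℝ)
    (f : ℝ → Plane → F) : Prop :=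
  ∃ M : ℝ, LinftyWBound T s M f

/-- Equality of two fields almost everywhere on `[0,T] × ℝ²`. -/
def EqOnSlab {F : Type*} (T : ℝ) (f g : ℝ → Plane → F) : Prop :=
  ∀ᵐ p : ℝ × Plane ∂(slab T), f p.1 p.2 = g p.1 p.2

/-- Test functions on `[0,T) × ℝ²`: smooth, compactly supported, vanishing near and after time `T`
but not necessarily at time `0`. -/
def IsTestFunction (T : ℝ) (ψ : ℝ × Plane → ℝ) : Prop :=
  ContDiff ℝ ∞ ψ ∧ HasCompactSupport ψ ∧ tsupport ψ ⊆ Iio T ×ˢ univ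

/-- Weak form on `[0,T]` of `∂_t ρ + ∇·(ρ u) = 0`, `ρ(0) = ρ₀`.
Here `fderiv ℝ ψ p (1, v)` is `∂_t ψ + v·∇ψ`. -/
def SolvesContinuity (T : ℝ) (ρ₀ : Plane → ℝ) (ρ : ℝ → Plane → ℝ) (u : ℝ → Plane → Plane) : Prop :=
  ∀ ψ : ℝ × Plane → ℝ, IsTestFunction T ψ →
    (∫ p, ρ p.1 p.2 * fderiv ℝ ψ p (1, u p.1 p.2) ∂(slab T)) + ∫ x, ρ₀ x * ψ (0, x) = 0

/-- Weak form on `[0,T]` of `∂_t (ρ u) + ∇·(ρ u ⊗ u) = (b/ε) ρ u^⊥`, `(ρ u)(0) = ρ₀ u₀`. -/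
def SolvesMomentum (T ε : ℝ) (b : Plane → ℝ) (ρ₀ : Plane → ℝ) (u₀ : Plane → Plane)
    (ρ : ℝ → Plane → ℝ) (u : ℝ → Plane → Plane) : Prop :=
  ∀ ψ : ℝ × Plane → ℝ, IsTestFunction T ψ →
    (∫ p, ((ρ p.1 p.2 * fderiv ℝ ψ p (1, u p.1 p.2)) • u p.1 p.2
        + (ψ p * (b p.2 / ε) * ρ p.1 p.2) • perp (u p.1 p.2)) ∂(slab T))
      + ∫ x, (ρ₀ x * ψ (0, x)) • u₀ x = 0

/-- Weak form on `[0,T]` of the velocity equation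
`∂_t u + (u·∇) u = (b/ε) u^⊥`, `u(0) = u₀`, where `G i` is the weak derivative `∂_i u` in space. -/
def SolvesVelocity (T ε : ℝ) (b : Plane → ℝ) (u₀ : Plane → Plane) (u : ℝ → Plane → Plane) : Prop :=
  ∃ G : Fin 2 → ℝ → Plane → Plane,
    (∀ i, AEStronglyMeasurable (fun p : ℝ × Plane => G i p.1 p.2) (slab T)) ∧
    (∀ᵐ t ∂(volume.restrict (Icc 0 T)), ∀ i, IsWeakDeriv (basisVec i) (u t) (G i t)) ∧
    ∀ ψ : ℝ × Plane → ℝ, IsTestFunction T ψ →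
      (∫ p, (fderiv ℝ ψ p (1, 0) • u p.1 p.2
          + ψ p • ((b p.2 / ε) • perp (u p.1 p.2) - ∑ i, (u p.1 p.2 i) • G i p.1 p.2)) ∂(slab T))
        + ∫ x, ψ (0, x) • u₀ x = 0

end

/-!
The velocity equation says that particles move by `X' = V`, `V' = (b(X)/ε) V^⊥`. Hence the speed is
conserved and `V` is the initial velocity turned by the angle `Φ/ε`, `Φ' = b(X)`. The whole theorem
is about the maps `X_t` so defined: as long as they are bi-Lipschitz, `u = V ∘ X_t⁻¹` and
`ρ = (ρ₀ ∘ X_t⁻¹) |det D X_t⁻¹|` solve the equations.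

**Why `T^*`.** In terms of the angle `τ`, a trajectory solves `dz/dτ = (ε/b(z)) rot τ v`, where the
right-hand side oscillates. Integration by parts in `τ` shows that the difference of two
trajectories *at equal angles* stays within `O(ε)` of its initial value, relative to the initial
distance (`FieldBounds.phaseCurve_sub_le`). At equal *times* the angles differ; since the time needed
to reach an angle is the integral of `ε/b`, the discrepancy of the clocks is at most
`T (e^{Λ d} - 1)` for trajectories at distance `d`, with `Λ = ‖∇ log b‖`, and costs at most
`U = ‖u₀‖` times as much in position (`FieldBounds.timeCurve_sub_le`). So the Lipschitz constant of
`X_t - id` is at most `T U Λ + o(1)`, which is less than `1` for small `ε` when `T < T^* = 1/(U Λ)`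
(`FieldBounds.exists_contraction`), and `X_t` is bi-Lipschitz.

**Regularity.** Every `s > 0` is `k + α` with `0 < α ≤ 1`, and then `W^{s,∞}` is the Hölder space
`C^{k,α}`, up to null sets (`MemW.exists_uHol_rep`, `UHol.exists_wBound`). Differentiable dependence
of solutions of differential equations on parameters (`UDer.ode`) and the regularity of inverse maps
(`UDer.inverse`) transfer the class of the data to `X_t`, `X_t⁻¹`, `V` and the solution, for each
fixed `ε`. That the solution so defined is one in the sense of distributions is the chain rule along
the trajectories (`IsParticleFlow.solvesContinuity`, `IsParticleFlow.solvesMomentum`,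
`IsParticleFlow.solvesVelocity`).

**Uniqueness.** A velocity in `L^∞([0,T], W^{s,∞})`, `s ≥ 1`, has Lipschitz time slices and hence a
bi-Lipschitz flow (`exists_isFlow`). Weak transport equations may be tested with Lipschitz functions
(`SolvesTransport.of_smooth`), so they can be pulled back by the flow to equations in time alone
(`SolvesTransport.pullback`, `SolvesTransport.eq_add_integral`). In this way either the velocity
equation or, off vacuum, the momentum equation yields `V' = (b(X)/ε) V^⊥` along almost every
trajectory, an ordinary differential equation with a unique solution (`IsLagrangian.ae_unique`). Its
trajectories determine the velocity and, by the continuity equation, the density.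

**No uniform bound.** Particles stay within `O(ε)` of their starting points, so the angle at time `t`
is `t b(x)/ε + O(1)`. Near a point where `u₀ ≠ 0` and `∇b ≠ 0` there are therefore two particles at
distance `O(ε)` with opposite velocities (`FieldBounds.exists_oscillation`), which no bound in
`W^{σ,∞}`, `σ > 0`, permits as `ε → 0` (`FieldBounds.exists_not_linftyWBound`).
-/

open Filter Topology
open scoped NNReal Convolution


/-! ### Integral equations and inequalities -/

/-- The integral form of Gronwall's inequality, without optimal constants. At the maximum point of
`e^{-lt} φ(t)`, `l = 2K + 1`, the integral term contributes at most half of the maximum. -/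
theorem gronwall_integral {φ : ℝ → ℝ} {T a K : ℝ} (hK : 0 ≤ K)
    (hφ : ContinuousOn φ (Icc 0 T)) (hφ0 : ∀ t ∈ Icc 0 T, 0 ≤ φ t)
    (h : ∀ t ∈ Icc 0 T, φ t ≤ a + K * ∫ s in (0 : ℝ)..t, φ s) :
    ∀ t ∈ Icc 0 T, φ t ≤ 2 * a * Real.exp ((2 * K + 1) * T) := by
  intro t ht
  have hT : 0 ≤ T := ht.1.trans ht.2
  set l := 2 * K + 1 with hl
  have hl0 : 0 < l := by positivity
  obtain ⟨t0, ht0, hmax⟩ := isCompact_Icc.exists_isMaxOn (nonempty_Icc.2 hT)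
    (f := fun t => Real.exp (-(l * t)) * φ t) (by fun_prop)
  set m := Real.exp (-(l * t0)) * φ t0 with hm
  have hbd : ∀ s ∈ Icc 0 T, φ s ≤ m * Real.exp (l * s) := by
    intro s hs
    have h1 : Real.exp (-(l * s)) * φ s ≤ m := hmax hs
    calc φ s = (Real.exp (-(l * s)) * φ s) * Real.exp (l * s) := by
          rw [mul_right_comm, ← Real.exp_add]; simp
      _ ≤ _ := by gcongr
  have hm0 : 0 ≤ m := mul_nonneg (Real.exp_pos _).le (hφ0 _ ht0)
  have hint : ∫ s in (0 : ℝ)..t0, φ s ≤ m * (Real.exp (l * t0) / l) := by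
    calc ∫ s in (0 : ℝ)..t0, φ s ≤ ∫ s in (0 : ℝ)..t0, m * Real.exp (l * s) := by
          apply intervalIntegral.integral_mono_on ht0.1
          · apply ContinuousOn.intervalIntegrable
            rw [uIcc_of_le ht0.1]; exact hφ.mono (Icc_subset_Icc le_rfl ht0.2)
          · apply Continuous.intervalIntegrable; fun_prop
          · intro s hs; exact hbd s ⟨hs.1, hs.2.trans ht0.2⟩
      _ = m * ((Real.exp (l * t0) - 1) / l) := by
          rw [intervalIntegral.integral_const_mul, intervalIntegral.integral_comp_mul_left _ hl0.ne']
          simp [integral_exp, div_eq_inv_mul]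
      _ ≤ _ := by gcongr; linarith
  have hm2 : m ≤ 2 * a := by
    have h1 := h t0 ht0
    have h2 : K * ∫ s in (0 : ℝ)..t0, φ s ≤ (m * Real.exp (l * t0)) / 2 := by
      calc K * ∫ s in (0 : ℝ)..t0, φ s ≤ K * (m * (Real.exp (l * t0) / l)) := by gcongr
        _ = (K / l) * (m * Real.exp (l * t0)) := by ring
        _ ≤ (1 / 2) * (m * Real.exp (l * t0)) := by
            have : K / l ≤ 1 / 2 := by
              rw [div_le_div_iff₀ hl0 (by norm_num)]; linarith
            exact mul_le_mul_of_nonneg_right this (by positivity)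
        _ = _ := by ring
    have h3 : φ t0 = m * Real.exp (l * t0) := by
      rw [hm, mul_right_comm, ← Real.exp_add]; simp
    have h4 : 1 ≤ Real.exp (l * t0) := Real.one_le_exp (mul_nonneg hl0.le ht0.1)
    have ha : m * Real.exp (l * t0) ≤ 2 * a := by linarith
    nlinarith
  have ha : 0 ≤ a := by linarith
  calc φ t ≤ m * Real.exp (l * t) := hbd t ht
    _ ≤ 2 * a * Real.exp (l * T) := by
      gcongr; exact ht.2

section Picard
variable {E : Type*} [NormedAddCommGroup E]

theorem intervalIntegrable_of_lipschitz_field {f : ℝ → E → E} {K C : ℝ} 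
    (hmeas : ∀ z : ℝ → E, Continuous z → AEStronglyMeasurable (fun t => f t (z t)) volume)
    (hlip : ∀ t x y, ‖f t x - f t y‖ ≤ K * ‖x - y‖) (hbd : ∀ t, ‖f t 0‖ ≤ C)
    {z : ℝ → E} (hz : Continuous z) (a b : ℝ) :
    IntervalIntegrable (fun t => f t (z t)) volume a b := by
  have h1 : IntervalIntegrable (fun t => C + K * ‖z t‖) volume a b :=
    (by fun_prop : Continuous fun t => C + K * ‖z t‖).intervalIntegrable _ _
  refine h1.mono_fun (hmeas z hz).restrict (Eventually.of_forall fun t => ?_)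
  have h2 := hlip t (z t) 0
  have h3 := hbd t
  rw [sub_zero] at h2
  calc ‖f t (z t)‖ = ‖f t 0 + (f t (z t) - f t 0)‖ := by congr 1; abel
    _ ≤ C + K * ‖z t‖ := (norm_add_le _ _).trans (add_le_add h3 h2)
    _ ≤ _ := le_abs_self _

/-- The weight `e^{l max(s,0)}` is bounded at negative times, where no equation is imposed. -/
theorem integral_exp_le {l t : ℝ} (hl : 0 < l) (ht : 0 ≤ t) (c : ℝ) (hc : 0 ≤ c) :
    ∫ s in (0 : ℝ)..t, c * Real.exp (l * max s 0) ≤ c * Real.exp (l * t) / l := by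
  have : ∫ s in (0 : ℝ)..t, c * Real.exp (l * max s 0) = ∫ s in (0 : ℝ)..t, c * Real.exp (l * s) := by
    apply intervalIntegral.integral_congr
    intro s hs
    rw [uIcc_of_le ht] at hs
    simp [hs.1]
  rw [this, intervalIntegral.integral_const_mul, intervalIntegral.integral_comp_mul_left _ hl.ne',
    mul_div_assoc]
  simp only [mul_zero, integral_exp, Real.exp_zero, smul_eq_mul]
  gcongr
  rw [inv_mul_eq_div]
  gcongr; linarith

variable [NormedSpace ℝ E]

/-- Carathéodory's theorem for a field which is Lipschitz in space and only measurable in time. The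
Picard map is a contraction for the norm `sup e^{-lt} ‖z(t)‖`, `l = 2K + 1`, on all `t ≥ 0` at once. -/
theorem exists_integral_curve [CompleteSpace E] {f : ℝ → E → E} {K C : ℝ} (hK : 0 ≤ K)
    (hmeas : ∀ z : ℝ → E, Continuous z → AEStronglyMeasurable (fun t => f t (z t)) volume)
    (hlip : ∀ t x y, ‖f t x - f t y‖ ≤ K * ‖x - y‖) (hbd : ∀ t, ‖f t 0‖ ≤ C) (z0 : E) :
    ∃ z : ℝ → E, Continuous z ∧ ∀ t, 0 ≤ t → z t = z0 + ∫ s in (0 : ℝ)..t, f s (z s) := by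
  set l := 2 * K + 1 with hl
  have hl0 : 0 < l := by positivity
  have hC : 0 ≤ C := (norm_nonneg _).trans (hbd 0)
  -- the curve is `W y`; in terms of `y` the weighted norm is the supremum norm
  let W : (ℝ → E) → ℝ → E := fun y t => Real.exp (l * max t 0) • y t
  let A : (ℝ → E) → ℝ → E := fun y t => Real.exp (-(l * max t 0)) •
    (z0 + ∫ s in (0 : ℝ)..(max t 0), f s (W y s))
  have hWc : ∀ y : BoundedContinuousFunction ℝ E, Continuous (W y) := fun y => by
    have := y.continuous
    simp only [W]; fun_prop
  have hii : ∀ (y : BoundedContinuousFunction ℝ E) a b,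
      IntervalIntegrable (fun t => f t (W y t)) volume a b := fun y a b =>
    intervalIntegrable_of_lipschitz_field hmeas hlip hbd (hWc y) a b
  have hAc : ∀ y : BoundedContinuousFunction ℝ E, Continuous (A y) := fun y => by
    have h1 : Continuous fun t => ∫ s in (0 : ℝ)..t, f s (W y s) :=
      intervalIntegral.continuous_primitive (hii y) 0
    have h2 : Continuous fun t : ℝ => ∫ s in (0 : ℝ)..(max t 0), f s (W y s) :=
      h1.comp (by fun_prop)
    simp only [A]; fun_prop
  have hWb : ∀ (y : BoundedContinuousFunction ℝ E) s,
      ‖W y s‖ ≤ Real.exp (l * max s 0) * ‖y‖ := fun y s => by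
    simp only [W, norm_smul, Real.norm_eq_abs, Real.abs_exp]
    gcongr; exact y.norm_coe_le_norm s
  have hAb : ∀ y : BoundedContinuousFunction ℝ E, ∃ B, ∀ t, ‖A y t‖ ≤ B := fun y => by
    refine ⟨‖z0‖ + (C + K * ‖y‖) / l, fun t => ?_⟩
    have h1 : ‖∫ s in (0 : ℝ)..(max t 0), f s (W y s)‖ ≤
        (C + K * ‖y‖) * Real.exp (l * max t 0) / l := by
      refine le_trans ?_ (integral_exp_le hl0 (le_max_right t 0) (C + K * ‖y‖) (by positivity))
      apply intervalIntegral.norm_integral_le_of_norm_le (le_max_right t 0)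
      · refine ae_of_all _ fun s _ => ?_
        have h2 := hlip s (W y s) 0
        rw [sub_zero] at h2
        have h4 : 1 ≤ Real.exp (l * max s 0) :=
          Real.one_le_exp (mul_nonneg hl0.le (le_max_right _ _))
        calc ‖f s (W y s)‖ = ‖f s 0 + (f s (W y s) - f s 0)‖ := by congr 1; abel
          _ ≤ C + K * ‖W y s‖ := (norm_add_le _ _).trans (add_le_add (hbd s) h2)
          _ ≤ C * Real.exp (l * max s 0) + K * (Real.exp (l * max s 0) * ‖y‖) := by
              gcongr
              · exact le_mul_of_one_le_right hC h4
              · exact hWb y s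
          _ = _ := by ring
      · apply Continuous.intervalIntegrable; fun_prop
    have h5 : Real.exp (-(l * max t 0)) ≤ 1 := by
      rw [Real.exp_le_one_iff]; have := mul_nonneg hl0.le (le_max_right t 0); linarith
    calc ‖A y t‖ ≤ Real.exp (-(l * max t 0)) *
          (‖z0‖ + (C + K * ‖y‖) * Real.exp (l * max t 0) / l) := by
          simp only [A, norm_smul, Real.norm_eq_abs, Real.abs_exp]
          gcongr
          exact (norm_add_le _ _).trans (by gcongr)
      _ = Real.exp (-(l * max t 0)) * ‖z0‖ + (C + K * ‖y‖) / l *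
          (Real.exp (-(l * max t 0)) * Real.exp (l * max t 0)) := by ring
      _ ≤ _ := by
        rw [← Real.exp_add]; simp only [neg_add_cancel, Real.exp_zero, mul_one]
        gcongr
        exact mul_le_of_le_one_left (norm_nonneg _) h5
  choose B hB using hAb
  let F : BoundedContinuousFunction ℝ E → BoundedContinuousFunction ℝ E := fun y =>
    BoundedContinuousFunction.ofNormedAddCommGroup (A y) (hAc y) (B y) (hB y)
  have hF : ContractingWith (1 / 2) F := by
    refine ⟨by norm_num, LipschitzWith.of_dist_le_mul fun y y' => ?_⟩
    rw [BoundedContinuousFunction.dist_le (by positivity)]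
    intro t
    rw [dist_eq_norm, dist_eq_norm]
    change ‖A y t - A y' t‖ ≤ _
    have h1 : ‖(∫ s in (0 : ℝ)..(max t 0), f s (W y s)) - ∫ s in (0 : ℝ)..(max t 0), f s (W y' s)‖ ≤
        (K * ‖y - y'‖) * Real.exp (l * max t 0) / l := by
      rw [← intervalIntegral.integral_sub (hii y _ _) (hii y' _ _)]
      refine le_trans ?_ (integral_exp_le hl0 (le_max_right t 0) (K * ‖y - y'‖) (by positivity))
      apply intervalIntegral.norm_integral_le_of_norm_le (le_max_right t 0)
      · refine ae_of_all _ fun s _ => (hlip s _ _).trans ?_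
        rw [mul_assoc]
        gcongr
        have := hWb (y - y') s
        rw [mul_comm]
        simpa [W, smul_sub] using this
      · apply Continuous.intervalIntegrable; fun_prop
    have h2 : A y t - A y' t = Real.exp (-(l * max t 0)) •
        ((∫ s in (0 : ℝ)..(max t 0), f s (W y s)) - ∫ s in (0 : ℝ)..(max t 0), f s (W y' s)) := by
      simp only [A, ← smul_sub]; congr 1; abel
    rw [h2, norm_smul, Real.norm_eq_abs, Real.abs_exp]
    calc _ ≤ Real.exp (-(l * max t 0)) * ((K * ‖y - y'‖) * Real.exp (l * max t 0) / l) := by gcongr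
      _ = (Real.exp (-(l * max t 0)) * Real.exp (l * max t 0)) * (K / l * ‖y - y'‖) := by ring
      _ = K / l * ‖y - y'‖ := by rw [← Real.exp_add]; simp
      _ ≤ _ := by
        have : K / l ≤ 1 / 2 := by
          rw [div_le_div_iff₀ hl0 (by norm_num)]; linarith
        simpa using mul_le_mul_of_nonneg_right this (norm_nonneg (y - y'))
  have hfix := hF.fixedPoint_isFixedPt
  set y := hF.fixedPoint F
  refine ⟨W y, hWc y, fun t ht => ?_⟩
  have h1 : y t = A y t := by
    conv_lhs => rw [← hfix]
    rfl
  have h2 : max t 0 = t := max_eq_left ht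
  change Real.exp (l * max t 0) • y t = _
  rw [h1]
  simp only [A, smul_smul, ← Real.exp_add, h2]
  simp

/-- The fundamental theorem of calculus for a Lipschitz curve differentiable almost everywhere. -/
theorem sub_eq_integral_of_ae_hasDerivAt [CompleteSpace E] [SecondCountableTopology E]
    {h g : ℝ → E} {a b : ℝ} {L : ℝ≥0} {M : ℝ} (hab : a ≤ b)
    (hh : LipschitzOnWith L h (Icc a b))
    (hgm : AEStronglyMeasurable g (volume.restrict (Icc a b))) 
    (hgb : ∀ᵐ t ∂volume.restrict (Icc a b), ‖g t‖ ≤ M)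
    (hd : ∀ᵐ t ∂volume.restrict (Icc a b), HasDerivAt h (g t) t) :
    IntervalIntegrable g volume a b ∧ h b - h a = ∫ t in a..b, g t := by
  have hii : IntervalIntegrable g volume a b := by
    rw [intervalIntegrable_iff_integrableOn_Icc_of_le hab]
    exact Integrable.of_bound hgm M hgb
  refine ⟨hii, ?_⟩
  have hlip : LipschitzOnWith (Real.toNNReal M) (fun x => ∫ t in a..x, g t) (Icc a b) := by
    apply LipschitzOnWith.of_dist_le_mul
    intro x hx y hy
    have hs : uIcc a b = Icc a b := uIcc_of_le hab
    have hix : ∀ x ∈ Icc a b, IntervalIntegrable g volume a x := fun x hx =>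
      hii.mono_set (by rw [hs, uIcc_of_le hx.1]; exact Icc_subset_Icc le_rfl hx.2)
    rw [dist_eq_norm, intervalIntegral.integral_interval_sub_left (hix x hx) (hix y hy), dist_eq_norm,
      Real.norm_eq_abs]
    apply intervalIntegral.norm_integral_le_of_norm_le_const_ae
    have h2 := (ae_restrict_iff' measurableSet_Icc).1 hgb
    filter_upwards [h2] with t ht ht2
    refine (ht ?_).trans (Real.le_coe_toNNReal M)
    have h3 : uIcc y x ⊆ Icc a b := by rw [← hs]; exact uIcc_subset_uIcc (hs ▸ hy) (hs ▸ hx)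
    exact h3 (uIoc_subset_uIcc ht2)
  have hac : AbsolutelyContinuousOnInterval (h - fun x => ∫ t in a..x, g t) a b := by
    rw [← uIcc_of_le hab] at hh hlip
    exact hh.absolutelyContinuousOnInterval.sub hlip.absolutelyContinuousOnInterval
  obtain ⟨c, hc⟩ := hac.const_of_ae_hasDerivAt_zero (by
    have h2 := (ae_restrict_iff' measurableSet_Icc).1 hd
    filter_upwards [h2, hii.ae_hasDerivAt_integral] with t h1 h2 ht
    have := (h1 (uIcc_of_le hab ▸ ht)).sub (h2 ht a left_mem_uIcc)
    simpa using this)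
  have ha := hc a left_mem_uIcc
  have hb := hc b right_mem_uIcc
  simp only [Pi.sub_apply, intervalIntegral.integral_same, sub_zero] at ha hb
  rw [ha, ← hb]; abel

end Picard

/-! ### Families bounded in Hölder spaces -/

section UHol
variable {ι E G V : Type} [NormedAddCommGroup E] [NormedSpace ℝ E]
  [NormedAddCommGroup G] [NormedSpace ℝ G]
  [NormedAddCommGroup V] [NormedSpace ℝ V]

/-- The family `(f i)`, `i ∈ I`, is bounded in the Hölder space `C^{k,α}`, where `0 < α ≤ 1` and
`α = 1` means Lipschitz derivatives. Bounds for families give estimates uniform in time when `i` is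
the time variable. -/
def UHol (α : ℝ) (I : Set ι) : ∀ (_ : ℕ) {F : Type} [NormedAddCommGroup F] [NormedSpace ℝ F],
    (ι → E → F) → Prop
  | 0, _, _, _, f => ∃ M : ℝ, ∀ i ∈ I, (∀ x, ‖f i x‖ ≤ M) ∧ ∀ x y, ‖f i x - f i y‖ ≤ M * ‖x - y‖ ^ α
  | k + 1, _, _, _, f => (∃ M : ℝ, ∀ i ∈ I, ∀ x, ‖f i x‖ ≤ M) ∧ (∀ i ∈ I, Differentiable ℝ (f i)) ∧
      UHol α I k (fun i => fderiv ℝ (f i))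

/-- The family `(f i)`, `i ∈ I`, is bounded in `C^{k,α}` up to the size of the functions
themselves: for `k = 0` it is uniformly Lipschitz, for `k ≥ 1` the derivatives are bounded
in `C^{k-1,α}`. -/
def UDer (α : ℝ) (I : Set ι) {F : Type} [NormedAddCommGroup F] [NormedSpace ℝ F] :
    ℕ → (ι → E → F) → Prop
  | 0, f => ∃ M : ℝ, ∀ i ∈ I, ∀ x y, ‖f i x - f i y‖ ≤ M * ‖x - y‖
  | k + 1, f => (∀ i ∈ I, Differentiable ℝ (f i)) ∧ UHol α I k (fun i => fderiv ℝ (f i))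

variable {α : ℝ} {I : Set ι} {k : ℕ} {F H : Type} [NormedAddCommGroup F] [NormedSpace ℝ F]
  [NormedAddCommGroup H] [NormedSpace ℝ H]

theorem UHol.congr {f g : ι → E → F} (hf : UHol α I k f) (h : ∀ i ∈ I, f i = g i) :
    UHol α I k g := by
  induction k generalizing F with
  | zero =>
    obtain ⟨M, hM⟩ := hf
    exact ⟨M, fun i hi => h i hi ▸ hM i hi⟩
  | succ k ih =>
    obtain ⟨⟨M, hM⟩, h2, h3⟩ := hf
    exact ⟨⟨M, fun i hi => h i hi ▸ hM i hi⟩, fun i hi => h i hi ▸ h2 i hi,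
      ih h3 fun i hi => by rw [h i hi]⟩

theorem UDer.congr {f g : ι → E → F} (hf : UDer α I k f) (h : ∀ i ∈ I, f i = g i) :
    UDer α I k g := by
  cases k with
  | zero =>
    obtain ⟨M, hM⟩ := hf
    exact ⟨M, fun i hi => h i hi ▸ hM i hi⟩
  | succ k => exact ⟨fun i hi => h i hi ▸ hf.1 i hi, hf.2.congr fun i hi => by rw [h i hi]⟩

theorem UHol.bdd {f : ι → E → F} (hf : UHol α I k f) :
    ∃ M : ℝ, 0 ≤ M ∧ ∀ i ∈ I, ∀ x, ‖f i x‖ ≤ M := by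
  have : ∃ M : ℝ, ∀ i ∈ I, ∀ x, ‖f i x‖ ≤ M := by
    cases k with
    | zero => obtain ⟨M, hM⟩ := hf; exact ⟨M, fun i hi => (hM i hi).1⟩
    | succ k => exact hf.1
  obtain ⟨M, hM⟩ := this
  exact ⟨max M 0, le_max_right _ _, fun i hi x => (hM i hi x).trans (le_max_left _ _)⟩

theorem UDer.lip {f : ι → E → F} (hf : UDer α I k f) :
    ∃ M : ℝ, 0 ≤ M ∧ ∀ i ∈ I, ∀ x y, ‖f i x - f i y‖ ≤ M * ‖x - y‖ := by
  have : ∃ M : ℝ, ∀ i ∈ I, ∀ x y, ‖f i x - f i y‖ ≤ M * ‖x - y‖ := by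
    cases k with
    | zero => exact hf
    | succ k =>
      obtain ⟨M, -, hM⟩ := hf.2.bdd
      exact ⟨M, fun i hi x y => convex_univ.norm_image_sub_le_of_norm_fderiv_le
        (fun z _ => hf.1 i hi z) (fun z _ => hM i hi z) (mem_univ _) (mem_univ _)⟩
  obtain ⟨M, hM⟩ := this
  exact ⟨max M 0, le_max_right _ _, fun i hi x y => (hM i hi x y).trans
    (by gcongr; exact le_max_left _ _)⟩

/-- Bounded Lipschitz functions are Hölder continuous: the Lipschitz bound serves at distances at most
`1`, the bound on the values beyond. -/
theorem UHol.of_bdd_lip (hα : 0 < α) (hα1 : α ≤ 1) {f : ι → E → F} {M L : ℝ}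
    (hM : ∀ i ∈ I, ∀ x, ‖f i x‖ ≤ M) (hL : ∀ i ∈ I, ∀ x y, ‖f i x - f i y‖ ≤ L * ‖x - y‖) :
    UHol α I 0 f := by
  refine ⟨2 * (max M 0) + max L 0, fun i hi => ⟨fun x => (hM i hi x).trans ?_, fun x y => ?_⟩⟩
  · have := le_max_left M 0; have := le_max_right M 0; have := le_max_right L 0; linarith
  · have h1 := hL i hi x y
    have h2 : ‖f i x - f i y‖ ≤ 2 * max M 0 := by
      calc _ ≤ ‖f i x‖ + ‖f i y‖ := norm_sub_le _ _
        _ ≤ max M 0 + max M 0 := add_le_add ((hM i hi x).trans (le_max_left _ _))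
            ((hM i hi y).trans (le_max_left _ _))
        _ = _ := by ring
    have hp : 0 ≤ ‖x - y‖ ^ α := by positivity
    have hM0 := le_max_right M 0
    have hL0 := le_max_right L 0
    rcases le_total ‖x - y‖ 1 with h | h
    · have h3 : ‖x - y‖ ≤ ‖x - y‖ ^ α := by
        rcases (norm_nonneg (x - y)).eq_or_lt with h0 | h0
        · rw [← h0]; positivity
        · simpa using Real.rpow_le_rpow_of_exponent_ge h0 h hα1
      calc _ ≤ L * ‖x - y‖ := h1
        _ ≤ max L 0 * ‖x - y‖ ^ α := by gcongr; exact le_max_left _ _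
        _ ≤ _ := by gcongr; linarith
    · have h3 : 1 ≤ ‖x - y‖ ^ α := Real.one_le_rpow h hα.le
      calc _ ≤ 2 * max M 0 * 1 := by linarith
        _ ≤ 2 * max M 0 * ‖x - y‖ ^ α := by gcongr
        _ ≤ _ := by gcongr; linarith

/-- The inclusion of `C^{k+1,α}` in `C^{k,α}`. -/
theorem UHol.pred (hα : 0 < α) (hα1 : α ≤ 1) {f : ι → E → F} (hf : UHol α I (k + 1) f) :
    UHol α I k f := by
  induction k generalizing F with
  | zero =>
    obtain ⟨M, -, hM⟩ := hf.bdd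
    obtain ⟨L, -, hL⟩ := (show UDer α I 1 f from hf.2).lip
    exact .of_bdd_lip hα hα1 hM hL
  | succ k ih => exact ⟨hf.1, hf.2.1, ih hf.2.2⟩

theorem UHol.mono (hα : 0 < α) (hα1 : α ≤ 1) {f : ι → E → F} (hf : UHol α I k f) {j : ℕ}
    (hj : j ≤ k) : UHol α I j f := by
  induction k, hj using Nat.le_induction with
  | base => exact hf
  | succ k _ ih => exact ih (hf.pred hα hα1)

theorem UDer.pred (hα : 0 < α) (hα1 : α ≤ 1) {f : ι → E → F} (hf : UDer α I (k + 1) f) :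
    UDer α I k f := by
  cases k with
  | zero => obtain ⟨L, -, hL⟩ := hf.lip; exact ⟨L, hL⟩
  | succ k => exact ⟨hf.1, hf.2.pred hα hα1⟩

theorem UHol.zero_bounds {f : ι → E → F} (hf : UHol α I 0 f) :
    ∃ M : ℝ, 0 ≤ M ∧ ∀ i ∈ I, (∀ x, ‖f i x‖ ≤ M) ∧ ∀ x y, ‖f i x - f i y‖ ≤ M * ‖x - y‖ ^ α := by
  obtain ⟨M, hM⟩ := hf
  exact ⟨max M 0, le_max_right _ _, fun i hi => ⟨fun x => ((hM i hi).1 x).trans (le_max_left _ _),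
    fun x y => ((hM i hi).2 x y).trans (by gcongr; exact le_max_left _ _)⟩⟩

theorem UHol.continuous (hα : 0 < α) (hα1 : α ≤ 1) {f : ι → E → F} (hf : UHol α I k f)
    {i : ι} (hi : i ∈ I) : Continuous (f i) := by
  obtain ⟨M, hM0, hM⟩ := (hf.mono hα hα1 (Nat.zero_le k)).zero_bounds
  rw [continuous_iff_continuousAt]
  intro x
  rw [ContinuousAt, tendsto_iff_norm_sub_tendsto_zero]
  have h1 : Tendsto (fun y => M * ‖y - x‖ ^ α) (𝓝 x) (𝓝 0) := by
    have : Continuous fun y => M * ‖y - x‖ ^ α :=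
      continuous_const.mul ((by fun_prop : Continuous fun y => ‖y - x‖).rpow_const
        (fun _ => Or.inr hα.le))
    simpa [Real.zero_rpow hα.ne'] using this.tendsto x
  exact squeeze_zero (fun _ => norm_nonneg _) (fun y => (hM i hi).2 y x) h1

theorem UHol.const {c : ι → F} {M : ℝ} (hc : ∀ i ∈ I, ‖c i‖ ≤ M) :
    UHol α I k (fun i (_ : E) => c i) := by
  induction k generalizing F M with
  | zero =>
    refine ⟨max M 0, fun i hi => ⟨fun x => (hc i hi).trans (le_max_left _ _), fun x y => ?_⟩⟩
    simp only [sub_self, norm_zero]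
    exact mul_nonneg (le_max_right _ _) (by positivity)
  | succ k ih =>
    refine ⟨⟨M, fun i hi x => hc i hi⟩, fun i hi => differentiable_const _, ?_⟩
    have : UHol α I k (fun (i : ι) (_ : E) => (0 : E →L[ℝ] F)) := ih (M := 0) (by simp)
    exact this.congr fun i hi => by ext; simp

theorem UHol.clm (L : F →L[ℝ] H) {f : ι → E → F} (hf : UHol α I k f) :
    UHol α I k (fun i x => L (f i x)) := by
  induction k generalizing F H with
  | zero =>
    obtain ⟨M, hM0, hM⟩ := hf.zero_bounds
    refine ⟨‖L‖ * M, fun i hi => ⟨fun x => (L.le_opNorm _).trans ?_, fun x y => ?_⟩⟩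
    · gcongr; exact (hM i hi).1 x
    · rw [← map_sub, mul_assoc]
      exact (L.le_opNorm _).trans (by gcongr; exact (hM i hi).2 x y)
  | succ k ih =>
    obtain ⟨M, hM0, hM⟩ := hf.bdd
    refine ⟨⟨‖L‖ * M, fun i hi x => (L.le_opNorm _).trans (by gcongr; exact hM i hi x)⟩,
      fun i hi => L.differentiable.comp (hf.2.1 i hi), ?_⟩
    have := ih (ContinuousLinearMap.compL ℝ E F H L) hf.2.2
    refine this.congr fun i hi => ?_
    ext1 x
    exact (L.hasFDerivAt.comp x (hf.2.1 i hi x).hasFDerivAt).fderiv.symm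

theorem UHol.add {f g : ι → E → F} (hf : UHol α I k f) (hg : UHol α I k g) :
    UHol α I k (fun i x => f i x + g i x) := by
  induction k generalizing F with
  | zero =>
    obtain ⟨M, hM0, hM⟩ := hf.zero_bounds
    obtain ⟨N, hN0, hN⟩ := hg.zero_bounds
    refine ⟨M + N, fun i hi => ⟨fun x => norm_add_le_of_le ((hM i hi).1 x) ((hN i hi).1 x),
      fun x y => ?_⟩⟩
    rw [add_sub_add_comm, add_mul]
    exact norm_add_le_of_le ((hM i hi).2 x y) ((hN i hi).2 x y)
  | succ k ih =>
    obtain ⟨M, hM0, hM⟩ := hf.bdd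
    obtain ⟨N, hN0, hN⟩ := hg.bdd
    refine ⟨⟨M + N, fun i hi x => norm_add_le_of_le (hM i hi x) (hN i hi x)⟩,
      fun i hi => (hf.2.1 i hi).add (hg.2.1 i hi), (ih hf.2.2 hg.2.2).congr fun i hi => ?_⟩
    ext1 x
    exact (fderiv_add (hf.2.1 i hi x) (hg.2.1 i hi x)).symm

theorem UHol.neg {f : ι → E → F} (hf : UHol α I k f) : UHol α I k (fun i x => - f i x) := by
  simpa using hf.clm (-ContinuousLinearMap.id ℝ F)

theorem UHol.sub {f g : ι → E → F} (hf : UHol α I k f) (hg : UHol α I k g) :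
    UHol α I k (fun i x => f i x - g i x) := by
  simpa only [sub_eq_add_neg] using hf.add hg.neg

theorem UHol.prodMk {f : ι → E → F} {g : ι → E → H} (hf : UHol α I k f) (hg : UHol α I k g) :
    UHol α I k (fun i x => (f i x, g i x)) := by
  simpa using (hf.clm (ContinuousLinearMap.inl ℝ F H)).add (hg.clm (ContinuousLinearMap.inr ℝ F H))

/-- Products of functions of class `C^{k,α}`, for any bounded bilinear product. The product rule
expresses the derivative by two bilinear products of one order less. -/
theorem UHol.bilin (hα : 0 < α) (hα1 : α ≤ 1) (B : F →L[ℝ] G →L[ℝ] H) {f : ι → E → F} {g : ι → E → G}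
    (hf : UHol α I k f) (hg : UHol α I k g) : UHol α I k (fun i x => B (f i x) (g i x)) := by
  induction k generalizing F G H with
  | zero =>
    obtain ⟨M, hM0, hM⟩ := hf.zero_bounds
    obtain ⟨N, hN0, hN⟩ := hg.zero_bounds
    have hB : ∀ a b, ‖B a b‖ ≤ ‖B‖ * ‖a‖ * ‖b‖ := fun a b => B.le_opNorm₂ a b
    refine ⟨2 * (‖B‖ * M * N), fun i hi => ⟨fun x => ?_, fun x y => ?_⟩⟩
    · calc _ ≤ ‖B‖ * ‖f i x‖ * ‖g i x‖ := hB _ _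
        _ ≤ ‖B‖ * M * N := by gcongr; exacts [(hM i hi).1 x, (hN i hi).1 x]
        _ ≤ _ := by have : 0 ≤ ‖B‖ * M * N := by positivity
                    linarith
    · have : B (f i x) (g i x) - B (f i y) (g i y) =
          B (f i x) (g i x - g i y) + B (f i x - f i y) (g i y) := by simp
      rw [this]
      calc _ ≤ ‖B‖ * ‖f i x‖ * ‖g i x - g i y‖ + ‖B‖ * ‖f i x - f i y‖ * ‖g i y‖ :=
            norm_add_le_of_le (hB _ _) (hB _ _)
        _ ≤ ‖B‖ * M * (N * ‖x - y‖ ^ α) + ‖B‖ * (M * ‖x - y‖ ^ α) * N := by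
            gcongr
            exacts [(hM i hi).1 x, (hN i hi).2 x y, (hM i hi).2 x y, (hN i hi).1 y]
        _ = _ := by ring
  | succ k ih =>
    obtain ⟨M, hM0, hM⟩ := hf.bdd
    obtain ⟨N, hN0, hN⟩ := hg.bdd
    refine ⟨⟨‖B‖ * M * N, fun i hi x => ?_⟩, fun i hi x => ?_, ?_⟩
    · calc _ ≤ ‖B‖ * ‖f i x‖ * ‖g i x‖ := B.le_opNorm₂ _ _
        _ ≤ ‖B‖ * M * N := by gcongr; exacts [hM i hi x, hN i hi x]
    · exact (B.hasFDerivAt_of_bilinear (hf.2.1 i hi x).hasFDerivAt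
        (hg.2.1 i hi x).hasFDerivAt).differentiableAt
    · have h1 := ih (B.precompR E) (hf.pred hα hα1) hg.2.2
      have h2 := ih (B.precompL E) hf.2.2 (hg.pred hα hα1)
      refine (h1.add h2).congr fun i hi => ?_
      ext1 x
      exact (B.hasFDerivAt_of_bilinear (hf.2.1 i hi x).hasFDerivAt
        (hg.2.1 i hi x).hasFDerivAt).fderiv.symm

theorem UHol.smul (hα : 0 < α) (hα1 : α ≤ 1) {f : ι → E → ℝ} {g : ι → E → F}
    (hf : UHol α I k f) (hg : UHol α I k g) : UHol α I k (fun i x => f i x • g i x) :=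
  hf.bilin hα hα1 (ContinuousLinearMap.lsmul ℝ ℝ) hg

/-- Composition with inner functions that may be unbounded, such as perturbations of the identity. -/
theorem UHol.comp (hα : 0 < α) (hα1 : α ≤ 1) {f : ι → G → F} {g : ι → E → G}
    (hf : UHol α I k f) (hg : UDer α I k g) : UHol α I k (fun i x => f i (g i x)) := by
  induction k generalizing F with
  | zero =>
    obtain ⟨M, hM0, hM⟩ := hf.zero_bounds
    obtain ⟨L, hL0, hL⟩ := hg.lip
    refine ⟨M + M * L ^ α, fun i hi => ⟨fun x => ((hM i hi).1 _).trans ?_, fun x y => ?_⟩⟩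
    · have : 0 ≤ M * L ^ α := by positivity
      linarith
    · calc _ ≤ M * ‖g i x - g i y‖ ^ α := (hM i hi).2 _ _
        _ ≤ M * (L * ‖x - y‖) ^ α := by gcongr; exact hL i hi x y
        _ = M * L ^ α * ‖x - y‖ ^ α := by rw [Real.mul_rpow hL0 (norm_nonneg _)]; ring
        _ ≤ _ := by gcongr; linarith
  | succ k ih =>
    obtain ⟨M, hM0, hM⟩ := hf.bdd
    refine ⟨⟨M, fun i hi x => hM i hi _⟩, fun i hi => (hf.2.1 i hi).comp (hg.1 i hi), ?_⟩
    have h1 := ih hf.2.2 (hg.pred hα hα1)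
    refine (h1.bilin hα hα1 (ContinuousLinearMap.compL ℝ E G F) hg.2).congr fun i hi => ?_
    ext1 x
    exact ((hf.2.1 i hi _).hasFDerivAt.comp x (hg.1 i hi x).hasFDerivAt).fderiv.symm

theorem UHol.uDer {f : ι → E → F} (hf : UHol α I (k + 1) f) : UDer α I (k + 1) f := hf.2

theorem UDer.clm (L : F →L[ℝ] H) {f : ι → E → F} (hf : UDer α I k f) :
    UDer α I k (fun i x => L (f i x)) := by
  cases k with
  | zero =>
    obtain ⟨M, hM0, hM⟩ := hf.lip
    refine ⟨‖L‖ * M, fun i hi x y => ?_⟩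
    rw [← map_sub, mul_assoc]
    exact (L.le_opNorm _).trans (by gcongr; exact hM i hi x y)
  | succ k =>
    refine ⟨fun i hi => L.differentiable.comp (hf.1 i hi), ?_⟩
    refine (hf.2.clm (ContinuousLinearMap.compL ℝ E F H L)).congr fun i hi => ?_
    ext1 x
    exact (L.hasFDerivAt.comp x (hf.1 i hi x).hasFDerivAt).fderiv.symm

theorem UDer.add {f g : ι → E → F} (hf : UDer α I k f) (hg : UDer α I k g) :
    UDer α I k (fun i x => f i x + g i x) := by
  cases k with
  | zero =>
    obtain ⟨M, hM0, hM⟩ := hf.lip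
    obtain ⟨N, hN0, hN⟩ := hg.lip
    refine ⟨M + N, fun i hi x y => ?_⟩
    rw [add_sub_add_comm, add_mul]
    exact norm_add_le_of_le (hM i hi x y) (hN i hi x y)
  | succ k =>
    refine ⟨fun i hi => (hf.1 i hi).add (hg.1 i hi), (hf.2.add hg.2).congr fun i hi => ?_⟩
    ext1 x
    exact (fderiv_add (hf.1 i hi x) (hg.1 i hi x)).symm

theorem UDer.prodMk {f : ι → E → F} {g : ι → E → H} (hf : UDer α I k f) (hg : UDer α I k g) :
    UDer α I k (fun i x => (f i x, g i x)) := by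
  simpa using (hf.clm (ContinuousLinearMap.inl ℝ F H)).add (hg.clm (ContinuousLinearMap.inr ℝ F H))

theorem UDer.of_clm (L : E →L[ℝ] F) : UDer α I k (fun (_ : ι) x => L x) := by
  cases k with
  | zero => exact ⟨‖L‖, fun i hi x y => by rw [← map_sub]; exact L.le_opNorm _⟩
  | succ k =>
    refine ⟨fun i hi => L.differentiable, ?_⟩
    have : UHol α I k (fun (_ : ι) (_ : E) => L) := .const (M := ‖L‖) (by simp)
    exact this.congr fun i hi => by ext1 x; exact L.hasFDerivAt.fderiv.symm

/-- Pointwise inverses of operators, by induction from `D(A⁻¹) = -A⁻¹ (DA) A⁻¹`. The bound on the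
inverses is assumed. -/
theorem UHol.ringInverse (hα : 0 < α) (hα1 : α ≤ 1) [CompleteSpace V] {A B : ι → E → (V →L[ℝ] V)}
    (hA : UHol α I k A) (hAB : ∀ i ∈ I, ∀ x, A i x * B i x = 1) (hBA : ∀ i ∈ I, ∀ x, B i x * A i x = 1)
    {M : ℝ} (hM : ∀ i ∈ I, ∀ x, ‖B i x‖ ≤ M) : UHol α I k B := by
  induction k with
  | zero =>
    obtain ⟨N, hN0, hN⟩ := hA.zero_bounds
    refine ⟨max M 0 + max M 0 * N * max M 0, fun i hi => ⟨fun x => (hM i hi x).trans ?_,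
      fun x y => ?_⟩⟩
    · have : 0 ≤ max M 0 * N * max M 0 := by positivity
      have := le_max_left M 0; linarith
    · have hM' : ∀ x, ‖B i x‖ ≤ max M 0 := fun x => (hM i hi x).trans (le_max_left _ _)
      -- resolvent identity
      have : B i x - B i y = B i x * (A i y - A i x) * B i y := by
        rw [mul_sub, sub_mul, mul_assoc, hAB i hi, hBA i hi]; simp
      rw [this]
      calc _ ≤ ‖B i x‖ * ‖A i y - A i x‖ * ‖B i y‖ :=
            (norm_mul_le _ _).trans (by gcongr; exact norm_mul_le _ _)
        _ ≤ max M 0 * (N * ‖x - y‖ ^ α) * max M 0 := by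
            gcongr
            exacts [hM' x, norm_sub_rev x y ▸ (hN i hi).2 y x, hM' y]
        _ = max M 0 * N * max M 0 * ‖x - y‖ ^ α := by ring
        _ ≤ _ := by gcongr; exact le_add_of_nonneg_left (le_max_right _ _)
  | succ k ih =>
    have hB := ih (hA.pred hα hα1)
    let C := ContinuousLinearMap.compL ℝ V V V
    have hd : ∀ i ∈ I, ∀ x, HasFDerivAt (B i)
        (-((C (B i x)).comp ((C.flip (B i x)).comp (fderiv ℝ (A i) x)))) x := by
      intro i hi x
      have h1 : B i = fun y => Ring.inverse (A i y) := by
        ext1 y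
        exact (Ring.inverse_unit ⟨A i y, B i y, hAB i hi y, hBA i hi y⟩).symm
      have h2 := hasFDerivAt_ringInverse (𝕜 := ℝ)
        (⟨A i x, B i x, hAB i hi x, hBA i hi x⟩ : (V →L[ℝ] V)ˣ)
      have h3 := h2.comp x (hA.2.1 i hi x).hasFDerivAt
      refine (h3.congr_of_eventuallyEq (Eventually.of_forall fun y => congrFun h1 y)).congr_fderiv ?_
      ext v w
      simp [C]
    refine ⟨⟨M, hM⟩, fun i hi x => (hd i hi x).differentiableAt, ?_⟩
    have h4 := UHol.bilin (H := E →L[ℝ] V →L[ℝ] V) hα hα1 (ContinuousLinearMap.compL ℝ E (V →L[ℝ] V) (V →L[ℝ] V))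
      (hB.clm C.flip) hA.2.2
    have h5 := UHol.bilin (H := E →L[ℝ] V →L[ℝ] V) hα hα1
      (ContinuousLinearMap.compL ℝ E (V →L[ℝ] V) (V →L[ℝ] V)) (hB.clm C) h4
    refine h5.neg.congr fun i hi => ?_
    ext1 x
    exact (hd i hi x).fderiv.symm

/-- The derivative of a map whose inverse is Lipschitz is bounded below. -/
theorem norm_le_of_hasFDerivAt_of_antilipschitz {f : E → F} {f' : E →L[ℝ] F} {x : E} {C : ℝ} 
    (hf : HasFDerivAt f f' x) (hC : ∀ x y, ‖x - y‖ ≤ C * ‖f x - f y‖) (v : E) :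
    ‖v‖ ≤ C * ‖f' v‖ := by
  have h1 : Tendsto (fun n : ℝ => C * ‖n • (f (x + n⁻¹ • v) - f x)‖) atTop (𝓝 (C * ‖f' v‖)) :=
    ((hf.lim_real v).norm).const_mul C
  refine ge_of_tendsto h1 ?_
  filter_upwards [eventually_gt_atTop 0] with n hn
  have h2 := hC (x + n⁻¹ • v) x
  simp only [add_sub_cancel_left, norm_smul, norm_inv, Real.norm_eq_abs, abs_of_pos hn] at h2 ⊢
  rw [inv_mul_le_iff₀ hn] at h2
  linarith

/-- A bijection with Lipschitz inverse, differentiable at a point, has an invertible derivative there: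
the lower bound makes the derivative injective, and the dimension is finite. -/
theorem exists_inverse_fderiv [FiniteDimensional ℝ V] {X Y : V → V} {C : ℝ} (hC0 : 0 ≤ C)
    (hXY : ∀ y, X (Y y) = y) (hYX : ∀ x, Y (X x) = x) 
    (hY : ∀ x y, ‖Y x - Y y‖ ≤ C * ‖x - y‖) (y : V) (hX : DifferentiableAt ℝ X (Y y)) :
    DifferentiableAt ℝ Y y ∧ fderiv ℝ X (Y y) * fderiv ℝ Y y = 1 ∧
      fderiv ℝ Y y * fderiv ℝ X (Y y) = 1 := by
  have hanti : ∀ x y, ‖x - y‖ ≤ C * ‖X x - X y‖ := fun x y => by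
    simpa [hYX] using hY (X x) (X y)
  have hinj : Function.Injective (fderiv ℝ X (Y y)) := by
    rw [injective_iff_map_eq_zero]
    intro v hv
    have := norm_le_of_hasFDerivAt_of_antilipschitz hX.hasFDerivAt hanti v
    rw [hv, norm_zero, mul_zero] at this
    exact norm_le_zero_iff.1 this
  -- the inverse function rule needs only continuity of the inverse map
  let e : V ≃L[ℝ] V := (LinearEquiv.ofInjectiveEndo (fderiv ℝ X (Y y) : V →ₗ[ℝ] V)
    hinj).toContinuousLinearEquiv
  have he : (e : V →L[ℝ] V) = fderiv ℝ X (Y y) := by ext v; rfl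
  have hYc : Continuous Y := (LipschitzWith.of_dist_le_mul (K := C.toNNReal) fun a b => by
    simpa [dist_eq_norm, Real.coe_toNNReal C hC0] using hY a b).continuous
  have h1 : HasFDerivAt Y (e.symm : V →L[ℝ] V) y := by
    apply HasFDerivAt.of_local_left_inverse (f := X) hYc.continuousAt _
      (Eventually.of_forall hXY)
    rw [he]; exact hX.hasFDerivAt
  refine ⟨h1.differentiableAt, ?_, ?_⟩
  · rw [h1.fderiv, ← he]; ext v; simp
  · rw [h1.fderiv, ← he]; ext v; simp

/-- Inverse maps are as regular as the maps themselves, given a uniform Lipschitz bound for the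
inverses. -/
theorem UDer.inverse (hα : 0 < α) (hα1 : α ≤ 1) [FiniteDimensional ℝ V] {X Y : ι → V → V}
    (hX : UDer α I k X) (hXY : ∀ i ∈ I, ∀ y, X i (Y i y) = y) (hYX : ∀ i ∈ I, ∀ x, Y i (X i x) = x)
    {C : ℝ} (hC0 : 0 ≤ C) (hY : ∀ i ∈ I, ∀ x y, ‖Y i x - Y i y‖ ≤ C * ‖x - y‖) : UDer α I k Y := by
  have : CompleteSpace V := FiniteDimensional.complete ℝ V
  induction k with
  | zero => exact ⟨C, hY⟩
  | succ k ih =>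
    have hYk := ih (hX.pred hα hα1)
    have hd := fun i hi y => exists_inverse_fderiv hC0 (hXY i hi) (hYX i hi) (hY i hi) y
      (hX.1 i hi (Y i y))
    refine ⟨fun i hi y => (hd i hi y).1, ?_⟩
    refine (hX.2.comp hα hα1 hYk).ringInverse hα hα1 (fun i hi x => (hd i hi x).2.1)
      (fun i hi x => (hd i hi x).2.2) (M := C) fun i hi x => ?_
    refine norm_fderiv_le_of_lip' ℝ hC0 (Eventually.of_forall fun z => hY i hi z x)

theorem UHol.cos_sin (hα : 0 < α) (hα1 : α ≤ 1) :
    UHol α I k (fun (_ : ι) => Real.cos) ∧ UHol α I k (fun (_ : ι) => Real.sin) := by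
  have hs : ∀ i ∈ I, ∀ x : ℝ, ‖Real.sin x‖ ≤ 1 := fun i _ x => Real.abs_sin_le_one x
  have hc : ∀ i ∈ I, ∀ x : ℝ, ‖Real.cos x‖ ≤ 1 := fun i _ x => Real.abs_cos_le_one x
  induction k with
  | zero =>
    refine ⟨.of_bdd_lip hα hα1 (L := 1) hc fun i hi x y => ?_,
      .of_bdd_lip hα hα1 (L := 1) hs fun i hi x y => ?_⟩
    · exact convex_univ.norm_image_sub_le_of_norm_hasDerivWithin_le
        (fun z _ => (Real.hasDerivAt_cos z).hasDerivWithinAt)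
        (fun z _ => by simpa using Real.abs_sin_le_one z) (mem_univ _) (mem_univ _)
    · exact convex_univ.norm_image_sub_le_of_norm_hasDerivWithin_le
        (fun z _ => (Real.hasDerivAt_sin z).hasDerivWithinAt)
        (fun z _ => by simpa using Real.abs_cos_le_one z) (mem_univ _) (mem_univ _)
  | succ k ih =>
    refine ⟨⟨⟨1, hc⟩, fun i _ => Real.differentiable_cos, ?_⟩,
      ⟨⟨1, hs⟩, fun i _ => Real.differentiable_sin, ?_⟩⟩
    · refine (ih.2.neg.clm (ContinuousLinearMap.lsmul ℝ ℝ)).congr fun i _ => ?_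
      ext x
      simp
    · refine (ih.1.clm (ContinuousLinearMap.lsmul ℝ ℝ)).congr fun i _ => ?_
      ext x
      simp

/-- The first order Taylor expansion, with a remainder uniform in the family. -/
theorem UDer.taylor (hα : 0 < α) (hα1 : α ≤ 1) {f : ι → E → F} (hf : UDer α I (k + 1) f) :
    ∃ M : ℝ, 0 ≤ M ∧ ∀ i ∈ I, ∀ x h,
      ‖f i (x + h) - f i x - fderiv ℝ (f i) x h‖ ≤ M * ‖h‖ ^ (1 + α) := by
  obtain ⟨M, hM0, hM⟩ := (hf.2.mono hα hα1 (Nat.zero_le k)).zero_bounds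
  refine ⟨M, hM0, fun i hi x h => ?_⟩
  have h1 : ∀ y ∈ Metric.closedBall x ‖h‖, ‖fderiv ℝ (f i) y - fderiv ℝ (f i) x‖ ≤ M * ‖h‖ ^ α := by
    intro y hy
    refine ((hM i hi).2 y x).trans ?_
    gcongr
    simpa [dist_eq_norm] using hy
  have h2 := (convex_closedBall x ‖h‖).norm_image_sub_le_of_norm_fderiv_le'
    (fun y _ => hf.1 i hi y) h1 (Metric.mem_closedBall_self (norm_nonneg _))
    (show x + h ∈ Metric.closedBall x ‖h‖ by simp)
  rw [add_sub_cancel_left] at h2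
  refine h2.trans (le_of_eq ?_)
  rcases (norm_nonneg h).eq_or_lt with h0 | h0
  · rw [← h0, Real.zero_rpow hα.ne', Real.zero_rpow (by positivity)]; simp
  · rw [Real.rpow_add h0, Real.rpow_one]; ring

/-- If the functions depend continuously on `i`, so do their derivatives, as uniform limits of
difference quotients. -/
theorem UDer.continuousOn_fderiv (hα : 0 < α) (hα1 : α ≤ 1) [FiniteDimensional ℝ E] [TopologicalSpace ι]
    {f : ι → E → F} (hf : UDer α I (k + 1) f) (hc : ∀ x, ContinuousOn (fun i => f i x) I) (x : E) :
    ContinuousOn (fun i => fderiv ℝ (f i) x) I := by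
  obtain ⟨M, hM0, hM⟩ := hf.taylor hα hα1
  rw [continuousOn_clm_apply]
  intro v
  have h1 : TendstoUniformlyOn (fun (n : ℕ) i => ((n : ℝ) + 1) • (f i (x + ((n : ℝ) + 1)⁻¹ • v) - f i x))
      (fun i => fderiv ℝ (f i) x v) atTop I := by
    rw [Metric.tendstoUniformlyOn_iff]
    intro e he
    have h2 : Tendsto (fun n : ℕ => M * ‖v‖ ^ (1 + α) * (((n : ℝ) + 1) ^ (-α))) atTop (𝓝 0) := by
      have : Tendsto (fun n : ℕ => ((n : ℝ) + 1) ^ (-α)) atTop (𝓝 0) :=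
        (tendsto_rpow_neg_atTop hα).comp (tendsto_atTop_add_const_right _ _ tendsto_natCast_atTop_atTop)
      simpa using this.const_mul (M * ‖v‖ ^ (1 + α))
    filter_upwards [h2.eventually (gt_mem_nhds he)] with n hn i hi
    refine lt_of_le_of_lt ?_ hn
    have hn0 : (0 : ℝ) < (n : ℝ) + 1 := by positivity
    have h3 := hM i hi x (((n : ℝ) + 1)⁻¹ • v)
    rw [dist_comm, dist_eq_norm]
    have h4 : ((n : ℝ) + 1) • (f i (x + ((n : ℝ) + 1)⁻¹ • v) - f i x) - fderiv ℝ (f i) x v =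
        ((n : ℝ) + 1) • (f i (x + ((n : ℝ) + 1)⁻¹ • v) - f i x
          - fderiv ℝ (f i) x (((n : ℝ) + 1)⁻¹ • v)) := by
      rw [map_smul, smul_sub _ _ (_ • _), smul_smul, mul_inv_cancel₀ hn0.ne', one_smul]
    rw [h4, norm_smul, Real.norm_eq_abs, abs_of_pos hn0]
    calc _ ≤ ((n : ℝ) + 1) * (M * ‖((n : ℝ) + 1)⁻¹ • v‖ ^ (1 + α)) := by gcongr
      _ = _ := by
        rw [norm_smul, norm_inv, Real.norm_eq_abs, abs_of_pos hn0,
          Real.mul_rpow (by positivity) (norm_nonneg _), Real.inv_rpow hn0.le,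
          Real.rpow_add hn0, Real.rpow_one, Real.rpow_neg hn0.le]
        field_simp
  refine h1.continuousOn (Eventually.of_forall fun n => ?_).frequently
  exact ((hc _).sub (hc _)).const_smul _

end UHol

/-! ### Regularity of solutions of differential equations in parameters -/

section ODERegularity
variable {W : Type} [NormedAddCommGroup W] [NormedSpace ℝ W]

/-- Gronwall's inequality for curves with values in a normed space. -/
theorem norm_le_of_eq_add_integral {y g : ℝ → W} {c : W} {K δ T : ℝ} (hK : 0 ≤ K) (hδ : 0 ≤ δ)
    (hy : ContinuousOn y (Icc 0 T)) (h : ∀ t ∈ Icc 0 T, y t = c + ∫ s in (0 : ℝ)..t, g s)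
    (hg : ∀ s ∈ Icc 0 T, ‖g s‖ ≤ K * ‖y s‖ + δ) :
    ∀ t ∈ Icc 0 T, ‖y t‖ ≤ 2 * (‖c‖ + δ * T) * Real.exp ((2 * K + 1) * T) := by
  refine gronwall_integral hK hy.norm (fun _ _ => norm_nonneg _) fun t ht => ?_
  have hyi : IntervalIntegrable (fun s => ‖y s‖) volume 0 t := by
    apply ContinuousOn.intervalIntegrable
    rw [uIcc_of_le ht.1]; exact hy.norm.mono (Icc_subset_Icc le_rfl ht.2)
  have h1 : ‖∫ s in (0 : ℝ)..t, g s‖ ≤ ∫ s in (0 : ℝ)..t, (K * ‖y s‖ + δ) := by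
    apply intervalIntegral.norm_integral_le_of_norm_le ht.1
    · exact ae_of_all _ fun s hs => hg s ⟨hs.1.le, hs.2.trans ht.2⟩
    · exact (hyi.const_mul K).add intervalIntegrable_const
  rw [intervalIntegral.integral_add (hyi.const_mul K) intervalIntegrable_const,
    intervalIntegral.integral_const_mul, intervalIntegral.integral_const] at h1
  calc ‖y t‖ ≤ ‖c‖ + ‖∫ s in (0 : ℝ)..t, g s‖ := by rw [h t ht]; exact norm_add_le _ _
    _ ≤ ‖c‖ + (K * (∫ s in (0 : ℝ)..t, ‖y s‖) + (t - 0) • δ) := by gcongr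
    _ ≤ _ := by
      have : t * δ ≤ δ * T := by rw [mul_comm]; exact mul_le_mul_of_nonneg_left ht.2 hδ
      simp only [sub_zero, smul_eq_mul]; linarith

/-- The solution on `[0,T]` of a linear equation with continuous coefficients. The coefficients are
extended to all times by their boundary values. -/
theorem exists_linear_curve [CompleteSpace W] {A : ℝ → W →L[ℝ] W} {S : ℝ → W} {T : ℝ} (hT : 0 ≤ T)
    (hA : ContinuousOn A (Icc 0 T)) (hS : ContinuousOn S (Icc 0 T)) (w0 : W) :
    ∃ w : ℝ → W, Continuous w ∧ ∀ t ∈ Icc 0 T, w t = w0 + ∫ s in (0 : ℝ)..t, (A s (w s) + S s) := by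
  obtain ⟨MA, hMA⟩ := isCompact_Icc.exists_bound_of_continuousOn hA
  obtain ⟨MS, hMS⟩ := isCompact_Icc.exists_bound_of_continuousOn hS
  let p : ℝ → ℝ := fun t => projIcc 0 T hT t
  have hp : ∀ t, p t ∈ Icc 0 T := fun t => (projIcc 0 T hT t).2
  have hpc : Continuous p := continuous_subtype_val.comp continuous_projIcc
  have hAc : Continuous fun t => A (p t) := hA.comp_continuous hpc hp
  have hSc : Continuous fun t => S (p t) := hS.comp_continuous hpc hp
  obtain ⟨w, hw, h⟩ := exists_integral_curve (f := fun t w => A (p t) w + S (p t)) (K := MA) (C := MS)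
    ((norm_nonneg _).trans (hMA _ (hp 0)))
    (fun z hz => ((hAc.clm_apply hz).add hSc).aestronglyMeasurable)
    (fun t x y => by
      rw [add_sub_add_right_eq_sub, ← map_sub]
      exact (ContinuousLinearMap.le_opNorm _ _).trans (by gcongr; exact hMA _ (hp t)))
    (fun t => by simpa using hMS _ (hp t)) w0
  refine ⟨w, hw, fun t ht => ?_⟩
  rw [h t ht.1]
  congr 1
  apply intervalIntegral.integral_congr
  intro s hs
  rw [uIcc_of_le ht.1] at hs
  have : p s = s := by
    simp only [p]
    rw [projIcc_of_mem hT ⟨hs.1, hs.2.trans ht.2⟩]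
  simp only [this]

variable {E G : Type} [NormedAddCommGroup E] [NormedSpace ℝ E] [FiniteDimensional ℝ E]
  [NormedAddCommGroup G] [NormedSpace ℝ G]
variable {α T : ℝ} {k : ℕ}

theorem intervalIntegrable_of_continuousOn_Icc {W : Type} [NormedAddCommGroup W] {y : ℝ → W} (hy : ContinuousOn y (Icc 0 T)) {t : ℝ}
    (ht : t ∈ Icc 0 T) : IntervalIntegrable y volume 0 t := by
  apply ContinuousOn.intervalIntegrable
  rw [uIcc_of_le ht.1]; exact hy.mono (Icc_subset_Icc le_rfl ht.2)

/-- A remainder of order `1 + α > 1` identifies the derivative. -/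
theorem hasFDerivAt_of_norm_le_rpow {E : Type} [NormedAddCommGroup E] [NormedSpace ℝ E] {f : E → W} {f' : E →L[ℝ] W} {x : E} {C : ℝ} (hα : 0 < α)
    (h : ∀ v, ‖f (x + v) - f x - f' v‖ ≤ C * ‖v‖ ^ (1 + α)) : HasFDerivAt f f' x := by
  rw [hasFDerivAt_iff_isLittleO_nhds_zero]
  have h1 : (fun v : E => f (x + v) - f x - f' v) =O[𝓝 0] fun v => ‖v‖ ^ (1 + α) :=
    Asymptotics.IsBigO.of_bound C (Eventually.of_forall fun v => by
      rw [Real.norm_of_nonneg (by positivity : (0 : ℝ) ≤ ‖v‖ ^ (1 + α))]; exact h v)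
  refine h1.trans_isLittleO ?_
  rw [← Asymptotics.isLittleO_norm_right, Asymptotics.isLittleO_iff_tendsto (by
    intro v hv; rw [hv, Real.zero_rpow (by positivity)])]
  have h2 : Tendsto (fun v : E => ‖v‖ ^ α) (𝓝 0) (𝓝 0) := by
    have : Continuous fun v : E => ‖v‖ ^ α := continuous_norm.rpow_const fun _ => Or.inr hα.le
    simpa [Real.zero_rpow hα.ne'] using this.tendsto 0
  refine h2.congr fun v => ?_
  rcases (norm_nonneg v).eq_or_lt with h0 | h0
  · rw [← h0, Real.zero_rpow hα.ne']; simp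
  · rw [Real.rpow_add h0, Real.rpow_one]; field_simp

/-- Solutions of linear equations `w' = A w + S` depend on a parameter `x` as regularly as the
coefficients do. The derivative in `x` solves the linear equation `v' = A v + (DA) w + DS`, which has
coefficients of one order less. -/
theorem UHol.linear_ode [CompleteSpace W] (hα : 0 < α) (hα1 : α ≤ 1) (hT : 0 ≤ T)
    {A : ℝ → E → (W →L[ℝ] W)} {S : ℝ → E → W} {w0 : E → W} {w : ℝ → E → W}
    (hA : UHol α (Icc 0 T) k A) (hAc : ∀ x, ContinuousOn (fun s => A s x) (Icc 0 T))
    (hS : UHol α (Icc 0 T) k S) (hSc : ∀ x, ContinuousOn (fun s => S s x) (Icc 0 T))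
    (hw0 : UHol α (Icc 0 T) k (fun _ => w0))
    (hwc : ∀ x, ContinuousOn (fun s => w s x) (Icc 0 T))
    (hw : ∀ x, ∀ t ∈ Icc 0 T, w t x = w0 x + ∫ s in (0 : ℝ)..t, (A s x (w s x) + S s x)) :
    UHol α (Icc 0 T) k w := by
  have h0T : (0 : ℝ) ∈ Icc 0 T := ⟨le_rfl, hT⟩
  have hii : ∀ x, ∀ t ∈ Icc 0 T, IntervalIntegrable (fun s => A s x (w s x) + S s x) volume 0 t :=
    fun x t ht => intervalIntegrable_of_continuousOn_Icc
      (((hAc x).clm_apply (hwc x)).add (hSc x)) ht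
  induction k generalizing W with
  | zero =>
    obtain ⟨MA, hA0, hMA⟩ := hA.zero_bounds
    obtain ⟨MS, hS0, hMS⟩ := hS.zero_bounds
    obtain ⟨M0, h00, hM0⟩ := hw0.zero_bounds
    set X := Real.exp ((2 * MA + 1) * T)
    have hb : ∀ t ∈ Icc 0 T, ∀ x, ‖w t x‖ ≤ 2 * (M0 + MS * T) * X := by
      intro t ht x
      refine (norm_le_of_eq_add_integral hA0 hS0 (hwc x) (hw x) (fun s hs => ?_) t ht).trans ?_
      · refine norm_add_le_of_le ((A s x).le_opNorm _ |>.trans ?_) ((hMS s hs).1 x)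
        gcongr; exact (hMA s hs).1 x
      · gcongr; exact (hM0 0 h0T).1 x
    set MW := 2 * (M0 + MS * T) * X
    have hMW0 : 0 ≤ MW := by positivity
    refine ⟨MW + 2 * (M0 + (MA * MW + MS) * T) * X, fun t ht => ⟨fun x => (hb t ht x).trans ?_,
      fun x y => ?_⟩⟩
    · have : 0 ≤ 2 * (M0 + (MA * MW + MS) * T) * X := by positivity
      linarith
    · have h1 : ‖w t x - w t y‖ ≤
          2 * (‖w0 x - w0 y‖ + ((MA * MW + MS) * ‖x - y‖ ^ α) * T) * X := by
        refine norm_le_of_eq_add_integral (y := fun t => w t x - w t y)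
          (g := fun s => (A s x (w s x) + S s x) - (A s y (w s y) + S s y))
          hA0 (by positivity) ((hwc x).sub (hwc y)) (fun s hs => ?_) (fun s hs => ?_) t ht
        · rw [intervalIntegral.integral_sub (hii x s hs) (hii y s hs), hw x s hs, hw y s hs]
          abel
        · have : (A s x (w s x) + S s x) - (A s y (w s y) + S s y) =
              A s x (w s x - w s y) + ((A s x - A s y) (w s y) + (S s x - S s y)) := by
            simp only [map_sub, sub_apply]; abel
          rw [this]
          refine norm_add_le_of_le ((A s x).le_opNorm _ |>.trans ?_) ?_
          · gcongr; exact (hMA s hs).1 x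
          · rw [add_mul]
            refine norm_add_le_of_le ((A s x - A s y).le_opNorm _ |>.trans ?_) ((hMS s hs).2 x y)
            rw [mul_right_comm]
            gcongr
            exacts [(hMA s hs).2 x y, hb s hs y]
      calc _ ≤ _ := h1
        _ ≤ 2 * (M0 * ‖x - y‖ ^ α + ((MA * MW + MS) * ‖x - y‖ ^ α) * T) * X := by
          gcongr; exact (hM0 0 h0T).2 x y
        _ = (2 * (M0 + (MA * MW + MS) * T) * X) * ‖x - y‖ ^ α := by ring
        _ ≤ _ := by gcongr; linarith
  | succ k ih =>
    have hwk := ih (hA.pred hα hα1) hAc (hS.pred hα hα1) hSc (hw0.pred hα hα1) hwc hw hii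
    obtain ⟨MW, hW0, hMW⟩ := (hwk.mono hα hα1 (Nat.zero_le k)).zero_bounds
    obtain ⟨MA, hA0, hMA⟩ := hA.bdd
    obtain ⟨LA, hLA0, hLA⟩ := hA.uDer.lip
    obtain ⟨NA, hNA0, hNA⟩ := hA.uDer.taylor hα hα1
    obtain ⟨NS, hNS0, hNS⟩ := hS.uDer.taylor hα hα1
    obtain ⟨N0, hN00, hN0⟩ := hw0.uDer.taylor hα hα1
    let P := (ContinuousLinearMap.id ℝ (W →L[ℝ] W)).precompL E
    let C := ContinuousLinearMap.compL ℝ E W W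
    -- the equation of the derivative, for curves of linear maps
    let A' : ℝ → E → ((E →L[ℝ] W) →L[ℝ] (E →L[ℝ] W)) := fun s x => C (A s x)
    let S' : ℝ → E → (E →L[ℝ] W) := fun s x => P (fderiv ℝ (A s) x) (w s x) + fderiv ℝ (S s) x
    have hAk : UHol α (Icc 0 T) k A := hA.pred hα hα1
    have hA' : UHol α (Icc 0 T) k A' :=
      UHol.clm (F := W →L[ℝ] W) (H := (E →L[ℝ] W) →L[ℝ] E →L[ℝ] W) (f := A) C hAk
    have hA'c : ∀ x, ContinuousOn (fun s => A' s x) (Icc 0 T) := fun x =>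
      (ContinuousLinearMap.continuous _).comp_continuousOn (hAc x)
    have hS' : UHol α (Icc 0 T) k S' := by
      have h1 : UHol α (Icc 0 T) k (fun s x => P (fderiv ℝ (A s) x) (w s x)) :=
        UHol.bilin (F := E →L[ℝ] W →L[ℝ] W) (G := W) (H := E →L[ℝ] W) hα hα1 P hA.2.2 hwk
      exact UHol.add (F := E →L[ℝ] W) h1 hS.2.2
    have hS'c : ∀ x, ContinuousOn (fun s => S' s x) (Icc 0 T) := fun x =>
      ((P.continuous.comp_continuousOn (hA.uDer.continuousOn_fderiv hα hα1 hAc x)).clm_apply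
        (hwc x)).add (hS.uDer.continuousOn_fderiv hα hα1 hSc x)
    have hv : ∀ x, ∃ v : ℝ → E →L[ℝ] W, Continuous v ∧ ∀ t ∈ Icc 0 T,
        v t = fderiv ℝ w0 x + ∫ s in (0 : ℝ)..t, (A' s x (v s) + S' s x) := fun x =>
      exists_linear_curve hT (hA'c x) (hS'c x) _
    choose v hvc hv using hv
    have hvii : ∀ x, ∀ t ∈ Icc 0 T,
        IntervalIntegrable (fun s => A' s x (v x s) + S' s x) volume 0 t :=
      fun x t ht => intervalIntegrable_of_continuousOn_Icc
        (((hA'c x).clm_apply (hvc x).continuousOn).add (hS'c x)) ht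
    have hd : ∀ t ∈ Icc 0 T, ∀ x, HasFDerivAt (w t) (v x t) x := by
      intro t ht x
      refine hasFDerivAt_of_norm_le_rpow hα (C := 2 * (N0 + (NA * MW + LA * MW + NS) * T) *
        Real.exp ((2 * MA + 1) * T)) fun h => ?_
      have hvh : ∀ t ∈ Icc 0 T, v x t h =
          fderiv ℝ w0 x h + ∫ s in (0 : ℝ)..t, (A' s x (v x s) + S' s x) h := by
        intro t ht
        conv_lhs => rw [hv x t ht]
        rw [add_apply, ContinuousLinearMap.intervalIntegral_apply (hvii x t ht)]
      have h1 : ‖w t (x + h) - w t x - v x t h‖ ≤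
          2 * (‖w0 (x + h) - w0 x - fderiv ℝ w0 x h‖ + ((NA * MW + LA * MW + NS) * ‖h‖ ^ (1 + α)) * T)
            * Real.exp ((2 * MA + 1) * T) := by
        refine norm_le_of_eq_add_integral (y := fun t => w t (x + h) - w t x - v x t h)
          (g := fun s => (A s (x + h) (w s (x + h)) + S s (x + h)) - (A s x (w s x) + S s x)
            - (A' s x (v x s) + S' s x) h)
          hA0 (by positivity) (((hwc _).sub (hwc x)).sub
            ((hvc x).clm_apply continuous_const).continuousOn) (fun s hs => ?_) (fun s hs => ?_) t ht
        · have i1 := hii (x + h) s hs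
          have i2 := hii x s hs
          have i3 : IntervalIntegrable (fun s => (A' s x (v x s) + S' s x) h) volume 0 s :=
            intervalIntegrable_of_continuousOn_Icc ((((hA'c x).clm_apply (hvc x).continuousOn).add
              (hS'c x)).clm_apply continuousOn_const) hs
          rw [intervalIntegral.integral_sub (i1.sub i2) i3, intervalIntegral.integral_sub i1 i2,
            hw _ s hs, hw x s hs, hvh s hs]
          abel
        -- the error solves the linear equation up to terms of order `1 + α` in `h`
        · have : (A s (x + h) (w s (x + h)) + S s (x + h)) - (A s x (w s x) + S s x)
              - (A' s x (v x s) + S' s x) h = A s x (w s (x + h) - w s x - v x s h) +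
              ((A s (x + h) - A s x - fderiv ℝ (A s) x h) (w s x) +
                (A s (x + h) - A s x) (w s (x + h) - w s x) +
                (S s (x + h) - S s x - fderiv ℝ (S s) x h)) := by
            simp only [A', C, S', P, map_sub, sub_apply,
              add_apply, ContinuousLinearMap.compL_apply,
              ContinuousLinearMap.comp_apply, ContinuousLinearMap.precompL_apply,
              ContinuousLinearMap.id_apply]
            abel
          rw [this]
          refine norm_add_le_of_le ((A s x).le_opNorm _ |>.trans ?_) ?_
          · gcongr; exact hMA s hs x
          · rw [add_mul, add_mul]
            refine norm_add_le_of_le (norm_add_le_of_le (ContinuousLinearMap.le_opNorm _ _ |>.trans ?_)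
              (ContinuousLinearMap.le_opNorm _ _ |>.trans ?_)) (hNS s hs x h)
            · rw [mul_right_comm]
              gcongr
              exacts [hNA s hs x h, (hMW s hs).1 x]
            · have e1 : ‖A s (x + h) - A s x‖ ≤ LA * ‖h‖ := by simpa using hLA s hs (x + h) x
              have e2 : ‖w s (x + h) - w s x‖ ≤ MW * ‖h‖ ^ α := by
                simpa using (hMW s hs).2 (x + h) x
              calc _ ≤ (LA * ‖h‖) * (MW * ‖h‖ ^ α) := by gcongr
                _ = _ := by
                  rcases (norm_nonneg h).eq_or_lt with h0 | h0
                  · rw [← h0, Real.zero_rpow hα.ne', Real.zero_rpow (by positivity)]; simp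
                  · rw [Real.rpow_add h0, Real.rpow_one]; ring
      calc _ ≤ _ := h1
        _ ≤ 2 * (N0 * ‖h‖ ^ (1 + α) + ((NA * MW + LA * MW + NS) * ‖h‖ ^ (1 + α)) * T)
            * Real.exp ((2 * MA + 1) * T) := by gcongr; exact hN0 0 h0T x h
        _ = _ := by ring
    refine ⟨hwk.bdd.imp fun M h => h.2, fun t ht x => (hd t ht x).differentiableAt, ?_⟩
    have h2 : UHol α (Icc 0 T) k (fun t x => v x t) :=
      ih hA' hA'c hS' hS'c hw0.2.2 (fun x => (hvc x).continuousOn) hv hvii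
    exact h2.congr fun t ht => by ext1 x; exact (hd t ht x).fderiv.symm

/-- Solutions of `z' = f(x, z)` depend on `x` as regularly as `f` and the initial value do: `Dz`
solves the linearised equation, to which `UHol.linear_ode` applies. The case `k = 0` asks only for a
Lipschitz field and gives a Lipschitz flow. -/
theorem UDer.ode [FiniteDimensional ℝ G] (hα : 0 < α) (hα1 : α ≤ 1) (hT : 0 ≤ T) {f : E × G → G} {L : ℝ}
    (hL0 : 0 ≤ L) (hL : ∀ p q, ‖f p - f q‖ ≤ L * ‖p - q‖)
    (hf : UHol α (Icc 0 T) k (fun _ => f)) {z0 : E → G}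
    (hz0 : UDer α (Icc 0 T) k (fun _ => z0)) {z : ℝ → E → G}
    (hzc : ∀ x, ContinuousOn (fun s => z s x) (Icc 0 T))
    (hz : ∀ x, ∀ t ∈ Icc 0 T, z t x = z0 x + ∫ s in (0 : ℝ)..t, f (x, z s x)) :
    UDer α (Icc 0 T) k z := by
  have : CompleteSpace G := FiniteDimensional.complete ℝ G
  have h0T : (0 : ℝ) ∈ Icc 0 T := ⟨le_rfl, hT⟩
  have hfc : Continuous f := (LipschitzWith.of_dist_le_mul (K := L.toNNReal) fun a b => by
    simpa [dist_eq_norm, Real.coe_toNNReal L hL0] using hL a b).continuous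
  have hfz : ∀ x, ContinuousOn (fun s => f (x, z s x)) (Icc 0 T) := fun x =>
    hfc.comp_continuousOn (continuousOn_const.prodMk (hzc x))
  have hii : ∀ x, ∀ t ∈ Icc 0 T, IntervalIntegrable (fun s => f (x, z s x)) volume 0 t :=
    fun x t ht => intervalIntegrable_of_continuousOn_Icc (hfz x) ht
  induction k with
  | zero =>
    obtain ⟨M0, h00, hM0⟩ := hz0.lip
    refine ⟨2 * (M0 + L * T) * Real.exp ((2 * L + 1) * T), fun t ht x y => ?_⟩
    have h1 : ‖z t x - z t y‖ ≤
        2 * (‖z0 x - z0 y‖ + (L * ‖x - y‖) * T) * Real.exp ((2 * L + 1) * T) := by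
      refine norm_le_of_eq_add_integral (y := fun t => z t x - z t y)
        (g := fun s => f (x, z s x) - f (y, z s y))
        hL0 (by positivity) ((hzc x).sub (hzc y)) (fun s hs => ?_) (fun s hs => ?_) t ht
      · rw [intervalIntegral.integral_sub (hii x s hs) (hii y s hs), hz x s hs, hz y s hs]
        abel
      · refine (hL _ _).trans ?_
        rw [← mul_add]
        gcongr
        simp only [Prod.mk_sub_mk, Prod.norm_mk]
        exact max_le (le_add_of_nonneg_left (norm_nonneg _)) (le_add_of_nonneg_right (norm_nonneg _))
    calc _ ≤ _ := h1
      _ ≤ 2 * (M0 * ‖x - y‖ + (L * ‖x - y‖) * T) * Real.exp ((2 * L + 1) * T) := by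
        gcongr; exact hM0 0 h0T x y
      _ = _ := by ring
  | succ k ih =>
    have hzk := ih (hf.pred hα hα1) (hz0.pred hα hα1)
    obtain ⟨MZ, hZ0, hMZ⟩ := hzk.lip
    obtain ⟨Nf, hNf0, hNf⟩ := hf.uDer.taylor hα hα1
    obtain ⟨Mf, hMf0, hMf⟩ := hf.2.2.bdd
    obtain ⟨N0, hN00, hN0⟩ := hz0.taylor hα hα1
    obtain ⟨D0, hD00, hD0⟩ := hz0.2.bdd
    have hfd : Differentiable ℝ f := hf.2.1 0 h0T
    have hg : UDer α (Icc 0 T) k (fun s x => (x, z s x)) :=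
      (UDer.of_clm (ContinuousLinearMap.id ℝ E)).prodMk hzk
    have hDf : UHol α (Icc 0 T) k (fun s x => fderiv ℝ f (x, z s x)) := hf.2.2.comp hα hα1 hg
    have hDc : ∀ x, ContinuousOn (fun s => fderiv ℝ f (x, z s x)) (Icc 0 T) := fun x =>
      (hf.2.2.continuous hα hα1 h0T).comp_continuousOn (continuousOn_const.prodMk (hzc x))
    let Q1 := (ContinuousLinearMap.compL ℝ E (E × G) G).flip (ContinuousLinearMap.inl ℝ E G)
    let Q2 := (ContinuousLinearMap.compL ℝ E G G).comp
      ((ContinuousLinearMap.compL ℝ G (E × G) G).flip (ContinuousLinearMap.inr ℝ E G))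
    -- the linearised equation: partial derivatives of `f` in `z` and in `x`
    let A' : ℝ → E → ((E →L[ℝ] G) →L[ℝ] (E →L[ℝ] G)) := fun s x => Q2 (fderiv ℝ f (x, z s x))
    let S' : ℝ → E → (E →L[ℝ] G) := fun s x => Q1 (fderiv ℝ f (x, z s x))
    have hA' : UHol α (Icc 0 T) k A' :=
      UHol.clm (H := (E →L[ℝ] G) →L[ℝ] E →L[ℝ] G) Q2 hDf
    have hA'c : ∀ x, ContinuousOn (fun s => A' s x) (Icc 0 T) := fun x =>
      Q2.continuous.comp_continuousOn (hDc x)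
    have hS' : UHol α (Icc 0 T) k S' := hDf.clm Q1
    have hS'c : ∀ x, ContinuousOn (fun s => S' s x) (Icc 0 T) := fun x =>
      Q1.continuous.comp_continuousOn (hDc x)
    have hv : ∀ x, ∃ v : ℝ → E →L[ℝ] G, Continuous v ∧ ∀ t ∈ Icc 0 T,
        v t = fderiv ℝ z0 x + ∫ s in (0 : ℝ)..t, (A' s x (v s) + S' s x) := fun x =>
      exists_linear_curve hT (hA'c x) (hS'c x) _
    choose v hvc hv using hv
    have hvii : ∀ x, ∀ t ∈ Icc 0 T,
        IntervalIntegrable (fun s => A' s x (v x s) + S' s x) volume 0 t :=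
      fun x t ht => intervalIntegrable_of_continuousOn_Icc
        (((hA'c x).clm_apply (hvc x).continuousOn).add (hS'c x)) ht
    have hd : ∀ t ∈ Icc 0 T, ∀ x, HasFDerivAt (z t) (v x t) x := by
      intro t ht x
      refine hasFDerivAt_of_norm_le_rpow hα (C := 2 * (N0 + (Nf * (1 + MZ) ^ (1 + α)) * T) *
        Real.exp ((2 * Mf + 1) * T)) fun h => ?_
      have hvh : ∀ t ∈ Icc 0 T, v x t h =
          fderiv ℝ z0 x h + ∫ s in (0 : ℝ)..t, (A' s x (v x s) + S' s x) h := by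
        intro t ht
        conv_lhs => rw [hv x t ht]
        rw [add_apply, ContinuousLinearMap.intervalIntegral_apply (hvii x t ht)]
      have h1 : ‖z t (x + h) - z t x - v x t h‖ ≤
          2 * (‖z0 (x + h) - z0 x - fderiv ℝ z0 x h‖ + (Nf * (1 + MZ) ^ (1 + α) * ‖h‖ ^ (1 + α)) * T)
            * Real.exp ((2 * Mf + 1) * T) := by
        refine norm_le_of_eq_add_integral (y := fun t => z t (x + h) - z t x - v x t h)
          (g := fun s => f (x + h, z s (x + h)) - f (x, z s x) - (A' s x (v x s) + S' s x) h)
          hMf0 (by positivity) (((hzc _).sub (hzc x)).sub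
            ((hvc x).clm_apply continuous_const).continuousOn) (fun s hs => ?_) (fun s hs => ?_) t ht
        · have i1 := hii (x + h) s hs
          have i2 := hii x s hs
          have i3 : IntervalIntegrable (fun s => (A' s x (v x s) + S' s x) h) volume 0 s :=
            intervalIntegrable_of_continuousOn_Icc ((((hA'c x).clm_apply (hvc x).continuousOn).add
              (hS'c x)).clm_apply continuousOn_const) hs
          rw [intervalIntegral.integral_sub (i1.sub i2) i3, intervalIntegral.integral_sub i1 i2,
            hz _ s hs, hz x s hs, hvh s hs]
          abel
        · set d : E × G := (h, z s (x + h) - z s x) with hdd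
          have e0 : (x + h, z s (x + h)) = (x, z s x) + d := by simp [hdd]
          -- the error solves the linearised equation up to a Taylor remainder
          have : f (x + h, z s (x + h)) - f (x, z s x) - (A' s x (v x s) + S' s x) h =
              fderiv ℝ f (x, z s x) (0, z s (x + h) - z s x - v x s h) +
              (f ((x, z s x) + d) - f (x, z s x) - fderiv ℝ f (x, z s x) d) := by
            have e1 : d = (0, z s (x + h) - z s x - v x s h) + ((h, 0) + (0, v x s h)) := by
              simp [hdd]
            have e2 : (A' s x (v x s) + S' s x) h =
                fderiv ℝ f (x, z s x) (0, v x s h) + fderiv ℝ f (x, z s x) (h, 0) := by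
              simp [A', S', Q1, Q2]
            rw [e0, e2]
            conv_rhs => rw [show fderiv ℝ f (x, z s x) d = fderiv ℝ f (x, z s x) _ from
              congrArg _ e1, map_add, map_add]
            abel
          rw [this]
          refine norm_add_le_of_le (ContinuousLinearMap.le_opNorm _ _ |>.trans ?_)
            ((hNf s hs _ _).trans ?_)
          · gcongr
            · exact hMf s hs _
            · simp
          · rw [mul_assoc, ← Real.mul_rpow (by positivity) (norm_nonneg _)]
            gcongr
            have e3 : ‖z s (x + h) - z s x‖ ≤ MZ * ‖h‖ := by simpa using hMZ s hs (x + h) x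
            have e4 : 0 ≤ MZ * ‖h‖ := by positivity
            have e5 := norm_nonneg h
            rw [hdd, Prod.norm_mk, add_mul, one_mul]
            exact max_le (by linarith) (by linarith)
      calc _ ≤ _ := h1
        _ ≤ 2 * (N0 * ‖h‖ ^ (1 + α) + (Nf * (1 + MZ) ^ (1 + α) * ‖h‖ ^ (1 + α)) * T)
            * Real.exp ((2 * Mf + 1) * T) := by gcongr; exact hN0 0 h0T x h
        _ = _ := by ring
    refine ⟨fun t ht x => (hd t ht x).differentiableAt, ?_⟩
    have h2 : UHol α (Icc 0 T) k (fun t x => v x t) :=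
      UHol.linear_ode hα hα1 hT hA' hA'c hS' hS'c hz0.2 (fun x => (hvc x).continuousOn) hv
    exact h2.congr fun t ht => by ext1 x; exact (hd t ht x).fderiv.symm

end ODERegularity

/-! ### Mollification -/

section Mollify

/-- A function that is Hölder continuous on a dense set agrees there with a continuous function
satisfying the same estimate everywhere. -/
theorem exists_extension_of_dense_of_holder {X F : Type} [NormedAddCommGroup X]
    [NormedAddCommGroup F] [CompleteSpace F]
    {A : Set X} (hA : Dense A) {f : X → F} {C θ : ℝ} (hθ : 0 < θ)
    (hf : ∀ x ∈ A, ∀ y ∈ A, ‖f x - f y‖ ≤ C * ‖x - y‖ ^ θ) :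
    ∃ g : X → F, (∀ x ∈ A, g x = f x) ∧ Continuous g ∧ ∀ x y, ‖g x - g y‖ ≤ C * ‖x - y‖ ^ θ := by
  have hrc : Continuous fun r : ℝ => C * r ^ θ :=
    continuous_const.mul (continuous_id.rpow_const fun _ => Or.inr hθ.le)
  have hu : UniformContinuous (fun a : A => f a) := by
    rw [Metric.uniformContinuous_iff]
    intro ε hε
    have h0 : Tendsto (fun r : ℝ => C * r ^ θ) (𝓝 0) (𝓝 0) := by
      simpa [Real.zero_rpow hθ.ne'] using hrc.tendsto 0
    obtain ⟨δ, hδ, h⟩ := Metric.eventually_nhds_iff.1 (h0.eventually (gt_mem_nhds hε))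
    refine ⟨δ, hδ, fun {a b} hab => ?_⟩
    rw [dist_eq_norm]
    refine (hf a a.2 b b.2).trans_lt (h ?_)
    rw [Subtype.dist_eq, dist_eq_norm] at hab
    simpa [dist_eq_norm, abs_of_nonneg] using hab
  have hgc := (hA.uniformContinuous_extend hu).continuous
  have hgA : ∀ x ∈ A, hA.extend (fun a : A => f a) x = f x := fun x hx =>
    hA.extend_of_ind hu ⟨x, hx⟩
  refine ⟨_, hgA, hgc, ?_⟩
  have hcl : IsClosed {p : X × X | ‖hA.extend (fun a : A => f a) p.1 -
      hA.extend (fun a : A => f a) p.2‖ ≤ C * ‖p.1 - p.2‖ ^ θ} :=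
    isClosed_le (by fun_prop) (hrc.comp (by fun_prop : Continuous fun p : X × X => ‖p.1 - p.2‖))
  have hd : Dense (A ×ˢ A) := hA.prod hA
  intro x y
  have : closure (A ×ˢ A) ⊆ _ := hcl.closure_subset_iff.2 (fun p hp => by
    simp only [mem_ofPred_eq]
    rw [hgA _ hp.1, hgA _ hp.2]; exact hf _ hp.1 _ hp.2)
  exact this (hd (x, y))

variable {E : Type} [NormedAddCommGroup E]
  {F : Type} [NormedAddCommGroup F] [NormedSpace ℝ F]

variable (E) in
/-- A sequence of smooth bump functions whose supports shrink to the origin. The ratio of the two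
radii is fixed, as the Lebesgue differentiation theorem behind `ae_tendsto_moll` demands. -/
noncomputable def mollBump (n : ℕ) : ContDiffBump (0 : E) where
  rIn := 1 / ((n : ℝ) + 1)
  rOut := 2 / ((n : ℝ) + 1)
  rIn_pos := by positivity
  rIn_lt_rOut := by gcongr; norm_num

theorem tendsto_mollBump_rOut : Tendsto (fun n => (mollBump E n).rOut) atTop (𝓝 0) := by
  have := (tendsto_one_div_add_atTop_nhds_zero_nat (𝕜 := ℝ)).const_mul 2
  simp only [mul_zero] at this
  exact this.congr fun n => by simp [mollBump, div_eq_mul_inv]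

theorem tendsto_rOut_rpow {θ C : ℝ} (hθ : 0 < θ) :
    Tendsto (fun n => C * (mollBump E n).rOut ^ θ) atTop (𝓝 0) := by
  have := ((tendsto_mollBump_rOut (E := E)).rpow_const (p := θ) (Or.inr hθ.le)).const_mul C
  simpa [Real.zero_rpow hθ.ne'] using this

variable [NormedSpace ℝ E] [FiniteDimensional ℝ E]
  [MeasurableSpace E] [BorelSpace E] {μ : Measure E} [μ.IsAddHaarMeasure]

variable (μ) in
/-- The `n`-th mollification of `f`. -/
noncomputable def moll (n : ℕ) (f : E → F) : E → F :=
  ((mollBump E n).normed μ) ⋆[ContinuousLinearMap.lsmul ℝ ℝ, μ] f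

theorem moll_apply (n : ℕ) (f : E → F) (x : E) :
    moll μ n f x = ∫ t, (mollBump E n).normed μ (x - t) • f t ∂μ := convolution_lsmul_swap

theorem ae_tendsto_moll [CompleteSpace F] {f : E → F} (hf : LocallyIntegrable f μ) :
    ∀ᵐ x ∂μ, Tendsto (fun n => moll μ n f x) atTop (𝓝 (f x)) :=
  ContDiffBump.ae_convolution_tendsto_right_of_locallyIntegrable (K := 2) tendsto_mollBump_rOut
    (Eventually.of_forall fun n => by simp [mollBump, div_eq_mul_inv]) hf

theorem norm_moll_le {f : E → F} {M : ℝ} (hf : ∀ᵐ x ∂μ, ‖f x‖ ≤ M) (n : ℕ) (x : E) :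
    ‖moll μ n f x‖ ≤ M := by
  rw [moll_apply]
  have h1 : ∫ t, (mollBump E n).normed μ (x - t) ∂μ = 1 := by
    rw [integral_sub_left_eq_self (fun t => (mollBump E n).normed μ t)]
    exact (mollBump E n).integral_normed
  have hi : Integrable (fun t => (mollBump E n).normed μ (x - t)) μ :=
    (mollBump E n).integrable_normed.comp_sub_left x
  calc _ ≤ ∫ t, (mollBump E n).normed μ (x - t) * M ∂μ := by
        apply norm_integral_le_of_norm_le (hi.mul_const M)
        filter_upwards [hf] with t ht
        rw [norm_smul, Real.norm_of_nonneg ((mollBump E n).nonneg_normed _)]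
        gcongr
        exact (mollBump E n).nonneg_normed _
    _ = M := by rw [integral_mul_const, h1, one_mul]

theorem moll_congr {f g : E → F} (h : f =ᵐ[μ] g) (n : ℕ) : moll μ n f = moll μ n g := by
  ext x
  rw [moll_apply, moll_apply]
  exact integral_congr_ae (by filter_upwards [h] with t ht; rw [ht])

/-- The rate of convergence of the mollifications of a Hölder continuous function. -/
theorem norm_moll_sub_le [CompleteSpace F] {f : E → F} (hf : Continuous f) {C θ : ℝ} (hC : 0 ≤ C) (hθ : 0 < θ)
    (h : ∀ x y, ‖f x - f y‖ ≤ C * ‖x - y‖ ^ θ) (n : ℕ) (x : E) :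
    ‖moll μ n f x - f x‖ ≤ C * (mollBump E n).rOut ^ θ := by
  rw [← dist_eq_norm]
  refine ContDiffBump.dist_normed_convolution_le hf.aestronglyMeasurable fun y hy => ?_
  rw [dist_eq_norm]
  refine (h y x).trans ?_
  rw [Metric.mem_ball, dist_eq_norm] at hy
  gcongr

theorem contDiff_moll {f : E → F} (hf : LocallyIntegrable f μ) (n : ℕ) : ContDiff ℝ ∞ (moll μ n f) :=
  (mollBump E n).hasCompactSupport_normed.contDiff_convolution_left _
    (mollBump E n).contDiff_normed hf

/-- Mollification turns a weak derivative into a derivative. -/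
theorem fderiv_moll_apply {v : E} {f g : E → F} (hf : LocallyIntegrable f μ)
    (hw : ∀ φ : E → ℝ, ContDiff ℝ ∞ φ → HasCompactSupport φ →
      ∫ x, (fderiv ℝ φ x v) • f x ∂μ = - ∫ x, φ x • g x ∂μ) (n : ℕ) (x : E) :
    fderiv ℝ (moll μ n f) x v = moll μ n g x := by
  set φ := (mollBump E n).normed μ with hφ
  have hφc : ContDiff ℝ ∞ φ := (mollBump E n).contDiff_normed
  have hφs : HasCompactSupport φ := (mollBump E n).hasCompactSupport_normed
  have h1 := hφs.hasFDerivAt_convolution_left (ContinuousLinearMap.lsmul ℝ ℝ) (hφc.of_le (by simp)) hf x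
  have h2 : fderiv ℝ (moll μ n f) x = _ := h1.fderiv
  have hce : ConvolutionExistsAt (fderiv ℝ φ) f x ((ContinuousLinearMap.lsmul ℝ ℝ).precompL E) μ :=
    (hφs.fderiv ℝ).convolutionExists_left _ (hφc.continuous_fderiv (by simp)) hf x
  rw [h2, convolution_eq_swap, ContinuousLinearMap.integral_apply, moll_apply]
  · have h3 := hw (fun t => φ (x - t)) (hφc.comp (contDiff_const.sub contDiff_id))
      (hφs.comp_homeomorph (Homeomorph.subLeft x))
    rw [← neg_eq_iff_eq_neg] at h3
    rw [← h3, ← integral_neg]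
    congr 1; ext t
    have h4 : fderiv ℝ (fun t => φ (x - t)) t = -(fderiv ℝ φ (x - t)) := by
      have := ((hφc.differentiable (by simp)) (x - t)).hasFDerivAt.comp t ((hasFDerivAt_id t).const_sub x)
      rw [HasFDerivAt.fderiv (f := fun t => φ (x - t)) this]
      ext; simp
    rw [h4]
    simp [ContinuousLinearMap.precompL_apply]
  · have := hce.integrable_swap
    exact this

end Mollify

/-! ### Hölder continuous representatives of Sobolev functions -/

section Weak
variable {F : Type} [NormedAddCommGroup F] [NormedSpace ℝ F]

theorem locallyIntegrable_of_ae_bdd {X F : Type} [TopologicalSpace X] [MeasurableSpace X]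
    [NormedAddCommGroup F] {μ : Measure X}
    [IsLocallyFiniteMeasure μ] {f : X → F} {M : ℝ} (hf : AEStronglyMeasurable f μ)
    (hM : ∀ᵐ x ∂μ, ‖f x‖ ≤ M) : LocallyIntegrable f μ := fun x => by
  obtain ⟨s, hs, hμ⟩ := μ.exists_isOpen_measure_lt_top x
  refine ⟨s, hμ.1.mem_nhds hs, ?_⟩
  have : IsFiniteMeasure (μ.restrict s) := ⟨by simpa using hμ.2⟩
  exact Integrable.of_bound hf.restrict M (ae_restrict_of_ae hM)

theorem IsWeakDeriv.fderiv_moll {v : Plane} {f g : Plane → F} (h : IsWeakDeriv v f g) (n : ℕ) (x : Plane) :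
    fderiv ℝ (moll volume n f) x v = moll volume n g x :=
  fderiv_moll_apply h.1 h.2.2 n x

theorem plane_decomp (v : Plane) : v = v 0 • basisVec 0 + v 1 • basisVec 1 := by
  ext i
  fin_cases i <;> simp [basisVec]

theorem norm_basisVec (i : Fin 2) : ‖basisVec i‖ = 1 := by
  simp [basisVec]

theorem norm_clm_le_of_basisVec {L : Plane →L[ℝ] F} {M : ℝ} (h : ∀ i, ‖L (basisVec i)‖ ≤ M) :
    ‖L‖ ≤ 2 * M := by
  have hM : 0 ≤ M := (norm_nonneg _).trans (h 0)
  refine L.opNorm_le_bound (by positivity) fun v => ?_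
  conv_lhs => rw [plane_decomp v]
  rw [map_add, map_smul, map_smul]
  have h0 : ‖v 0‖ ≤ ‖v‖ := PiLp.norm_apply_le v 0
  have h1 : ‖v 1‖ ≤ ‖v‖ := PiLp.norm_apply_le v 1
  calc _ ≤ ‖v 0‖ * ‖L (basisVec 0)‖ + ‖v 1‖ * ‖L (basisVec 1)‖ := by
        rw [← norm_smul, ← norm_smul]; exact norm_add_le _ _
    _ ≤ ‖v‖ * M + ‖v‖ * M := by gcongr; exacts [h 0, h 1]
    _ = _ := by ring

/-- A bounded function with bounded weak derivatives has a Lipschitz representative. -/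
theorem exists_lipschitz_rep [CompleteSpace F] {f : Plane → F} {g : Fin 2 → Plane → F} {M : ℝ}
    (hf : ∀ᵐ x, ‖f x‖ ≤ M) (hg : ∀ i, IsWeakDeriv (basisVec i) f (g i))
    (hgM : ∀ i, ∀ᵐ x, ‖g i x‖ ≤ M) :
    ∃ f' : Plane → F, f =ᵐ[volume] f' ∧ (∀ x, ‖f' x‖ ≤ M) ∧
      ∀ x y, ‖f' x - f' y‖ ≤ 2 * M * ‖x - y‖ := by
  have hfl : LocallyIntegrable f volume := (hg 0).1
  let A := {x | Tendsto (fun n => moll volume n f x) atTop (𝓝 (f x))}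
  have hA : ∀ᵐ x, x ∈ A := ae_tendsto_moll hfl
  have hAd : Dense A := Measure.dense_of_ae hA
  have hlip : ∀ n x y, ‖moll volume n f x - moll volume n f y‖ ≤ 2 * M * ‖x - y‖ := fun n x y => by
    refine convex_univ.norm_image_sub_le_of_norm_fderiv_le (𝕜 := ℝ)
      (fun z _ => ((contDiff_moll hfl n).differentiable (by simp)) z) (fun z _ => ?_) (mem_univ _) (mem_univ _)
    refine norm_clm_le_of_basisVec fun i => ?_
    rw [(hg i).fderiv_moll]
    exact norm_moll_le (hgM i) n z
  obtain ⟨f', h1, h2, h3⟩ := exists_extension_of_dense_of_holder hAd (f := f) (C := 2 * M) (θ := 1)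
    one_pos (fun x hx y hy => by
      rw [Real.rpow_one]
      exact le_of_tendsto' (hx.sub hy).norm fun n => hlip n x y)
  refine ⟨f', by filter_upwards [hA] with x hx using (h1 x hx).symm, ?_, fun x y => by simpa using h3 x y⟩
  have hcl : IsClosed {x | ‖f' x‖ ≤ M} := isClosed_le (by fun_prop) continuous_const
  have : closure A ⊆ {x | ‖f' x‖ ≤ M} := hcl.closure_subset_iff.2 fun x hx => by
    simp only [mem_ofPred_eq]
    rw [h1 x hx]
    exact le_of_tendsto' hx.norm fun n => norm_moll_le hf n x
  exact fun x => this (hAd x)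

/-- A bounded function with an almost everywhere Hölder estimate for pairs of points has a Hölder
continuous representative. Two good points are compared through a third point tending to one of
them. -/
theorem exists_holder_rep {F : Type} [NormedAddCommGroup F] [CompleteSpace F] {f : Plane → F} {M θ : ℝ} (hθ : 0 < θ)
    (hf : ∀ᵐ x, ‖f x‖ ≤ M) (hh : ∀ᵐ p : Plane × Plane ∂(volume.prod volume),
          ‖f p.1 - f p.2‖ ≤ M * ‖p.1 - p.2‖ ^ θ) :
    ∃ f' : Plane → F, f =ᵐ[volume] f' ∧ Continuous f' ∧ (∀ x, ‖f' x‖ ≤ M) ∧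
      ∀ x y, ‖f' x - f' y‖ ≤ M * ‖x - y‖ ^ θ := by
  let A := {x | ‖f x‖ ≤ M ∧ ∀ᵐ y, ‖f x - f y‖ ≤ M * ‖x - y‖ ^ θ}
  have hA : ∀ᵐ x, x ∈ A := by
    filter_upwards [hf, Measure.ae_ae_of_ae_prod hh] with x h1 h2 using ⟨h1, h2⟩
  have hAd : Dense A := Measure.dense_of_ae hA
  obtain ⟨f', h1, h2, h3⟩ := exists_extension_of_dense_of_holder hAd (f := f) (C := M) (θ := θ) hθ
    (fun x hx y hy => by
      -- a third point `z` comparable with both `x` and `y` may be taken close to `y`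
      have hd : Dense {z | ‖f x - f z‖ ≤ M * ‖x - z‖ ^ θ ∧ ‖f y - f z‖ ≤ M * ‖y - z‖ ^ θ} :=
        Measure.dense_of_ae (hx.2.and hy.2)
      have hcl : IsClosed {z | ‖f x - f y‖ ≤ M * ‖x - z‖ ^ θ + M * ‖y - z‖ ^ θ} := by
        refine isClosed_le continuous_const (Continuous.add ?_ ?_) <;>
        exact continuous_const.mul ((by fun_prop : Continuous fun z : Plane => ‖_ - z‖).rpow_const
          fun _ => Or.inr hθ.le)
      have : closure _ ⊆ _ := hcl.closure_subset_iff.2 (fun z hz => by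
        simp only [mem_ofPred_eq] at hz ⊢
        have : f x - f y = (f x - f z) - (f y - f z) := by abel
        rw [this]
        exact norm_sub_le_of_le hz.1 hz.2 :
          {z | ‖f x - f z‖ ≤ M * ‖x - z‖ ^ θ ∧ ‖f y - f z‖ ≤ M * ‖y - z‖ ^ θ} ⊆ _)
      have h4 := this (hd y)
      simpa [Real.zero_rpow hθ.ne'] using h4)
  refine ⟨f', by filter_upwards [hA] with x hx using (h1 x hx).symm, h2, ?_, h3⟩
  have hcl : IsClosed {x | ‖f' x‖ ≤ M} := isClosed_le (by fun_prop) continuous_const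
  have : closure A ⊆ {x | ‖f' x‖ ≤ M} := hcl.closure_subset_iff.2 fun x hx => by
    simp only [mem_ofPred_eq]
    rw [h1 x hx]; exact hx.1
  exact fun x => this (hAd x)

/-- `coordCLM i a` is the linear map `v ↦ v_i a`; a linear map of the plane with values `a₀`, `a₁` at
the basis vectors is `coordCLM 0 a₀ + coordCLM 1 a₁`. -/
noncomputable def coordCLM (i : Fin 2) : F →L[ℝ] (Plane →L[ℝ] F) :=
  ContinuousLinearMap.smulRightL ℝ Plane F (EuclideanSpace.proj i)

theorem coordCLM_apply (i : Fin 2) (a : F) (v : Plane) : coordCLM i a v = v i • a := by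
  simp [coordCLM]

/-- A function whose weak derivatives have Hölder continuous representatives is differentiable. -/
theorem hasFDerivAt_of_isWeakDeriv [CompleteSpace F] {f : Plane → F} {g : Fin 2 → Plane → F} {C θ L : ℝ}
    (hC : 0 ≤ C) (hθ : 0 < θ) (hL : 0 ≤ L) (hf : ∀ x y, ‖f x - f y‖ ≤ L * ‖x - y‖)
    (hg : ∀ i, IsWeakDeriv (basisVec i) f (g i)) (hgc : ∀ i, Continuous (g i))
    (hgM : ∀ i x y, ‖g i x - g i y‖ ≤ C * ‖x - y‖ ^ θ) (x : Plane) :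
    HasFDerivAt f (coordCLM 0 (g 0 x) + coordCLM 1 (g 1 x)) x := by
  have hfl : LocallyIntegrable f volume := (hg 0).1
  have hfc : Continuous f := (LipschitzWith.of_dist_le_mul (K := L.toNNReal) fun a b => by
    simpa [dist_eq_norm, Real.coe_toNNReal L hL] using hf a b).continuous
  refine hasFDerivAt_of_tendstoUniformly (l := atTop) (f := fun n => moll volume n f)
    (f' := fun n x => fderiv ℝ (moll volume n f) x)
    (g' := fun x => coordCLM 0 (g 0 x) + coordCLM 1 (g 1 x)) ?_
    (fun n x => ((contDiff_moll hfl n).differentiable (by simp) x).hasFDerivAt) (fun x => ?_) x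
  · rw [Metric.tendstoUniformly_iff]
    intro ε hε
    have := tendsto_rOut_rpow (E := Plane) (C := 2 * C) hθ
    filter_upwards [this.eventually (gt_mem_nhds hε)] with n hn x
    refine lt_of_le_of_lt ?_ hn
    rw [dist_comm, dist_eq_norm, mul_assoc]
    refine norm_clm_le_of_basisVec fun i => ?_
    have h1 : (coordCLM 0 (g 0 x) + coordCLM 1 (g 1 x)) (basisVec i) = g i x := by
      fin_cases i <;> simp [coordCLM_apply, basisVec]
    rw [sub_apply, h1, (hg i).fderiv_moll]
    exact norm_moll_sub_le (hgc i) hC hθ (hgM i) n x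
  · rw [tendsto_iff_norm_sub_tendsto_zero]
    refine squeeze_zero (fun _ => norm_nonneg _) (fun n => ?_) (tendsto_rOut_rpow (E := Plane) (C := L) one_pos)
    exact norm_moll_sub_le hfc hL one_pos (by simpa using hf) n x

theorem IsWeakDeriv.congr {v : Plane} {f g f' g' : Plane → F} (h : IsWeakDeriv v f g)
    (hf : f =ᵐ[volume] f') (hg : g =ᵐ[volume] g') : IsWeakDeriv v f' g' := by
  refine ⟨(locallyIntegrable_congr hf).1 h.1, (locallyIntegrable_congr hg).1 h.2.1, fun φ h1 h2 => ?_⟩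
  have e1 : ∫ x, (fderiv ℝ φ x v) • f x = ∫ x, (fderiv ℝ φ x v) • f' x :=
    integral_congr_ae (by filter_upwards [hf] with x hx; rw [hx])
  have e2 : ∫ x, φ x • g x = ∫ x, φ x • g' x :=
    integral_congr_ae (by filter_upwards [hg] with x hx; rw [hx])
  rw [← e1, ← e2]
  exact h.2.2 φ h1 h2

/-- The inductive step: if the weak derivatives have representatives of class `C^{k,α}`, the function
has a representative of class `C^{k+1,α}`. -/
theorem exists_uHol_rep_succ [CompleteSpace F] {α : ℝ} (hα : 0 < α) (hα1 : α ≤ 1) {k : ℕ} {f : Plane → F} {M : ℝ}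
    (hf : ∀ᵐ x, ‖f x‖ ≤ M)
    (hg : ∀ i : Fin 2, ∃ g : Plane → F, IsWeakDeriv (basisVec i) f g ∧ ∃ g' : Plane → F,
      g =ᵐ[volume] g' ∧ UHol α (univ : Set Unit) k (fun _ => g')) :
    ∃ f' : Plane → F, f =ᵐ[volume] f' ∧ UHol α (univ : Set Unit) (k + 1) (fun _ => f') := by
  choose g hgw g' hgg hg' using hg
  have hg'0 := fun i => ((hg' i).mono hα hα1 (Nat.zero_le k)).zero_bounds
  choose N hN0 hN using hg'0
  have hM : ∃ M' : ℝ, 0 ≤ M' ∧ M ≤ M' ∧ ∀ i, N i ≤ M' :=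
    ⟨max M (max (N 0) (N 1)), ((hN0 0).trans (le_max_left _ _)).trans (le_max_right _ _),
      le_max_left _ _, fun i => by fin_cases i <;> simp⟩
  obtain ⟨M', hM0, hMM, hNM⟩ := hM
  obtain ⟨f', h1, h2, h3⟩ := exists_lipschitz_rep (f := f) (g := g) (M := M')
    (hf.mono fun x hx => hx.trans hMM) hgw (fun i => by
      filter_upwards [hgg i] with x hx
      rw [hx]
      exact ((hN i () (mem_univ _)).1 x).trans (hNM i))
  have hd := hasFDerivAt_of_isWeakDeriv (f := f') (g := g') (C := M') (θ := α) hM0 hα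
    (by positivity) h3 (fun i => (hgw i).congr h1 (hgg i))
    (fun i => (hg' i).continuous hα hα1 (mem_univ ()))
    (fun i x y => ((hN i () (mem_univ _)).2 x y).trans (by gcongr; exact hNM i))
  refine ⟨f', h1, ⟨M', fun _ _ => h2⟩, fun _ _ x => (hd x).differentiableAt, ?_⟩
  refine (((hg' 0).clm (coordCLM 0)).add ((hg' 1).clm (coordCLM 1))).congr fun _ _ => ?_
  ext1 x
  exact (hd x).fderiv.symm

theorem WBoundAux.exists_lipschitz_rep [CompleteSpace F] {θ M : ℝ} {k : ℕ} {f : Plane → F}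
    (h : WBoundAux θ M (k + 1) f) :
    ∃ f' : Plane → F, f =ᵐ[volume] f' ∧ (∀ x, ‖f' x‖ ≤ M) ∧
      ∀ x y, ‖f' x - f' y‖ ≤ 2 * M * ‖x - y‖ := by
  obtain ⟨-, h1, h2⟩ := h
  choose g hg hgW using h2
  refine _root_.exists_lipschitz_rep h1 hg fun i => ?_
  have := hgW i
  cases k with
  | zero => exact this.2.1
  | succ k => exact this.2.1

/-- Sobolev functions of noninteger order are Hölder functions. -/
theorem WBoundAux.exists_uHol_rep [CompleteSpace F] {θ M : ℝ} (hθ : 0 < θ) (hθ1 : θ ≤ 1) {k : ℕ}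
    {f : Plane → F} (h : WBoundAux θ M k f) :
    ∃ f' : Plane → F, f =ᵐ[volume] f' ∧ UHol θ (univ : Set Unit) k (fun _ => f') := by
  induction k generalizing f with
  | zero =>
    obtain ⟨-, h1, h2⟩ := h
    obtain ⟨f', h3, -, h4, h5⟩ := exists_holder_rep hθ h1 (h2 hθ)
    exact ⟨f', h3, M, fun _ _ => ⟨h4, h5⟩⟩
  | succ k ih =>
    obtain ⟨-, h1, h2⟩ := h
    refine exists_uHol_rep_succ hθ hθ1 h1 fun i => ?_
    obtain ⟨g, hg, hgW⟩ := h2 i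
    exact ⟨g, hg, ih hgW⟩

/-- Sobolev functions of integer order `k + 1` are functions of class `C^{k,1}`: bounded top
derivatives mean Lipschitz derivatives one order below. -/
theorem WBoundAux.exists_uHol_rep_one [CompleteSpace F] {M : ℝ} {k : ℕ}
    {f : Plane → F} (h : WBoundAux 0 M (k + 1) f) :
    ∃ f' : Plane → F, f =ᵐ[volume] f' ∧ UHol 1 (univ : Set Unit) k (fun _ => f') := by
  induction k generalizing f with
  | zero =>
    obtain ⟨f', h3, h4, h5⟩ := h.exists_lipschitz_rep
    exact ⟨f', h3, .of_bdd_lip one_pos le_rfl (fun _ _ => h4) (fun _ _ => h5)⟩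
  | succ k ih =>
    obtain ⟨-, h1, h2⟩ := h
    refine exists_uHol_rep_succ one_pos le_rfl h1 fun i => ?_
    obtain ⟨g, hg, hgW⟩ := h2 i
    exact ⟨g, hg, ih hgW⟩

theorem UHol.reindex {ι κ E : Type} [NormedAddCommGroup E] [NormedSpace ℝ E] {α : ℝ} {k : ℕ} {I : Set ι} {J : Set κ}
    {f : ι → E → F} (hf : UHol α I k f) {φ : κ → ι} (hφ : ∀ j ∈ J, φ j ∈ I) :
    UHol α J k (fun j => f (φ j)) := by
  induction k generalizing F with
  | zero => exact hf.imp fun M h j hj => h _ (hφ j hj)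
  | succ k ih => exact ⟨hf.1.imp fun M h j hj => h _ (hφ j hj), fun j hj => hf.2.1 _ (hφ j hj), ih hf.2.2⟩

end Weak

/-! ### Integration by parts for Lipschitz functions, and Sobolev bounds from Hölder bounds -/

section LipschitzIBP

theorem integrable_of_ae_bdd_of_support {X F : Type} [TopologicalSpace X] [T2Space X] [MeasurableSpace X]
    [OpensMeasurableSpace X] [NormedAddCommGroup F] {μ : Measure X} [IsFiniteMeasureOnCompacts μ]
    {h : X → F} {K : Set X} {B : ℝ} (hK : IsCompact K) (hm : AEStronglyMeasurable h μ)
    (hB : ∀ᵐ x ∂μ, ‖h x‖ ≤ B) (h0 : ∀ x, x ∉ K → h x = 0) : Integrable h μ := by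
  rw [← integrableOn_iff_integrable_of_support_subset (s := K)
    (fun x hx => by_contra fun hxK => hx (h0 x hxK))]
  have : IsFiniteMeasure (μ.restrict K) := ⟨by simpa using hK.measure_lt_top⟩
  exact Integrable.of_bound hm.restrict B (ae_restrict_of_ae hB)

variable {E F : Type} [NormedAddCommGroup E] [NormedSpace ℝ E] [FiniteDimensional ℝ E]
  [MeasurableSpace E] [BorelSpace E] {μ : Measure E} [μ.IsAddHaarMeasure]
  [NormedAddCommGroup F] [NormedSpace ℝ F] [FiniteDimensional ℝ F]

theorem stronglyMeasurable_fderiv_apply {E : Type} [NormedAddCommGroup E] [NormedSpace ℝ E]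
    [MeasurableSpace E] [OpensMeasurableSpace E] (f : E → F) (v : E) :
    StronglyMeasurable (fun x => fderiv ℝ f x v) := by
  have : CompleteSpace F := FiniteDimensional.complete ℝ F
  have : ProperSpace F := FiniteDimensional.proper_real F
  borelize F
  exact (measurable_fderiv_apply_const ℝ f v).stronglyMeasurable

theorem norm_fderiv_apply_le {E F : Type} [NormedAddCommGroup E] [NormedSpace ℝ E]
    [NormedAddCommGroup F] [NormedSpace ℝ F] {f : E → F} {C : ℝ≥0} (hf : LipschitzWith C f) (x v : E) :
    ‖fderiv ℝ f x v‖ ≤ C * ‖v‖ :=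
  (ContinuousLinearMap.le_opNorm _ _).trans (by gcongr; exact norm_fderiv_le_of_lipschitz ℝ hf)

theorem fderiv_eq_zero_of_notMem_tsupport {E F : Type} [NormedAddCommGroup E] [NormedSpace ℝ E]
    [NormedAddCommGroup F] [NormedSpace ℝ F] {ψ : E → F} {x : E} (hx : x ∉ tsupport ψ) :
    fderiv ℝ ψ x = 0 := by
  have := (notMem_tsupport_iff_eventuallyEq.1 hx).fderiv_eq (𝕜 := ℝ)
  rw [this]; simp

/-- Integration by parts for Lipschitz functions. The scalar case is Rademacher's theorem together
with `LipschitzWith.integral_lineDeriv_mul_eq`; vector values are tested with functionals. -/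
theorem integral_fderiv_smul_eq {f : E → F} {ψ : E → ℝ} {C D : ℝ≥0} (hf : LipschitzWith C f)
    (hψ : LipschitzWith D ψ) (hs : HasCompactSupport ψ) (v : E) :
    Integrable (fun x => fderiv ℝ ψ x v • f x) μ ∧ Integrable (fun x => ψ x • fderiv ℝ f x v) μ ∧
    ∫ x, fderiv ℝ ψ x v • f x ∂μ = - ∫ x, ψ x • fderiv ℝ f x v ∂μ := by
  have : CompleteSpace F := FiniteDimensional.complete ℝ F
  obtain ⟨Bf, hBf⟩ := hs.isCompact.exists_bound_of_continuousOn hf.continuous.continuousOn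
  obtain ⟨Bψ, hBψ⟩ := hψ.continuous.bounded_above_of_compact_support hs
  have i1 : Integrable (fun x => fderiv ℝ ψ x v • f x) μ := by
    refine integrable_of_ae_bdd_of_support (K := tsupport ψ) (B := D * ‖v‖ * max Bf 0) hs.isCompact
      ((stronglyMeasurable_fderiv_apply ψ v).aestronglyMeasurable.smul
        hf.continuous.aestronglyMeasurable) (ae_of_all _ fun x => ?_) fun x hx => ?_
    · by_cases hx : x ∈ tsupport ψ
      · rw [norm_smul]
        gcongr
        exacts [norm_fderiv_apply_le hψ x v, (hBf x hx).trans (le_max_left _ _)]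
      · simp only [fderiv_eq_zero_of_notMem_tsupport hx]
        simp only [zero_apply, zero_smul, norm_zero]
        positivity
    · simp [fderiv_eq_zero_of_notMem_tsupport hx]
  have i2 : Integrable (fun x => ψ x • fderiv ℝ f x v) μ := by
    refine integrable_of_ae_bdd_of_support (K := tsupport ψ) (B := max Bψ 0 * (C * ‖v‖)) hs.isCompact
      (hψ.continuous.aestronglyMeasurable.smul
        (stronglyMeasurable_fderiv_apply f v).aestronglyMeasurable) (ae_of_all _ fun x => ?_)
        fun x hx => ?_
    · rw [norm_smul]
      gcongr
      exacts [(hBψ x).trans (le_max_left _ _), norm_fderiv_apply_le hf x v]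
    · simp [image_eq_zero_of_notMem_tsupport hx]
  refine ⟨i1, i2, ?_⟩
  rw [SeparatingDual.eq_iff_forall_dual_eq (R := ℝ)]
  intro g
  have hgf : LipschitzWith (‖g‖₊ * C) (fun x => g (f x)) := g.lipschitz.comp hf
  have h1 := LipschitzWith.integral_lineDeriv_mul_eq (μ := μ) hgf hψ hs v
  rw [map_neg, ← g.integral_comp_comm i1, ← g.integral_comp_comm i2]
  have h2 : ∫ x, g (ψ x • fderiv ℝ f x v) ∂μ = ∫ x, lineDeriv ℝ (fun x => g (f x)) x v * ψ x ∂μ := by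
    refine integral_congr_ae ?_
    filter_upwards [hf.ae_differentiableAt (μ := μ)] with x hx
    have : HasFDerivAt (fun x => g (f x)) (g.comp (fderiv ℝ f x)) x := g.hasFDerivAt.comp x hx.hasFDerivAt
    rw [this.differentiableAt.lineDeriv_eq_fderiv, this.fderiv]
    simp [mul_comm]
  have h3 : ∫ x, g (fderiv ℝ ψ x v • f x) ∂μ = - ∫ x, lineDeriv ℝ ψ x (-v) * g (f x) ∂μ := by
    rw [← integral_neg]
    refine integral_congr_ae ?_
    filter_upwards [hψ.ae_differentiableAt (μ := μ)] with x hx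
    rw [hx.lineDeriv_eq_fderiv]
    simp
  rw [h3, h2, h1]

theorem lipschitzWith_of_norm_le {E F : Type} [NormedAddCommGroup E] [NormedAddCommGroup F]
    {f : E → F} {C : ℝ} (h : ∀ x y, ‖f x - f y‖ ≤ C * ‖x - y‖) : LipschitzWith C.toNNReal f :=
  LipschitzWith.of_dist_le_mul fun a b => by
    rw [dist_eq_norm, dist_eq_norm]
    exact (h a b).trans (by gcongr; exact Real.le_coe_toNNReal C)

theorem lipschitzWith_of_contDiff {E : Type} [NormedAddCommGroup E] [NormedSpace ℝ E] {ψ : E → ℝ} (h1 : ContDiff ℝ ∞ ψ) (h2 : HasCompactSupport ψ) :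
    ∃ D, LipschitzWith D ψ :=
  ContDiff.lipschitzWith_of_hasCompactSupport (𝕂 := ℝ) h2 h1 (by simp)

/-- The almost everywhere derivative of a Lipschitz function is its weak derivative. -/
theorem isWeakDeriv_fderiv {f : Plane → F} {C : ℝ≥0} (hf : LipschitzWith C f) (v : Plane) :
    IsWeakDeriv v f (fun x => fderiv ℝ f x v) := by
  refine ⟨hf.continuous.locallyIntegrable, ?_, fun φ h1 h2 => ?_⟩
  · exact locallyIntegrable_of_ae_bdd (stronglyMeasurable_fderiv_apply f v).aestronglyMeasurable
      (ae_of_all _ fun x => norm_fderiv_apply_le hf x v)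
  · obtain ⟨D, hD⟩ := lipschitzWith_of_contDiff h1 h2
    exact (integral_fderiv_smul_eq hf hD h2 v).2.2

theorem WBoundAux.mono {F : Type} [NormedAddCommGroup F] [NormedSpace ℝ F] {θ M M' : ℝ} (hM : M ≤ M')
    {k : ℕ} {f : Plane → F} (h : WBoundAux θ M k f) : WBoundAux θ M' k f := by
  induction k generalizing f with
  | zero =>
    exact ⟨h.1, h.2.1.mono fun x hx => hx.trans hM, fun hθ => (h.2.2 hθ).mono fun p hp =>
      hp.trans (by gcongr)⟩
  | succ k ih =>
    refine ⟨h.1, h.2.1.mono fun x hx => hx.trans hM, fun i => ?_⟩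
    obtain ⟨g, hg, hgW⟩ := h.2.2 i
    exact ⟨g, hg, ih hgW⟩

theorem UHol.exists_wBoundAux {ι : Type} {α : ℝ} (hα : 0 < α) (hα1 : α ≤ 1) {I : Set ι} {k : ℕ}
    {f : ι → Plane → F} (hf : UHol α I k f) : ∃ M, ∀ i ∈ I, WBoundAux α M k (f i) := by
  induction k generalizing f with
  | zero =>
    obtain ⟨M, hM⟩ := hf
    exact ⟨M, fun i hi => ⟨(UHol.continuous hα hα1 (k := 0) ⟨M, hM⟩ hi).aestronglyMeasurable,
      ae_of_all _ (hM i hi).1, fun _ => ae_of_all _ fun p => (hM i hi).2 p.1 p.2⟩⟩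
  | succ k ih =>
    obtain ⟨M, hM0, hM⟩ := hf.bdd
    obtain ⟨L, hL0, hL⟩ := hf.uDer.lip
    have h1 : ∀ j : Fin 2, ∃ M, ∀ i ∈ I, WBoundAux α M k (fun x => fderiv ℝ (f i) x (basisVec j)) :=
      fun j => ih (hf.2.2.clm (ContinuousLinearMap.apply ℝ F (basisVec j)))
    choose N hN using h1
    refine ⟨max M (max (N 0) (N 1)), fun i hi => ⟨(hf.continuous hα hα1 hi).aestronglyMeasurable,
      ae_of_all _ fun x => (hM i hi x).trans (le_max_left _ _), fun j => ?_⟩⟩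
    refine ⟨_, isWeakDeriv_fderiv (lipschitzWith_of_norm_le (hL i hi)) _, (hN j i hi).mono ?_⟩
    fin_cases j <;> simp

theorem wBoundAux_zero_one {f : Plane → F} {M L : ℝ} (hM : ∀ x, ‖f x‖ ≤ M)
    (hL : ∀ x y, ‖f x - f y‖ ≤ L * ‖x - y‖) (hL0 : 0 ≤ L) : WBoundAux 0 (max M L) 1 f := by
  have hlip := lipschitzWith_of_norm_le hL
  refine ⟨hlip.continuous.aestronglyMeasurable, ae_of_all _ fun x => (hM x).trans (le_max_left _ _),
    fun i => ⟨_, isWeakDeriv_fderiv hlip _,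
      (stronglyMeasurable_fderiv_apply f _).aestronglyMeasurable, ae_of_all _ fun x => ?_,
      fun h => absurd h (lt_irrefl _)⟩⟩
  refine (norm_fderiv_apply_le hlip x _).trans ?_
  rw [norm_basisVec, mul_one, Real.coe_toNNReal L hL0]
  exact le_max_right _ _

theorem UHol.exists_wBoundAux_one {ι : Type} {I : Set ι} {k : ℕ}
    {f : ι → Plane → F} (hf : UHol 1 I k f) : ∃ M, ∀ i ∈ I, WBoundAux 0 M (k + 1) (f i) := by
  induction k generalizing f with
  | zero =>
    obtain ⟨M, hM0, hM⟩ := hf.zero_bounds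
    exact ⟨max M M, fun i hi => wBoundAux_zero_one (hM i hi).1 (by simpa using (hM i hi).2) hM0⟩
  | succ k ih =>
    obtain ⟨M, hM0, hM⟩ := hf.bdd
    obtain ⟨L, hL0, hL⟩ := hf.uDer.lip
    have h1 : ∀ j : Fin 2, ∃ M, ∀ i ∈ I, WBoundAux 0 M (k + 1) (fun x => fderiv ℝ (f i) x (basisVec j)) :=
      fun j => ih (hf.2.2.clm (ContinuousLinearMap.apply ℝ F (basisVec j)))
    choose N hN using h1
    refine ⟨max M (max (N 0) (N 1)), fun i hi => ⟨(hf.continuous one_pos le_rfl hi).aestronglyMeasurable,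
      ae_of_all _ fun x => (hM i hi x).trans (le_max_left _ _), fun j => ?_⟩⟩
    refine ⟨_, isWeakDeriv_fderiv (lipschitzWith_of_norm_le (hL i hi)) _, (hN j i hi).mono ?_⟩
    fin_cases j <;> simp

/-- The Hölder index of a Sobolev order. An integer `s` is written `(s - 1) + 1`, as `W^{s,∞}` is then
`C^{s-1,1}`; hence `k` is not the integer part of `s` in general. -/
theorem exists_holder_index {s : ℝ} (hs : 0 < s) : ∃ (k : ℕ) (α : ℝ), 0 < α ∧ α ≤ 1 ∧ s = k + α := by
  have h0 : 1 ≤ ⌈s⌉₊ := Nat.one_le_iff_ne_zero.2 (by simpa using hs)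
  have h1 : ((⌈s⌉₊ - 1 : ℕ) : ℝ) = (⌈s⌉₊ : ℝ) - 1 := by push_cast [h0]; ring
  refine ⟨⌈s⌉₊ - 1, s - ((⌈s⌉₊ - 1 : ℕ) : ℝ), ?_, ?_, by ring⟩
  · rw [h1]; have := Nat.ceil_lt_add_one hs.le; linarith
  · rw [h1]; have := Nat.le_ceil s; linarith

theorem fract_floor_of_lt_one {k : ℕ} {α : ℝ} (hα : 0 < α) (hα1 : α < 1) :
    Int.fract ((k : ℝ) + α) = α ∧ ⌊(k : ℝ) + α⌋₊ = k := by
  refine ⟨by rw [Int.fract_natCast_add, Int.fract_eq_self.2 ⟨hα.le, hα1⟩], ?_⟩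
  rw [Nat.floor_eq_iff (by positivity)]; constructor <;> linarith

theorem fract_floor_add_one (k : ℕ) : Int.fract ((k : ℝ) + 1) = 0 ∧ ⌊(k : ℝ) + 1⌋₊ = k + 1 := by
  constructor
  · rw [Int.fract_eq_zero_iff]; exact ⟨k + 1, by simp⟩
  · exact_mod_cast Nat.floor_natCast (k + 1)

/-- Elements of `W^{k+α,∞}` have representatives of class `C^{k,α}`, `0 < α ≤ 1`. -/
theorem MemW.exists_uHol_rep {k : ℕ} {α : ℝ} (hα : 0 < α) (hα1 : α ≤ 1) {f : Plane → F}
    (h : MemW (k + α) f) :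
    ∃ f' : Plane → F, f =ᵐ[volume] f' ∧ UHol α (univ : Set Unit) k (fun _ => f') := by
  have : CompleteSpace F := FiniteDimensional.complete ℝ F
  obtain ⟨M, hM⟩ := h
  rcases hα1.lt_or_eq with h1 | rfl
  · rw [WBound, (fract_floor_of_lt_one hα h1).1, (fract_floor_of_lt_one hα h1).2] at hM
    exact hM.exists_uHol_rep hα hα1
  · rw [WBound, (fract_floor_add_one k).1, (fract_floor_add_one k).2] at hM
    exact hM.exists_uHol_rep_one

/-- A family bounded in `C^{k,α}` is bounded in `W^{k+α,∞}`, `0 < α ≤ 1`. -/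
theorem UHol.exists_wBound {ι : Type} {I : Set ι} {k : ℕ} {α : ℝ} (hα : 0 < α) (hα1 : α ≤ 1)
    {f : ι → Plane → F} (hf : UHol α I k f) : ∃ M, ∀ i ∈ I, WBound (k + α) M (f i) := by
  rcases hα1.lt_or_eq with h1 | rfl
  · simp only [WBound, (fract_floor_of_lt_one hα h1).1, (fract_floor_of_lt_one hα h1).2]
    exact hf.exists_wBoundAux hα hα1
  · simp only [WBound, (fract_floor_add_one k).1, (fract_floor_add_one k).2]
    exact hf.exists_wBoundAux_one

theorem WBound.exists_lipschitz_rep {s M : ℝ} (hs : 1 ≤ s) {f : Plane → F} (h : WBound s M f) :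
    ∃ f' : Plane → F, f =ᵐ[volume] f' ∧ (∀ x, ‖f' x‖ ≤ M) ∧
      ∀ x y, ‖f' x - f' y‖ ≤ 2 * M * ‖x - y‖ := by
  have : CompleteSpace F := FiniteDimensional.complete ℝ F
  have h1 : 1 ≤ ⌊s⌋₊ := Nat.one_le_floor_iff s |>.2 hs
  obtain ⟨k, hk⟩ := Nat.exists_eq_add_of_le' h1
  rw [WBound, hk] at h
  exact WBoundAux.exists_lipschitz_rep h

theorem WBound.ae_norm_le {F : Type} [NormedAddCommGroup F] [NormedSpace ℝ F] {s M : ℝ} {f : Plane → F}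
    (h : WBound s M f) : ∀ᵐ x, ‖f x‖ ≤ M := by
  rw [WBound] at h
  rcases hk : ⌊s⌋₊ with _ | k
  · rw [hk] at h; exact h.2.1
  · rw [hk] at h; exact h.2.1

/-- A continuous function of norm at most `M` in `W^{σ,∞}`, `σ > 0`, has a modulus of continuity
which depends only on `M` and `σ`. -/
theorem WBound.norm_sub_le {σ M : ℝ} (hσ : 0 < σ) {f : Plane → F} (h : WBound σ M f) (hf : Continuous f)
    (x y : Plane) : ‖f x - f y‖ ≤ 2 * |M| * (‖x - y‖ ^ (if σ < 1 then σ else 1)) := by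
  split_ifs with h1
  · have h2 : ⌊σ⌋₊ = 0 := Nat.floor_eq_zero.2 h1
    have h3 : Int.fract σ = σ := Int.fract_eq_self.2 ⟨hσ.le, h1⟩
    rw [WBound, h2, h3] at h
    have : CompleteSpace F := FiniteDimensional.complete ℝ F
    obtain ⟨f', e1, e2, -, e3⟩ := exists_holder_rep hσ h.2.1 (h.2.2 hσ)
    have : f = f' := (hf.ae_eq_iff_eq volume e2).1 e1
    rw [this]
    refine (e3 x y).trans ?_
    gcongr
    have := le_abs_self M; have := abs_nonneg M; linarith
  · obtain ⟨f', e1, e2, e3⟩ := h.exists_lipschitz_rep (not_lt.1 h1)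
    have : f = f' := (hf.ae_eq_iff_eq volume (lipschitzWith_of_norm_le e3).continuous).1 e1
    rw [this, Real.rpow_one]
    refine (e3 x y).trans ?_
    gcongr
    exact le_abs_self M

end LipschitzIBP

/-! ### Bi-Lipschitz changes of variables -/

section ChangeOfVariables

theorem LipschitzWith.volume_image_eq_zero {f : Plane → Plane} {C : ℝ≥0} (hf : LipschitzWith C f)
    {s : Set Plane} (hs : volume s = 0) : volume (f '' s) = 0 := by
  have h1 : (volume : Measure Plane) ≪ μH[(Module.finrank ℝ Plane : ℝ)] :=
    Measure.absolutelyContinuous_isAddHaarMeasure _ _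
  have h2 : (μH[(Module.finrank ℝ Plane : ℝ)] : Measure Plane) ≪ volume :=
    Measure.absolutelyContinuous_isAddHaarMeasure _ _
  apply h1
  have := hf.hausdorffMeasure_image_le (d := (Module.finrank ℝ Plane : ℝ)) (by positivity) s
  rw [h2 hs, mul_zero] at this
  exact le_antisymm this zero_le

/-- Change of variables along a Lipschitz bijection of the plane. -/
theorem lintegral_eq_lintegral_det_mul {X Y : Plane → Plane} {C : ℝ≥0} (hX : LipschitzWith C X)
    (hXY : ∀ y, X (Y y) = y) (hYX : ∀ x, Y (X x) = x) (g : Plane → ℝ≥0∞) :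
    ∫⁻ y, g y = ∫⁻ x, ENNReal.ofReal |(fderiv ℝ X x).det| * g (X x) := by
  set s := {x | DifferentiableAt ℝ X x} with hs
  have hsm : MeasurableSet s := measurableSet_of_differentiableAt ℝ X
  have hs0 : volume sᶜ = 0 := hX.ae_differentiableAt (μ := volume)
  have hi0 : volume (X '' s)ᶜ = 0 := by
    have : (X '' s)ᶜ = X '' sᶜ := by
      rw [image_compl_eq]
      exact ⟨fun a b h => by rw [← hYX a, h, hYX], fun y => ⟨Y y, hXY y⟩⟩
    rw [this]; exact hX.volume_image_eq_zero hs0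
  have hinj : Function.Injective X := fun a b h => by rw [← hYX a, h, hYX]
  have h1 := lintegral_image_eq_lintegral_abs_det_fderiv_mul volume hsm
    (fun x hx => (DifferentiableAt.hasFDerivAt hx).hasFDerivWithinAt) hinj.injOn g
  rw [Measure.restrict_eq_self_of_ae_mem (s := s) hX.ae_differentiableAt,
    Measure.restrict_eq_self_of_ae_mem (s := X '' s) (by rw [ae_iff]; exact hi0)] at h1
  exact h1

/-- Two families of maps of the plane that are inverse to each other and jointly Lipschitz in time
and space. -/
structure IsBiLip (C : ℝ≥0) (X Y : ℝ → Plane → Plane) : Prop where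
  lipX : LipschitzWith C (fun p : ℝ × Plane => X p.1 p.2)
  lipY : LipschitzWith C (fun p : ℝ × Plane => Y p.1 p.2)
  right_inv : ∀ t y, X t (Y t y) = y
  left_inv : ∀ t x, Y t (X t x) = x

theorem lipschitz_slice {F : Type} [NormedAddCommGroup F] {C : ℝ≥0} {X : ℝ → Plane → F}
    (h : LipschitzWith C (fun p : ℝ × Plane => X p.1 p.2)) (t : ℝ) : LipschitzWith C (X t) := by
  have := h.comp (LipschitzWith.prodMk_left t)
  rw [mul_one] at this
  exact this

theorem lipschitz_time {F : Type} [NormedAddCommGroup F] {C : ℝ≥0} {X : ℝ → Plane → F}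
    (h : LipschitzWith C (fun p : ℝ × Plane => X p.1 p.2)) (x : Plane) : LipschitzWith C (fun t => X t x) := by
  have := h.comp (LipschitzWith.prodMk_right x)
  rw [mul_one] at this
  exact this

namespace IsBiLip
variable {C : ℝ≥0} {X Y : ℝ → Plane → Plane} 

theorem symm (h : IsBiLip C X Y) : IsBiLip C Y X := ⟨h.lipY, h.lipX, h.left_inv, h.right_inv⟩

/-- The Jacobian of the maps `X t`, that is the absolute value of the determinant of `D(X t)`. It has
a meaning where `X t` is differentiable, hence almost everywhere if `X t` is Lipschitz. -/
noncomputable def _root_.jac (X : ℝ → Plane → Plane) (p : ℝ × Plane) : ℝ :=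
  |(fderiv ℝ (X p.1) p.2).det|

theorem _root_.jac_nonneg (X : ℝ → Plane → Plane) (p : ℝ × Plane) : 0 ≤ jac X p := abs_nonneg _

theorem measurable_jac (h : IsBiLip C X Y) : Measurable (jac X) := by
  have h1 : Measurable fun p : ℝ × Plane => fderiv ℝ (X p.1) p.2 :=
    measurable_fderiv_with_param ℝ h.lipX.continuous
  exact (ContinuousLinearMap.continuous_det.measurable.comp h1).norm

theorem _root_.exists_det_bound (C : ℝ) : ∃ B : ℝ, ∀ L : Plane →L[ℝ] Plane, ‖L‖ ≤ C → |L.det| ≤ B := by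
  obtain ⟨B, hB⟩ := (isCompact_closedBall (0 : Plane →L[ℝ] Plane) C).exists_bound_of_continuousOn
    (f := fun L => L.det) ContinuousLinearMap.continuous_det.continuousOn
  exact ⟨B, fun L hL => hB L (by simpa using hL)⟩

theorem exists_jac_le (h : IsBiLip C X Y) : ∃ B, ∀ p, jac X p ≤ B := by
  obtain ⟨B, hB⟩ := exists_det_bound C
  exact ⟨B, fun p => hB _ (norm_fderiv_le_of_lipschitz ℝ (lipschitz_slice h.lipX p.1))⟩

theorem jac_pos (h : IsBiLip C X Y) {p : ℝ × Plane} (hp : DifferentiableAt ℝ (X p.1) p.2) :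
    0 < jac X p := by
  rw [jac, abs_pos]
  have hY : ∀ x y, ‖Y p.1 x - Y p.1 y‖ ≤ C * ‖x - y‖ := fun x y =>
    (lipschitz_slice h.lipY p.1).norm_sub_le x y
  have h1 := exists_inverse_fderiv C.2 (h.right_inv p.1) (h.left_inv p.1) hY (X p.1 p.2)
    (by rwa [h.left_inv])
  rw [h.left_inv] at h1
  have h2 := congrArg ContinuousLinearMap.det h1.2.1
  intro h0
  have h3 : ContinuousLinearMap.det (fderiv ℝ (X p.1) p.2 * fderiv ℝ (Y p.1) (X p.1 p.2)) =
    (fderiv ℝ (X p.1) p.2).det * (fderiv ℝ (Y p.1) (X p.1 p.2)).det := by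
    exact LinearMap.det_comp _ _
  rw [h3, h0, zero_mul] at h2
  have h4 : ContinuousLinearMap.det (1 : Plane →L[ℝ] Plane) = 1 := LinearMap.det_id
  rw [h4] at h2
  exact zero_ne_one h2

theorem ae_jac_pos (h : IsBiLip C X Y) (T : ℝ) : ∀ᵐ p ∂slab T, 0 < jac X p := by
  have hm : MeasurableSet {p : ℝ × Plane | 0 < jac X p} := measurableSet_lt measurable_const h.measurable_jac
  rw [slab, Measure.ae_prod_iff_ae_ae hm]
  refine ae_of_all _ fun t => ?_
  filter_upwards [(lipschitz_slice h.lipX t).ae_differentiableAt (μ := volume)] with x hx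
  exact h.jac_pos (p := (t, x)) hx

theorem measurableEmbedding (h : IsBiLip C X Y) :
    MeasurableEmbedding (fun p : ℝ × Plane => (p.1, X p.1 p.2)) := by
  have hX := h.lipX.continuous
  have hY := h.lipY.continuous
  let e : (ℝ × Plane) ≃ₜ (ℝ × Plane) :=
    { toFun := fun p => (p.1, X p.1 p.2)
      invFun := fun p => (p.1, Y p.1 p.2)
      left_inv := fun p => by simp [h.left_inv]
      right_inv := fun p => by simp [h.right_inv]
      continuous_toFun := continuous_fst.prodMk hX
      continuous_invFun := continuous_fst.prodMk hY }
  exact e.measurableEmbedding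

/-- The area formula on the slab, as an equality of measures. -/
theorem map_withDensity_slab (h : IsBiLip C X Y) (T : ℝ) :
    ((slab T).withDensity fun p => ENNReal.ofReal (jac X p)).map (fun p => (p.1, X p.1 p.2)) = slab T := by
  ext s hs
  have hΞ := h.measurableEmbedding
  rw [hΞ.map_apply, withDensity_apply _ (hΞ.measurable hs), ← lintegral_indicator (hΞ.measurable hs), slab,
    lintegral_prod, Measure.prod_apply hs]
  · congr 1; ext t
    have h1 := lintegral_eq_lintegral_det_mul (lipschitz_slice h.lipX t) (h.right_inv t) (h.left_inv t)
      (indicator (Prod.mk t ⁻¹' s) 1)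
    rw [lintegral_indicator_one (measurable_prodMk_left hs)] at h1
    rw [h1]
    congr 1; ext x
    by_cases hx : (t, X t x) ∈ s <;> simp [indicator, jac, hx]
  · exact ((h.measurable_jac.ennreal_ofReal).indicator (hΞ.measurable hs)).aemeasurable

/-- A bi-Lipschitz change of variables preserves null sets, because its Jacobian is positive almost
everywhere. -/
theorem ae_comp (h : IsBiLip C X Y) {T : ℝ} {P : ℝ × Plane → Prop} (hP : ∀ᵐ p ∂slab T, P p) :
    ∀ᵐ p ∂slab T, P (p.1, X p.1 p.2) := by
  rw [← h.map_withDensity_slab T, h.measurableEmbedding.ae_map_iff] at hP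
  exact (withDensity_absolutelyContinuous' h.measurable_jac.ennreal_ofReal.aemeasurable (by
    filter_upwards [h.ae_jac_pos T] with p hp
    simpa using hp)) hP

theorem aestronglyMeasurable_comp {F : Type} [NormedAddCommGroup F] (h : IsBiLip C X Y) {T : ℝ}
    {g : ℝ × Plane → F} (hg : AEStronglyMeasurable g (slab T)) :
    AEStronglyMeasurable (fun p => g (p.1, X p.1 p.2)) (slab T) :=
  ⟨fun p => hg.mk g (p.1, X p.1 p.2), hg.stronglyMeasurable_mk.comp_measurable h.measurableEmbedding.measurable,
    h.ae_comp hg.ae_eq_mk⟩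

theorem integral_eq {F : Type} [NormedAddCommGroup F] [NormedSpace ℝ F] (h : IsBiLip C X Y) (T : ℝ)
    (g : ℝ × Plane → F) :
    ∫ p, g p ∂slab T = ∫ p, jac X p • g (p.1, X p.1 p.2) ∂slab T := by
  conv_lhs => rw [← h.map_withDensity_slab T, h.measurableEmbedding.integral_map,
    integral_withDensity_eq_integral_toReal_smul₀ h.measurable_jac.ennreal_ofReal.aemeasurable (by simp)]
  simp [ENNReal.toReal_ofReal (jac_nonneg X _)]

end IsBiLip

theorem slab_eq_restrict (T : ℝ) : slab T = (volume : Measure (ℝ × Plane)).restrict (Icc 0 T ×ˢ univ) := by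
  rw [slab, Measure.volume_eq_prod, ← Measure.prod_restrict, Measure.restrict_univ]

theorem slab_ac (T : ℝ) : slab T ≪ (volume : Measure (ℝ × Plane)) := by
  rw [slab_eq_restrict]; exact Measure.absolutelyContinuous_of_le Measure.restrict_le_self

instance (T : ℝ) : IsLocallyFiniteMeasure (slab T) := by
  rw [slab_eq_restrict]; infer_instance

theorem slab_ae_slice {T : ℝ} {P : ℝ × Plane → Prop} (h : ∀ᵐ p ∂slab T, P p) :
    ∀ᵐ x : Plane, ∀ᵐ t ∂volume.restrict (Icc 0 T), P (t, x) := by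
  rw [slab, ← Measure.prod_swap] at h
  have h1 := ae_of_ae_map measurable_swap.aemeasurable h
  exact Measure.ae_ae_of_ae_prod h1

theorem slab_ae_of_ae_snd {T : ℝ} {P : Plane → Prop} (h : ∀ᵐ x, P x) : ∀ᵐ p ∂slab T, P p.2 :=
  Measure.quasiMeasurePreserving_snd.ae h

theorem slab_ae_of_ae_fst {T : ℝ} {P : ℝ → Prop} (h : ∀ᵐ t ∂volume.restrict (Icc 0 T), P t) : ∀ᵐ p ∂slab T, P p.1 :=
  Measure.quasiMeasurePreserving_fst.ae h

theorem slab_ae_mem_Ioo (T : ℝ) : ∀ᵐ p ∂slab T, p.1 ∈ Ioo 0 T := by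
  refine slab_ae_of_ae_fst ?_
  rw [← restrict_Ioo_eq_restrict_Icc]
  exact ae_restrict_mem measurableSet_Ioo

end ChangeOfVariables

/-! ### Weak transport equations with Lipschitz test functions -/

section Transport

instance : (volume : Measure (ℝ × Plane)).IsAddHaarMeasure :=
  inferInstanceAs ((volume : Measure ℝ).prod (volume : Measure Plane)).IsAddHaarMeasure

theorem slab_ae_of_slice {T : ℝ} {P : ℝ × Plane → Prop} (hP : MeasurableSet {p | P p})
    (h : ∀ᵐ x : Plane, ∀ᵐ t ∂volume.restrict (Icc 0 T), P (t, x)) : ∀ᵐ p ∂slab T, P p := by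
  rw [slab, ← Measure.prod_swap, ae_map_iff measurable_swap.aemeasurable hP]
  exact (Measure.ae_prod_iff_ae_ae (measurable_swap hP)).2 h

theorem exists_bounded_rep {X F : Type} [MeasurableSpace X] [NormedAddCommGroup F] {μ : Measure X}
    {g : X → F} {M : ℝ} (hM : 0 ≤ M)
    (hg : AEStronglyMeasurable g μ) (hgM : ∀ᵐ x ∂μ, ‖g x‖ ≤ M) :
    ∃ g' : X → F, StronglyMeasurable g' ∧ (∀ x, ‖g' x‖ ≤ M) ∧ g =ᵐ[μ] g' := by
  have hs : MeasurableSet {x | ‖hg.mk g x‖ ≤ M} :=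
    hg.stronglyMeasurable_mk.norm.measurable measurableSet_Iic
  refine ⟨indicator {x | ‖hg.mk g x‖ ≤ M} (hg.mk g), hg.stronglyMeasurable_mk.indicator hs, fun x => ?_, ?_⟩
  · by_cases hx : x ∈ {x | ‖hg.mk g x‖ ≤ M}
    · rw [indicator_of_mem hx]; exact hx
    · rw [indicator_of_notMem hx, norm_zero]; exact hM
  · filter_upwards [hg.ae_eq_mk, hgM] with x h1 h2
    rw [indicator_of_mem]
    · exact h1
    · rw [mem_ofPred_eq, ← h1]; exact h2

variable {F : Type} [NormedAddCommGroup F] [NormedSpace ℝ F] 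

/-- Weak form, tested with Lipschitz functions, of `∂_t Q + ∇·(Q w) = S`, `Q(0) = Q0` on `[0,T]`. -/
def SolvesTransport (T : ℝ) (w : ℝ × Plane → Plane) (Q S : ℝ × Plane → F) (Q0 : Plane → F) : Prop :=
  ∀ (ψ : ℝ × Plane → ℝ) (C : ℝ≥0), LipschitzWith C ψ → HasCompactSupport ψ →
    tsupport ψ ⊆ Iio T ×ˢ univ →
    (∫ p, (fderiv ℝ ψ p (1, w p) • Q p + ψ p • S p) ∂slab T) + ∫ x, ψ (0, x) • Q0 x = 0

theorem spacetime_decomp (w : Plane) : ((1, w) : ℝ × Plane) =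
    (1, 0) + (w 0 • ((0 : ℝ), basisVec 0) + w 1 • ((0 : ℝ), basisVec 1)) := by
  have := plane_decomp w
  ext1
  · simp
  · simpa using this

/-- A transport equation with bounded data that holds for smooth test functions holds for Lipschitz
ones: mollified test functions and their derivatives converge boundedly almost everywhere. -/
theorem SolvesTransport.of_smooth [CompleteSpace F] {T : ℝ} {w : ℝ × Plane → Plane} {Q S : ℝ × Plane → F} {Q0 : Plane → F}
    {Mw MQ MS M0 : ℝ}
    (hw : AEStronglyMeasurable w (slab T)) (hwM : ∀ᵐ p ∂slab T, ‖w p‖ ≤ Mw)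
    (hQ : AEStronglyMeasurable Q (slab T)) (hQM : ∀ᵐ p ∂slab T, ‖Q p‖ ≤ MQ)
    (hS : AEStronglyMeasurable S (slab T)) (hSM : ∀ᵐ p ∂slab T, ‖S p‖ ≤ MS)
    (hQ0 : AEStronglyMeasurable Q0 volume) (hQ0M : ∀ᵐ x, ‖Q0 x‖ ≤ M0)
    (h : ∀ ψ : ℝ × Plane → ℝ, IsTestFunction T ψ →
      (∫ p, (fderiv ℝ ψ p (1, w p) • Q p + ψ p • S p) ∂slab T) + ∫ x, ψ (0, x) • Q0 x = 0) :
    SolvesTransport T w Q S Q0 := by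
  intro ψ D hψ hψs hψT
  have hψl : LocallyIntegrable ψ (volume : Measure (ℝ × Plane)) := hψ.continuous.locallyIntegrable
  set ψn : ℕ → ℝ × Plane → ℝ := fun n => moll volume n ψ with hψn
  have hsm : ∀ n, ContDiff ℝ ∞ (ψn n) := fun n => contDiff_moll hψl n
  have hfd : ∀ n p v, fderiv ℝ (ψn n) p v = moll volume n (fun z => fderiv ℝ ψ z v) p := fun n p v =>
    fderiv_moll_apply hψl (fun φ h1 h2 => by
      obtain ⟨D', hD'⟩ := lipschitzWith_of_contDiff h1 h2
      exact (integral_fderiv_smul_eq hψ hD' h2 v).2.2) n p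
  have hfb : ∀ n p v, ‖fderiv ℝ (ψn n) p v‖ ≤ D * ‖v‖ := fun n p v => by
    rw [hfd]; exact norm_moll_le (ae_of_all _ fun z => norm_fderiv_apply_le hψ z v) n p
  have hlb : ∀ v, LocallyIntegrable (fun z => fderiv ℝ ψ z v) (volume : Measure (ℝ × Plane)) := fun v =>
    locallyIntegrable_of_ae_bdd (stronglyMeasurable_fderiv_apply ψ v).aestronglyMeasurable
      (ae_of_all _ fun z => norm_fderiv_apply_le hψ z v)
  have hsupp : ∀ n, tsupport (ψn n) ⊆ Metric.cthickening (mollBump (ℝ × Plane) n).rOut (tsupport ψ) := by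
    intro n
    refine closure_minimal (fun p hp => ?_) Metric.isClosed_cthickening
    by_contra hcon
    apply hp
    simp only [hψn]
    rw [moll_apply]
    refine integral_eq_zero_of_ae (ae_of_all _ fun t => ?_)
    by_cases ht : t ∈ tsupport ψ
    · have : (mollBump (ℝ × Plane) n).normed volume (p - t) = 0 := by
        rw [← Function.notMem_support, ContDiffBump.support_normed_eq]
        intro hb
        apply hcon
        apply Metric.mem_cthickening_of_dist_le p t _ _ ht
        rw [mem_ball_zero_iff] at hb
        rw [dist_eq_norm]; exact hb.le
      simp [this]
    · simp [image_eq_zero_of_notMem_tsupport ht]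
  have hr2 : ∀ n, (mollBump (ℝ × Plane) n).rOut ≤ 2 := fun n => by
    simp only [mollBump]
    rw [div_le_iff₀ (by positivity)]
    have : (0 : ℝ) ≤ n := n.cast_nonneg
    linarith
  set K := Metric.cthickening 2 (tsupport ψ) with hK
  have hKc : IsCompact K := hψs.isCompact.cthickening
  have hsuppK : ∀ n, tsupport (ψn n) ⊆ K := fun n => (hsupp n).trans (Metric.cthickening_mono (hr2 n) _)
  have hcs : ∀ n, HasCompactSupport (ψn n) := fun n =>
    hKc.of_isClosed_subset (isClosed_tsupport _) (hsuppK n)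
  obtain ⟨Bψ, hBψ⟩ := hψ.continuous.bounded_above_of_compact_support hψs
  have hBn : ∀ n p, ‖ψn n p‖ ≤ Bψ := fun n p => norm_moll_le (ae_of_all _ hBψ) n p
  have hconv : ∀ p, Tendsto (fun n => ψn n p) atTop (𝓝 (ψ p)) := fun p => by
    rw [tendsto_iff_norm_sub_tendsto_zero]
    refine squeeze_zero (fun _ => norm_nonneg _) (fun n => ?_)
      (tendsto_rOut_rpow (E := ℝ × Plane) (C := D) one_pos)
    exact norm_moll_sub_le hψ.continuous D.2 one_pos (fun x y => by simpa using hψ.norm_sub_le x y) n p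
  -- the support keeps a positive distance from the final time
  have htest : ∀ᶠ n in atTop, IsTestFunction T (ψn n) := by
    obtain ⟨δ, hδ, hδT⟩ := hψs.isCompact.exists_cthickening_subset_open
      (isOpen_Iio.prod isOpen_univ) hψT
    filter_upwards [(tendsto_mollBump_rOut (E := ℝ × Plane)).eventually (gt_mem_nhds hδ)] with n hn
    exact ⟨hsm n, hcs n, ((hsupp n).trans (Metric.cthickening_mono hn.le _)).trans hδT⟩
  have hMw : 0 ≤ max Mw 0 := le_max_right _ _
  have lim1 : Tendsto (fun n => ∫ p, (fderiv ℝ (ψn n) p (1, w p) • Q p + ψn n p • S p) ∂slab T) atTop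
      (𝓝 (∫ p, (fderiv ℝ ψ p (1, w p) • Q p + ψ p • S p) ∂slab T)) := by
    refine tendsto_integral_of_dominated_convergence
      (indicator K fun _ => D * (1 + max Mw 0) * max MQ 0 + Bψ * max MS 0) (fun n => ?_) ?_ (fun n => ?_) ?_
    · refine AEStronglyMeasurable.add (AEStronglyMeasurable.smul ?_ hQ)
        ((hsm n).continuous.aestronglyMeasurable.smul hS)
      have h1 : AEStronglyMeasurable (fun p => fderiv ℝ (ψn n) p) (slab T) :=
        ((hsm n).continuous_fderiv (by simp)).aestronglyMeasurable
      exact isBoundedBilinearMap_apply.continuous.comp_aestronglyMeasurable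
        (h1.prodMk (aestronglyMeasurable_const.prodMk hw))
    · rw [integrable_indicator_iff hKc.measurableSet]
      exact integrableOn_const hKc.measure_lt_top.ne
    · filter_upwards [hwM, hQM, hSM] with p h1 h2 h3
      by_cases hp : p ∈ K
      · rw [indicator_of_mem hp]
        refine (norm_add_le _ _).trans ?_
        rw [norm_smul, norm_smul]
        have e1 : ‖((1, w p) : ℝ × Plane)‖ ≤ 1 + max Mw 0 := by
          rw [Prod.norm_mk]
          refine max_le (by simp) ?_
          have := h1.trans (le_max_left Mw 0); linarith
        have hB0 : 0 ≤ Bψ := (norm_nonneg _).trans (hBψ 0)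
        gcongr
        · exact (hfb n p _).trans (by gcongr)
        · exact h2.trans (le_max_left _ _)
        · exact hBn n p
        · exact h3.trans (le_max_left _ _)
      · rw [indicator_of_notMem hp]
        have hp' : p ∉ tsupport (ψn n) := fun h => hp (hsuppK n h)
        rw [fderiv_eq_zero_of_notMem_tsupport hp', image_eq_zero_of_notMem_tsupport hp']
        simp
    -- the direction `(1, w p)` depends on `p`, so convergence is used in three fixed directions
    · have hae : ∀ v, ∀ᵐ p ∂slab T, Tendsto (fun n => fderiv ℝ (ψn n) p v) atTop (𝓝 (fderiv ℝ ψ p v)) := by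
        intro v
        filter_upwards [(slab_ac T).ae_le (ae_tendsto_moll (hlb v))] with p hp
        simpa only [hfd] using hp
      filter_upwards [hae (1, 0), hae (0, basisVec 0), hae (0, basisVec 1)] with p h1 h2 h3
      refine Tendsto.add (Tendsto.smul_const ?_ _) ((hconv p).smul_const _)
      rw [spacetime_decomp]
      simp only [map_add, map_smul]
      exact h1.add ((h2.const_smul _).add (h3.const_smul _))
  have lim2 : Tendsto (fun n => ∫ x, ψn n (0, x) • Q0 x) atTop (𝓝 (∫ x, ψ (0, x) • Q0 x)) := by
    have hK2 : IsCompact (Prod.snd '' K) := hKc.image continuous_snd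
    refine tendsto_integral_of_dominated_convergence
      (indicator (Prod.snd '' K) fun _ => Bψ * max M0 0) (fun n => ?_) ?_ (fun n => ?_) ?_
    · exact ((hsm n).continuous.comp (Continuous.prodMk_right 0)).aestronglyMeasurable.smul hQ0
    · rw [integrable_indicator_iff hK2.measurableSet]
      exact integrableOn_const hK2.measure_lt_top.ne
    · filter_upwards [hQ0M] with x hx
      have hB0 : 0 ≤ Bψ := (norm_nonneg _).trans (hBψ 0)
      by_cases hp : ((0 : ℝ), x) ∈ K
      · rw [indicator_of_mem (show x ∈ Prod.snd '' K from ⟨_, hp, rfl⟩), norm_smul]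
        gcongr
        exacts [hBn n _, hx.trans (le_max_left _ _)]
      · have hp' : ((0 : ℝ), x) ∉ tsupport (ψn n) := fun h => hp (hsuppK n h)
        rw [image_eq_zero_of_notMem_tsupport hp', zero_smul, norm_zero]
        exact indicator_nonneg (fun _ _ => by positivity) _
    · exact ae_of_all _ fun x => (hconv _).smul_const _
  have hlim := lim1.add lim2
  refine tendsto_nhds_unique hlim ?_
  refine tendsto_const_nhds.congr' ?_
  filter_upwards [htest] with n hn
  exact (h _ hn).symm

end Transport

/-! ### The equation without transport -/

section TransportStationary

theorem hasDerivAt_comp_spacetime {E F : Type} [NormedAddCommGroup E] [NormedSpace ℝ E]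
    [NormedAddCommGroup F] [NormedSpace ℝ F] {ψ : ℝ × E → F} {z : ℝ → E} {v : E} {t : ℝ}
    (hψ : DifferentiableAt ℝ ψ (t, z t)) (hz : HasDerivAt z v t) :
    HasDerivAt (fun t => ψ (t, z t)) (fderiv ℝ ψ (t, z t) (1, v)) t :=
  HasFDerivAt.comp_hasDerivAt (f := fun t => (t, z t)) t hψ.hasFDerivAt ((hasDerivAt_id t).prodMk hz)

theorem hasDerivAt_integral_add {ζ : ℝ → ℝ} (hζ : Continuous ζ) (T t : ℝ) :
    HasDerivAt (fun t => ∫ r in (0 : ℝ)..T, ζ (t + r)) (ζ (t + T) - ζ t) t := by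
  have h1 : (fun t => ∫ r in (0 : ℝ)..T, ζ (t + r)) =
      fun t => (∫ s in (0 : ℝ)..(t + T), ζ s) - ∫ s in (0 : ℝ)..t, ζ s := by
    ext t
    rw [intervalIntegral.integral_comp_add_left (fun s => ζ s) t, add_zero,
      intervalIntegral.integral_interval_sub_left (hζ.intervalIntegrable _ _) (hζ.intervalIntegrable _ _)]
  rw [h1]
  have h2 : ∀ s, HasDerivAt (fun s => ∫ r in (0 : ℝ)..s, ζ r) (ζ s) s := fun s =>
    (hζ.integral_hasStrictDerivAt 0 s).hasDerivAt
  exact ((h2 (t + T)).comp_add_const t T).sub (h2 t)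

variable {F : Type} [NormedAddCommGroup F] [NormedSpace ℝ F] [FiniteDimensional ℝ F]

/-- A weak solution of `∂_t Q = g` is the time integral `P` of `g`. For a smooth `ζ` the function
`H(t,x) = ∫_t^T ζ(s,x) ds` is an admissible test function, with which both `Q` and `P` give
`∫ ζ Q = ∫ ζ P`. -/
theorem SolvesTransport.eq_add_integral_of_bounded {T M : ℝ} (hT : 0 ≤ T) {Q g : ℝ × Plane → F} {Q0 : Plane → F}
    (hQ : StronglyMeasurable Q) (hg : StronglyMeasurable g) (hQ0 : StronglyMeasurable Q0)
    (hQM : ∀ p, ‖Q p‖ ≤ M) (hgM : ∀ p, ‖g p‖ ≤ M) (hQ0M : ∀ x, ‖Q0 x‖ ≤ M)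
    (h : SolvesTransport T (fun _ => 0) Q g Q0) :
    ∀ᵐ p ∂slab T, Q p = Q0 p.2 + ∫ s in (0 : ℝ)..p.1, g (s, p.2) := by
  have : CompleteSpace F := FiniteDimensional.complete ℝ F
  have : ProperSpace F := FiniteDimensional.proper_real F
  have hM : 0 ≤ M := (norm_nonneg _).trans (hQM 0)
  have hgx : ∀ x, StronglyMeasurable fun s => g (s, x) := fun x =>
    hg.comp_measurable measurable_prodMk_right
  have hgi : ∀ x a b, IntervalIntegrable (fun s => g (s, x)) volume a b := fun x a b => by
    rw [intervalIntegrable_iff]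
    exact Measure.integrableOn_of_bounded (M := M) (by simp) (hgx x).aestronglyMeasurable
      (ae_of_all _ fun s => hgM _)
  set J : ℝ → Plane → F := fun t x => ∫ s in (0 : ℝ)..t, g (s, x) with hJ
  have hJlip : ∀ x t t', ‖J t x - J t' x‖ ≤ M * |t - t'| := fun x t t' => by
    simp only [hJ]
    rw [intervalIntegral.integral_interval_sub_left (hgi _ _ _) (hgi _ _ _)]
    exact intervalIntegral.norm_integral_le_of_norm_le_const fun s _ => hgM _
  have hJlip' : ∀ x, LipschitzWith M.toNNReal fun t => J t x := fun x =>
    lipschitzWith_of_norm_le (hJlip x)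
  have hJm : StronglyMeasurable (Function.uncurry J) := by
    refine stronglyMeasurable_uncurry_of_continuous_of_stronglyMeasurable
      (fun x => (hJlip' x).continuous) fun t => ?_
    have : ∀ x, J t x = (∫ s in Ioc 0 t, g (s, x)) - ∫ s in Ioc t 0, g (s, x) := fun x => rfl
    rw [funext this]
    exact (hg.integral_prod_left' (μ := volume.restrict (Ioc 0 t))).sub
      (hg.integral_prod_left' (μ := volume.restrict (Ioc t 0)))
  set P : ℝ × Plane → F := fun p => Q0 p.2 + J p.1 p.2 with hP
  have hPm : StronglyMeasurable P := (hQ0.comp_measurable measurable_snd).add hJm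
  have hPb : ∀ x, ∀ t ∈ Icc 0 T, ‖P (t, x)‖ ≤ M + M * T := fun x t ht => by
    refine (norm_add_le _ _).trans (add_le_add (hQ0M x) ?_)
    have := hJlip x t 0
    simp only [hJ, intervalIntegral.integral_same, sub_zero, abs_of_nonneg ht.1] at this
    exact this.trans (by gcongr; exact ht.2)
  have hd : ∀ᵐ x, ∀ᵐ t ∂volume.restrict (Icc 0 T), HasDerivAt (fun t => P (t, x)) (g (t, x)) t := by
    refine ae_of_all _ fun x => ?_
    have h1 := (hgi x 0 T).ae_hasDerivAt_integral
    filter_upwards [ae_restrict_of_ae h1, ae_restrict_mem measurableSet_Icc] with t h2 ht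
    rw [uIcc_of_le hT] at h2
    exact (h2 ht 0 ⟨le_rfl, hT⟩).const_add (Q0 x)
  have hPae : ∀ᵐ p ∂slab T, ‖P p‖ ≤ M + M * T := by
    filter_upwards [slab_ae_mem_Ioo T] with p hp using hPb p.2 p.1 (Ioo_subset_Icc_self hp)
  have key : ∀ ζ : ℝ × Plane → ℝ, ContDiff ℝ ∞ ζ → HasCompactSupport ζ → tsupport ζ ⊆ Ioo 0 T ×ˢ univ →
      ∫ p, ζ p • (Q p - P p) = 0 := by
    intro ζ hζ hζs hζT
    obtain ⟨D, hD⟩ := lipschitzWith_of_contDiff hζ hζs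
    have hζc := hζ.continuous
    have hζx : ∀ x, Continuous fun t => ζ (t, x) := fun x => hζc.comp (Continuous.prodMk_left x)
    -- for `t ≥ 0` integrating over `[t, t + T]` is integrating over `[t, T]`, and this form of `H` is
    -- Lipschitz with compact support on the whole of space-time
    set H : ℝ × Plane → ℝ := fun p => ∫ r in (0 : ℝ)..T, ζ (p.1 + r, p.2) with hH
    have hHl : LipschitzWith (D * T).toNNReal H := by
      refine lipschitzWith_of_norm_le fun p q => ?_
      have hi : ∀ p : ℝ × Plane, IntervalIntegrable (fun r => ζ (p.1 + r, p.2)) volume 0 T := fun p =>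
        (Continuous.intervalIntegrable (by fun_prop) _ _)
      simp only [hH]
      rw [← intervalIntegral.integral_sub (hi p) (hi q)]
      refine (intervalIntegral.norm_integral_le_of_norm_le_const (C := D * ‖p - q‖) fun r _ => ?_).trans
        (by rw [sub_zero, abs_of_nonneg hT]; linarith)
      refine (hD.norm_sub_le _ _).trans (le_of_eq ?_)
      congr 2
      ext1 <;> simp
    set K := (fun z : (ℝ × Plane) × ℝ => ((z.1.1 - z.2, z.1.2) : ℝ × Plane)) '' (tsupport ζ ×ˢ Icc 0 T) with hK
    have hKc : IsCompact K := (hζs.isCompact.prod isCompact_Icc).image (by fun_prop)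
    have hH0 : ∀ p, p ∉ K → H p = 0 := fun p hp => by
      refine intervalIntegral.integral_zero_ae (ae_of_all _ fun r hr => ?_)
      rw [uIoc_of_le hT] at hr
      by_contra hne
      refine hp ⟨((p.1 + r, p.2), r), ⟨subset_closure hne, hr.1.le, hr.2⟩, ?_⟩
      ext1 <;> simp
    have hHs : HasCompactSupport H := HasCompactSupport.intro hKc hH0
    have hHK : tsupport H ⊆ K := closure_minimal (fun p hp => by_contra fun h => hp (hH0 p h)) hKc.isClosed
    have hKT : K ⊆ Iio T ×ˢ univ := by
      rintro _ ⟨⟨q, r⟩, ⟨hq, hr⟩, rfl⟩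
      have := (hζT hq).1.2
      have h2 := hr.1
      refine ⟨?_, trivial⟩
      simp only [mem_Iio] at *
      linarith
    have hζT0 : ∀ t x, T ≤ t → ζ (t, x) = 0 := fun t x ht =>
      image_eq_zero_of_notMem_tsupport fun hm => (not_lt.2 ht) (hζT hm).1.2
    have hHd : ∀ x, ∀ t, 0 ≤ t → HasDerivAt (fun t => H (t, x)) (-ζ (t, x)) t := fun x t ht => by
      have := hasDerivAt_integral_add (hζx x) T t
      simp only [hζT0 (t + T) x (by linarith), zero_sub] at this
      exact this
    have hHT : ∀ x, H (T, x) = 0 := fun x => hH0 _ fun hm => lt_irrefl T (hKT hm).1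
    obtain ⟨BH, hBH⟩ := hHl.continuous.bounded_above_of_compact_support hHs
    obtain ⟨Bζ, hBζ⟩ := hζc.bounded_above_of_compact_support hζs
    have hBH0 : 0 ≤ BH := (norm_nonneg _).trans (hBH 0)
    have hBζ0 : 0 ≤ Bζ := (norm_nonneg _).trans (hBζ 0)
    -- along every vertical line
    have hline : ∀ᵐ x, ∫ t in Icc 0 T, (-ζ (t, x) • P (t, x) + H (t, x) • g (t, x)) = - (H (0, x) • Q0 x) := by
      filter_upwards [hd] with x hx
      have hPl : LipschitzWith M.toNNReal fun t => P (t, x) := lipschitzWith_of_norm_le fun t t' => by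
        have := hJlip x t t'
        simpa [hP] using this
      have hHx : LipschitzWith (D * T).toNNReal fun t => H (t, x) := by
        have := hHl.comp (LipschitzWith.prodMk_right x)
        rw [mul_one] at this
        exact this
      have hl : LipschitzOnWith ((D * T).toNNReal * (M + M * T).toNNReal + BH.toNNReal * M.toNNReal)
          (fun t => H (t, x) • P (t, x)) (Icc 0 T) := by
        refine LipschitzOnWith.of_dist_le_mul fun t ht t' ht' => ?_
        rw [dist_eq_norm]
        have e : H (t, x) • P (t, x) - H (t', x) • P (t', x) =
            (H (t, x) - H (t', x)) • P (t, x) + H (t', x) • (P (t, x) - P (t', x)) := by module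
        rw [e]
        refine (norm_add_le _ _).trans ?_
        rw [norm_smul, norm_smul]
        have a1 := hHx.norm_sub_le t t'
        have a2 := hPl.norm_sub_le t t'
        have a3 := hPb x t ht
        have a4 := hBH (t', x)
        push_cast
        rw [Real.coe_toNNReal _ hM, Real.coe_toNNReal _ (show 0 ≤ M + M * T by positivity),
          Real.coe_toNNReal _ (show 0 ≤ D * T by positivity), Real.coe_toNNReal _ hBH0, dist_eq_norm] at *
        calc _ ≤ (D * T * ‖t - t'‖) * (M + M * T) + BH * (M * ‖t - t'‖) := by gcongr
          _ = _ := by ring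
      have := sub_eq_integral_of_ae_hasDerivAt (g := fun t => -ζ (t, x) • P (t, x) + H (t, x) • g (t, x))
        (M := Bζ * (M + M * T) + BH * M) hT hl ?_ ?_ ?_
      · rw [intervalIntegral.integral_of_le hT] at this
        rw [integral_Icc_eq_integral_Ioc, ← this.2, hHT]
        simp [hP, hJ]
      · exact (((hζx x).neg.aestronglyMeasurable.smul hPl.continuous.aestronglyMeasurable).add
          (hHx.continuous.aestronglyMeasurable.smul (hgx x).aestronglyMeasurable)).restrict
      · filter_upwards [ae_restrict_mem measurableSet_Icc] with t ht
        refine (norm_add_le _ _).trans ?_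
        rw [norm_smul, norm_smul, norm_neg]
        gcongr
        exacts [hBζ _, hPb x t ht, hBH _, hgM _]
      · filter_upwards [hx, ae_restrict_mem measurableSet_Icc] with t h1 ht
        have := (hHd x t ht.1).smul h1
        rwa [add_comm] at this
    have hζH : ∀ p, p ∉ K ∪ tsupport ζ → ζ p = 0 ∧ H p = 0 := fun p hp =>
      ⟨image_eq_zero_of_notMem_tsupport fun h => hp (Or.inr h), hH0 p fun h => hp (Or.inl h)⟩
    have hKK : IsCompact (K ∪ tsupport ζ) := hKc.union hζs.isCompact
    have iP : Integrable (fun p => -ζ p • P p + H p • g p) (slab T) := by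
      refine integrable_of_ae_bdd_of_support (B := Bζ * (M + M * T) + BH * M) hKK
        ((hζc.neg.aestronglyMeasurable.smul hPm.aestronglyMeasurable).add
          (hHl.continuous.aestronglyMeasurable.smul hg.aestronglyMeasurable)) ?_ fun p hp => by
            simp [hζH p hp]
      filter_upwards [hPae] with p hp
      refine (norm_add_le _ _).trans ?_
      rw [norm_smul, norm_smul, norm_neg]
      gcongr
      exacts [hBζ _, hBH _, hgM _]
    have iQ : Integrable (fun p => -ζ p • Q p + H p • g p) (slab T) := by
      refine integrable_of_ae_bdd_of_support (B := Bζ * M + BH * M) hKK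
        ((hζc.neg.aestronglyMeasurable.smul hQ.aestronglyMeasurable).add
          (hHl.continuous.aestronglyMeasurable.smul hg.aestronglyMeasurable)) ?_ fun p hp => by
            simp [hζH p hp]
      refine ae_of_all _ fun p => ?_
      refine (norm_add_le _ _).trans ?_
      rw [norm_smul, norm_smul, norm_neg]
      gcongr
      exacts [hBζ _, hQM _, hBH _, hgM _]
    -- both functions satisfy the weak equation tested with `H`
    have eP : ∫ p, (-ζ p • P p + H p • g p) ∂slab T = - ∫ x, H (0, x) • Q0 x := by
      rw [slab, integral_prod_symm _ (by rw [← slab]; exact iP), integral_congr_ae hline, integral_neg]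
    have eQ : ∫ p, (-ζ p • Q p + H p • g p) ∂slab T = - ∫ x, H (0, x) • Q0 x := by
      have h0 := h H _ hHl hHs (hHK.trans hKT)
      rw [← eq_neg_iff_add_eq_zero] at h0
      rw [← h0]
      refine integral_congr_ae ?_
      filter_upwards [(slab_ac T).ae_le (hHl.ae_differentiableAt (μ := volume)), slab_ae_mem_Ioo T] with p h1 h2
      have h3 : HasDerivAt (fun t => H (t, p.2)) (fderiv ℝ H p (1, 0)) p.1 :=
        hasDerivAt_comp_spacetime h1 (hasDerivAt_const p.1 p.2)
      rw [h3.unique (hHd p.2 p.1 h2.1.le)]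
    have e3 : ∫ p, ζ p • (Q p - P p) ∂slab T = 0 := by
      rw [← sub_self (- ∫ x, H (0, x) • Q0 x)]
      nth_rw 1 [← eP]
      rw [← eQ, ← integral_sub iP iQ]
      congr 1; ext p; module
    rw [slab_eq_restrict, setIntegral_eq_integral_of_forall_compl_eq_zero] at e3
    · exact e3
    · intro p hp
      rw [image_eq_zero_of_notMem_tsupport (fun hm => hp ⟨Ioo_subset_Icc_self (hζT hm).1, trivial⟩), zero_smul]
  have hloc : LocallyIntegrableOn (fun p => Q p - P p) (Ioo 0 T ×ˢ univ) (volume : Measure (ℝ × Plane)) := by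
    have : LocallyIntegrable (fun p => Q p - P p) (slab T) :=
      locallyIntegrable_of_ae_bdd (M := M + (M + M * T)) (hQ.sub hPm).aestronglyMeasurable (by
        filter_upwards [hPae] with p hp
        exact (norm_sub_le _ _).trans (add_le_add (hQM p) hp))
    rw [slab_eq_restrict] at this
    exact (locallyIntegrableOn_of_locallyIntegrable_restrict this).mono_set
      (prod_mono Ioo_subset_Icc_self le_rfl)
  have := (isOpen_Ioo.prod isOpen_univ).ae_eq_zero_of_integral_contDiff_smul_eq_zero hloc key
  filter_upwards [(slab_ac T).ae_le this, slab_ae_mem_Ioo T] with p h1 h2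
  exact sub_eq_zero.1 (h1 ⟨h2, trivial⟩)

/-- A weak solution of `∂_t Q = g`, `Q(0) = Q0` is the time integral of `g`. -/
theorem SolvesTransport.eq_add_integral {T MQ Mg M0 : ℝ} (hT : 0 ≤ T) {Q g : ℝ × Plane → F} {Q0 : Plane → F}
    (hQ : AEStronglyMeasurable Q (slab T)) (hg : AEStronglyMeasurable g (slab T))
    (hQ0 : AEStronglyMeasurable Q0 volume)
    (hQM : ∀ᵐ p ∂slab T, ‖Q p‖ ≤ MQ) (hgM : ∀ᵐ p ∂slab T, ‖g p‖ ≤ Mg) (hQ0M : ∀ᵐ x, ‖Q0 x‖ ≤ M0)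
    (h : SolvesTransport T (fun _ => 0) Q g Q0) :
    ∀ᵐ p ∂slab T, Q p = Q0 p.2 + ∫ s in (0 : ℝ)..p.1, g (s, p.2) := by
  set M := max (max MQ Mg) (max M0 0)
  have hM : 0 ≤ M := (le_max_right _ _).trans (le_max_right _ _)
  obtain ⟨Q', q1, q2, q3⟩ := exists_bounded_rep (M := M) hM hQ
    (hQM.mono fun p hp => hp.trans ((le_max_left _ _).trans (le_max_left _ _)))
  obtain ⟨g', g1, g2, g3⟩ := exists_bounded_rep (M := M) hM hg
    (hgM.mono fun p hp => hp.trans ((le_max_right _ _).trans (le_max_left _ _)))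
  obtain ⟨R, r1, r2, r3⟩ := exists_bounded_rep (M := M) hM hQ0
    (hQ0M.mono fun p hp => hp.trans ((le_max_left _ _).trans (le_max_right _ _)))
  have h' : SolvesTransport T (fun _ => 0) Q' g' R := by
    intro ψ C h1 h2 h3
    rw [← h ψ C h1 h2 h3]
    congr 1
    · refine integral_congr_ae ?_
      filter_upwards [q3, g3] with p hp hp'
      rw [hp, hp']
    · refine integral_congr_ae ?_
      filter_upwards [r3] with p hp
      rw [hp]
  filter_upwards [h'.eq_add_integral_of_bounded hT q1 g1 r1 q2 g2 r2, q3, slab_ae_of_ae_snd (T := T) r3,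
    slab_ae_of_ae_snd (T := T) (slab_ae_slice g3), slab_ae_mem_Ioo T] with p h1 h2 h3 h4 h5
  rw [h2, h1, h3]
  congr 1
  refine intervalIntegral.integral_congr_ae ?_
  rw [ae_restrict_iff' measurableSet_Icc] at h4
  filter_upwards [h4] with s hs hs'
  rw [uIoc_of_le h5.1.le] at hs'
  exact (hs ⟨hs'.1.le, hs'.2.trans h5.2.le⟩).symm

end TransportStationary

/-! ### Transport equations in the coordinates of a flow -/

section PullBack

/-- The maps `X t` are the flow of the field `w` on the time interval `[0,T]`, with inverse maps
`Y t`. The equation of the flow is required at almost every point of the slab. -/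
structure IsFlow (T : ℝ) (C : ℝ≥0) (w : ℝ × Plane → Plane) (X Y : ℝ → Plane → Plane) : Prop
    extends IsBiLip C X Y where
  zero : ∀ x, X 0 x = x
  deriv : ∀ᵐ p ∂slab T, HasDerivAt (fun t => X t p.2) (w (p.1, X p.1 p.2)) p.1

variable {F : Type} [NormedAddCommGroup F] [NormedSpace ℝ F]

/-- Along the flow of `w`, a transport equation becomes an equation without transport. -/
theorem SolvesTransport.pullback {T : ℝ} {C : ℝ≥0} {w : ℝ × Plane → Plane} {X Y : ℝ → Plane → Plane}
    (hX : IsFlow T C w X Y) {Q S : ℝ × Plane → F} {Q0 : Plane → F} (h : SolvesTransport T w Q S Q0) :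
    SolvesTransport T (fun _ => 0) (fun p => jac X p • Q (p.1, X p.1 p.2))
      (fun p => jac X p • S (p.1, X p.1 p.2)) Q0 := by
  intro η D hη hηs hηT
  let e : (ℝ × Plane) ≃ₜ (ℝ × Plane) :=
    { toFun := fun p => (p.1, Y p.1 p.2)
      invFun := fun p => (p.1, X p.1 p.2)
      left_inv := fun p => by simp [hX.right_inv]
      right_inv := fun p => by simp [hX.left_inv]
      continuous_toFun := continuous_fst.prodMk hX.lipY.continuous
      continuous_invFun := continuous_fst.prodMk hX.lipX.continuous }
  set ψ : ℝ × Plane → ℝ := fun p => η (p.1, Y p.1 p.2) with hψ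
  have hψl : LipschitzWith (D * max 1 C) ψ := hη.comp (LipschitzWith.prod_fst.prodMk hX.lipY)
  have hψs : HasCompactSupport ψ := hηs.comp_homeomorph e
  have hψT : tsupport ψ ⊆ Iio T ×ˢ univ := by
    have : tsupport ψ ⊆ e ⁻¹' tsupport η := tsupport_comp_subset_preimage η e.continuous
    exact fun p hp => ⟨(hηT (this hp)).1, trivial⟩
  have key := h ψ _ hψl hψs hψT
  rw [hX.toIsBiLip.integral_eq] at key
  have e0 : ∀ x, ψ (0, x) = η (0, x) := fun x => by
    have : Y 0 x = x := by rw [← hX.zero (Y 0 x), hX.right_inv]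
    simp [hψ, this]
  simp only [e0] at key
  rw [← key]
  congr 1
  refine integral_congr_ae ?_
  filter_upwards [hX.deriv, (slab_ac T).ae_le (hη.ae_differentiableAt (μ := volume)),
    hX.toIsBiLip.ae_comp ((slab_ac T).ae_le (hψl.ae_differentiableAt (μ := volume)))] with p h1 h2 h3
  have a1 : HasDerivAt (fun t => ψ (t, X t p.2)) (fderiv ℝ ψ (p.1, X p.1 p.2) (1, w (p.1, X p.1 p.2))) p.1 :=
    hasDerivAt_comp_spacetime h3 h1
  have a2 : HasDerivAt (fun t => η (t, p.2)) (fderiv ℝ η p (1, 0)) p.1 :=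
    hasDerivAt_comp_spacetime h2 (hasDerivAt_const p.1 p.2)
  have a3 : (fun t => ψ (t, X t p.2)) = fun t => η (t, p.2) := by
    ext t; simp [hψ, hX.left_inv]
  rw [a3] at a1
  have a4 : ψ (p.1, X p.1 p.2) = η p := by simp [hψ, hX.left_inv]
  rw [a1.unique a2, a4]
  module

/-- The equation of the flow, in integral form, gives the equation almost everywhere. -/
theorem ae_slab_hasDerivAt_of_integral {T : ℝ} (hT : 0 ≤ T) {G : Type} [NormedAddCommGroup G] [NormedSpace ℝ G]
    [FiniteDimensional ℝ G] {Z : ℝ → Plane → G} (hZ : Continuous fun p : ℝ × Plane => Z p.1 p.2)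
    {v : ℝ × Plane → G} (hv : StronglyMeasurable v)
    (hi : ∀ x, IntervalIntegrable (fun s => v (s, x)) volume 0 T)
    (h : ∀ᵐ x, ∀ t ∈ Icc 0 T, Z t x = Z 0 x + ∫ s in (0 : ℝ)..t, v (s, x)) :
    ∀ᵐ p ∂slab T, HasDerivAt (fun t => Z t p.2) (v p) p.1 := by
  have : CompleteSpace G := FiniteDimensional.complete ℝ G
  have : ProperSpace G := FiniteDimensional.proper_real G
  borelize G
  have hZ' : Continuous (Function.uncurry fun (x : Plane) (t : ℝ) => Z t x) :=
    hZ.comp continuous_swap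
  have hm : MeasurableSet {p : ℝ × Plane | HasDerivAt (fun t => Z t p.2) (v p) p.1} := by
    have e : {p : ℝ × Plane | HasDerivAt (fun t => Z t p.2) (v p) p.1} =
        {p | DifferentiableAt ℝ (fun t => Z t p.2) p.1} ∩ {p | deriv (fun t => Z t p.2) p.1 = v p} := by
      ext p
      exact ⟨fun h => ⟨h.differentiableAt, h.deriv⟩, fun h => by
        have := h.1.hasDerivAt
        rwa [show deriv (fun t => Z t p.2) p.1 = v p from h.2] at this⟩
    rw [e]
    refine (measurable_swap (measurableSet_of_differentiableAt_with_param ℝ hZ')).inter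
      (measurableSet_eq_fun ?_ hv.measurable)
    exact (measurable_deriv_with_param hZ').comp measurable_swap
  refine slab_ae_of_slice hm ?_
  filter_upwards [h] with x hx
  have h1 := (hi x).ae_hasDerivAt_integral
  rw [uIcc_of_le hT] at h1
  rw [← restrict_Ioo_eq_restrict_Icc]
  filter_upwards [ae_restrict_of_ae h1, ae_restrict_mem measurableSet_Ioo] with t h2 ht
  refine ((h2 (Ioo_subset_Icc_self ht) 0 ⟨le_rfl, hT⟩).const_add (Z 0 x)).congr_of_eventuallyEq ?_
  filter_upwards [Icc_mem_nhds ht.1 ht.2] with s hs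
  exact hx s hs

end PullBack

/-! ### Representatives in time and space -/

section LipschitzFields

/-- An element of `L^∞([0,T], W^{s,∞})`, `s ≥ 1`, has a representative all of whose time slices are
bounded and Lipschitz. -/
theorem MemLinftyW.exists_lipschitz_slices {T s : ℝ} (hs : 1 ≤ s) {u : ℝ → Plane → Plane}
    (h : MemLinftyW T s u) : ∃ (M : ℝ) (w : ℝ × Plane → Plane), 0 ≤ M ∧ StronglyMeasurable w ∧
      (∀ p, ‖w p‖ ≤ M) ∧ (∀ t x y, ‖w (t, x) - w (t, y)‖ ≤ 2 * M * ‖x - y‖) ∧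
      ∀ᵐ p ∂slab T, u p.1 p.2 = w p := by
  obtain ⟨M, hm, hM⟩ := h
  set v := hm.mk _ with hv
  have hvm : StronglyMeasurable v := hm.stronglyMeasurable_mk
  have h1 : ∀ᵐ t ∂volume.restrict (Icc 0 T), ∀ᵐ x, u t x = v (t, x) :=
    Measure.ae_ae_of_ae_prod hm.ae_eq_mk
  have h2 : ∀ᵐ t ∂volume.restrict (Icc 0 T), ∃ f : Plane → Plane, (∀ᵐ x, v (t, x) = f x) ∧ (∀ x, ‖f x‖ ≤ M) ∧
      ∀ x y, ‖f x - f y‖ ≤ 2 * M * ‖x - y‖ := by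
    filter_upwards [h1, hM] with t ht1 ht2
    obtain ⟨f, f1, f2, f3⟩ := ht2.exists_lipschitz_rep hs
    refine ⟨f, ?_, f2, f3⟩
    filter_upwards [ht1, f1] with x hx hx'
    rw [← hx, hx']
  -- the slices are chosen outside a null set of times; mollification shows joint measurability
  obtain ⟨N, hN, hNm, hN0⟩ := exists_measurable_superset_of_null (ae_iff.1 h2)
  have h3 : ∀ t, t ∉ N → ∃ f : Plane → Plane, (∀ᵐ x, v (t, x) = f x) ∧ (∀ x, ‖f x‖ ≤ M) ∧
      ∀ x y, ‖f x - f y‖ ≤ 2 * M * ‖x - y‖ := fun t ht => by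
    by_contra hcon; exact ht (hN hcon)
  choose! f f1 f2 f3 using h3
  set w : ℝ × Plane → Plane := indicator (Prod.fst ⁻¹' Nᶜ) fun p => f p.1 p.2 with hw
  have hset : MeasurableSet (Prod.fst ⁻¹' Nᶜ : Set (ℝ × Plane)) := measurable_fst hNm.compl
  have hwm : StronglyMeasurable w := by
    refine stronglyMeasurable_of_tendsto (u := atTop) (f := fun n =>
      indicator (Prod.fst ⁻¹' Nᶜ) fun p : ℝ × Plane => moll volume n (fun y => v (p.1, y)) p.2) (fun n => ?_) ?_
    · refine StronglyMeasurable.indicator ?_ hset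
      simp only [moll_apply]
      refine StronglyMeasurable.integral_prod_right (f := fun (p : ℝ × Plane) y =>
        (mollBump Plane n).normed volume (p.2 - y) • v (p.1, y)) ?_
      have c1 : Continuous fun z : (ℝ × Plane) × Plane => (mollBump Plane n).normed volume (z.1.2 - z.2) :=
        (mollBump Plane n).continuous_normed.comp (by fun_prop)
      exact c1.stronglyMeasurable.smul (hvm.comp_measurable (by fun_prop))
    · rw [tendsto_pi_nhds]
      intro p
      by_cases hp : p.1 ∈ N
      · have hp' : p ∉ (Prod.fst ⁻¹' Nᶜ : Set (ℝ × Plane)) := fun h => h hp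
        simp only [hw, indicator_of_notMem hp', tendsto_const_nhds]
      · have hp' : p ∈ (Prod.fst ⁻¹' Nᶜ : Set (ℝ × Plane)) := hp
        simp only [hw, indicator_of_mem hp']
        have hM0 : 0 ≤ M := (norm_nonneg _).trans (f2 p.1 hp 0)
        rw [tendsto_iff_norm_sub_tendsto_zero]
        refine squeeze_zero (fun _ => norm_nonneg _) (fun n => ?_)
          (tendsto_rOut_rpow (E := Plane) (C := 2 * M) one_pos)
        rw [moll_congr (f1 p.1 hp)]
        exact norm_moll_sub_le (lipschitzWith_of_norm_le (f3 p.1 hp)).continuous (by positivity) one_pos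
          (by simpa using f3 p.1 hp) n p.2
  refine ⟨max M 0, w, le_max_right _ _, hwm, fun p => ?_, fun t x y => ?_, ?_⟩
  · by_cases hp : p.1 ∈ N
    · have hp' : p ∉ (Prod.fst ⁻¹' Nᶜ : Set (ℝ × Plane)) := fun h => h hp
      simp only [hw, indicator_of_notMem hp', norm_zero, le_max_right]
    · have hp' : p ∈ (Prod.fst ⁻¹' Nᶜ : Set (ℝ × Plane)) := hp
      simp only [hw, indicator_of_mem hp']
      exact (f2 p.1 hp _).trans (le_max_left _ _)
  · by_cases hp : t ∈ N
    · have hp' : ∀ x, ((t, x) : ℝ × Plane) ∉ (Prod.fst ⁻¹' Nᶜ : Set (ℝ × Plane)) := fun x h => h hp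
      simp only [hw, indicator_of_notMem (hp' _), sub_self, norm_zero]; positivity
    · have hp' : ∀ x, ((t, x) : ℝ × Plane) ∈ (Prod.fst ⁻¹' Nᶜ : Set (ℝ × Plane)) := fun x => hp
      simp only [hw, indicator_of_mem (hp' _)]
      exact (f3 t hp x y).trans (by gcongr; exact le_max_left _ _)
  · have hg : ∀ᵐ t ∂volume.restrict (Icc 0 T), t ∉ N := compl_mem_ae_iff.2 hN0
    have e1 : ∀ᵐ p ∂slab T, u p.1 p.2 = v p := hm.ae_eq_mk
    have e2 : ∀ᵐ p ∂slab T, v p = w p := by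
      have hms : MeasurableSet {p | v p = w p} := hvm.measurableSet_eq_fun hwm
      refine (Measure.ae_prod_iff_ae_ae hms).2 ?_
      filter_upwards [hg] with t ht
      filter_upwards [f1 t ht] with x hx
      have hp' : ((t, x) : ℝ × Plane) ∈ (Prod.fst ⁻¹' Nᶜ : Set (ℝ × Plane)) := ht
      simp only [hw, indicator_of_mem hp', hx]
    filter_upwards [e1, e2] with p h h' using h.trans h'

end LipschitzFields

/-! ### Flows of Lipschitz fields -/

section Flow

/-- The point of `[0,T]` closest to `t`. -/
noncomputable def clamp (T t : ℝ) : ℝ := max 0 (min t T)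

theorem clamp_mem {T : ℝ} (hT : 0 ≤ T) (t : ℝ) : clamp T t ∈ Icc 0 T :=
  ⟨le_max_left _ _, max_le hT (min_le_right _ _)⟩

theorem clamp_of_mem {T t : ℝ} (ht : t ∈ Icc 0 T) : clamp T t = t := by
  rw [clamp, min_eq_left ht.2, max_eq_right ht.1]

theorem abs_clamp_sub_le (T t t' : ℝ) : |clamp T t - clamp T t'| ≤ |t - t'| := by
  have h1 := abs_max_sub_max_le_abs (min t T) (min t' T) 0
  have h2 := abs_min_sub_min_le_max t T t' T
  rw [sub_self, abs_zero, max_eq_left (abs_nonneg _)] at h2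
  rw [clamp, clamp, max_comm 0, max_comm 0]
  exact h1.trans h2

/-- Time reversal of a primitive. -/
theorem reverse_eq_add_integral {G : Type} [NormedAddCommGroup G] [NormedSpace ℝ G] {y g : ℝ → G} {τ : ℝ}
    (hg : IntervalIntegrable g volume 0 τ)
    (h : ∀ t ∈ Icc 0 τ, y t = y 0 + ∫ s in (0 : ℝ)..t, g s) :
    ∀ σ ∈ Icc 0 τ, y (τ - σ) = y τ + ∫ s in (0 : ℝ)..σ, -g (τ - s) := by
  intro σ hσ
  have hτ : 0 ≤ τ := hσ.1.trans hσ.2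
  have h1 : τ - σ ∈ Icc 0 τ := ⟨by linarith [hσ.2], by linarith [hσ.1]⟩
  rw [intervalIntegral.integral_neg, intervalIntegral.integral_comp_sub_left (fun s => g s) τ, sub_zero,
    h τ ⟨hτ, le_rfl⟩, h _ h1, ← intervalIntegral.integral_interval_sub_left (a := 0) (b := τ) (c := τ - σ) hg
      (hg.mono_set (by rw [uIcc_of_le hτ, uIcc_of_le h1.1]; exact Icc_subset_Icc le_rfl h1.2))]
  abel

/-- A jointly Lipschitz family of maps that are onto and uniformly expanding up to a constant has
a jointly Lipschitz family of inverse maps. -/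
theorem exists_isBiLip {X : ℝ → Plane → Plane} {C : ℝ≥0} (hX : LipschitzWith C fun p : ℝ × Plane => X p.1 p.2)
    {L : ℝ} (hL : 0 ≤ L) (hanti : ∀ t x y, ‖x - y‖ ≤ L * ‖X t x - X t y‖)
    (hsurj : ∀ t, Function.Surjective (X t)) : ∃ (C' : ℝ≥0) (Y : ℝ → Plane → Plane), IsBiLip C' X Y := by
  have hr : ∀ t y, X t (Function.surjInv (hsurj t) y) = y := fun t y => Function.surjInv_eq (hsurj t) y
  have hY : ∀ p q : ℝ × Plane, ‖Function.surjInv (hsurj p.1) p.2 - Function.surjInv (hsurj q.1) q.2‖ ≤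
      L * (1 + C) * ‖p - q‖ := fun p q => by
    have a1 := hanti p.1 (Function.surjInv (hsurj p.1) p.2) (Function.surjInv (hsurj q.1) q.2)
    have a2 := hX.norm_sub_le (q.1, Function.surjInv (hsurj q.1) q.2) (p.1, Function.surjInv (hsurj q.1) q.2)
    simp only [hr, Prod.mk_sub_mk, sub_self] at a1 a2
    have a3 : ‖((q.1 - p.1, 0) : ℝ × Plane)‖ ≤ ‖p - q‖ := by
      rw [Prod.norm_mk, norm_zero, max_eq_left (norm_nonneg _), norm_sub_rev]
      exact norm_fst_le (p - q)
    have a4 : ‖p.2 - q.2‖ ≤ ‖p - q‖ := norm_snd_le (p - q)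
    have a5 : ‖p.2 - X p.1 (Function.surjInv (hsurj q.1) q.2)‖ ≤ ‖p - q‖ + C * ‖p - q‖ := by
      refine (norm_sub_le_norm_sub_add_norm_sub _ q.2 _).trans (add_le_add a4 (a2.trans ?_))
      gcongr
    calc _ ≤ L * (‖p - q‖ + C * ‖p - q‖) := a1.trans (by gcongr)
      _ = _ := by ring
  refine ⟨max C (L * (1 + C)).toNNReal, fun t => Function.surjInv (hsurj t), hX.weaken (le_max_left _ _),
    (lipschitzWith_of_norm_le hY).weaken (le_max_right _ _), hr, fun t x => ?_⟩
  have := hanti t (Function.surjInv (hsurj t) (X t x)) x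
  rw [hr, sub_self, norm_zero, mul_zero] at this
  exact sub_eq_zero.1 (norm_le_zero_iff.1 this)

/-- A bounded field with Lipschitz time slices has a flow. -/
theorem exists_isFlow {T M L : ℝ} (hT : 0 ≤ T) (hL : 0 ≤ L) {w : ℝ × Plane → Plane} (hw : StronglyMeasurable w)
    (hM : ∀ p, ‖w p‖ ≤ M) (hLip : ∀ t x y, ‖w (t, x) - w (t, y)‖ ≤ L * ‖x - y‖) :
    ∃ (C : ℝ≥0) (X Y : ℝ → Plane → Plane), IsFlow T C w X Y ∧
      ∀ x, ∀ t ∈ Icc 0 T, X t x = x + ∫ s in (0 : ℝ)..t, w (s, X s x) := by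
  have hM0 : 0 ≤ M := (norm_nonneg _).trans (hM 0)
  have hmeas : ∀ z : ℝ → Plane, Continuous z → StronglyMeasurable (fun t => w (t, z t)) := fun z hz =>
    hw.comp_measurable (by fun_prop)
  have hii : ∀ z : ℝ → Plane, Continuous z → ∀ a b, IntervalIntegrable (fun t => w (t, z t)) volume a b :=
    fun z hz => intervalIntegrable_of_lipschitz_field (f := fun t x => w (t, x))
      (fun z hz => (hmeas z hz).aestronglyMeasurable) hLip (fun t => hM _) hz
  have hex := fun x => exists_integral_curve (f := fun t x => w (t, x)) hL
    (fun z hz => (hmeas z hz).aestronglyMeasurable) hLip (fun t => hM _) x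
  choose Z hZc hZ using hex
  have hZ0 : ∀ x, Z x 0 = x := fun x => by rw [hZ x 0 le_rfl]; simp
  obtain ⟨c, hcm, hce, hcl⟩ : ∃ c : ℝ → ℝ, (∀ t, c t ∈ Icc 0 T) ∧ (∀ t ∈ Icc 0 T, c t = t) ∧
      ∀ t t', |c t - c t'| ≤ |t - t'| :=
    ⟨clamp T, clamp_mem hT, fun t ht => clamp_of_mem ht, abs_clamp_sub_le T⟩
  have hdiff : ∀ τ ∈ Icc 0 T, ∀ r r' : ℝ → Plane, Continuous r → Continuous r' → ∀ d : Plane,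
      (∀ t ∈ Icc 0 τ, r t - r' t = d + ∫ s in (0 : ℝ)..t, (w (s, r s) - w (s, r' s))) →
      ∀ t ∈ Icc 0 τ, ‖r t - r' t‖ ≤ 2 * Real.exp ((2 * L + 1) * T) * ‖d‖ := by
    intro τ hτ r r' hr hr' d h t ht
    have := norm_le_of_eq_add_integral (y := fun t => r t - r' t) hL le_rfl (by fun_prop) h
      (fun s _ => by simpa using hLip s (r s) (r' s)) t ht
    simp only [zero_mul, add_zero] at this
    refine this.trans ?_
    rw [mul_assoc, mul_assoc, mul_comm ‖d‖]
    gcongr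
    exact hτ.2
  set B := 2 * Real.exp ((2 * L + 1) * T) with hB
  have hB0 : 0 ≤ B := by positivity
  have hZx : ∀ t ∈ Icc 0 T, ∀ x y, ‖Z x t - Z y t‖ ≤ B * ‖x - y‖ := fun t ht x y => by
    refine hdiff T ⟨hT, le_rfl⟩ _ _ (hZc x) (hZc y) (x - y) (fun t ht => ?_) t ht
    rw [intervalIntegral.integral_sub (hii _ (hZc x) _ _) (hii _ (hZc y) _ _), hZ x t ht.1, hZ y t ht.1]
    abel
  have hZt : ∀ x, ∀ t ∈ Icc 0 T, ∀ t' ∈ Icc 0 T, ‖Z x t - Z x t'‖ ≤ M * |t - t'| := fun x t ht t' ht' => by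
    rw [hZ x t ht.1, hZ x t' ht'.1, add_sub_add_left_eq_sub,
      intervalIntegral.integral_interval_sub_left (hii _ (hZc x) _ _) (hii _ (hZc x) _ _)]
    exact intervalIntegral.norm_integral_le_of_norm_le_const fun s _ => hM _
  have hX : LipschitzWith (M + B).toNNReal fun p : ℝ × Plane => Z p.2 (c p.1) := by
    refine lipschitzWith_of_norm_le fun p q => ?_
    refine (norm_sub_le_norm_sub_add_norm_sub _ (Z p.2 (c q.1)) _).trans ?_
    rw [add_mul]
    have n1 : |p.1 - q.1| ≤ ‖p - q‖ := norm_fst_le (p - q)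
    have n2 : ‖p.2 - q.2‖ ≤ ‖p - q‖ := norm_snd_le (p - q)
    refine add_le_add ((hZt _ _ (hcm _) _ (hcm _)).trans ?_) ((hZx _ (hcm _) _ _).trans (by gcongr))
    gcongr
    exact (hcl _ _).trans n1
  -- run two trajectories backwards from the time `c t`
  have hanti : ∀ t x y, ‖x - y‖ ≤ B * ‖Z x (c t) - Z y (c t)‖ := by
    intro t x y
    set τ := c t
    have hτ : τ ∈ Icc 0 T := hcm t
    have hcont : Continuous fun s => Z x (τ - s) - Z y (τ - s) := by
      have := hZc x; have := hZc y; fun_prop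
    have h1 := reverse_eq_add_integral (y := fun t => Z x t - Z y t)
      (g := fun s => w (s, Z x s) - w (s, Z y s)) (τ := τ)
      ((hii _ (hZc x) _ _).sub (hii _ (hZc y) _ _)) (fun t ht => by
        rw [intervalIntegral.integral_sub (hii _ (hZc x) _ _) (hii _ (hZc y) _ _), hZ x t ht.1, hZ y t ht.1,
          hZ0, hZ0]
        abel)
    have := norm_le_of_eq_add_integral (y := fun s => Z x (τ - s) - Z y (τ - s)) hL le_rfl
      hcont.continuousOn h1 (fun s _ => by rw [norm_neg, add_zero]; exact hLip _ _ _) τ ⟨hτ.1, le_rfl⟩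
    simp only [sub_self, hZ0, zero_mul, add_zero] at this
    refine this.trans ?_
    rw [hB, mul_assoc, mul_assoc, mul_comm ‖_‖]
    gcongr
    exact hτ.2
  -- the trajectory through `y` is obtained by solving the time-reversed equation
  have hsurj : ∀ t, Function.Surjective fun x => Z x (c t) := by
    intro t y
    set τ := c t
    have hτ : τ ∈ Icc 0 T := hcm t
    have hm' : ∀ z : ℝ → Plane, Continuous z → StronglyMeasurable (fun s => -w (τ - s, z s)) := fun z hz =>
      (hw.comp_measurable (by fun_prop : Measurable fun s => (τ - s, z s))).neg
    have hl' : ∀ s x y, ‖-w (τ - s, x) - -w (τ - s, y)‖ ≤ L * ‖x - y‖ := fun s x y => by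
      rw [← norm_neg]; simpa [sub_eq_add_neg, add_comm] using hLip (τ - s) x y
    obtain ⟨z, hzc, hz⟩ := exists_integral_curve (f := fun s x => -w (τ - s, x)) hL
      (fun z hz => (hm' z hz).aestronglyMeasurable) hl' (fun t => by rw [norm_neg]; exact hM _) y
    have hz0 : z 0 = y := by rw [hz 0 le_rfl]; simp
    have hzi := intervalIntegrable_of_lipschitz_field (f := fun s x => -w (τ - s, x))
      (fun z hz => (hm' z hz).aestronglyMeasurable) hl' (fun t => by rw [norm_neg]; exact hM _) hzc
    refine ⟨z τ, ?_⟩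
    have h1 := reverse_eq_add_integral (y := z) (hzi 0 τ) (fun t ht => by rw [hz0]; exact hz t ht.1)
    simp only [neg_neg, sub_sub_cancel] at h1
    have hrc : Continuous fun s => z (τ - s) := by fun_prop
    have h2 := hdiff τ hτ (Z (z τ)) (fun s => z (τ - s)) (hZc _) hrc 0 (fun t ht => by
      rw [intervalIntegral.integral_sub (hii _ (hZc _) _ _) (hii _ hrc _ _), h1 t ht, hZ _ t ht.1]
      abel) τ ⟨hτ.1, le_rfl⟩
    rw [norm_zero, mul_zero, sub_self, hz0] at h2
    exact sub_eq_zero.1 (norm_le_zero_iff.1 h2)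
  obtain ⟨C, Y, hXY⟩ := exists_isBiLip (X := fun t x => Z x (c t)) hX hB0 hanti hsurj
  have hX0 : ∀ x, Z x (c 0) = x := fun x => by rw [hce 0 ⟨le_rfl, hT⟩, hZ0]
  have hXi : ∀ x, ∀ t ∈ Icc 0 T, Z x (c t) = x + ∫ s in (0 : ℝ)..t, w (s, Z x (c s)) := fun x t ht => by
    rw [hce t ht, hZ x t ht.1]
    congr 1
    refine intervalIntegral.integral_congr fun s hs => ?_
    rw [uIcc_of_le ht.1] at hs
    simp only [hce s ⟨hs.1, hs.2.trans ht.2⟩]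
  refine ⟨C, fun t x => Z x (c t), Y, ⟨hXY, hX0, ?_⟩, hXi⟩
  have hXc : Continuous fun p : ℝ × Plane => Z p.2 (c p.1) := hX.continuous
  have hvm : StronglyMeasurable fun p : ℝ × Plane => w (p.1, Z p.2 (c p.1)) :=
    hw.comp_measurable (measurable_fst.prodMk hXc.measurable)
  have hvi : ∀ x, IntervalIntegrable (fun s => w (s, Z x (c s))) volume 0 T := fun x =>
    hii (fun s => Z x (c s)) (hXc.comp (Continuous.prodMk_left x)) 0 T
  have hXi' : ∀ x, ∀ t ∈ Icc 0 T, Z x (c t) = Z x (c 0) + ∫ s in (0 : ℝ)..t, w (s, Z x (c s)) := fun x t ht => by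
    rw [hX0]; exact hXi x t ht
  exact ae_slab_hasDerivAt_of_integral (Z := fun t x => Z x (c t)) hT hXc
    (v := fun p => w (p.1, Z p.2 (c p.1))) hvm hvi (ae_of_all _ hXi')

end Flow

/-! ### Rotation by a right angle -/

section Perp

theorem norm_perp (v : Plane) : ‖perp v‖ = ‖v‖ := by
  simp [perp, EuclideanSpace.norm_eq, Fin.sum_univ_two, add_comm]

/-- The rotation `v ↦ v^⊥` as a continuous linear map. -/
noncomputable def perpCLM : Plane →L[ℝ] Plane :=
  LinearMap.toContinuousLinearMap
    { toFun := perp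
      map_add' := fun v w => by ext i; fin_cases i <;> simp [perp, add_comm]
      map_smul' := fun c v => by ext i; fin_cases i <;> simp [perp] }

theorem perpCLM_apply (v : Plane) : perpCLM v = perp v := rfl

theorem continuous_perp : Continuous perp := perpCLM.continuous

theorem perp_sub (v w : Plane) : perp (v - w) = perp v - perp w := map_sub perpCLM v w

end Perp

/-! ### The Euler equations along the flow -/

section Lagrangian

theorem IsWeakDeriv.ae_unique {F : Type} [NormedAddCommGroup F] [NormedSpace ℝ F] [FiniteDimensional ℝ F]
    {v : Plane} {f g g' : Plane → F}
    (h : IsWeakDeriv v f g) (h' : IsWeakDeriv v f g') : g =ᵐ[volume] g' := by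
  have : CompleteSpace F := FiniteDimensional.complete ℝ F
  refine ae_eq_of_integral_contDiff_smul_eq h.2.1 h'.2.1 fun φ h1 h2 => ?_
  rw [← neg_inj, ← h.2.2 φ h1 h2, ← h'.2.2 φ h1 h2]

theorem slab_ae_norm_le {F : Type} [NormedAddCommGroup F] {T M : ℝ} {g : ℝ × Plane → F}
    (hg : AEStronglyMeasurable g (slab T)) (h : ∀ᵐ t ∂volume.restrict (Icc 0 T), ∀ᵐ x, ‖g (t, x)‖ ≤ M) :
    ∀ᵐ p ∂slab T, ‖g p‖ ≤ M := by
  have hm : MeasurableSet {p | ‖hg.mk g p‖ ≤ M} := hg.stronglyMeasurable_mk.norm.measurable measurableSet_Iic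
  have h1 : ∀ᵐ t ∂volume.restrict (Icc 0 T), ∀ᵐ x, g (t, x) = hg.mk g (t, x) := Measure.ae_ae_of_ae_prod hg.ae_eq_mk
  have h2 : ∀ᵐ p ∂slab T, ‖hg.mk g p‖ ≤ M := by
    refine (Measure.ae_prod_iff_ae_ae hm).2 ?_
    filter_upwards [h, h1] with t a b
    filter_upwards [a, b] with x a b
    rwa [← b]
  filter_upwards [h2, hg.ae_eq_mk] with p a b
  rwa [b]

variable {T : ℝ} {C : ℝ≥0} {w : ℝ × Plane → Plane} {X Y : ℝ → Plane → Plane}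

/-- A bounded weak solution of `∂_t Q + ∇·(Q w) = S` along the flow of `w`. -/
theorem SolvesTransport.along_flow {F : Type} [NormedAddCommGroup F] [NormedSpace ℝ F] [FiniteDimensional ℝ F]
    (hT : 0 ≤ T) (hX : IsFlow T C w X Y) {Q S : ℝ × Plane → F} {Q0 : Plane → F} {MQ MS M0 : ℝ}
    (hQ : AEStronglyMeasurable Q (slab T)) (hQM : ∀ᵐ p ∂slab T, ‖Q p‖ ≤ MQ)
    (hS : AEStronglyMeasurable S (slab T)) (hSM : ∀ᵐ p ∂slab T, ‖S p‖ ≤ MS)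
    (hQ0 : AEStronglyMeasurable Q0 volume) (hQ0M : ∀ᵐ x, ‖Q0 x‖ ≤ M0)
    (h : SolvesTransport T w Q S Q0) :
    ∀ᵐ p ∂slab T, jac X p • Q (p.1, X p.1 p.2) =
      Q0 p.2 + ∫ s in (0 : ℝ)..p.1, jac X (s, p.2) • S (s, X s p.2) := by
  obtain ⟨B, hB⟩ := hX.toIsBiLip.exists_jac_le
  have hjm := hX.toIsBiLip.measurable_jac.aestronglyMeasurable (μ := slab T)
  have hb : ∀ {R : ℝ × Plane → F} {M : ℝ}, (∀ᵐ p ∂slab T, ‖R p‖ ≤ M) →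
      ∀ᵐ p ∂slab T, ‖jac X p • R (p.1, X p.1 p.2)‖ ≤ B * M := fun hR => by
    filter_upwards [hX.toIsBiLip.ae_comp hR] with p hp
    rw [norm_smul, Real.norm_of_nonneg (jac_nonneg X p)]
    exact mul_le_mul (hB p) hp (norm_nonneg _) ((jac_nonneg X p).trans (hB p))
  exact (h.pullback hX).eq_add_integral hT (hjm.smul (hX.toIsBiLip.aestronglyMeasurable_comp hQ))
    (hjm.smul (hX.toIsBiLip.aestronglyMeasurable_comp hS)) hQ0 (hb hQM) (hb hSM) hQ0M

variable {ρ₀ : Plane → ℝ} {u₀ : Plane → Plane} {ρ : ℝ → Plane → ℝ} {u : ℝ → Plane → Plane} {M Mρ M0 Mu : ℝ}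

/-- The density along the flow. -/
theorem SolvesContinuity.along_flow (hT : 0 ≤ T) (hX : IsFlow T C w X Y) (hw : StronglyMeasurable w)
    (hwM : ∀ p, ‖w p‖ ≤ M) (hu : ∀ᵐ p ∂slab T, u p.1 p.2 = w p)
    (hρ : AEStronglyMeasurable (fun p : ℝ × Plane => ρ p.1 p.2) (slab T)) (hρM : ∀ᵐ p ∂slab T, ‖ρ p.1 p.2‖ ≤ Mρ)
    (hρ0 : AEStronglyMeasurable ρ₀ volume) (hρ0M : ∀ᵐ x, ‖ρ₀ x‖ ≤ M0)
    (h : SolvesContinuity T ρ₀ ρ u) :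
    ∀ᵐ p ∂slab T, jac X p * ρ p.1 (X p.1 p.2) = ρ₀ p.2 := by
  have h1 : SolvesTransport T w (fun p => ρ p.1 p.2) (fun _ => (0 : ℝ)) ρ₀ := by
    refine SolvesTransport.of_smooth hw.aestronglyMeasurable (ae_of_all _ hwM) hρ hρM
      aestronglyMeasurable_const (MS := 0) (by simp) hρ0 hρ0M fun ψ hψ => ?_
    refine Eq.trans ?_ (h ψ hψ)
    congr 1
    · refine integral_congr_ae ?_
      filter_upwards [hu] with p hp
      rw [hp]; simp [mul_comm]
    · simp [mul_comm]
  have := h1.along_flow hT hX hρ hρM aestronglyMeasurable_const (MS := 0) (by simp) hρ0 hρ0M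
  filter_upwards [this] with p hp
  simpa using hp

variable {ε B : ℝ} {b : Plane → ℝ}

/-- Where there is no vacuum, the momentum equation gives the equation of the velocity along the
flow. -/
theorem SolvesMomentum.along_flow (hT : 0 ≤ T) (hX : IsFlow T C w X Y) (hw : StronglyMeasurable w)
    (hwM : ∀ p, ‖w p‖ ≤ M) (hu : ∀ᵐ p ∂slab T, u p.1 p.2 = w p)
    (hρ : AEStronglyMeasurable (fun p : ℝ × Plane => ρ p.1 p.2) (slab T)) (hρM : ∀ᵐ p ∂slab T, ‖ρ p.1 p.2‖ ≤ Mρ)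
    (hρ0 : AEStronglyMeasurable ρ₀ volume) (hρ0M : ∀ᵐ x, ‖ρ₀ x‖ ≤ M0)
    (hu0 : AEStronglyMeasurable u₀ volume) (hu0M : ∀ᵐ x, ‖u₀ x‖ ≤ Mu)
    (hb : Continuous b) (hbB : ∀ x, ‖b x / ε‖ ≤ B) (hpos : ∀ᵐ x, 0 < ρ₀ x)
    (hc : SolvesContinuity T ρ₀ ρ u) (h : SolvesMomentum T ε b ρ₀ u₀ ρ u) :
    ∀ᵐ p ∂slab T, w (p.1, X p.1 p.2) =
      u₀ p.2 + ∫ s in (0 : ℝ)..p.1, (b (X s p.2) / ε) • perp (w (s, X s p.2)) := by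
  have hM0 : 0 ≤ M := (norm_nonneg _).trans (hwM 0)
  have hB0 : 0 ≤ B := (norm_nonneg _).trans (hbB 0)
  set Q : ℝ × Plane → Plane := fun p => ρ p.1 p.2 • w p with hQ
  set S : ℝ × Plane → Plane := fun p => (b p.2 / ε * ρ p.1 p.2) • perp (w p) with hS
  have hQm : AEStronglyMeasurable Q (slab T) := hρ.smul hw.aestronglyMeasurable
  have hSm : AEStronglyMeasurable S (slab T) :=
    ((((hb.div_const ε).comp continuous_snd).aestronglyMeasurable).mul hρ).smul
      (continuous_perp.comp_stronglyMeasurable hw).aestronglyMeasurable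
  have hQM : ∀ᵐ p ∂slab T, ‖Q p‖ ≤ Mρ * M := by
    filter_upwards [hρM] with p hp
    rw [hQ, norm_smul]
    exact mul_le_mul hp (hwM p) (norm_nonneg _) ((norm_nonneg _).trans hp)
  have hSM : ∀ᵐ p ∂slab T, ‖S p‖ ≤ B * Mρ * M := by
    filter_upwards [hρM] with p hp
    have := (norm_nonneg _).trans hp
    rw [hS, norm_smul, norm_mul, norm_perp]
    gcongr
    exacts [hbB _, hwM p]
  have hQ0m : AEStronglyMeasurable (fun x => ρ₀ x • u₀ x) volume := hρ0.smul hu0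
  have hQ0M : ∀ᵐ x, ‖ρ₀ x • u₀ x‖ ≤ M0 * Mu := by
    filter_upwards [hρ0M, hu0M] with x h1 h2
    rw [norm_smul]
    exact mul_le_mul h1 h2 (norm_nonneg _) ((norm_nonneg _).trans h1)
  have h1 : SolvesTransport T w Q S (fun x => ρ₀ x • u₀ x) := by
    refine SolvesTransport.of_smooth hw.aestronglyMeasurable (ae_of_all _ hwM) hQm hQM hSm hSM hQ0m hQ0M
      fun ψ hψ => ?_
    refine Eq.trans ?_ (h ψ hψ)
    congr 1
    · refine integral_congr_ae ?_
      filter_upwards [hu] with p hp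
      rw [hp, hQ, hS]
      simp only [smul_smul]
      congr 2 <;> ring
    · simp only [smul_smul, mul_comm]
  have h2 := h1.along_flow hT hX hQm hQM hSm hSM hQ0m hQ0M
  have h3 := hc.along_flow hT hX hw hwM hu hρ hρM hρ0 hρ0M
  filter_upwards [h2, h3, slab_ae_of_ae_snd (T := T) (slab_ae_slice h3), slab_ae_of_ae_snd (T := T) hpos,
    slab_ae_mem_Ioo T] with p e1 e2 e3 e4 e5
  have e6 : ∫ s in (0 : ℝ)..p.1, jac X (s, p.2) • S (s, X s p.2) =
      ρ₀ p.2 • ∫ s in (0 : ℝ)..p.1, (b (X s p.2) / ε) • perp (w (s, X s p.2)) := by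
    rw [← intervalIntegral.integral_smul]
    refine intervalIntegral.integral_congr_ae ?_
    rw [ae_restrict_iff' measurableSet_Icc] at e3
    filter_upwards [e3] with s hs hs'
    rw [uIoc_of_le e5.1.le] at hs'
    have := hs ⟨hs'.1.le, hs'.2.trans e5.2.le⟩
    simp only [hS, smul_smul]
    rw [← this]
    congr 1
    ring
  rw [e6, hQ, smul_smul, e2, ← smul_add] at e1
  exact smul_right_injective Plane e4.ne' e1

theorem le_of_ae_le_of_continuous {f g : Plane → ℝ} (hf : Continuous f) (hg : Continuous g) (h : ∀ᵐ x, f x ≤ g x) (x : Plane) :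
    f x ≤ g x := by
  have hd := Measure.dense_of_ae h
  have hcl : IsClosed {x | f x ≤ g x} := isClosed_le hf hg
  have := hcl.closure_eq ▸ hd.closure_eq
  exact (this ▸ mem_univ x : x ∈ {x | f x ≤ g x})

/-- The velocity equation along the flow. The velocity has a Lipschitz representative in time and
space, for which the chain rule holds almost everywhere. -/
theorem SolvesVelocity.along_flow (hT : 0 < T) (hX : IsFlow T C w X Y) (hw : StronglyMeasurable w)
    (hwM : ∀ p, ‖w p‖ ≤ M) (hwL : ∀ t x y, ‖w (t, x) - w (t, y)‖ ≤ 2 * M * ‖x - y‖)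
    (hu : ∀ᵐ p ∂slab T, u p.1 p.2 = w p)
    (hu0 : AEStronglyMeasurable u₀ volume) (hu0M : ∀ᵐ x, ‖u₀ x‖ ≤ Mu)
    (hb : Continuous b) (hbB : ∀ x, ‖b x / ε‖ ≤ B) (h : SolvesVelocity T ε b u₀ u) :
    ∀ᵐ p ∂slab T, w (p.1, X p.1 p.2) =
      u₀ p.2 + ∫ s in (0 : ℝ)..p.1, (b (X s p.2) / ε) • perp (w (s, X s p.2)) := by
  have hM0 : 0 ≤ M := (norm_nonneg _).trans (hwM 0)
  have hB0 : 0 ≤ B := (norm_nonneg _).trans (hbB 0)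
  obtain ⟨G, hGm, hGw, hG⟩ := h
  have hwl : ∀ t, LipschitzWith (2 * M).toNNReal fun y => w (t, y) := fun t => lipschitzWith_of_norm_le (hwL t)
  have hut : ∀ᵐ t ∂volume.restrict (Icc 0 T), u t =ᵐ[volume] fun x => w (t, x) := Measure.ae_ae_of_ae_prod hu
  have hGt : ∀ᵐ t ∂volume.restrict (Icc 0 T), ∀ i,
      G i t =ᵐ[volume] fun x => fderiv ℝ (fun y => w (t, y)) x (basisVec i) := by
    filter_upwards [hGw, hut] with t h1 h2 i
    exact ((h1 i).congr h2 ae_eq_rfl).ae_unique (isWeakDeriv_fderiv (hwl t) _)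
  have hGb : ∀ i, ∀ᵐ p ∂slab T, ‖G i p.1 p.2‖ ≤ 2 * M := fun i => by
    refine slab_ae_norm_le (hGm i) ?_
    filter_upwards [hGt] with t ht
    filter_upwards [ht i] with x hx
    rw [hx]
    refine (norm_fderiv_apply_le (hwl t) _ _).trans ?_
    rw [norm_basisVec, mul_one, Real.coe_toNNReal _ (by positivity)]
  have hM2 : 0 ≤ 2 * M := by positivity
  choose g hgm hgM hgG using fun i => exists_bounded_rep hM2 (hGm i) (hGb i)
  set S : ℝ × Plane → Plane := fun p => (b p.2 / ε) • perp (w p) - ∑ i, (w p i) • g i p with hS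
  have hwi : ∀ i, StronglyMeasurable fun p => w p i := fun i =>
    (EuclideanSpace.proj (𝕜 := ℝ) i : Plane →L[ℝ] ℝ).continuous.comp_stronglyMeasurable hw
  have hSm : StronglyMeasurable S :=
    ((((hb.div_const ε).comp continuous_snd).stronglyMeasurable).smul
      (continuous_perp.comp_stronglyMeasurable hw)).sub
      (Finset.stronglyMeasurable_fun_sum _ fun i _ => (hwi i).smul (hgm i))
  set N := B * M + ∑ i : Fin 2, M * (2 * M) with hN
  have hN0 : 0 ≤ N := by positivity
  have hSM : ∀ p, ‖S p‖ ≤ N := fun p => by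
    refine (norm_sub_le _ _).trans (add_le_add ?_ ((norm_sum_le _ _).trans (Finset.sum_le_sum fun i _ => ?_)))
    · rw [norm_smul, norm_perp]
      exact mul_le_mul (hbB _) (hwM p) (norm_nonneg _) hB0
    · rw [norm_smul]
      exact mul_le_mul ((PiLp.norm_apply_le (w p) i).trans (hwM p)) (hgM i p) (norm_nonneg _) hM0
  have hSx : ∀ x, StronglyMeasurable fun s => S (s, x) := fun x => hSm.comp_measurable measurable_prodMk_right
  have hSi : ∀ x a b, IntervalIntegrable (fun s => S (s, x)) volume a b := fun x a b => by
    rw [intervalIntegrable_iff]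
    exact Measure.integrableOn_of_bounded (M := N) (by simp) (hSx x).aestronglyMeasurable
      (ae_of_all _ fun s => hSM _)
  have hSl : ∀ x t t', ‖(∫ s in (0 : ℝ)..t, S (s, x)) - ∫ s in (0 : ℝ)..t', S (s, x)‖ ≤ N * |t - t'| := fun x t t' => by
    rw [intervalIntegral.integral_interval_sub_left (hSi _ _ _) (hSi _ _ _)]
    exact intervalIntegral.norm_integral_le_of_norm_le_const fun s _ => hSM _
  -- the time derivative of `w` is bounded
  have hQ : SolvesTransport T (fun _ => 0) w S u₀ := by
    refine SolvesTransport.of_smooth aestronglyMeasurable_const (Mw := 0) (by simp) hw.aestronglyMeasurable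
      (ae_of_all _ hwM) hSm.aestronglyMeasurable (ae_of_all _ hSM) hu0 hu0M fun ψ hψ => ?_
    refine Eq.trans ?_ (hG ψ hψ)
    congr 1
    refine integral_congr_ae ?_
    filter_upwards [hu, hgG 0, hgG 1] with p h1 h2 h3
    simp only [hS, Fin.sum_univ_two, h1, h2, h3]
  have hP := hQ.eq_add_integral hT.le hw.aestronglyMeasurable hSm.aestronglyMeasurable hu0 (ae_of_all _ hwM)
    (ae_of_all _ hSM) hu0M
  set A : Set ℝ := {t | ∀ᵐ x, w (t, x) = u₀ x + ∫ s in (0 : ℝ)..t, S (s, x)} with hA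
  have hAae : ∀ᵐ t ∂volume.restrict (Icc 0 T), t ∈ A := Measure.ae_ae_of_ae_prod hP
  -- outside a null set of times `w` is Lipschitz in both variables, and extends
  have hwA : LipschitzOnWith (2 * M + N).toNNReal w (A ×ˢ univ) := by
    refine LipschitzOnWith.of_dist_le_mul fun p hp q hq => ?_
    rw [dist_eq_norm, dist_eq_norm, Real.coe_toNNReal _ (by positivity)]
    have a1 : ‖w (p.1, q.2) - w (q.1, q.2)‖ ≤ N * |p.1 - q.1| := by
      refine le_of_ae_le_of_continuous (f := fun y => ‖w (p.1, y) - w (q.1, y)‖) (g := fun _ => N * |p.1 - q.1|)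
        ((hwl _).continuous.sub (hwl _).continuous).norm continuous_const ?_ q.2
      filter_upwards [hp.1, hq.1] with y h1 h2
      rw [h1, h2, add_sub_add_left_eq_sub]
      exact hSl _ _ _
    refine (norm_sub_le_norm_sub_add_norm_sub _ (w (p.1, q.2)) _).trans ?_
    have n1 : |p.1 - q.1| ≤ ‖p - q‖ := norm_fst_le (p - q)
    have n2 : ‖p.2 - q.2‖ ≤ ‖p - q‖ := norm_snd_le (p - q)
    rw [add_mul]
    exact add_le_add ((hwL _ _ _).trans (by gcongr)) (a1.trans (by gcongr))
  obtain ⟨U, hUl, hUw⟩ := hwA.extend_finite_dimension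
  have hUw' : ∀ᵐ p ∂slab T, U p = w p := by
    filter_upwards [slab_ae_of_ae_fst hAae] with p hp
    exact (hUw ⟨hp, trivial⟩).symm
  have hUP : ∀ᵐ x, ∀ t ∈ Icc 0 T, U (t, x) = u₀ x + ∫ s in (0 : ℝ)..t, S (s, x) := by
    filter_upwards [slab_ae_slice hUw', slab_ae_slice hP] with x h1 h2
    refine Measure.eqOn_Icc_of_ae_eq (μ := volume) hT.ne (f := fun t => U (t, x)) ?_
      (hUl.continuous.comp (Continuous.prodMk_left x)).continuousOn ?_
    · filter_upwards [h1, h2] with t a c using a.trans c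
    · exact (continuous_const.add (lipschitzWith_of_norm_le (hSl x)).continuous).continuousOn
  have hU0 : ∀ᵐ x, U (0, x) = u₀ x := by
    filter_upwards [hUP] with x hx
    rw [hx 0 ⟨le_rfl, hT.le⟩]; simp
  have hUt : ∀ᵐ p ∂slab T, HasDerivAt (fun t => U (t, p.2)) (S p) p.1 := by
    refine ae_slab_hasDerivAt_of_integral (Z := fun t x => U (t, x)) hT.le hUl.continuous hSm
      (fun x => hSi x 0 T) ?_
    filter_upwards [hUP, hU0] with x h1 h2 t ht
    rw [h1 t ht, h2]
  have hUd : ∀ᵐ p ∂slab T, DifferentiableAt ℝ U p := (slab_ac T).ae_le (hUl.ae_differentiableAt (μ := volume))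
  -- the spatial derivatives of `U` are the given weak derivatives
  have hUx : ∀ i, ∀ᵐ p ∂slab T, fderiv ℝ U p (0, basisVec i) = g i p := fun i => by
    have hm : MeasurableSet {p | fderiv ℝ U p (0, basisVec i) = g i p} :=
      (stronglyMeasurable_fderiv_apply U _).measurableSet_eq_fun (hgm i)
    refine (Measure.ae_prod_iff_ae_ae hm).2 ?_
    have b1 : ∀ᵐ t ∂volume.restrict (Icc 0 T), ∀ᵐ x, DifferentiableAt ℝ U (t, x) :=
      Measure.ae_ae_of_ae_prod hUd
    have b2 : ∀ᵐ t ∂volume.restrict (Icc 0 T), ∀ᵐ x, G i t x = g i (t, x) :=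
      Measure.ae_ae_of_ae_prod (hgG i)
    filter_upwards [b1, b2, hGt, hAae] with t h1 h2 h3 h4
    filter_upwards [h1, h2, h3 i] with x k1 k2 k3
    have e1 : (fun y => w (t, y)) = fun y => U (t, y) := by
      ext1 y; exact hUw ⟨h4, trivial⟩
    have e2 : HasFDerivAt (fun y => U (t, y)) ((fderiv ℝ U (t, x)).comp (ContinuousLinearMap.inr ℝ ℝ Plane)) x :=
      HasFDerivAt.comp (f := fun y => (t, y)) x k1.hasFDerivAt (hasFDerivAt_prodMk_right t x)
    rw [← k2, k3, e1, e2.fderiv]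
    simp
  -- chain rule, at the image under the flow of a point of differentiability
  have hfin : ∀ᵐ p ∂slab T, HasDerivAt (fun t => U (t, X t p.2))
      ((b (X p.1 p.2) / ε) • perp (w (p.1, X p.1 p.2))) p.1 := by
    have hall := hUt.and (hUd.and ((hUx 0).and (hUx 1)))
    filter_upwards [hX.toIsBiLip.ae_comp hall, hX.deriv] with p ⟨h1, h2, h3, h4⟩ h5
    have e1 := hasDerivAt_comp_spacetime h2 h5
    have e2 : fderiv ℝ U (p.1, X p.1 p.2) (1, 0) = S (p.1, X p.1 p.2) :=
      (hasDerivAt_comp_spacetime (z := fun _ => X p.1 p.2) h2 (hasDerivAt_const _ _)).unique h1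
    have e3 : fderiv ℝ U (p.1, X p.1 p.2) (1, w (p.1, X p.1 p.2)) =
        (b (X p.1 p.2) / ε) • perp (w (p.1, X p.1 p.2)) := by
      rw [spacetime_decomp, map_add, map_add, map_smul, map_smul, e2, h3, h4]
      simp [hS, Fin.sum_univ_two]
    rwa [e3] at e1
  have hconc : ∀ᵐ x, ∀ t ∈ Icc 0 T, U (t, X t x) =
      u₀ x + ∫ s in (0 : ℝ)..t, (b (X s x) / ε) • perp (w (s, X s x)) := by
    filter_upwards [slab_ae_slice hfin, hU0] with x h1 h2 t ht
    have hXx : LipschitzWith C fun t => X t x := lipschitz_time hX.lipX x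
    have hl := hUl.comp (LipschitzWith.id.prodMk hXx)
    have := (sub_eq_integral_of_ae_hasDerivAt (M := B * M) ht.1 (hl.lipschitzOnWith (s := Icc 0 t))
      (g := fun s => (b (X s x) / ε) • perp (w (s, X s x))) ?_ ?_ ?_).2
    · simp only [Function.comp, id] at this
      rw [← this, hX.zero, h2]; abel
    · have c1 : Continuous fun s => b (X s x) / ε := (hb.comp hXx.continuous).div_const _
      have c2 : StronglyMeasurable fun s => w (s, X s x) :=
        hw.comp_measurable (measurable_id.prodMk hXx.continuous.measurable)
      exact (c1.stronglyMeasurable.smul (continuous_perp.comp_stronglyMeasurable c2)).aestronglyMeasurable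
    · refine ae_of_all _ fun s => ?_
      rw [norm_smul, norm_perp]
      exact mul_le_mul (hbB _) (hwM _) (norm_nonneg _) hB0
    · exact ae_restrict_of_ae_restrict_of_subset (Icc_subset_Icc le_rfl ht.2) h1
  filter_upwards [slab_ae_of_ae_snd (T := T) hconc, hX.toIsBiLip.ae_comp hUw', slab_ae_mem_Ioo T] with p h1 h2 h3
  rw [← h2, h1 p.1 (Ioo_subset_Icc_self h3)]

end Lagrangian

/-! ### Uniqueness -/

section Uniqueness

/-- The maps `X` are the trajectories of the field `w` on `[0,T]`, and along almost every one of
them the velocity solves `W' = β(X) W^⊥` with initial value `u₀`. -/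
structure IsLagrangian (T : ℝ) (β : Plane → ℝ) (u₀ : Plane → Plane) (w : ℝ × Plane → Plane)
    (X : ℝ → Plane → Plane) : Prop where
  meas : StronglyMeasurable w
  bdd : ∃ M, ∀ p, ‖w p‖ ≤ M
  cont : ∀ x, Continuous fun t => X t x
  position : ∀ x, ∀ t ∈ Icc 0 T, X t x = x + ∫ s in (0 : ℝ)..t, w (s, X s x)
  velocity : ∀ᵐ p ∂slab T, w (p.1, X p.1 p.2) =
    u₀ p.2 + ∫ s in (0 : ℝ)..p.1, β (X s p.2) • perp (w (s, X s p.2))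

variable {T : ℝ} {β : Plane → ℝ} {u₀ : Plane → Plane} {w w' : ℝ × Plane → Plane} {X X' : ℝ → Plane → Plane} 

/-- Almost every trajectory has a continuous velocity, which solves the equations of motion at all
times. -/
theorem IsLagrangian.exists_curve (h : IsLagrangian T β u₀ w X) (hβ : Continuous β) {B : ℝ} (hB : ∀ x, ‖β x‖ ≤ B) :
    ∀ᵐ x, ∃ W : ℝ → Plane, Continuous W ∧ (∀ᵐ t ∂volume.restrict (Icc 0 T), w (t, X t x) = W t) ∧
      ∀ t ∈ Icc 0 T, X t x = x + ∫ s in (0 : ℝ)..t, W s ∧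
        W t = u₀ x + ∫ s in (0 : ℝ)..t, β (X s x) • perp (W s) := by
  obtain ⟨M, hM⟩ := h.bdd
  filter_upwards [slab_ae_slice h.velocity] with x hx
  have hB0 : 0 ≤ B := (norm_nonneg _).trans (hB 0)
  have hm : StronglyMeasurable fun s => β (X s x) • perp (w (s, X s x)) :=
    (hβ.comp (h.cont x)).stronglyMeasurable.smul (continuous_perp.comp_stronglyMeasurable
      (h.meas.comp_measurable (measurable_id.prodMk (h.cont x).measurable)))
  have hb : ∀ s, ‖β (X s x) • perp (w (s, X s x))‖ ≤ B * M := fun s => by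
    rw [norm_smul, norm_perp]
    exact mul_le_mul (hB _) (hM _) (norm_nonneg _) hB0
  have hi : ∀ a b, IntervalIntegrable (fun s => β (X s x) • perp (w (s, X s x))) volume a b := fun a b => by
    rw [intervalIntegrable_iff]
    exact Measure.integrableOn_of_bounded (M := B * M) (by simp) hm.aestronglyMeasurable (ae_of_all _ hb)
  have hcong : ∀ t ∈ Icc 0 T, ∀ᵐ s, s ∈ uIoc 0 t → w (s, X s x) =
      u₀ x + ∫ r in (0 : ℝ)..s, β (X r x) • perp (w (r, X r x)) := fun t ht => by
    rw [ae_restrict_iff' measurableSet_Icc] at hx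
    filter_upwards [hx] with s hs hs'
    rw [uIoc_of_le ht.1] at hs'
    exact hs ⟨hs'.1.le, hs'.2.trans ht.2⟩
  refine ⟨fun t => u₀ x + ∫ s in (0 : ℝ)..t, β (X s x) • perp (w (s, X s x)),
    continuous_const.add (intervalIntegral.continuous_primitive hi 0), hx, fun t ht => ⟨?_, ?_⟩⟩
  · rw [h.position x t ht]
    congr 1
    refine intervalIntegral.integral_congr_ae ?_
    filter_upwards [hcong t ht] with s hs hs' using hs hs'
  · refine congrArg (u₀ x + ·) (intervalIntegral.integral_congr_ae ?_)
    filter_upwards [hcong t ht] with s hs hs'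
    exact congrArg (fun v => β (X s x) • perp v) (hs hs')

/-- A field is determined by the equation of its velocity along its own trajectories. -/
theorem IsLagrangian.ae_unique (hT : 0 < T) (h : IsLagrangian T β u₀ w X) (h' : IsLagrangian T β u₀ w' X')
    {B L : ℝ} (hB : ∀ x, ‖β x‖ ≤ B) (hL0 : 0 ≤ L) (hL : ∀ x y, ‖β x - β y‖ ≤ L * ‖x - y‖) :
    ∀ᵐ x, (∀ t ∈ Icc 0 T, X t x = X' t x) ∧ ∀ᵐ t ∂volume.restrict (Icc 0 T), w (t, X t x) = w' (t, X' t x) := by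
  have hβ : Continuous β := (lipschitzWith_of_norm_le hL).continuous
  have hB0 : 0 ≤ B := (norm_nonneg _).trans (hB 0)
  filter_upwards [h.exists_curve hβ hB, h'.exists_curve hβ hB] with x ⟨W, hWc, hWw, hW⟩ ⟨W', hWc', hWw', hW'⟩
  have hXc := h.cont x
  have hXc' := h'.cont x
  have hpc : ∀ {V : ℝ → Plane}, Continuous V → Continuous fun s => perp (V s) := fun hV => continuous_perp.comp hV
  have g1 : Continuous fun s => β (X s x) • perp (W s) := (hβ.comp hXc).smul (hpc hWc)
  have g2 : Continuous fun s => β (X' s x) • perp (W' s) := (hβ.comp hXc').smul (hpc hWc')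
  obtain ⟨N, hN⟩ := isCompact_Icc.exists_bound_of_continuousOn (hWc.continuousOn (s := Icc 0 T))
  have hN0 : 0 ≤ N := (norm_nonneg _).trans (hN 0 ⟨le_rfl, hT.le⟩)
  let g : ℝ → Plane × Plane := fun s => (W s - W' s, β (X s x) • perp (W s) - β (X' s x) • perp (W' s))
  have hgc : Continuous g := (hWc.sub hWc').prodMk (g1.sub g2)
  have key := norm_le_of_eq_add_integral (y := fun t => (X t x - X' t x, W t - W' t)) (g := g) (c := 0)
    (K := 1 + L * N + B) (δ := 0) (T := T) (by positivity) le_rfl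
    ((hXc.sub hXc').prodMk (hWc.sub hWc')).continuousOn (fun t ht => ?_) (fun s hs => ?_)
  · have hz : ∀ t ∈ Icc 0 T, X t x = X' t x ∧ W t = W' t := fun t ht => by
      have := key t ht
      rw [norm_zero, zero_mul, add_zero, mul_zero, zero_mul] at this
      have := norm_le_zero_iff.1 this
      rw [Prod.mk_eq_zero] at this
      exact ⟨sub_eq_zero.1 this.1, sub_eq_zero.1 this.2⟩
    refine ⟨fun t ht => (hz t ht).1, ?_⟩
    filter_upwards [hWw, hWw', ae_restrict_mem measurableSet_Icc] with t h1 h2 h3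
    rw [h1, h2, (hz t h3).2]
  · have hgi := hgc.intervalIntegrable (μ := volume) 0 t
    have e1 := (ContinuousLinearMap.fst ℝ Plane Plane).intervalIntegral_comp_comm hgi
    have e2 := (ContinuousLinearMap.snd ℝ Plane Plane).intervalIntegral_comp_comm hgi
    rw [zero_add]
    ext1
    · refine Eq.trans ?_ e1
      rw [(hW t ht).1, (hW' t ht).1, add_sub_add_left_eq_sub, ← intervalIntegral.integral_sub
        (hWc.intervalIntegrable _ _) (hWc'.intervalIntegrable _ _)]
      rfl
    · refine Eq.trans ?_ e2
      rw [(hW t ht).2, (hW' t ht).2, add_sub_add_left_eq_sub, ← intervalIntegral.integral_sub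
        (g1.intervalIntegrable _ _) (g2.intervalIntegrable _ _)]
      rfl
  · have n1 : ‖X s x - X' s x‖ ≤ ‖(X s x - X' s x, W s - W' s)‖ := norm_fst_le (X s x - X' s x, W s - W' s)
    have n2 : ‖W s - W' s‖ ≤ ‖(X s x - X' s x, W s - W' s)‖ := norm_snd_le (X s x - X' s x, W s - W' s)
    set n := ‖(X s x - X' s x, W s - W' s)‖
    have hn : 0 ≤ n := norm_nonneg _
    rw [add_zero]
    refine max_le (n2.trans ?_) ?_
    · have : 0 ≤ (L * N + B) * n := by positivity
      linarith
    · have e : β (X s x) • perp (W s) - β (X' s x) • perp (W' s) =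
          (β (X s x) - β (X' s x)) • perp (W s) + β (X' s x) • perp (W s - W' s) := by
        rw [perp_sub]; module
      refine (congrArg norm e).le.trans ((norm_add_le _ _).trans ?_)
      rw [norm_smul, norm_smul, norm_perp, norm_perp]
      have a1 : ‖β (X s x) - β (X' s x)‖ * ‖W s‖ ≤ (L * n) * N := by
        gcongr
        exacts [(hL _ _).trans (by gcongr), hN s hs]
      have a2 : ‖β (X' s x)‖ * ‖W s - W' s‖ ≤ B * n := by gcongr; exact hB _
      linarith

theorem LinftyWBound.ae_norm_le {F : Type} [NormedAddCommGroup F] [NormedSpace ℝ F] {s M : ℝ} {f : ℝ → Plane → F}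
    (h : LinftyWBound T s M f) : ∀ᵐ p ∂slab T, ‖f p.1 p.2‖ ≤ M := by
  refine slab_ae_norm_le h.1 ?_
  filter_upwards [h.2] with t ht using ht.ae_norm_le

variable {s ε : ℝ} {b : Plane → ℝ} {ρ₀ : Plane → ℝ} {M0 Mu B L : ℝ}

/-- Every solution is transported by the flow of a Lipschitz field. -/
theorem exists_isLagrangian (hT : 0 < T) (hs : 1 ≤ s) (hb : Continuous b) (hB : ∀ x, ‖b x / ε‖ ≤ B)
    (hρ0 : AEStronglyMeasurable ρ₀ volume) (hρ0M : ∀ᵐ x, ‖ρ₀ x‖ ≤ M0)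
    (hu0 : AEStronglyMeasurable u₀ volume) (hu0M : ∀ᵐ x, ‖u₀ x‖ ≤ Mu)
    {ρ : ℝ → Plane → ℝ} {u : ℝ → Plane → Plane}
    (hρ : MemLinftyW T (s - 1) ρ) (hu : MemLinftyW T s u) (hc : SolvesContinuity T ρ₀ ρ u)
    (hv : SolvesVelocity T ε b u₀ u ∨ ((∀ᵐ x, 0 < ρ₀ x) ∧ SolvesMomentum T ε b ρ₀ u₀ ρ u)) :
    ∃ (C : ℝ≥0) (w : ℝ × Plane → Plane) (X Y : ℝ → Plane → Plane), IsFlow T C w X Y ∧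
      IsLagrangian T (fun x => b x / ε) u₀ w X ∧ (∀ᵐ p ∂slab T, u p.1 p.2 = w p) ∧
      ∀ᵐ p ∂slab T, jac X p * ρ p.1 (X p.1 p.2) = ρ₀ p.2 := by
  obtain ⟨M, w, hM0, hw, hwM, hwL, huw⟩ := hu.exists_lipschitz_slices hs
  obtain ⟨Mρ, hρM⟩ := hρ
  obtain ⟨C, X, Y, hX, hXi⟩ := exists_isFlow hT.le (by positivity) hw hwM hwL
  refine ⟨C, w, X, Y, hX, ⟨hw, ⟨M, hwM⟩, fun x => (lipschitz_time hX.lipX x).continuous, hXi, ?_⟩, huw,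
    hc.along_flow hT.le hX hw hwM huw hρM.1 hρM.ae_norm_le hρ0 hρ0M⟩
  rcases hv with hv | ⟨hpos, hm⟩
  · exact hv.along_flow hT hX hw hwM hwL huw hu0 hu0M hb hB
  · exact hm.along_flow hT.le hX hw hwM huw hρM.1 hρM.ae_norm_le hρ0 hρ0M hu0 hu0M hb hB hpos hc

/-- Uniqueness of the solution of the continuity equation and the velocity equation, or of the
momentum equation where there is no vacuum. -/
theorem eqOnSlab_of_solves (hT : 0 < T) (hs : 1 ≤ s) (hB : ∀ x, ‖b x / ε‖ ≤ B) (hL0 : 0 ≤ L)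
    (hL : ∀ x y, ‖b x / ε - b y / ε‖ ≤ L * ‖x - y‖) (hb : Continuous b)
    (hρ0 : AEStronglyMeasurable ρ₀ volume) (hρ0M : ∀ᵐ x, ‖ρ₀ x‖ ≤ M0)
    (hu0 : AEStronglyMeasurable u₀ volume) (hu0M : ∀ᵐ x, ‖u₀ x‖ ≤ Mu)
    {ρ ρ' : ℝ → Plane → ℝ} {u u' : ℝ → Plane → Plane}
    (hρ : MemLinftyW T (s - 1) ρ) (hu : MemLinftyW T s u) (hc : SolvesContinuity T ρ₀ ρ u)
    (hv : SolvesVelocity T ε b u₀ u ∨ ((∀ᵐ x, 0 < ρ₀ x) ∧ SolvesMomentum T ε b ρ₀ u₀ ρ u))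
    (hρ' : MemLinftyW T (s - 1) ρ') (hu' : MemLinftyW T s u') (hc' : SolvesContinuity T ρ₀ ρ' u')
    (hv' : SolvesVelocity T ε b u₀ u' ∨ ((∀ᵐ x, 0 < ρ₀ x) ∧ SolvesMomentum T ε b ρ₀ u₀ ρ' u')) :
    EqOnSlab T ρ ρ' ∧ EqOnSlab T u u' := by
  obtain ⟨C, w, X, Y, hX, hl, huw, hρX⟩ := exists_isLagrangian hT hs hb hB hρ0 hρ0M hu0 hu0M hρ hu hc hv
  obtain ⟨C', w', X', Y', hX', hl', huw', hρX'⟩ :=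
    exists_isLagrangian hT hs hb hB hρ0 hρ0M hu0 hu0M hρ' hu' hc' hv'
  have huniq := hl.ae_unique hT hl' hB hL0 hL
  have hXX : ∀ t ∈ Icc 0 T, X t = X' t := fun t ht => by
    refine ((lipschitz_slice hX.lipX t).continuous.ae_eq_iff_eq volume (lipschitz_slice hX'.lipX t).continuous).1 ?_
    filter_upwards [huniq] with x hx using hx.1 t ht
  -- statements along the flow hold almost everywhere on the slab
  have hback : ∀ {P : ℝ × Plane → Prop}, (∀ᵐ p ∂slab T, P (p.1, X p.1 p.2)) → ∀ᵐ p ∂slab T, P p := fun hP => by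
    filter_upwards [hX.toIsBiLip.symm.ae_comp hP] with p hp
    simpa [hX.right_inv] using hp
  constructor
  · refine hback (P := fun p => ρ p.1 p.2 = ρ' p.1 p.2) ?_
    filter_upwards [hρX, hρX', hX.toIsBiLip.ae_jac_pos T, slab_ae_mem_Ioo T] with p h1 h2 h3 h4
    have e : X p.1 = X' p.1 := hXX _ (Ioo_subset_Icc_self h4)
    have e' : jac X p = jac X' p := by rw [jac, jac, e]
    rw [← h1, ← e', ← e] at h2
    exact (mul_left_cancel₀ h3.ne' h2).symm
  · have hww : ∀ᵐ p ∂slab T, w p = w' p := by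
      refine hback ?_
      have hm : MeasurableSet {p : ℝ × Plane | w (p.1, X p.1 p.2) = w' (p.1, X p.1 p.2)} :=
        (hl.meas.measurableSet_eq_fun hl'.meas).preimage (measurable_fst.prodMk hX.lipX.continuous.measurable)
      refine slab_ae_of_slice hm ?_
      filter_upwards [huniq] with x hx
      filter_upwards [hx.2, ae_restrict_mem measurableSet_Icc] with t h1 h2
      rw [h1, hXX t h2]
    filter_upwards [hww, huw, huw'] with p h1 h2 h3
    rw [h2, h3, h1]

end Uniqueness

/-! ### Rotations -/

section Rotation

/-- The rotation of angle `-θ`; `rot θ v` solves `W' = W^⊥`, `W(0) = v`. -/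
noncomputable def rot (θ : ℝ) : Plane →L[ℝ] Plane :=
  Real.cos θ • ContinuousLinearMap.id ℝ Plane + Real.sin θ • perpCLM

theorem rot_apply (θ : ℝ) (v : Plane) : rot θ v = Real.cos θ • v + Real.sin θ • perp v := by
  simp [rot, perpCLM_apply]

theorem rot_zero (v : Plane) : rot 0 v = v := by simp [rot_apply]

theorem perp_perp (v : Plane) : perp (perp v) = -v := by
  ext i; fin_cases i <;> simp [perp]

theorem norm_rot (θ : ℝ) (v : Plane) : ‖rot θ v‖ = ‖v‖ := by
  rw [rot_apply, EuclideanSpace.norm_eq, EuclideanSpace.norm_eq]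
  congr 1
  simp only [Fin.sum_univ_two, perp, PiLp.add_apply, PiLp.smul_apply, smul_eq_mul, Real.norm_eq_abs, sq_abs]
  simp
  linear_combination (v 0 ^ 2 + v 1 ^ 2) * Real.sin_sq_add_cos_sq θ

theorem perp_rot (θ : ℝ) (v : Plane) : perp (rot θ v) = rot θ (perp v) := by
  simp only [← perpCLM_apply, rot]
  simp

theorem hasDerivAt_rot {θ : ℝ → ℝ} {v : ℝ → Plane} {θ' t : ℝ} {v' : Plane} (hθ : HasDerivAt θ θ' t)
    (hv : HasDerivAt v v' t) :
    HasDerivAt (fun s => rot (θ s) (v s)) (θ' • perp (rot (θ t) (v t)) + rot (θ t) v') t := by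
  have h1 := (hθ.cos.smul hv).add (hθ.sin.smul (perpCLM.hasFDerivAt.comp_hasDerivAt t hv))
  have e : (fun s => rot (θ s) (v s)) = fun s => Real.cos (θ s) • v s + Real.sin (θ s) • perpCLM (v s) := by
    ext1 s; rw [rot_apply, perpCLM_apply]
  rw [e]
  refine h1.congr_deriv ?_
  have pp : perpCLM (perpCLM (v t)) = -v t := perp_perp _
  simp only [rot_apply, ← perpCLM_apply, map_add, map_smul, Function.comp, pp]
  module

theorem continuous_rot : Continuous fun p : ℝ × Plane => rot p.1 p.2 := by
  simp only [rot_apply]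
  have := continuous_perp
  fun_prop

theorem norm_rot_sub_le (θ θ' : ℝ) (v : Plane) : ‖rot θ v - rot θ' v‖ ≤ ‖v‖ * |θ - θ'| := by
  have := convex_univ.norm_image_sub_le_of_norm_hasDerivWithin_le (f := fun s => rot s v)
    (f' := fun s => (1 : ℝ) • perp (rot s v) + rot s 0) (C := ‖v‖)
    (fun s _ => (hasDerivAt_rot (hasDerivAt_id s) (hasDerivAt_const s v)).hasDerivWithinAt)
    (fun s _ => by simp [norm_perp, norm_rot]) (mem_univ θ') (mem_univ θ)
  simpa using this

end Rotation

/-! ### Differentiable solutions of differential equations -/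

section Curves

/-- The solution of an ordinary differential equation with a continuous field, Lipschitz in space,
for nonnegative times. -/
theorem exists_hasDerivAt_curve {E : Type} [NormedAddCommGroup E] [NormedSpace ℝ E] [FiniteDimensional ℝ E]
    {f : ℝ → E → E} {K C : ℝ} (hK : 0 ≤ K) (hf : Continuous fun p : ℝ × E => f p.1 p.2)
    (hlip : ∀ t x y, ‖f t x - f t y‖ ≤ K * ‖x - y‖) (hbd : ∀ t, ‖f t 0‖ ≤ C) (z0 : E) :
    ∃ z : ℝ → E, Continuous z ∧ z 0 = z0 ∧ ∀ t, 0 ≤ t → HasDerivAt z (f t (z t)) t := by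
  have : CompleteSpace E := FiniteDimensional.complete ℝ E
  have hc : ∀ z : ℝ → E, Continuous z → Continuous fun t => f t (z t) := fun z hz =>
    hf.comp (continuous_id.prodMk hz)
  obtain ⟨z, hz, hzi⟩ := exists_integral_curve hK (fun z hz => (hc z hz).aestronglyMeasurable) hlip hbd z0
  have hd : ∀ t, HasDerivAt (fun t => z0 + ∫ s in (0 : ℝ)..t, f s (z s)) (f t (z t)) t := fun t =>
    (((hc z hz).integral_hasStrictDerivAt 0 t).hasDerivAt).const_add z0
  refine ⟨fun t => z0 + ∫ s in (0 : ℝ)..t, f s (z s), continuous_iff_continuousAt.2 fun t => (hd t).continuousAt,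
    by simp, fun t ht => ?_⟩
  exact (hd t).congr_deriv (congrArg (f t) (hzi t ht))

theorem integral_eq_sub_of_nonneg {E : Type} [NormedAddCommGroup E] [NormedSpace ℝ E] [CompleteSpace E]
    {z g : ℝ → E} (hg : Continuous g) (hz : ∀ t, 0 ≤ t → HasDerivAt z (g t) t) {a c : ℝ} (ha : 0 ≤ a) (hc : 0 ≤ c) :
    ∫ s in a..c, g s = z c - z a :=
  intervalIntegral.integral_eq_sub_of_hasDerivAt
    (fun s hs => hz s ((le_min ha hc).trans hs.1)) (hg.intervalIntegrable _ _)

theorem norm_sub_le_of_deriv_bound {E : Type} [NormedAddCommGroup E] [NormedSpace ℝ E]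
    {z g : ℝ → E} {N S : ℝ} (hz : ∀ t, 0 ≤ t → HasDerivAt z (g t) t) (hN : ∀ t ∈ Icc 0 S, ‖g t‖ ≤ N) :
    ∀ t ∈ Icc 0 S, ‖z t - z 0‖ ≤ N * t := fun t ht => by
  have := norm_image_sub_le_of_norm_deriv_le_segment' (f := z) (f' := g) (C := N) (a := 0) (b := S)
    (fun s hs => (hz s hs.1).hasDerivWithinAt) (fun s hs => hN s (Ico_subset_Icc_self hs)) t ht
  simpa using this

end Curves

/-! ### Trajectories parametrised by the angle of the velocity -/

section GuidingCentre

/-- Bounds on the field `b` and on the velocity `v`: `b` lies between `m > 0` and `B` and is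
differentiable, `L` is a Lipschitz constant of `b`, of `1/b` and of `b⁻³ ∇b`, the last of which is
bounded by `H` and governs the derivative of `1/b` along a phase curve, `Λ` is a Lipschitz constant of `log b`, and `v` is bounded by `U` with Lipschitz constant `K`. -/
structure FieldBounds (b : Plane → ℝ) (v : Plane → Plane) (m B L H Λ U K : ℝ) : Prop where
  m_pos : 0 < m
  H_nonneg : 0 ≤ H
  L_nonneg : 0 ≤ L
  Λ_nonneg : 0 ≤ Λ
  K_nonneg : 0 ≤ K
  lower : ∀ x, m ≤ b x
  upper : ∀ x, b x ≤ B
  diff : Differentiable ℝ b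
  lip : ∀ x y, |b x - b y| ≤ L * ‖x - y‖
  lip_inv : ∀ x y, |(b x)⁻¹ - (b y)⁻¹| ≤ L * ‖x - y‖
  grad_le : ∀ x, ‖((b x)⁻¹ ^ 3) • fderiv ℝ b x‖ ≤ H
  grad_lip : ∀ x y, ‖((b x)⁻¹ ^ 3) • fderiv ℝ b x - ((b y)⁻¹ ^ 3) • fderiv ℝ b y‖ ≤ L * ‖x - y‖
  log_lip : ∀ x y, |Real.log (b x) - Real.log (b y)| ≤ Λ * ‖x - y‖
  v_le : ∀ x, ‖v x‖ ≤ U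
  v_lip : ∀ x y, ‖v x - v y‖ ≤ K * ‖x - y‖

variable {b : Plane → ℝ} {v : Plane → Plane} {m B L H Λ U K : ℝ}

namespace FieldBounds

theorem pos (h : FieldBounds b v m B L H Λ U K) (x : Plane) : 0 < b x := h.m_pos.trans_le (h.lower x)

theorem U_nonneg (h : FieldBounds b v m B L H Λ U K) : 0 ≤ U := (norm_nonneg _).trans (h.v_le 0)

theorem B_pos (h : FieldBounds b v m B L H Λ U K) : 0 < B := (h.pos 0).trans_le (h.upper 0)

theorem inv_le (h : FieldBounds b v m B L H Λ U K) (x : Plane) : (b x)⁻¹ ≤ m⁻¹ :=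
  inv_anti₀ h.m_pos (h.lower x)

theorem inv_pos (h : FieldBounds b v m B L H Λ U K) (x : Plane) : 0 < (b x)⁻¹ := _root_.inv_pos.2 (h.pos x)

theorem continuous (h : FieldBounds b v m B L H Λ U K) : Continuous b := h.diff.continuous

theorem continuous_inv (h : FieldBounds b v m B L H Λ U K) : Continuous fun x => (b x)⁻¹ :=
  h.continuous.inv₀ fun x => (h.pos x).ne'

/-- The trajectory of a particle with initial velocity `a`, parametrised by the angle `τ` of the
velocity. As the angle turns at the rate `b/ε`, the equation is `dz/dτ = (ε/b(z)) rot τ a`. -/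
def _root_.IsPhaseCurve (b : Plane → ℝ) (ε : ℝ) (a : Plane) (z : ℝ → Plane) : Prop :=
  Continuous z ∧ ∀ τ, 0 ≤ τ → HasDerivAt z ((ε * (b (z τ))⁻¹) • rot τ a) τ

theorem exists_phaseCurve (h : FieldBounds b v m B L H Λ U K) {ε : ℝ} (hε : 0 < ε) (x a : Plane) :
    ∃ z, z 0 = x ∧ IsPhaseCurve b ε a z := by
  have hc : Continuous fun p : ℝ × Plane => (ε * (b p.2)⁻¹) • rot p.1 a :=
    (continuous_const.mul (h.continuous_inv.comp continuous_snd)).smul (continuous_rot.comp (continuous_fst.prodMk continuous_const))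
  have hl : ∀ τ p q, ‖(ε * (b p)⁻¹) • rot τ a - (ε * (b q)⁻¹) • rot τ a‖ ≤ ε * L * ‖a‖ * ‖p - q‖ := fun τ p q => by
    rw [← sub_smul, ← mul_sub, norm_smul, norm_rot, norm_mul, Real.norm_of_nonneg hε.le]
    have := h.lip_inv p q
    calc ε * |(b p)⁻¹ - (b q)⁻¹| * ‖a‖ ≤ ε * (L * ‖p - q‖) * ‖a‖ := by gcongr
      _ = _ := by ring
  have h0 : ∀ τ, ‖(ε * (b 0)⁻¹) • rot τ a‖ ≤ ε * (b 0)⁻¹ * ‖a‖ := fun τ => by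
    rw [norm_smul, norm_rot, Real.norm_of_nonneg (by have := (h.inv_pos 0).le; positivity)]
  obtain ⟨z, h1, h2, h3⟩ := exists_hasDerivAt_curve (by have := h.L_nonneg; positivity) hc hl h0 x
  exact ⟨z, h2, h1, h3⟩

/-- The derivative of `1/b` along a phase curve is of order `ε`. -/
theorem hasDerivAt_inv_field (h : FieldBounds b v m B L H Λ U K) {ε τ : ℝ} {a : Plane} {z : ℝ → Plane} (hz : IsPhaseCurve b ε a z) (hτ : 0 ≤ τ) :
    HasDerivAt (fun s => (b (z s))⁻¹) (-(ε * (((b (z τ))⁻¹ ^ 3) • fderiv ℝ b (z τ)) (rot τ a))) τ := by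
  have h1 := (h.diff (z τ)).hasFDerivAt.comp_hasDerivAt τ (hz.2 τ hτ)
  have h2 := h1.inv (h.pos _).ne'
  refine h2.congr_deriv ?_
  simp only [map_smul, smul_apply, smul_eq_mul, Function.comp]
  have := (h.pos (z τ)).ne'
  field_simp

/-- At equal angles of the velocity, the distance between two trajectories varies by `O(ε)` relative
to the initial distance. The drift is computed by integrating the fast rotation by parts. -/
theorem phaseCurve_sub_le (h : FieldBounds b v m B L H Λ U K) {T : ℝ} (hT : 0 < T) :
    ∃ C : ℝ, 0 ≤ C ∧ ∀ ε : ℝ, 0 < ε → C * ε ≤ 1 → ∀ x y : Plane, ∀ z₁ z₂ : ℝ → Plane,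
      z₁ 0 = x → z₂ 0 = y → IsPhaseCurve b ε (v x) z₁ → IsPhaseCurve b ε (v y) z₂ →
      ∀ τ ∈ Icc 0 (T * B / ε), ‖z₂ τ - z₁ τ - (y - x)‖ ≤ C * ε * ‖y - x‖ := by
  have hm := h.m_pos; have hL := h.L_nonneg; have hH := h.H_nonneg; have hU := h.U_nonneg
  have hK := h.K_nonneg; have hB := h.B_pos
  set C₁ := K * m⁻¹ + U * L with hC₁
  set C₂ := L * U ^ 2 + 2 * H * U * K with hC₂
  have hC₁0 : 0 ≤ C₁ := by positivity
  have hC₂0 : 0 ≤ C₂ := by positivity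
  -- `C₁` bounds the two boundary terms, `C₂` the remaining integral over angles up to `T B / ε`
  set A := 2 * C₁ + C₂ * (T * B) with hA
  have hA0 : 0 ≤ A := by positivity
  refine ⟨4 * A, by positivity, fun ε hε hεA x y z₁ z₂ hx hy h₁ h₂ => ?_⟩
  set S := T * B / ε with hS
  have hS0 : 0 ≤ S := by positivity
  set D : ℝ → Plane := fun τ => z₂ τ - z₁ τ with hD
  have hDc : Continuous D := h₂.1.sub h₁.1
  obtain ⟨τm, hτm, hmax⟩ := (isCompact_Icc (a := (0 : ℝ)) (b := S)).exists_isMaxOn ⟨0, le_rfl, hS0⟩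
    hDc.norm.continuousOn
  set N := ‖D τm‖ with hN
  have hDN : ∀ τ ∈ Icc 0 S, ‖D τ‖ ≤ N := fun τ hτ => hmax hτ
  set δ := ‖y - x‖ with hδ
  have hD0 : D 0 = y - x := by simp [hD, hx, hy]
  set g : ℝ → Plane := fun τ => (b (z₂ τ))⁻¹ • v y - (b (z₁ τ))⁻¹ • v x with hg
  have hg_le : ∀ τ ∈ Icc 0 S, ‖g τ‖ ≤ C₁ * (δ + N) := fun τ hτ => by
    have e : g τ = (b (z₂ τ))⁻¹ • (v y - v x) + ((b (z₂ τ))⁻¹ - (b (z₁ τ))⁻¹) • v x := by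
      simp only [hg]; module
    rw [e]
    refine (norm_add_le _ _).trans ?_
    rw [norm_smul, norm_smul, Real.norm_of_nonneg (h.inv_pos _).le]
    have a1 : (b (z₂ τ))⁻¹ * ‖v y - v x‖ ≤ m⁻¹ * (K * δ) := by gcongr; exacts [h.lower _, h.v_lip y x]
    have a2 : ‖(b (z₂ τ))⁻¹ - (b (z₁ τ))⁻¹‖ * ‖v x‖ ≤ (L * N) * U := by
      gcongr
      exacts [(h.lip_inv _ _).trans (by gcongr; exact hDN τ hτ), h.v_le x]
    have hδ0 : 0 ≤ δ := norm_nonneg _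
    have hN0 : 0 ≤ N := norm_nonneg _
    have : 0 ≤ K * m⁻¹ * N + U * L * δ := by positivity
    rw [hC₁]; linarith
  -- the derivative of the corrected difference
  set Q : ℝ → (Plane →L[ℝ] ℝ) := fun τ => ((b (z₁ τ))⁻¹ ^ 3) • fderiv ℝ b (z₁ τ) with hQ
  set Q' : ℝ → (Plane →L[ℝ] ℝ) := fun τ => ((b (z₂ τ))⁻¹ ^ 3) • fderiv ℝ b (z₂ τ) with hQ'
  set g' : ℝ → Plane := fun τ => (-(ε * Q' τ (rot τ (v y)))) • v y - (-(ε * Q τ (rot τ (v x)))) • v x with hg'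
  have hgd : ∀ τ, 0 ≤ τ → HasDerivAt g (g' τ) τ := fun τ hτ =>
    ((h.hasDerivAt_inv_field h₂ hτ).smul_const (v y)).sub ((h.hasDerivAt_inv_field h₁ hτ).smul_const (v x))
  have hg'_le : ∀ τ ∈ Icc 0 S, ‖g' τ‖ ≤ ε * (C₂ * (δ + N)) := fun τ hτ => by
    have e : g' τ = (-ε) • ((Q' τ - Q τ) (rot τ (v y)) • v y + (Q τ (rot τ (v y - v x))) • v y +
        (Q τ (rot τ (v x))) • (v y - v x)) := by
      simp only [hg', map_sub, sub_apply]; module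
    rw [e, norm_smul, norm_neg, Real.norm_of_nonneg hε.le]
    gcongr
    have a1 : ‖(Q' τ - Q τ) (rot τ (v y)) • v y‖ ≤ (L * N * U) * U := by
      rw [norm_smul]
      gcongr
      · refine (ContinuousLinearMap.le_opNorm _ _).trans ?_
        rw [norm_rot]
        gcongr
        exacts [(h.grad_lip _ _).trans (by gcongr; exact hDN τ hτ), h.v_le y]
      · exact h.v_le y
    have a2 : ‖(Q τ (rot τ (v y - v x))) • v y‖ ≤ (H * (K * δ)) * U := by
      rw [norm_smul]
      gcongr
      · refine (ContinuousLinearMap.le_opNorm _ _).trans ?_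
        rw [norm_rot]
        gcongr
        exacts [h.grad_le _, h.v_lip y x]
      · exact h.v_le y
    have a3 : ‖(Q τ (rot τ (v x))) • (v y - v x)‖ ≤ (H * U) * (K * δ) := by
      rw [norm_smul]
      gcongr
      · refine (ContinuousLinearMap.le_opNorm _ _).trans ?_
        rw [norm_rot]
        gcongr
        exacts [h.grad_le _, h.v_le x]
      · exact h.v_lip y x
    have hδ0 : 0 ≤ δ := norm_nonneg _
    have hN0 : 0 ≤ N := norm_nonneg _
    have : 0 ≤ L * U ^ 2 * δ + 2 * H * U * K * N := by positivity
    refine (norm_add₃_le).trans ((add_le_add_three a1 a2 a3).trans ?_)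
    rw [hC₂]; linarith
  -- since `(perp ∘ rot τ)' = -rot τ`, the fast terms cancel in the derivative of `E`
  set E : ℝ → Plane := fun τ => D τ + ε • perp (rot τ (g τ)) with hE
  have hEd : ∀ τ, 0 ≤ τ → HasDerivAt E (ε • perp (rot τ (g' τ))) τ := fun τ hτ => by
    have k1 := ((h₂.2 τ hτ).sub (h₁.2 τ hτ)).add
      ((perpCLM.hasFDerivAt.comp_hasDerivAt τ (hasDerivAt_rot (hasDerivAt_id τ) (hgd τ hτ))).const_smul ε)
    refine k1.congr_deriv ?_
    simp only [id, one_smul, map_add, perpCLM_apply, perp_perp]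
    simp only [hg, map_sub, map_smul]
    module
  have hEle : ∀ τ ∈ Icc 0 S, ‖E τ - E 0‖ ≤ ε * (C₂ * (T * B) * (δ + N)) := fun τ hτ => by
    have k1 := norm_sub_le_of_deriv_bound hEd (S := S) (N := ε * (ε * (C₂ * (δ + N)))) (fun s hs => by
      rw [norm_smul, norm_perp, norm_rot, Real.norm_of_nonneg hε.le]
      gcongr
      exact hg'_le s hs) τ hτ
    have hδ0 : 0 ≤ δ := norm_nonneg _
    have hN0 : 0 ≤ N := norm_nonneg _
    calc _ ≤ ε * (ε * (C₂ * (δ + N))) * τ := k1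
      _ ≤ ε * (ε * (C₂ * (δ + N))) * S := by gcongr; exact hτ.2
      _ = _ := by rw [hS]; field_simp
  have hfin : ∀ τ ∈ Icc 0 S, ‖D τ - (y - x)‖ ≤ ε * (A * (δ + N)) := fun τ hτ => by
    have e : D τ - (y - x) = (E τ - E 0) - ε • perp (rot τ (g τ)) + ε • perp (rot 0 (g 0)) := by
      simp only [hE, hD0]; abel
    have n1 : ∀ τ ∈ Icc 0 S, ‖ε • perp (rot τ (g τ))‖ ≤ ε * (C₁ * (δ + N)) := fun τ hτ => by
      rw [norm_smul, norm_perp, norm_rot, Real.norm_of_nonneg hε.le]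
      gcongr
      exact hg_le τ hτ
    rw [e]
    refine (norm_add_le _ _).trans ((add_le_add_left (norm_sub_le _ _) _).trans ?_)
    have := n1 τ hτ; have := n1 0 ⟨le_rfl, hS0⟩; have := hEle τ hτ
    rw [hA]; linarith
  -- the maximal distance `N` on the right-hand side is absorbed for `4 A ε ≤ 1`
  have hN3 : N ≤ 3 * δ := by
    have k1 := hfin τm hτm
    have k2 : N ≤ ‖D τm - (y - x)‖ + δ := by
      have := norm_add_le (D τm - (y - x)) (y - x)
      rwa [sub_add_cancel] at this
    have hδ0 : 0 ≤ δ := norm_nonneg _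
    have hN0 : 0 ≤ N := norm_nonneg _
    have k3 : (4 * A * ε) * (δ + N) ≤ 1 * (δ + N) := by gcongr
    linarith
  intro τ hτ
  refine (hfin τ hτ).trans ?_
  have : ε * (A * (δ + N)) ≤ ε * (A * (δ + 3 * δ)) := by gcongr
  linarith

end FieldBounds

end GuidingCentre

/-! ### Trajectories in time, and the contraction property -/

section TimeCurves

/-- The trajectory `X` of a particle with initial velocity `a`, and the phase `Φ`: the velocity at
time `t` is `a` turned by `rot (Φ t / ε)`. -/
structure IsTimeCurve (b : Plane → ℝ) (ε : ℝ) (x a : Plane) (X : ℝ → Plane) (Φ : ℝ → ℝ) : Prop where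
  contX : Continuous X
  contΦ : Continuous Φ
  X_zero : X 0 = x
  Φ_zero : Φ 0 = 0
  derivX : ∀ t, 0 ≤ t → HasDerivAt X (rot (Φ t / ε) a) t
  derivΦ : ∀ t, 0 ≤ t → HasDerivAt Φ (b (X t)) t

variable {b : Plane → ℝ} {v : Plane → Plane} {m B L H Λ U K : ℝ}

namespace FieldBounds

theorem lip_timeField (h : FieldBounds b v m B L H Λ U K) {ε : ℝ} (hε : 0 < ε) (a : Plane) (z z' : Plane × ℝ) :
    ‖((rot (z.2 / ε) a, b z.1) : Plane × ℝ) - (rot (z'.2 / ε) a, b z'.1)‖ ≤ (‖a‖ / ε + L) * ‖z - z'‖ := by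
  have hL := h.L_nonneg
  have n1 : ‖z.1 - z'.1‖ ≤ ‖z - z'‖ := norm_fst_le (z - z')
  have n2 : |z.2 - z'.2| ≤ ‖z - z'‖ := norm_snd_le (z - z')
  have n0 := norm_nonneg (z - z')
  rw [add_mul]
  refine max_le ?_ ?_
  · refine (norm_rot_sub_le _ _ _).trans ?_
    rw [← sub_div, abs_div, abs_of_pos hε]
    have : ‖a‖ * (|z.2 - z'.2| / ε) ≤ ‖a‖ / ε * ‖z - z'‖ := by
      rw [mul_div_assoc', div_mul_eq_mul_div]; gcongr
    have : 0 ≤ L * ‖z - z'‖ := by positivity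
    linarith
  · refine (h.lip _ _).trans ?_
    have : 0 ≤ ‖a‖ / ε * ‖z - z'‖ := by positivity
    have : L * ‖z.1 - z'.1‖ ≤ L * ‖z - z'‖ := by gcongr
    linarith

/-- The equations of motion for position and phase, whose right-hand side is globally Lipschitz. -/
theorem exists_timeCurve (h : FieldBounds b v m B L H Λ U K) {ε : ℝ} (hε : 0 < ε) (x a : Plane) :
    ∃ X Φ, IsTimeCurve b ε x a X Φ := by
  have hL := h.L_nonneg
  have c1 := h.continuous
  have c2 := continuous_rot
  have hc : Continuous fun p : ℝ × (Plane × ℝ) => ((rot (p.2.2 / ε) a, b p.2.1) : Plane × ℝ) := by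
    have d1 : Continuous fun p : ℝ × (Plane × ℝ) => rot (p.2.2 / ε) a :=
      c2.comp (f := fun p : ℝ × (Plane × ℝ) => (p.2.2 / ε, a)) (by fun_prop)
    have d2 : Continuous fun p : ℝ × (Plane × ℝ) => b p.2.1 :=
      c1.comp (f := fun p : ℝ × (Plane × ℝ) => p.2.1) (by fun_prop)
    exact d1.prodMk d2
  obtain ⟨z, h1, h2, h3⟩ := exists_hasDerivAt_curve (f := fun _ z => ((rot (z.2 / ε) a, b z.1) : Plane × ℝ))
    (K := ‖a‖ / ε + L) (by positivity) hc (fun _ => h.lip_timeField hε a) (fun _ => le_rfl) (x, 0)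
  refine ⟨fun t => (z t).1, fun t => (z t).2, continuous_fst.comp h1, continuous_snd.comp h1, by rw [h2], by rw [h2],
    fun t ht => ?_, fun t ht => ?_⟩
  · exact (ContinuousLinearMap.fst ℝ Plane ℝ).hasFDerivAt.comp_hasDerivAt t (h3 t ht)
  · exact (ContinuousLinearMap.snd ℝ Plane ℝ).hasFDerivAt.comp_hasDerivAt t (h3 t ht)

variable {ε : ℝ} {x a : Plane} {X : ℝ → Plane} {Φ : ℝ → ℝ}

theorem phase_eq_integral (h : FieldBounds b v m B L H Λ U K) (hX : IsTimeCurve b ε x a X Φ) {t : ℝ} (ht : 0 ≤ t) :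
    Φ t = ∫ s in (0 : ℝ)..t, b (X s) := by
  have hc : Continuous fun s => b (X s) := h.continuous.comp hX.contX
  rw [integral_eq_sub_of_nonneg hc hX.derivΦ le_rfl ht, hX.Φ_zero, sub_zero]

theorem phase_nonneg (h : FieldBounds b v m B L H Λ U K) (hX : IsTimeCurve b ε x a X Φ) {t : ℝ} (ht : 0 ≤ t) :
    0 ≤ Φ t := by
  rw [h.phase_eq_integral hX ht]
  exact intervalIntegral.integral_nonneg ht fun s _ => (h.pos _).le

theorem phase_le (h : FieldBounds b v m B L H Λ U K) (hX : IsTimeCurve b ε x a X Φ) {t : ℝ} (ht : 0 ≤ t) :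
    Φ t ≤ B * t := by
  have := norm_sub_le_of_deriv_bound hX.derivΦ (N := B) (S := t) (fun s _ => by
    rw [Real.norm_of_nonneg (h.pos _).le]; exact h.upper _) t ⟨ht, le_rfl⟩
  rw [hX.Φ_zero, sub_zero] at this
  exact (le_abs_self _).trans this

/-- The trajectory as a function of time is the trajectory as a function of the angle. -/
theorem timeCurve_eq (h : FieldBounds b v m B L H Λ U K) (hε : 0 < ε) (hX : IsTimeCurve b ε x a X Φ) {z : ℝ → Plane}
    (hz0 : z 0 = x) (hz : IsPhaseCurve b ε a z) {t : ℝ} (ht : 0 ≤ t) : X t = z (Φ t / ε) := by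
  have hL := h.L_nonneg; have hm := h.m_pos
  have hΦ : ∀ s, 0 ≤ s → 0 ≤ Φ s / ε := fun s hs => div_nonneg (h.phase_nonneg hX hs) hε.le
  have hd : ∀ s, 0 ≤ s → HasDerivAt (fun s => z (Φ s / ε) - X s)
      ((b (X s) / ε) • (ε * (b (z (Φ s / ε)))⁻¹) • rot (Φ s / ε) a - rot (Φ s / ε) a) s := fun s hs =>
    ((hz.2 _ (hΦ s hs)).scomp s ((hX.derivΦ s hs).div_const ε)).sub (hX.derivX s hs)
  have key := eq_zero_of_abs_deriv_le_mul_abs_self_of_eq_zero_right (f := fun s => z (Φ s / ε) - X s)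
    (a := 0) (b := t) (K := L * m⁻¹ * ‖a‖) (fun s hs => (hd s hs.1).continuousAt.continuousWithinAt)
    (fun s hs => (hd s hs.1).hasDerivWithinAt) (by simp [hX.Φ_zero, hX.X_zero, hz0]) (fun s hs => ?_) t ⟨ht, le_rfl⟩
  · exact (sub_eq_zero.1 key).symm
  · have hb := (h.pos (z (Φ s / ε))).ne'
    have e : (b (X s) / ε) • (ε * (b (z (Φ s / ε)))⁻¹) • rot (Φ s / ε) a - rot (Φ s / ε) a =
        ((b (X s) - b (z (Φ s / ε))) * (b (z (Φ s / ε)))⁻¹) • rot (Φ s / ε) a := by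
      rw [smul_smul, sub_mul, mul_inv_cancel₀ hb, sub_smul, one_smul]
      congr 2
      field_simp
    rw [e, norm_smul, norm_rot, norm_mul, Real.norm_of_nonneg (h.inv_pos _).le]
    have a1 := h.lip (X s) (z (Φ s / ε))
    rw [norm_sub_rev] at a1
    calc _ ≤ (L * ‖z (Φ s / ε) - X s‖) * m⁻¹ * ‖a‖ := by
          gcongr
          exacts [(h.inv_pos _).le, a1, h.lower _]
      _ = _ := by ring

/-- The time at which the velocity has turned by the angle `σ`. -/
noncomputable def _root_.clock (b : Plane → ℝ) (ε : ℝ) (z : ℝ → Plane) (σ : ℝ) : ℝ :=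
  ∫ r in (0 : ℝ)..σ, ε * (b (z r))⁻¹

theorem continuous_clock_integrand (h : FieldBounds b v m B L H Λ U K) {z : ℝ → Plane} (hz : IsPhaseCurve b ε a z) :
    Continuous fun r => ε * (b (z r))⁻¹ := continuous_const.mul (h.continuous_inv.comp hz.1)

/-- The clock is the inverse of the angle as a function of time. -/
theorem clock_phase (h : FieldBounds b v m B L H Λ U K) (hε : 0 < ε) (hX : IsTimeCurve b ε x a X Φ) {z : ℝ → Plane}
    (hz0 : z 0 = x) (hz : IsPhaseCurve b ε a z) {t : ℝ} (ht : 0 ≤ t) : clock b ε z (Φ t / ε) = t := by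
  have hd : ∀ s, 0 ≤ s → HasDerivAt (fun s => clock b ε z (Φ s / ε) - s) 0 s := fun s hs => by
    have h1 := (((h.continuous_clock_integrand hz).integral_hasStrictDerivAt 0 (Φ s / ε)).hasDerivAt.scomp s
      ((hX.derivΦ s hs).div_const ε)).sub (hasDerivAt_id s)
    refine h1.congr_deriv ?_
    rw [← h.timeCurve_eq hε hX hz0 hz hs]
    have := (h.pos (X s)).ne'
    simp only [smul_eq_mul]
    field_simp
    ring
  have := norm_sub_le_of_deriv_bound hd (N := 0) (S := t) (by simp) t ⟨ht, le_rfl⟩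
  simp only [hX.Φ_zero, zero_mul, sub_zero, zero_div] at this
  have h0 : clock b ε z 0 = 0 := by simp [clock]
  rw [h0, sub_zero] at this
  exact sub_eq_zero.1 (norm_le_zero_iff.1 this)

/-- The distance travelled is at most the speed times the time elapsed on the clock. -/
theorem norm_phaseCurve_sub_le (h : FieldBounds b v m B L H Λ U K) (hε : 0 < ε) {z : ℝ → Plane}
    (hz : IsPhaseCurve b ε a z) {σ σ' : ℝ} (hσ : 0 ≤ σ) (hσ' : 0 ≤ σ') :
    ‖z σ' - z σ‖ ≤ ‖a‖ * |clock b ε z σ' - clock b ε z σ| := by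
  have hci := h.continuous_clock_integrand hz
  have hr : Continuous fun τ => rot τ a :=
    continuous_rot.comp (f := fun τ : ℝ => (τ, a)) (by fun_prop)
  have hc : Continuous fun τ => (ε * (b (z τ))⁻¹) • rot τ a := hci.smul hr
  have e0 := integral_eq_sub_of_nonneg hc hz.2 hσ hσ'
  rw [← e0, clock, clock, intervalIntegral.integral_interval_sub_left (hci.intervalIntegrable _ _) (hci.intervalIntegrable _ _)]
  refine intervalIntegral.norm_integral_le_abs_integral_norm.trans ?_
  have e : ∀ τ, ‖(ε * (b (z τ))⁻¹) • rot τ a‖ = ‖a‖ * (ε * (b (z τ))⁻¹) := fun τ => by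
    rw [norm_smul, norm_rot, Real.norm_of_nonneg (by have := (h.inv_pos (z τ)).le; positivity), mul_comm]
  simp only [e, intervalIntegral.integral_const_mul, abs_mul, abs_norm]
  exact le_rfl

/-- The relative variation of `1/b` is controlled by the Lipschitz constant of `log b`; this is where
`‖∇ log b‖` enters the time of existence. -/
theorem abs_inv_sub_le (h : FieldBounds b v m B L H Λ U K) (p q : Plane) {N : ℝ} (hN : ‖q - p‖ ≤ N) :
    |(b q)⁻¹ - (b p)⁻¹| ≤ (b p)⁻¹ * (Real.exp (Λ * N) - 1) := by
  have hp := h.pos p; have hq := h.pos q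
  have h1 : (b q)⁻¹ = (b p)⁻¹ * Real.exp (Real.log (b p) - Real.log (b q)) := by
    rw [Real.exp_sub, Real.exp_log hp, Real.exp_log hq]; field_simp
  have h2 : |Real.log (b p) - Real.log (b q)| ≤ Λ * N := by
    refine (h.log_lip p q).trans ?_
    rw [norm_sub_rev]; have := h.Λ_nonneg; gcongr
  set d := Real.log (b p) - Real.log (b q)
  have h3 : |Real.exp d - 1| ≤ Real.exp (Λ * N) - 1 := by
    rw [abs_le] at h2 ⊢
    have e1 : Real.exp d ≤ Real.exp (Λ * N) := Real.exp_le_exp.2 h2.2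
    have e2 : Real.exp (-(Λ * N)) ≤ Real.exp d := Real.exp_le_exp.2 h2.1
    have e3 := Real.add_one_le_exp (Λ * N)
    have e4 : 2 ≤ Real.exp (Λ * N) + Real.exp (-(Λ * N)) := by
      have := Real.add_one_le_exp (-(Λ * N))
      nlinarith [sq_nonneg (Real.exp (Λ * N) - 1), Real.exp_pos (Λ * N), Real.exp_neg (Λ * N),
        mul_inv_cancel₀ (Real.exp_pos (Λ * N)).ne', Real.exp_pos (-(Λ * N))]
    constructor <;> linarith
  rw [h1, ← mul_sub_one, abs_mul, abs_of_pos (h.inv_pos p)]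
  have := (h.inv_pos p).le
  gcongr

/-- The trajectories at a given time: the distance is changed by the drift, of order `ε`, and by the
difference of the times at which a given angle is reached. -/
theorem timeCurve_sub_le (h : FieldBounds b v m B L H Λ U K) {T : ℝ} (hT : 0 < T) :
    ∃ C : ℝ, 0 ≤ C ∧ ∀ ε : ℝ, 0 < ε → C * ε ≤ 1 → ∀ x y : Plane, ∀ (X₁ X₂ : ℝ → Plane) (Φ₁ Φ₂ : ℝ → ℝ),
      IsTimeCurve b ε x (v x) X₁ Φ₁ → IsTimeCurve b ε y (v y) X₂ Φ₂ →
      ∀ t ∈ Icc 0 T, ‖X₂ t - X₁ t - (y - x)‖ ≤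
        C * ε * ‖y - x‖ + U * (T * (Real.exp (Λ * ((1 + C * ε) * ‖y - x‖)) - 1)) := by
  obtain ⟨C, hC0, hC⟩ := h.phaseCurve_sub_le hT
  refine ⟨C, hC0, fun ε hε hCε x y X₁ X₂ Φ₁ Φ₂ h₁ h₂ t ht => ?_⟩
  obtain ⟨z₁, i₁, k₁⟩ := h.exists_phaseCurve hε x (v x)
  obtain ⟨z₂, i₂, k₂⟩ := h.exists_phaseCurve hε y (v y)
  have hdiff := hC ε hε hCε x y z₁ z₂ i₁ i₂ k₁ k₂
  set τ := Φ₁ t / ε with hτ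
  set τ' := Φ₂ t / ε with hτ'
  have hτ0 : 0 ≤ τ := div_nonneg (h.phase_nonneg h₁ ht.1) hε.le
  have hτ'0 : 0 ≤ τ' := div_nonneg (h.phase_nonneg h₂ ht.1) hε.le
  have hB := h.B_pos
  have hτS : τ ≤ T * B / ε := by
    rw [hτ]; gcongr
    refine (h.phase_le h₁ ht.1).trans ?_
    rw [mul_comm]; gcongr; exact ht.2
  set N := (1 + C * ε) * ‖y - x‖ with hN
  have hDN : ∀ r ∈ Icc 0 τ, ‖z₂ r - z₁ r‖ ≤ N := fun r hr => by
    have a1 := hdiff r ⟨hr.1, hr.2.trans hτS⟩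
    have a2 := norm_add_le (z₂ r - z₁ r - (y - x)) (y - x)
    rw [sub_add_cancel] at a2
    rw [hN, add_mul]; linarith
  have hclock : |clock b ε z₁ τ - clock b ε z₂ τ| ≤ T * (Real.exp (Λ * N) - 1) := by
    have c1 := h.continuous_clock_integrand k₁
    have c2 := h.continuous_clock_integrand k₂
    have hE : 0 ≤ Real.exp (Λ * N) - 1 := by
      have := Real.add_one_le_exp (Λ * N)
      have : 0 ≤ Λ * N := by have := h.Λ_nonneg; positivity
      linarith
    rw [clock, clock, ← intervalIntegral.integral_sub (c1.intervalIntegrable _ _) (c2.intervalIntegrable _ _)]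
    have hle : ‖∫ r in (0 : ℝ)..τ, (ε * (b (z₁ r))⁻¹ - ε * (b (z₂ r))⁻¹)‖ ≤
        ∫ r in (0 : ℝ)..τ, (ε * (b (z₁ r))⁻¹) * (Real.exp (Λ * N) - 1) := by
      refine intervalIntegral.norm_integral_le_of_norm_le hτ0 (ae_of_all _ fun r hr => ?_)
        ((c1.mul continuous_const).intervalIntegrable _ _)
      rw [← mul_sub, norm_mul, Real.norm_of_nonneg hε.le, mul_assoc, norm_sub_rev]
      gcongr
      exact h.abs_inv_sub_le _ _ (hDN r ⟨hr.1.le, hr.2⟩)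
    rw [intervalIntegral.integral_mul_const] at hle
    refine hle.trans ?_
    gcongr
    have := h.clock_phase hε h₁ i₁ k₁ ht.1
    rw [clock] at this
    rw [this]; exact ht.2
  have e1 : X₁ t = z₁ τ := h.timeCurve_eq hε h₁ i₁ k₁ ht.1
  have e2 : X₂ t = z₂ τ' := h.timeCurve_eq hε h₂ i₂ k₂ ht.1
  have hz : ‖z₂ τ' - z₂ τ‖ ≤ U * (T * (Real.exp (Λ * N) - 1)) := by
    refine (h.norm_phaseCurve_sub_le hε k₂ hτ0 hτ'0).trans ?_
    rw [h.clock_phase hε h₂ i₂ k₂ ht.1]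
    nth_rw 1 [← h.clock_phase hε h₁ i₁ k₁ ht.1]
    have := h.U_nonneg
    gcongr
    exact h.v_le y
  -- at time `t` the two angles differ: compare at equal angles first, then move along the second curve
  have e3 : X₂ t - X₁ t - (y - x) = (z₂ τ - z₁ τ - (y - x)) + (z₂ τ' - z₂ τ) := by rw [e1, e2]; abel
  rw [e3]
  exact (norm_add_le _ _).trans (add_le_add (hdiff τ ⟨hτ0, hτS⟩) hz)

/-- A map with a Lipschitz bound at small distances has it at all distances. -/
theorem _root_.norm_sub_le_of_local {E F : Type} [NormedAddCommGroup E] [NormedSpace ℝ E] [NormedAddCommGroup F]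
    {f : E → F} {q r : ℝ} (hr : 0 < r) (h : ∀ x y, ‖y - x‖ ≤ r → ‖f y - f x‖ ≤ q * ‖y - x‖) (x y : E) :
    ‖f y - f x‖ ≤ q * ‖y - x‖ := by
  obtain ⟨n, hn⟩ := exists_nat_gt (‖y - x‖ / r)
  have hn0 : (0 : ℝ) < n := (div_nonneg (norm_nonneg _) hr.le).trans_lt hn
  set p : ℕ → E := fun i => x + ((i : ℝ) / n) • (y - x) with hp
  have hstep : ∀ i, p (i + 1) - p i = (1 / (n : ℝ)) • (y - x) := fun i => by
    simp only [hp, add_sub_add_left_eq_sub, ← sub_smul]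
    congr 1; push_cast; ring
  have hs : ∀ i, ‖f (p (i + 1)) - f (p i)‖ ≤ q * (‖y - x‖ / n) := fun i => by
    have e : ‖p (i + 1) - p i‖ = ‖y - x‖ / n := by
      rw [hstep, norm_smul, Real.norm_of_nonneg (by positivity)]; ring
    have := h (p i) (p (i + 1)) (by
      rw [e, div_le_iff₀ hn0]
      rw [div_lt_iff₀ hr] at hn
      linarith)
    rwa [e] at this
  have hsum : f y - f x = ∑ i ∈ Finset.range n, (f (p (i + 1)) - f (p i)) := by
    rw [Finset.sum_range_sub (fun i => f (p i))]
    have e0 : p 0 = x := by simp [hp]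
    have e1 : p n = y := by simp [hp, div_self hn0.ne']
    rw [e0, e1]
  rw [hsum]
  refine (norm_sum_le _ _).trans ((Finset.sum_le_sum fun i _ => hs i).trans (le_of_eq ?_))
  rw [Finset.sum_const, Finset.card_range, nsmul_eq_mul]
  field_simp

/-- For small `ε` the displacement of the particles at time `t ∈ [0,T]`, `T < T^*`, is a contraction. -/
theorem exists_contraction (h : FieldBounds b v m B L H Λ U K) {T : ℝ} (hT : 0 < T) (hTs : T * (U * Λ) < 1) :
    ∃ ε₀ q : ℝ, 0 < ε₀ ∧ 0 ≤ q ∧ q < 1 ∧ ∀ ε : ℝ, 0 < ε → ε ≤ ε₀ →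
      ∀ (X : Plane → ℝ → Plane) (Φ : Plane → ℝ → ℝ), (∀ x, IsTimeCurve b ε x (v x) (X x) (Φ x)) →
      ∀ t ∈ Icc 0 T, ∀ x y, ‖X y t - X x t - (y - x)‖ ≤ q * ‖y - x‖ := by
  obtain ⟨C, hC0, hC⟩ := h.timeCurve_sub_le hT
  have hU := h.U_nonneg; have hΛ := h.Λ_nonneg
  -- `φ 0 = T U Λ < 1`, so `φ η < 1` for some `η`, which bounds both `ε` and the distance `‖y - x‖`
  set φ : ℝ → ℝ := fun η => C * η + T * (U * Λ) * ((1 + C * η) * Real.exp (Λ * ((1 + C * η) * η))) with hφ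
  have hφc : Continuous φ := by fun_prop
  have hφ0 : φ 0 < 1 := by simpa [hφ] using hTs
  have hev : ∀ᶠ η in 𝓝 (0 : ℝ), φ η < 1 ∧ C * η < 1 :=
    ((hφc.tendsto 0).eventually (gt_mem_nhds hφ0)).and
      (((continuous_const.mul continuous_id).tendsto (0 : ℝ)).eventually (gt_mem_nhds (by simp)))
  obtain ⟨η, ⟨hη1, hη2⟩, hη0⟩ := ((hev.filter_mono nhdsWithin_le_nhds).and (self_mem_nhdsWithin (s := Ioi 0))).exists
  replace hη0 : 0 < η := hη0
  refine ⟨η, φ η, hη0, by positivity, hη1, fun ε hε hεη X Φ hX t ht => ?_⟩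
  have hCε : C * ε ≤ C * η := by gcongr
  intro x y
  have key := norm_sub_le_of_local (f := fun x => X x t - x) (q := φ η) hη0 (fun x y hxy => ?_) x y
  · have e : X y t - X x t - (y - x) = X y t - y - (X x t - x) := by abel
    rw [e]
    exact key
  · have k1 := hC ε hε (hCε.trans hη2.le) x y _ _ _ _ (hX x) (hX y) t ht
    have e : X y t - y - (X x t - x) = X y t - X x t - (y - x) := by abel
    refine (congrArg norm e).le.trans (k1.trans ?_)
    set d := ‖y - x‖ with hd
    have hd0 : 0 ≤ d := norm_nonneg _
    set z := Λ * ((1 + C * ε) * d) with hz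
    have hz0 : 0 ≤ z := by positivity
    have k2 : Real.exp z - 1 ≤ z * Real.exp z := by
      have := Real.one_sub_le_exp_neg z
      have k3 : (1 - z) * Real.exp z ≤ Real.exp (-z) * Real.exp z := by gcongr
      rw [← Real.exp_add, neg_add_cancel, Real.exp_zero] at k3
      linarith
    have k4 : z * Real.exp z ≤ (Λ * ((1 + C * η) * d)) * Real.exp (Λ * ((1 + C * η) * η)) := by
      rw [hz]; gcongr
    calc C * ε * d + U * (T * (Real.exp z - 1))
        ≤ C * η * d + U * (T * ((Λ * ((1 + C * η) * d)) * Real.exp (Λ * ((1 + C * η) * η)))) := by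
          gcongr
          exact k2.trans k4
      _ = φ η * d := by rw [hφ]; ring

end FieldBounds
end TimeCurves

/-! ### The solution carried by the flow of particles -/

section LagrangianSolution

/-- Flow maps `X` with inverses `Y` and velocities `V` along the trajectories which solve
`X' = V`, `V' = (b(X)/ε) V^⊥` on `(0,T)`. -/
structure IsParticleFlow (T ε : ℝ) (b : Plane → ℝ) (v : Plane → Plane) (C : ℝ≥0) (X Y V : ℝ → Plane → Plane) : Prop
    extends IsBiLip C X Y where
  lipV : LipschitzWith C (fun p : ℝ × Plane => V p.1 p.2)
  normV : ∀ t x, ‖V t x‖ = ‖v x‖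
  X_zero : ∀ x, X 0 x = x
  V_zero : ∀ x, V 0 x = v x
  derivX : ∀ x, ∀ t ∈ Ioo 0 T, HasDerivAt (fun s => X s x) (V t x) t
  derivV : ∀ x, ∀ t ∈ Ioo 0 T, HasDerivAt (fun s => V s x) ((b (X t x) / ε) • perp (V t x)) t

variable {b : Plane → ℝ} {v : Plane → Plane} {m B L H Λ U K T ε : ℝ}

theorem hasDerivAt_comp_clamp {E : Type} [NormedAddCommGroup E] [NormedSpace ℝ E] {f : ℝ → E} {f' : E} {t : ℝ}
    (ht : t ∈ Ioo 0 T) (h : HasDerivAt f f' t) : HasDerivAt (fun s => f (clamp T s)) f' t := by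
  refine h.congr_of_eventuallyEq ?_
  filter_upwards [Icc_mem_nhds ht.1 ht.2] with s hs
  rw [clamp_of_mem hs]

/-- A displacement that is a contraction makes the maps of the flow bi-Lipschitz. -/
theorem FieldBounds.exists_isParticleFlow (h : FieldBounds b v m B L H Λ U K) (hT : 0 < T) (hε : 0 < ε)
    {q : ℝ} (hq0 : 0 ≤ q) (hq : q < 1) {X : Plane → ℝ → Plane} {Φ : Plane → ℝ → ℝ}
    (hX : ∀ x, IsTimeCurve b ε x (v x) (X x) (Φ x))
    (hcon : ∀ t ∈ Icc 0 T, ∀ x y, ‖X y t - X x t - (y - x)‖ ≤ q * ‖y - x‖) :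
    ∃ (C : ℝ≥0) (Y : ℝ → Plane → Plane), IsParticleFlow T ε b v C (fun t x => X x (clamp T t)) Y
      (fun t x => rot (Φ x (clamp T t) / ε) (v x)) := by
  have hc := clamp_mem hT.le
  have hU := h.U_nonneg; have hL := h.L_nonneg; have hB := h.B_pos; have hK := h.K_nonneg
  have hXx : ∀ t ∈ Icc 0 T, ∀ x y, ‖X x t - X y t‖ ≤ (1 + q) * ‖x - y‖ := fun t ht x y => by
    have h1 := hcon t ht y x
    have h2 := norm_add_le (X x t - X y t - (x - y)) (x - y)
    rw [sub_add_cancel] at h2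
    linarith
  have hXl : LipschitzWith (U + (1 + q)).toNNReal fun p : ℝ × Plane => X p.2 (clamp T p.1) := by
    refine lipschitzWith_of_norm_le fun p p' => ?_
    have n1 : |p.1 - p'.1| ≤ ‖p - p'‖ := norm_fst_le (p - p')
    have n2 : ‖p.2 - p'.2‖ ≤ ‖p - p'‖ := norm_snd_le (p - p')
    have a1 : ‖X p.2 (clamp T p.1) - X p.2 (clamp T p'.1)‖ ≤ U * |clamp T p.1 - clamp T p'.1| := by
      have := (convex_Ici (0 : ℝ)).norm_image_sub_le_of_norm_hasDerivWithin_le (f := X p.2) (C := U)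
        (fun s hs => ((hX p.2).derivX s hs).hasDerivWithinAt)
        (fun s _ => by rw [norm_rot]; exact h.v_le _) (hc p'.1).1 (hc p.1).1
      exact this
    have a2 := hXx (clamp T p'.1) (hc _) p.2 p'.2
    refine (norm_sub_le_norm_sub_add_norm_sub _ (X p.2 (clamp T p'.1)) _).trans ?_
    rw [add_mul]
    exact add_le_add (a1.trans (by gcongr; exact (abs_clamp_sub_le _ _ _).trans n1)) (a2.trans (by gcongr))
  have hanti : ∀ t x y, ‖x - y‖ ≤ (1 - q)⁻¹ * ‖X x (clamp T t) - X y (clamp T t)‖ := fun t x y => by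
    have h1 := hcon _ (hc t) y x
    have h2 := norm_sub_le (X x (clamp T t) - X y (clamp T t)) (X x (clamp T t) - X y (clamp T t) - (x - y))
    rw [sub_sub_cancel] at h2
    rw [inv_mul_eq_div, le_div_iff₀ (by linarith)]
    linarith
  have hsurj : ∀ t, Function.Surjective fun x => X x (clamp T t) := fun t y => by
    -- a preimage of `y` is a fixed point of `x ↦ y - (X_t x - x)`
    have hcw : ContractingWith q.toNNReal (fun x => x - X x (clamp T t) + y) := by
      refine ⟨by rw [← NNReal.coe_lt_coe, Real.coe_toNNReal _ hq0]; exact hq, lipschitzWith_of_norm_le fun a c => ?_⟩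
      have h1 := hcon _ (hc t) c a
      have e : a - X a (clamp T t) + y - (c - X c (clamp T t) + y) =
          -(X a (clamp T t) - X c (clamp T t) - (a - c)) := by abel
      rw [e, norm_neg]; exact h1
    refine ⟨ContractingWith.fixedPoint _ hcw, ?_⟩
    have := hcw.fixedPoint_isFixedPt
    set x := ContractingWith.fixedPoint _ hcw
    have h2 : x - X x (clamp T t) + y = x := this
    have h3 : X x (clamp T t) = y := by
      rw [← sub_eq_zero, ← sub_eq_zero.2 h2]
      abel_nf
      simp only [neg_smul, one_smul] at h2 ⊢
      have : y - X x (clamp T t) = 0 := by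
        have := sub_eq_zero.2 h2
        rw [← this]; abel
      rw [sub_eq_zero.1 this]; abel
    exact h3
  obtain ⟨C, Y, hXY⟩ := exists_isBiLip (X := fun t x => X x (clamp T t)) hXl (by
    have : 0 < 1 - q := by linarith
    positivity) hanti hsurj
  have hΦx : ∀ t ∈ Icc 0 T, ∀ x y, |Φ x t - Φ y t| ≤ L * (1 + q) * T * ‖x - y‖ := fun t ht x y => by
    have c1 : ∀ x, Continuous fun s => b (X x s) := fun x => h.continuous.comp (hX x).contX
    rw [h.phase_eq_integral (hX x) ht.1, h.phase_eq_integral (hX y) ht.1,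
      ← intervalIntegral.integral_sub ((c1 x).intervalIntegrable _ _) ((c1 y).intervalIntegrable _ _)]
    have := intervalIntegral.norm_integral_le_of_norm_le_const (a := 0) (b := t) (C := L * ((1 + q) * ‖x - y‖))
      (f := fun s => b (X x s) - b (X y s)) (fun s hs => by
        rw [uIoc_of_le ht.1] at hs
        exact (h.lip _ _).trans (by gcongr; exact hXx s ⟨hs.1.le, hs.2.trans ht.2⟩ x y))
    refine this.trans ?_
    rw [sub_zero, abs_of_nonneg ht.1]
    calc _ ≤ L * ((1 + q) * ‖x - y‖) * T := by gcongr; exact ht.2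
      _ = _ := by ring
  have hVl : LipschitzWith (U * ((B + L * (1 + q) * T) / ε) + K).toNNReal
      fun p : ℝ × Plane => rot (Φ p.2 (clamp T p.1) / ε) (v p.2) := by
    refine lipschitzWith_of_norm_le fun p p' => ?_
    have n1 : |p.1 - p'.1| ≤ ‖p - p'‖ := norm_fst_le (p - p')
    have n2 : ‖p.2 - p'.2‖ ≤ ‖p - p'‖ := norm_snd_le (p - p')
    have a1 : |Φ p.2 (clamp T p.1) - Φ p.2 (clamp T p'.1)| ≤ B * |clamp T p.1 - clamp T p'.1| := by
      have := (convex_Ici (0 : ℝ)).norm_image_sub_le_of_norm_hasDerivWithin_le (f := Φ p.2) (C := B)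
        (fun s hs => ((hX p.2).derivΦ s hs).hasDerivWithinAt)
        (fun s _ => by rw [Real.norm_of_nonneg (h.pos _).le]; exact h.upper _) (hc p'.1).1 (hc p.1).1
      exact this
    have a2 := hΦx (clamp T p'.1) (hc _) p.2 p'.2
    have a3 : |Φ p.2 (clamp T p.1) - Φ p'.2 (clamp T p'.1)| ≤ (B + L * (1 + q) * T) * ‖p - p'‖ := by
      refine (abs_sub_le _ (Φ p.2 (clamp T p'.1)) _).trans ?_
      rw [add_mul]
      exact add_le_add (a1.trans (by gcongr; exact (abs_clamp_sub_le _ _ _).trans n1)) (a2.trans (by gcongr))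
    refine (norm_sub_le_norm_sub_add_norm_sub _ (rot (Φ p'.2 (clamp T p'.1) / ε) (v p.2)) _).trans ?_
    rw [← map_sub, norm_rot, add_mul]
    refine add_le_add ((norm_rot_sub_le _ _ _).trans ?_) ((h.v_lip _ _).trans (by gcongr))
    rw [← sub_div, abs_div, abs_of_pos hε, mul_assoc, div_mul_eq_mul_div]
    gcongr
    exact h.v_le _
  refine ⟨max C (U * ((B + L * (1 + q) * T) / ε) + K).toNNReal, Y, ⟨⟨hXY.lipX.weaken (le_max_left _ _),
    hXY.lipY.weaken (le_max_left _ _), hXY.right_inv, hXY.left_inv⟩, hVl.weaken (le_max_right _ _), ?_, ?_, ?_, ?_, ?_⟩⟩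
  · intro t x; exact norm_rot _ _
  · intro x; simp only [clamp_of_mem (show (0 : ℝ) ∈ Icc 0 T from ⟨le_rfl, hT.le⟩), (hX x).X_zero]
  · intro x
    simp only [clamp_of_mem (show (0 : ℝ) ∈ Icc 0 T from ⟨le_rfl, hT.le⟩), (hX x).Φ_zero, zero_div, rot_zero]
  · intro x t ht
    simp only [clamp_of_mem (Ioo_subset_Icc_self ht)]
    exact hasDerivAt_comp_clamp ht ((hX x).derivX t ht.1.le)
  · intro x t ht
    simp only [clamp_of_mem (Ioo_subset_Icc_self ht)]
    have h1 := hasDerivAt_rot (((hX x).derivΦ t ht.1.le).div_const ε) (hasDerivAt_const t (v x))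
    rw [map_zero, add_zero] at h1
    exact hasDerivAt_comp_clamp (f := fun s => rot (Φ x s / ε) (v x)) ht h1

theorem LipschitzWith.const_smul_of_lipschitz {F : Type} [NormedAddCommGroup F] [NormedSpace ℝ F] {g : ℝ → F}
    {D : ℝ≥0} (hg : LipschitzWith D g) (c : ℝ) : LipschitzWith (|c| * D).toNNReal (fun t => c • g t) :=
  lipschitzWith_of_norm_le fun t s => by
    rw [← smul_sub, norm_smul, mul_assoc, Real.norm_eq_abs]
    gcongr
    exact hg.norm_sub_le t s

theorem exists_lipschitzOnWith_smul {F : Type} [NormedAddCommGroup F] [NormedSpace ℝ F] {f : ℝ → ℝ} {g : ℝ → F}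
    {C D : ℝ≥0} (hf : LipschitzWith C f) (hg : LipschitzWith D g) (a c : ℝ) :
    ∃ N, LipschitzOnWith N (fun t => f t • g t) (Icc a c) := by
  obtain ⟨Bf, hBf⟩ := isCompact_Icc.exists_bound_of_continuousOn (hf.continuous.continuousOn (s := Icc a c))
  obtain ⟨Bg, hBg⟩ := isCompact_Icc.exists_bound_of_continuousOn (hg.continuous.continuousOn (s := Icc a c))
  refine ⟨C * Bg.toNNReal + Bf.toNNReal * D, LipschitzOnWith.of_dist_le_mul fun t ht s hs => ?_⟩
  have e : f t • g t - f s • g s = (f t - f s) • g t + f s • (g t - g s) := by module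
  rw [dist_eq_norm, dist_eq_norm, e]
  refine (norm_add_le _ _).trans ?_
  rw [norm_smul, norm_smul]
  push_cast
  have a1 := hf.norm_sub_le t s
  have a2 := hg.norm_sub_le t s
  have a3 := (hBg t ht).trans (Real.le_coe_toNNReal Bg)
  have a4 := (hBf s hs).trans (Real.le_coe_toNNReal Bf)
  calc _ ≤ (C * ‖t - s‖) * Bg.toNNReal + Bf.toNNReal * (D * ‖t - s‖) := by gcongr
    _ = _ := by ring

/-- Integration in time over the slab. -/
theorem integral_slab_deriv {F : Type} [NormedAddCommGroup F] [NormedSpace ℝ F] [FiniteDimensional ℝ F]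
    (hT : 0 < T) {A A' : ℝ × Plane → F} {M : ℝ} {S : Set (ℝ × Plane)} (hS : IsCompact S)
    (hA' : AEStronglyMeasurable A' (slab T)) (hM : ∀ᵐ p ∂slab T, ‖A' p‖ ≤ M) (h0 : ∀ p, p ∉ S → A' p = 0)
    (hl : ∀ x, ∃ N, LipschitzOnWith N (fun t => A (t, x)) (Icc 0 T)) (hAT : ∀ x, A (T, x) = 0)
    (hd : ∀ᵐ x, ∀ᵐ t ∂volume.restrict (Icc 0 T), HasDerivAt (fun t => A (t, x)) (A' (t, x)) t) :
    ∫ p, A' p ∂slab T + ∫ x, A (0, x) = 0 := by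
  have : CompleteSpace F := FiniteDimensional.complete ℝ F
  have : ProperSpace F := FiniteDimensional.proper_real F
  have hi := integrable_of_ae_bdd_of_support hS hA' hM h0
  have hline : ∀ᵐ x, ∫ t in Icc 0 T, A' (t, x) = - A (0, x) := by
    have hmx : ∀ᵐ x : Plane, AEStronglyMeasurable (fun t => A' (t, x)) (volume.restrict (Icc 0 T)) := by
      have h1 : AEStronglyMeasurable (fun p : Plane × ℝ => A' p.swap) (volume.prod (volume.restrict (Icc 0 T))) := by
        rw [slab] at hA'
        exact hA'.prod_swap
      exact h1.prodMk_left
    filter_upwards [hmx, slab_ae_slice hM, hd] with x h1 h2 h3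
    obtain ⟨N, hN⟩ := hl x
    have := (sub_eq_integral_of_ae_hasDerivAt hT.le hN h1 h2 h3).2
    rw [hAT, zero_sub, intervalIntegral.integral_of_le hT.le] at this
    rw [integral_Icc_eq_integral_Ioc, this]
  rw [slab, integral_prod_symm _ (by rw [← slab]; exact hi), integral_congr_ae hline, integral_neg, neg_add_cancel]

namespace IsParticleFlow
variable {C : ℝ≥0} {X Y V : ℝ → Plane → Plane} {ρ₀ : Plane → ℝ} {M0 : ℝ}

/-- The velocity field of the flow. -/
def _root_.eulerVelocity (V Y : ℝ → Plane → Plane) (t : ℝ) (y : Plane) : Plane := V t (Y t y)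

/-- The density transported by the flow. -/
noncomputable def _root_.eulerDensity (ρ₀ : Plane → ℝ) (Y : ℝ → Plane → Plane) (t : ℝ) (y : Plane) : ℝ :=
  ρ₀ (Y t y) * jac Y (t, y)

theorem lip_velocity (h : IsParticleFlow T ε b v C X Y V) :
    LipschitzWith (C * max 1 C) (fun p : ℝ × Plane => eulerVelocity V Y p.1 p.2) :=
  LipschitzWith.comp (f := fun p : ℝ × Plane => V p.1 p.2) (g := fun p : ℝ × Plane => (p.1, Y p.1 p.2)) h.lipV
    (LipschitzWith.prod_fst.prodMk h.lipY)

theorem aestronglyMeasurable_density (h : IsParticleFlow T ε b v C X Y V) (hρ0 : AEStronglyMeasurable ρ₀ volume) :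
    AEStronglyMeasurable (fun p : ℝ × Plane => eulerDensity ρ₀ Y p.1 p.2) (slab T) := by
  have h1 : AEStronglyMeasurable (fun p : ℝ × Plane => ρ₀ p.2) (slab T) := hρ0.comp_snd
  have h2 : AEStronglyMeasurable (fun p : ℝ × Plane => ρ₀ (Y p.1 p.2)) (slab T) :=
    h.toIsBiLip.symm.aestronglyMeasurable_comp h1
  have h3 : AEStronglyMeasurable (jac Y) (slab T) := h.toIsBiLip.symm.measurable_jac.aestronglyMeasurable
  exact h2.mul h3

/-- The test function along the flow. -/
theorem comp_test (h : IsParticleFlow T ε b v C X Y V) {ψ : ℝ × Plane → ℝ} (hψ : IsTestFunction T ψ) :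
    ∃ (D : ℝ≥0) (S : Set (ℝ × Plane)), IsCompact S ∧ (∀ x, LipschitzWith D fun t => ψ (t, X t x)) ∧
      (∀ p, p ∉ S → ψ (p.1, X p.1 p.2) = 0 ∧ fderiv ℝ ψ (p.1, X p.1 p.2) = 0) ∧
      (∀ x, ∀ t ∈ Ioo 0 T, HasDerivAt (fun t => ψ (t, X t x)) (fderiv ℝ ψ (t, X t x) (1, V t x)) t) ∧
      (∀ x, ψ (T, X T x) = 0) := by
  obtain ⟨D, hD⟩ := lipschitzWith_of_contDiff hψ.1 hψ.2.1
  let e : (ℝ × Plane) ≃ₜ (ℝ × Plane) :=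
    { toFun := fun p => (p.1, X p.1 p.2)
      invFun := fun p => (p.1, Y p.1 p.2)
      left_inv := fun p => by simp [h.left_inv]
      right_inv := fun p => by simp [h.right_inv]
      continuous_toFun := continuous_fst.prodMk h.lipX.continuous
      continuous_invFun := continuous_fst.prodMk h.lipY.continuous }
  refine ⟨D * max 1 C, e ⁻¹' tsupport ψ, e.isCompact_preimage.2 hψ.2.1, fun x => ?_, fun p hp => ⟨?_, ?_⟩,
    fun x t ht => ?_, fun x => ?_⟩
  · exact hD.comp (LipschitzWith.id.prodMk (lipschitz_time h.lipX x))
  · exact image_eq_zero_of_notMem_tsupport hp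
  · exact fderiv_eq_zero_of_notMem_tsupport hp
  · exact hasDerivAt_comp_spacetime ((hψ.1.differentiable (by simp)) _) (h.derivX x t ht)
  · exact image_eq_zero_of_notMem_tsupport fun hm => lt_irrefl T (hψ.2.2 hm).1

theorem continuous_fderiv_test (h : IsParticleFlow T ε b v C X Y V) {ψ : ℝ × Plane → ℝ} (hψ : IsTestFunction T ψ) :
    Continuous fun p : ℝ × Plane => fderiv ℝ ψ (p.1, X p.1 p.2) (1, V p.1 p.2) :=
  ((hψ.1.continuous_fderiv (by simp)).comp (continuous_fst.prodMk h.lipX.continuous)).clm_apply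
    (continuous_const.prodMk h.lipV.continuous)

theorem norm_fderiv_test_le {D : ℝ≥0} {ψ : ℝ × Plane → ℝ} (h : IsParticleFlow T ε b v C X Y V) {U : ℝ} (hU : 0 ≤ U)
    (hv : ∀ x, ‖v x‖ ≤ U) (hD : LipschitzWith D ψ) (p : ℝ × Plane) :
    ‖fderiv ℝ ψ (p.1, X p.1 p.2) (1, V p.1 p.2)‖ ≤ D * (1 + U) := by
  refine (norm_fderiv_apply_le hD _ _).trans ?_
  gcongr
  rw [Prod.norm_mk]
  refine max_le (by simp [hU]) ?_
  rw [h.normV]; have := hv p.2; linarith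

/-- The transported density solves the continuity equation. -/
theorem solvesContinuity (h : IsParticleFlow T ε b v C X Y V) (hT : 0 < T) (hv : ∀ x, ‖v x‖ ≤ U)
    (hρ0 : AEStronglyMeasurable ρ₀ volume) (hM0 : ∀ᵐ x, ‖ρ₀ x‖ ≤ M0) :
    SolvesContinuity T ρ₀ (eulerDensity ρ₀ Y) (eulerVelocity V Y) := by
  intro ψ hψ
  have hU : 0 ≤ U := (norm_nonneg _).trans (hv 0)
  obtain ⟨D', hD'⟩ := lipschitzWith_of_contDiff hψ.1 hψ.2.1
  obtain ⟨D, S, hS, hl, h0, hd, hTz⟩ := h.comp_test hψ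
  have hsnd : AEStronglyMeasurable (fun p : ℝ × Plane => ρ₀ p.2) (slab T) := hρ0.comp_snd
  have key := integral_slab_deriv hT (A := fun p => ψ (p.1, X p.1 p.2) • ρ₀ p.2)
    (A' := fun p => fderiv ℝ ψ (p.1, X p.1 p.2) (1, V p.1 p.2) • ρ₀ p.2) (M := D' * (1 + U) * M0) hS
    ((h.continuous_fderiv_test hψ).aestronglyMeasurable.smul hsnd) ?_ (fun p hp => by simp [h0 p hp])
    (fun x => exists_lipschitzOnWith_smul (hl x) (LipschitzWith.const (ρ₀ x)) 0 T)
    (fun x => by simp [hTz]) (ae_of_all _ fun x => ?_)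
  · rw [h.toIsBiLip.symm.integral_eq] at key
    refine Eq.trans ?_ key
    congr 1
    · refine integral_congr_ae (ae_of_all _ fun p => ?_)
      simp only [eulerDensity, eulerVelocity, h.right_inv, smul_eq_mul]
      ring
    · simp [h.X_zero, mul_comm]
  · filter_upwards [slab_ae_of_ae_snd (T := T) hM0] with p hp
    rw [norm_smul]
    exact mul_le_mul (h.norm_fderiv_test_le hU hv hD' p) hp (norm_nonneg _) (by positivity)
  · rw [← restrict_Ioo_eq_restrict_Icc]
    filter_upwards [ae_restrict_mem measurableSet_Ioo] with t ht
    exact (hd x t ht).smul_const _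

/-- The transported density and the velocity of the flow solve the momentum equation. -/
theorem solvesMomentum (h : IsParticleFlow T ε b v C X Y V) (hT : 0 < T) (hv : ∀ x, ‖v x‖ ≤ U)
    (hb : Continuous b) (hbB : ∀ x, ‖b x / ε‖ ≤ B)
    (hρ0 : AEStronglyMeasurable ρ₀ volume) (hM0 : ∀ᵐ x, ‖ρ₀ x‖ ≤ M0) :
    SolvesMomentum T ε b ρ₀ v (eulerDensity ρ₀ Y) (eulerVelocity V Y) := by
  intro ψ hψ
  have hU : 0 ≤ U := (norm_nonneg _).trans (hv 0)
  have hB : 0 ≤ B := (norm_nonneg _).trans (hbB 0)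
  obtain ⟨D', hD'⟩ := lipschitzWith_of_contDiff hψ.1 hψ.2.1
  obtain ⟨Bψ, hBψ⟩ := hψ.1.continuous.bounded_above_of_compact_support hψ.2.1
  have hBψ0 : 0 ≤ Bψ := (norm_nonneg _).trans (hBψ 0)
  obtain ⟨D, S, hS, hl, h0, hd, hTz⟩ := h.comp_test hψ
  have hsnd : AEStronglyMeasurable (fun p : ℝ × Plane => ρ₀ p.2) (slab T) := hρ0.comp_snd
  have hVc := h.lipV.continuous
  have hXc := h.lipX.continuous
  have hψX : Continuous fun p : ℝ × Plane => ψ (p.1, X p.1 p.2) :=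
    hψ.1.continuous.comp (continuous_fst.prodMk hXc)
  have hF : Continuous fun p : ℝ × Plane => (b (X p.1 p.2) / ε) • perp (V p.1 p.2) :=
    ((hb.comp hXc).div_const ε).smul (continuous_perp.comp hVc)
  have hm : AEStronglyMeasurable (fun p : ℝ × Plane => fderiv ℝ ψ (p.1, X p.1 p.2) (1, V p.1 p.2) • (ρ₀ p.2 • V p.1 p.2) +
      ψ (p.1, X p.1 p.2) • (ρ₀ p.2 • ((b (X p.1 p.2) / ε) • perp (V p.1 p.2)))) (slab T) :=
    ((h.continuous_fderiv_test hψ).aestronglyMeasurable.smul (hsnd.smul hVc.aestronglyMeasurable)).add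
      (hψX.aestronglyMeasurable.smul (hsnd.smul hF.aestronglyMeasurable))
  have hbd : ∀ᵐ p ∂slab T, ‖fderiv ℝ ψ (p.1, X p.1 p.2) (1, V p.1 p.2) • (ρ₀ p.2 • V p.1 p.2) +
      ψ (p.1, X p.1 p.2) • (ρ₀ p.2 • ((b (X p.1 p.2) / ε) • perp (V p.1 p.2)))‖ ≤
      D' * (1 + U) * (M0 * U) + Bψ * (M0 * (B * U)) := by
    filter_upwards [slab_ae_of_ae_snd (T := T) hM0] with p hp
    have hM00 : 0 ≤ M0 := (norm_nonneg _).trans hp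
    refine (norm_add_le _ _).trans ?_
    simp only [norm_smul _ (_ : Plane), norm_perp, h.normV]
    gcongr
    exacts [h.norm_fderiv_test_le hU hv hD' p, hv _, hBψ _, hbB _, hv _]
  have key := integral_slab_deriv hT (A := fun p => ψ (p.1, X p.1 p.2) • (ρ₀ p.2 • V p.1 p.2)) hS hm hbd
    (fun p hp => by simp [h0 p hp])
    (fun x => exists_lipschitzOnWith_smul (hl x) ((LipschitzWith.const_smul_of_lipschitz (lipschitz_time h.lipV x) (ρ₀ x))) 0 T)
    (fun x => by simp [hTz]) (ae_of_all _ fun x => ?_)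
  · rw [h.toIsBiLip.symm.integral_eq] at key
    refine Eq.trans ?_ key
    congr 1
    · refine integral_congr_ae (ae_of_all _ fun p => ?_)
      simp only [eulerDensity, eulerVelocity, h.right_inv, smul_add, smul_smul]
      congr 2 <;> ring
    · simp [h.X_zero, h.V_zero, mul_comm, smul_smul]
  · rw [← restrict_Ioo_eq_restrict_Icc]
    filter_upwards [ae_restrict_mem measurableSet_Ioo] with t ht
    have := (hd x t ht).smul ((h.derivV x t ht).const_smul (ρ₀ x))
    rwa [add_comm] at this

/-- The velocity of the flow solves the velocity equation: it is Lipschitz in time and space, and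
the chain rule along the trajectories holds at almost every point. -/
theorem solvesVelocity (h : IsParticleFlow T ε b v C X Y V) (hT : 0 < T) (hv : ∀ x, ‖v x‖ ≤ U) :
    SolvesVelocity T ε b v (eulerVelocity V Y) := by
  have hU : 0 ≤ U := (norm_nonneg _).trans (hv 0)
  set u : ℝ × Plane → Plane := fun p => eulerVelocity V Y p.1 p.2 with hu
  have hul : LipschitzWith (C * max 1 C) u := h.lip_velocity
  have hus : ∀ t, LipschitzWith (C * max 1 C) (eulerVelocity V Y t) := fun t => lipschitz_slice h.lip_velocity t
  refine ⟨fun i t y => fderiv ℝ (eulerVelocity V Y t) y (basisVec i), fun i => ?_,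
    ae_of_all _ fun t i => isWeakDeriv_fderiv (hus t) _, fun ψ hψ => ?_⟩
  · exact (measurable_fderiv_apply_const_with_param ℝ (f := eulerVelocity V Y) hul.continuous
      (basisVec i)).aestronglyMeasurable
  obtain ⟨D, hD⟩ := lipschitzWith_of_contDiff hψ.1 hψ.2.1
  obtain ⟨Bψ, hBψ⟩ := hψ.1.continuous.bounded_above_of_compact_support hψ.2.1
  have huU : ∀ p, ‖u p‖ ≤ U := fun p => by
    simp only [hu, eulerVelocity, h.normV]; exact hv _
  have hud : ∀ᵐ p ∂slab T, DifferentiableAt ℝ u p := (slab_ac T).ae_le (hul.ae_differentiableAt (μ := volume))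
  have hψd : Differentiable ℝ ψ := hψ.1.differentiable (by simp)
  have hψc : Continuous fun p => fderiv ℝ ψ p (1, 0) :=
    (hψ.1.continuous_fderiv (by simp)).clm_apply continuous_const
  have key := integral_slab_deriv hT (A := fun p => ψ p • u p)
    (A' := fun p => fderiv ℝ ψ p (1, 0) • u p + ψ p • fderiv ℝ u p (1, 0))
    (M := D * ‖((1, 0) : ℝ × Plane)‖ * U + Bψ * ((C * max 1 C : ℝ≥0) * ‖((1, 0) : ℝ × Plane)‖)) hψ.2.1
    ((hψc.aestronglyMeasurable.smul hul.continuous.aestronglyMeasurable).add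
      (hψ.1.continuous.aestronglyMeasurable.smul (stronglyMeasurable_fderiv_apply u _).aestronglyMeasurable))
    (ae_of_all _ fun p => ?_)
    (fun p hp => by simp [image_eq_zero_of_notMem_tsupport hp, fderiv_eq_zero_of_notMem_tsupport hp])
    (fun x => exists_lipschitzOnWith_smul (lipschitz_time (X := fun t x => ψ (t, x)) hD x)
      (lipschitz_time h.lip_velocity x) 0 T)
    (fun x => by
      have h0 : ψ (T, x) = 0 := image_eq_zero_of_notMem_tsupport fun hm => lt_irrefl T (hψ.2.2 hm).1
      show ψ (T, x) • u (T, x) = 0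
      rw [h0, zero_smul]) ?_
  · refine Eq.trans ?_ key
    have hY0 : ∀ x, Y 0 x = x := fun x => by rw [← h.X_zero (Y 0 x), h.right_inv]
    congr 1
    · refine integral_congr_ae ?_
      have hflow : ∀ᵐ p ∂slab T, DifferentiableAt ℝ u p ∧ p.1 ∈ Ioo 0 T := hud.and (slab_ae_mem_Ioo T)
      filter_upwards [hflow] with p ⟨hp, ht⟩
      -- the derivative of `u` along the trajectory through `p`
      have hXp : X p.1 (Y p.1 p.2) = p.2 := h.right_inv _ _
      have e1 : HasDerivAt (fun t => u (t, X t (Y p.1 p.2))) (fderiv ℝ u p (1, u p)) p.1 := by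
        have := hasDerivAt_comp_spacetime (ψ := u) (z := fun t => X t (Y p.1 p.2)) (t := p.1)
          (v := V p.1 (Y p.1 p.2)) (by rw [hXp]; exact hp) (h.derivX _ _ ht)
        rwa [hXp] at this
      have e2 : (fun t => u (t, X t (Y p.1 p.2))) = fun t => V t (Y p.1 p.2) := by
        ext1 t; simp only [hu, eulerVelocity, h.left_inv]
      rw [e2] at e1
      have e3 := e1.unique (h.derivV _ _ ht)
      rw [hXp, spacetime_decomp, map_add, map_add, map_smul, map_smul] at e3
      have e4 : ∀ i, fderiv ℝ u p (0, basisVec i) = fderiv ℝ (eulerVelocity V Y p.1) p.2 (basisVec i) := fun i => by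
        have e5 : HasFDerivAt (fun y => u (p.1, y)) ((fderiv ℝ u p).comp (ContinuousLinearMap.inr ℝ ℝ Plane)) p.2 :=
          HasFDerivAt.comp (f := fun y => (p.1, y)) p.2 hp.hasFDerivAt (hasFDerivAt_prodMk_right p.1 p.2)
        have e6 : fderiv ℝ (eulerVelocity V Y p.1) p.2 = (fderiv ℝ u p).comp (ContinuousLinearMap.inr ℝ ℝ Plane) :=
          e5.fderiv
        rw [e6]; simp
      rw [e4, e4] at e3
      have e7 : u p = V p.1 (Y p.1 p.2) := rfl
      have e8 : fderiv ℝ u p (1, 0) = (b p.2 / ε) • perp (u p) -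
          ∑ i, (u p i) • fderiv ℝ (eulerVelocity V Y p.1) p.2 (basisVec i) := by
        rw [Fin.sum_univ_two, e7, ← e3, ← e7]; abel
      simp only [e8]
      rfl
    · refine integral_congr_ae (ae_of_all _ fun x => ?_)
      simp only [hu, eulerVelocity, hY0, h.V_zero]
  · refine (norm_add_le _ _).trans ?_
    rw [norm_smul, norm_smul]
    have hBψ0 : 0 ≤ Bψ := (norm_nonneg _).trans (hBψ 0)
    gcongr
    exacts [norm_fderiv_apply_le hD _ _, huU p, hBψ p, norm_fderiv_apply_le hul _ _]
  · filter_upwards [slab_ae_slice hud] with x hx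
    filter_upwards [hx] with t ht
    have d1 : HasDerivAt (fun t => ψ (t, x)) (fderiv ℝ ψ (t, x) (1, 0)) t :=
      hasDerivAt_comp_spacetime (hψd _) (hasDerivAt_const t x)
    have d2 : HasDerivAt (fun t => u (t, x)) (fderiv ℝ u (t, x) (1, 0)) t :=
      hasDerivAt_comp_spacetime ht (hasDerivAt_const t x)
    have := d1.smul d2
    rwa [add_comm] at this

end IsParticleFlow
end LagrangianSolution

/-! ### Regularity of the flow -/

section FlowRegularity
variable {b : Plane → ℝ} {v : Plane → Plane} {m B L H Λ U K T ε α : ℝ} {k : ℕ}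

theorem UHol.rot {ι E : Type} [NormedAddCommGroup E] [NormedSpace ℝ E] {I : Set ι} (hα : 0 < α) (hα1 : α ≤ 1)
    {θ : ι → E → ℝ} {w : ι → E → Plane} (hθ : UDer α I k θ) (hw : UHol α I k w) :
    UHol α I k (fun i x => _root_.rot (θ i x) (w i x)) := by
  have h1 := UHol.smul hα hα1 ((UHol.cos_sin hα hα1).1.comp hα hα1 hθ) hw
  have h2 := UHol.smul hα hα1 ((UHol.cos_sin hα hα1).2.comp hα hα1 hθ) (hw.clm perpCLM)
  refine (h1.add h2).congr fun i _ => ?_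
  ext1 x
  rw [rot_apply, perpCLM_apply]

theorem norm_rot_sub_rot_le (θ θ' : ℝ) (w w' : Plane) :
    ‖rot θ w - rot θ' w'‖ ≤ ‖w - w'‖ + ‖w'‖ * |θ - θ'| := by
  have h1 : rot θ w - rot θ' w' = rot θ (w - w') + (rot θ w' - rot θ' w') := by rw [map_sub]; abel
  rw [h1]
  exact (norm_add_le _ _).trans (add_le_add (norm_rot _ _).le (norm_rot_sub_le _ _ _))

/-- The vector field of the particle system as a function of the starting point, the position and
the phase. -/
noncomputable def particleField (ε : ℝ) (b : Plane → ℝ) (v : Plane → Plane) (p : Plane × (Plane × ℝ)) : Plane × ℝ :=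
  (rot (p.2.2 / ε) (v p.1), b p.2.1)

theorem FieldBounds.norm_particleField_sub_le (h : FieldBounds b v m B L H Λ U K) (hε : 0 < ε)
    (p q : Plane × (Plane × ℝ)) :
    ‖particleField ε b v p - particleField ε b v q‖ ≤ (K + U / ε + L) * ‖p - q‖ := by
  have hU := h.U_nonneg; have hL := h.L_nonneg; have hK := h.K_nonneg
  have n0 := norm_nonneg (p - q)
  have n1 : ‖p.1 - q.1‖ ≤ ‖p - q‖ := norm_fst_le (p - q)
  have n2 : ‖p.2 - q.2‖ ≤ ‖p - q‖ := norm_snd_le (p - q)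
  have n3 : ‖p.2.1 - q.2.1‖ ≤ ‖p - q‖ := (norm_fst_le (p.2 - q.2)).trans n2
  have n4 : |p.2.2 - q.2.2| ≤ ‖p - q‖ := (norm_snd_le (p.2 - q.2)).trans n2
  refine max_le (α := ℝ) ?_ ?_
  · refine (norm_rot_sub_rot_le (p.2.2 / ε) (q.2.2 / ε) (v p.1) (v q.1)).trans ?_
    rw [← sub_div, abs_div, abs_of_pos hε]
    have e1 := (h.v_lip p.1 q.1).trans (mul_le_mul_of_nonneg_left n1 hK)
    have e2 : ‖v q.1‖ * (|p.2.2 - q.2.2| / ε) ≤ U * (‖p - q‖ / ε) := by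
      gcongr
      exact h.v_le _
    have e3 : 0 ≤ L * ‖p - q‖ := by positivity
    calc _ ≤ K * ‖p - q‖ + U * (‖p - q‖ / ε) := add_le_add e1 e2
      _ ≤ K * ‖p - q‖ + U * (‖p - q‖ / ε) + L * ‖p - q‖ := by linarith
      _ = _ := by ring
  · have e1 := (h.lip p.2.1 q.2.1).trans (mul_le_mul_of_nonneg_left n3 hL)
    have e3 : 0 ≤ (K + U / ε) * ‖p - q‖ := by positivity
    refine e1.trans ?_
    rw [add_mul]; linarith

theorem UHol.rotated {ι : Type} {I : Set ι} (hα : 0 < α) (hα1 : α ≤ 1) (ε : ℝ) (hv : UHol α I k fun _ => v) :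
    UHol α I k fun _ (p : Plane × (Plane × ℝ)) => _root_.rot (p.2.2 / ε) (v p.1) := by
  have hθ : UDer α I k fun (_ : ι) (p : Plane × (Plane × ℝ)) => p.2.2 / ε := by
    refine (UDer.of_clm (ε⁻¹ • ((ContinuousLinearMap.snd ℝ Plane ℝ).comp
      (ContinuousLinearMap.snd ℝ Plane (Plane × ℝ))))).congr fun t _ => ?_
    ext1 p
    simp [div_eq_inv_mul]
  exact UHol.rot hα hα1 hθ (UHol.comp (f := fun _ => v) hα hα1 hv
    (UDer.of_clm (ContinuousLinearMap.fst ℝ Plane (Plane × ℝ))))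

theorem UHol.particleField {ι : Type} {I : Set ι} (hα : 0 < α) (hα1 : α ≤ 1) (ε : ℝ) (hb : UHol α I k fun _ => b)
    (hv : UHol α I k fun _ => v) : UHol α I k fun _ => _root_.particleField ε b v :=
  (UHol.rotated hα hα1 ε hv).prodMk (UHol.comp (f := fun _ => b) hα hα1 hb
    (UDer.of_clm ((ContinuousLinearMap.fst ℝ Plane ℝ).comp (ContinuousLinearMap.snd ℝ Plane (Plane × ℝ)))))

/-- The flow of the particle system inherits the Hölder regularity of the field and of the initial
velocity. -/
theorem FieldBounds.uDer_flow (h : FieldBounds b v m B L H Λ U K) (hα : 0 < α) (hα1 : α ≤ 1) (hT : 0 ≤ T)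
    (hε : 0 < ε) (hb : UHol α (univ : Set Unit) k fun _ => b) (hv : UHol α (univ : Set Unit) k fun _ => v)
    {X : Plane → ℝ → Plane} {Φ : Plane → ℝ → ℝ} (hX : ∀ x, IsTimeCurve b ε x (v x) (X x) (Φ x)) :
    UDer α (Icc 0 T) k (fun t x => X x t) ∧
      UHol α (Icc 0 T) k (fun t x => rot (Φ x t / ε) (v x)) := by
  have hU := h.U_nonneg; have hL := h.L_nonneg; have hK := h.K_nonneg
  have hb' : UHol α (Icc 0 T) k fun _ : ℝ => b := hb.reindex (φ := fun _ => ()) fun _ _ => mem_univ _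
  have hv' : UHol α (Icc 0 T) k fun _ : ℝ => v := hv.reindex (φ := fun _ => ()) fun _ _ => mem_univ _
  have hc : 0 ≤ K + U / ε + L := by positivity
  have hfc : Continuous (particleField ε b v) :=
    (lipschitzWith_of_norm_le (h.norm_particleField_sub_le hε)).continuous
  have hz : UDer α (Icc 0 T) k (fun t x => (X x t, Φ x t)) := by
    refine UDer.ode (z0 := fun x => (x, (0 : ℝ))) hα hα1 hT hc (h.norm_particleField_sub_le hε)
      (UHol.particleField hα hα1 ε hb' hv')
      (UDer.of_clm (ContinuousLinearMap.inl ℝ Plane ℝ)) (fun x => ?_) fun x t ht => ?_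
    · exact ((hX x).contX.prodMk (hX x).contΦ).continuousOn
    · have hg : Continuous fun s => particleField ε b v (x, (X x s, Φ x s)) :=
        hfc.comp (continuous_const.prodMk ((hX x).contX.prodMk (hX x).contΦ))
      rw [integral_eq_sub_of_nonneg (z := fun s => (X x s, Φ x s)) hg
        (fun s hs => ((hX x).derivX s hs).prodMk ((hX x).derivΦ s hs)) le_rfl ht.1]
      simp [(hX x).X_zero, (hX x).Φ_zero]
  exact ⟨UDer.clm (f := fun t x => (X x t, Φ x t)) (ContinuousLinearMap.fst ℝ Plane ℝ) hz,
    UHol.comp (f := fun _ (p : Plane × (Plane × ℝ)) => rot (p.2.2 / ε) (v p.1))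
      (g := fun t x => (x, (X x t, Φ x t))) hα hα1 (UHol.rotated hα hα1 ε hv')
      (UDer.prodMk (f := fun _ x => x) (UDer.of_clm (ContinuousLinearMap.id ℝ Plane)) hz)⟩

theorem det_eq_of_basisVec (A : Plane →L[ℝ] Plane) :
    A.det = A (basisVec 0) 0 * A (basisVec 1) 1 - A (basisVec 1) 0 * A (basisVec 0) 1 := by
  rw [ContinuousLinearMap.det, ← LinearMap.det_toMatrix (EuclideanSpace.basisFun (Fin 2) ℝ).toBasis,
    Matrix.det_fin_two]
  simp [LinearMap.toMatrix_apply, basisVec]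

theorem UHol.det {ι E : Type} [NormedAddCommGroup E] [NormedSpace ℝ E] {I : Set ι} (hα : 0 < α) (hα1 : α ≤ 1)
    {A : ι → E → (Plane →L[ℝ] Plane)} (hA : UHol α I k A) : UHol α I k (fun i x => (A i x).det) := by
  have hc : ∀ i j : Fin 2, UHol α I k (fun n x => A n x (basisVec i) j) := fun i j =>
    hA.clm ((EuclideanSpace.proj j : Plane →L[ℝ] ℝ).comp
      (ContinuousLinearMap.apply ℝ Plane (basisVec i)))
  refine ((UHol.smul hα hα1 (hc 0 0) (hc 1 1)).sub (UHol.smul hα hα1 (hc 1 0) (hc 0 1))).congr fun i _ => ?_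
  ext1 x
  rw [det_eq_of_basisVec]; rfl

namespace IsParticleFlow
variable {C : ℝ≥0} {X Y V : ℝ → Plane → Plane} {ρ₀ : Plane → ℝ}

theorem uDer_inverse (h : IsParticleFlow T ε b v C X Y V) (hα : 0 < α) (hα1 : α ≤ 1)
    (hX : UDer α (Icc 0 T) k X) : UDer α (Icc 0 T) k Y :=
  hX.inverse hα hα1 (fun t _ => h.right_inv t) (fun t _ => h.left_inv t) C.2 fun t _ =>
    (lipschitz_slice h.lipY t).norm_sub_le

theorem memLinftyW_velocity (h : IsParticleFlow T ε b v C X Y V) (hα : 0 < α) (hα1 : α ≤ 1)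
    (hX : UDer α (Icc 0 T) k X) (hV : UHol α (Icc 0 T) k V) :
    MemLinftyW T (k + α) (eulerVelocity V Y) := by
  obtain ⟨M, hM⟩ := UHol.exists_wBound hα hα1 (hV.comp hα hα1 (h.uDer_inverse hα hα1 hX))
  exact ⟨M, h.lip_velocity.continuous.aestronglyMeasurable,
    (ae_restrict_mem measurableSet_Icc).mono fun t ht => hM t ht⟩

/-- The Jacobian of a `C¹` flow has a constant sign, so taking its absolute value does not harm its
regularity. -/
theorem uHol_jac (h : IsParticleFlow T ε b v C X Y V) (hα : 0 < α) (hα1 : α ≤ 1)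
    (hX : UDer α (Icc 0 T) (k + 1) X) : UHol α (Icc 0 T) k (fun t y => jac Y (t, y)) := by
  have hY := h.uDer_inverse hα hα1 hX
  have hd := UHol.det hα hα1 hY.2
  -- `|det| = sign · det`, where the sign at the origin serves for all points
  have hs : UHol α (Icc 0 T) k fun t (_ : Plane) => (SignType.sign (fderiv ℝ (Y t) 0).det : ℝ) := by
    refine UHol.const (M := 1) fun t _ => ?_
    rcases lt_trichotomy (fderiv ℝ (Y t) 0).det 0 with h0 | h0 | h0 <;> simp [h0]
  refine (UHol.smul hα hα1 hs hd).congr fun t ht => ?_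
  ext1 y
  have hne : ∀ y, (fderiv ℝ (Y t) y).det ≠ 0 := fun y =>
    abs_pos.1 (h.toIsBiLip.symm.jac_pos (p := (t, y)) (hY.1 t ht y))
  have hc : Continuous fun y => (fderiv ℝ (Y t) y).det := hd.continuous hα hα1 ht
  have hsame : SignType.sign (fderiv ℝ (Y t) 0).det = SignType.sign (fderiv ℝ (Y t) y).det := by
    by_contra hcon
    have : (0 : ℝ) ∈ range fun y => (fderiv ℝ (Y t) y).det := by
      rcases lt_or_gt_of_ne (hne 0) with a | a <;> rcases lt_or_gt_of_ne (hne y) with a' | a'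
      · exact absurd (by rw [sign_neg a, sign_neg a']) hcon
      · exact mem_range_of_exists_le_of_exists_ge hc ⟨0, a.le⟩ ⟨y, a'.le⟩
      · exact mem_range_of_exists_le_of_exists_ge hc ⟨y, a'.le⟩ ⟨0, a.le⟩
      · exact absurd (by rw [sign_pos a, sign_pos a']) hcon
    obtain ⟨z, hz⟩ := this
    exact hne z hz
  simp only [smul_eq_mul, hsame, jac]
  exact sign_mul_self _

theorem memLinftyW_density (h : IsParticleFlow T ε b v C X Y V) (hα : 0 < α) (hα1 : α ≤ 1)
    (hX : UDer α (Icc 0 T) (k + 1) X) (hρ : UHol α (univ : Set Unit) k fun _ => ρ₀) :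
    MemLinftyW T (k + α) (eulerDensity ρ₀ Y) := by
  have hρ' : UHol α (Icc 0 T) k fun _ : ℝ => ρ₀ := hρ.reindex (φ := fun _ => ()) fun _ _ => mem_univ _
  have hY := h.uDer_inverse hα hα1 hX
  have hr : UHol α (Icc 0 T) k (eulerDensity ρ₀ Y) :=
    UHol.smul hα hα1 (hρ'.comp hα hα1 (hY.pred hα hα1)) (h.uHol_jac hα hα1 hX)
  obtain ⟨M, hM⟩ := UHol.exists_wBound hα hα1 hr
  exact ⟨M, h.aestronglyMeasurable_density (hρ.continuous hα hα1 (mem_univ ())).aestronglyMeasurable,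
    (ae_restrict_mem measurableSet_Icc).mono fun t ht => hM t ht⟩

/-- For `s = 1` the flow is merely bi-Lipschitz and the initial density merely bounded. -/
theorem memLinftyW_density_zero (h : IsParticleFlow T ε b v C X Y V) (hρ : StronglyMeasurable ρ₀) {M : ℝ}
    (hM : ∀ x, ‖ρ₀ x‖ ≤ M) : MemLinftyW T 0 (eulerDensity ρ₀ Y) := by
  obtain ⟨J, hJ⟩ := h.toIsBiLip.symm.exists_jac_le
  have hM0 : 0 ≤ M := (norm_nonneg _).trans (hM 0)
  refine ⟨M * J, h.aestronglyMeasurable_density hρ.aestronglyMeasurable, ae_of_all _ fun t => ?_⟩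
  rw [WBound, Nat.floor_zero]
  refine ⟨?_, ae_of_all _ fun y => ?_, fun h0 => absurd h0 (by simp)⟩
  · refine StronglyMeasurable.aestronglyMeasurable (StronglyMeasurable.mul ?_ ?_)
    · exact hρ.comp_measurable (lipschitz_slice h.lipY t).continuous.measurable
    · exact (h.toIsBiLip.symm.measurable_jac.comp measurable_prodMk_left).stronglyMeasurable
  · rw [eulerDensity, norm_mul, Real.norm_of_nonneg (jac_nonneg _ _)]
    exact mul_le_mul (hM _) (hJ _) (jac_nonneg _ _) hM0

end IsParticleFlow
end FlowRegularity

/-! ### Constants of the magnetic field -/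

section FieldHypotheses
variable {b : Plane → ℝ} {v : Plane → Plane} {m : ℝ}

/-- A continuous function has the Hölder regularity of its Sobolev class. -/
theorem MemW.uHol_of_continuous {F : Type} [NormedAddCommGroup F] [NormedSpace ℝ F] [FiniteDimensional ℝ F]
    {k : ℕ} {α : ℝ} (hα : 0 < α) (hα1 : α ≤ 1) {f : Plane → F}
    (h : MemW (k + α) f) (hf : Continuous f) : UHol α (univ : Set Unit) k fun _ => f := by
  obtain ⟨f', hf', hk⟩ := h.exists_uHol_rep hα hα1
  have hc : Continuous f' := hk.continuous hα hα1 (mem_univ ())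
  rw [(hf.ae_eq_iff_eq volume hc).1 hf']
  exact hk

theorem uHol_one_of_memW_two (hb : MemW 2 b) (hc : Continuous b) : UHol 1 (univ : Set Unit) 1 fun _ => b := by
  refine MemW.uHol_of_continuous one_pos le_rfl ?_ hc
  norm_num
  exact hb

/-- The magnetic field has at least the regularity of the velocity. -/
theorem uHol_field {k : ℕ} {α : ℝ} (hα : 0 < α) (hα1 : α ≤ 1) (hc : Continuous b) (hb : MemW 2 b)
    (hbs : 2 < k + α → MemW (k + α) b) : UHol α (univ : Set Unit) k fun _ => b := by
  by_cases h2 : 2 < k + α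
  · exact (hbs h2).uHol_of_continuous hα hα1 hc
  have h1 := uHol_one_of_memW_two hb hc
  have h1α : UHol α (univ : Set Unit) 1 fun _ => b := by
    obtain ⟨M, -, hM⟩ := h1.2.2.bdd
    obtain ⟨N, hN⟩ := h1.2.2
    exact ⟨h1.1, h1.2.1, .of_bdd_lip hα hα1 hM fun i hi x y => by simpa using (hN i hi).2 x y⟩
  have hk : k ≤ 1 := by
    by_contra hk
    have : (2 : ℝ) ≤ k := by exact_mod_cast (by omega : 2 ≤ k)
    linarith
  exact h1α.mono hα hα1 hk

theorem norm_gradient (f : Plane → ℝ) (x : Plane) : ‖gradient f x‖ = ‖fderiv ℝ f x‖ :=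
  LinearIsometryEquiv.norm_map _ _

theorem eLpNorm_top_lt_top {F : Type} [NormedAddCommGroup F] {f : Plane → F} {M : ℝ} (h : ∀ᵐ x, ‖f x‖ ≤ M) :
    eLpNorm f ∞ volume < ⊤ := by
  rw [eLpNorm_exponent_top]; exact eLpNormEssSup_lt_top_of_ae_bound h

/-- For a continuous function the essential supremum is an upper bound at every point. -/
theorem norm_le_toReal_eLpNorm_top {F : Type} [NormedAddCommGroup F] {f : Plane → F} (hf : Continuous f)
    (h : eLpNorm f ∞ volume < ⊤) (x : Plane) : ‖f x‖ ≤ (eLpNorm f ∞ volume).toReal := by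
  refine le_of_ae_le_of_continuous (f := fun x => ‖f x‖) (g := fun _ => (eLpNorm f ∞ volume).toReal)
    hf.norm continuous_const ?_ x
  rw [eLpNorm_exponent_top] at h ⊢
  filter_upwards [ae_le_eLpNormEssSup (f := f) (μ := volume)] with x hx
  rw [← toReal_enorm]
  exact ENNReal.toReal_mono h.ne hx

variable (hb : ContDiff ℝ ∞ b) (hb2 : MemW 2 b) (hm : 0 < m) (hmb : ∀ x, m ≤ b x)
include hb hm hmb

theorem contDiff_log_field : ContDiff ℝ ∞ fun x => Real.log (b x) :=
  hb.log fun x => (hm.trans_le (hmb x)).ne'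

theorem continuous_gradient_log : Continuous (gradient fun x => Real.log (b x)) :=
  (LinearIsometryEquiv.continuous _).comp ((contDiff_log_field hb hm hmb).continuous_fderiv (by simp))

include hb2

theorem eLpNorm_gradient_log_lt_top : eLpNorm (gradient fun x => Real.log (b x)) ∞ volume < ⊤ := by
  obtain ⟨N, hN0, hN⟩ := (uHol_one_of_memW_two hb2 hb.continuous).2.2.bdd
  refine eLpNorm_top_lt_top (M := m⁻¹ * N) (ae_of_all _ fun x => ?_)
  have hx := hm.trans_le (hmb x)
  rw [norm_gradient, fderiv.log (hb.differentiable (by simp) x) hx.ne', norm_smul, norm_inv, Real.norm_of_nonneg hx.le]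
  gcongr
  · exact hmb x
  · exact hN () (mem_univ _) x

/-- The constants of the guiding-centre estimates. -/
theorem exists_fieldBounds {U K : ℝ} (hK : 0 ≤ K) (hv : ∀ x, ‖v x‖ ≤ U) (hvK : ∀ x y, ‖v x - v y‖ ≤ K * ‖x - y‖) :
    ∃ B L H, FieldBounds b v m B L H
      (eLpNorm (gradient fun x => Real.log (b x)) ∞ volume).toReal U K := by
  have hb1 := uHol_one_of_memW_two hb2 hb.continuous
  have hpos : ∀ x, 0 < b x := fun x => hm.trans_le (hmb x)
  obtain ⟨B, hB0, hB⟩ := hb1.bdd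
  obtain ⟨L₁, hL₁0, hL₁⟩ := (show UDer 1 (univ : Set Unit) 1 fun _ => b from hb1.2).lip
  have hinv : ∀ x y, |(b x)⁻¹ - (b y)⁻¹| ≤ (m⁻¹ * m⁻¹ * L₁) * ‖x - y‖ := fun x y => by
    have hx := hpos x; have hy := hpos y
    have e : (b x)⁻¹ - (b y)⁻¹ = (b x)⁻¹ * (b y)⁻¹ * (b y - b x) := by field_simp
    rw [e, abs_mul, abs_mul, abs_inv, abs_inv, abs_of_pos hx, abs_of_pos hy, abs_sub_comm, mul_assoc (m⁻¹ * m⁻¹)]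
    have h1 : |b x - b y| ≤ L₁ * ‖x - y‖ := hL₁ () (mem_univ _) x y
    have h2 := hmb x; have h3 := hmb y
    gcongr
  have hi : UHol 1 (univ : Set Unit) 0 fun _ x => (b x)⁻¹ :=
    .of_bdd_lip one_pos le_rfl (M := m⁻¹) (fun _ _ x => by
      rw [norm_inv, Real.norm_of_nonneg (hpos x).le]; exact inv_anti₀ hm (hmb x)) fun _ _ => hinv
  have hg : UHol 1 (univ : Set Unit) 0 fun _ x => ((b x)⁻¹ * ((b x)⁻¹ * (b x)⁻¹)) • fderiv ℝ b x :=
    UHol.smul one_pos le_rfl (UHol.smul one_pos le_rfl hi (UHol.smul one_pos le_rfl hi hi)) hb1.2.2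
  obtain ⟨H, hH0, hH⟩ := hg.zero_bounds
  have hc : ∀ x, (b x)⁻¹ ^ 3 = (b x)⁻¹ * ((b x)⁻¹ * (b x)⁻¹) := fun x => by ring
  refine ⟨B, max (max L₁ (m⁻¹ * m⁻¹ * L₁)) H, H, ⟨hm, hH0, le_max_of_le_right hH0, ENNReal.toReal_nonneg, hK, hmb,
    fun x => (le_abs_self _).trans (hB () (mem_univ _) x), hb.differentiable (by simp), fun x y => ?_, fun x y => ?_,
    fun x => ?_, fun x y => ?_, fun x y => ?_, hv, hvK⟩⟩
  · refine (hL₁ () (mem_univ _) x y).trans ?_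
    gcongr
    exact (le_max_left _ _).trans (le_max_left _ _)
  · refine (hinv x y).trans ?_
    gcongr
    exact (le_max_right _ _).trans (le_max_left _ _)
  · rw [hc]; exact (hH () (mem_univ _)).1 x
  · rw [hc, hc]
    have := (hH () (mem_univ _)).2 x y
    rw [Real.rpow_one] at this
    refine this.trans ?_
    gcongr
    exact le_max_right _ _
  · refine (convex_univ (𝕜 := ℝ)).norm_image_sub_le_of_norm_fderiv_le (𝕜 := ℝ) (f := fun x => Real.log (b x))
      (fun z _ => (contDiff_log_field hb hm hmb).differentiable (by simp) z) (fun z _ => ?_) (mem_univ y) (mem_univ x)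
    rw [← norm_gradient]
    exact norm_le_toReal_eLpNorm_top (continuous_gradient_log hb hm hmb)
      (eLpNorm_gradient_log_lt_top hb hb2 hm hmb) z

omit hb hb2 hm hmb
/-- The condition `T < T^*` in terms of real numbers. -/
theorem mul_lt_one_of_lt_inv {A N : ℝ≥0∞} {T : ℝ} (hT : 0 < T)
    (h : ENNReal.ofReal T < (A * N)⁻¹) : T * (A.toReal * N.toReal) < 1 := by
  have h1 : A * N < (ENNReal.ofReal T)⁻¹ := ENNReal.lt_inv_iff_lt_inv.1 h
  rw [← ENNReal.ofReal_inv_of_pos hT] at h1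
  have h2 := ENNReal.toReal_lt_of_lt_ofReal h1
  rw [ENNReal.toReal_mul] at h2
  calc T * (A.toReal * N.toReal) < T * T⁻¹ := by gcongr
    _ = 1 := mul_inv_cancel₀ hT.ne'

end FieldHypotheses

/-! ### Oscillations of the velocity -/

section Oscillation
variable {b : Plane → ℝ} {v : Plane → Plane} {m B L H Λ U K ε T : ℝ}

namespace FieldBounds

/-- A bound on `∇(1/b)`. -/
theorem norm_fderiv_inv_le (h : FieldBounds b v m B L H Λ U K) (x : Plane) :
    ‖((b x)⁻¹ ^ 2) • fderiv ℝ b x‖ ≤ B * H := by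
  have hp := h.pos x
  have e : ((b x)⁻¹ ^ 2) • fderiv ℝ b x = b x • ((b x)⁻¹ ^ 3) • fderiv ℝ b x := by
    rw [smul_smul]; congr 1; field_simp
  rw [e, norm_smul, Real.norm_of_nonneg hp.le]
  have := h.B_pos
  exact mul_le_mul (h.upper x) (h.grad_le x) (norm_nonneg _) this.le

/-- Particles stay close to their starting point: the guiding centre `X + (ε/b(X)) (X')^⊥`
has velocity of order `ε`. -/
theorem norm_timeCurve_sub_le (h : FieldBounds b v m B L H Λ U K) (hε : 0 < ε) {x : Plane} {X : ℝ → Plane}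
    {Φ : ℝ → ℝ} (hX : IsTimeCurve b ε x (v x) X Φ) : ∀ t ∈ Icc 0 T,
    ‖X t - x‖ ≤ (2 * (U * m⁻¹) + T * (B * H * U * U)) * ε := fun t ht => by
  have hU := h.U_nonneg; have hm := h.m_pos; have hB := h.B_pos; have hH := h.H_nonneg
  set a := v x
  have ha : ‖a‖ ≤ U := h.v_le x
  set P : ℝ → Plane := fun t => (ε * (b (X t))⁻¹) • rot (Φ t / ε) (perp a) with hP
  have hPn : ∀ t, ‖P t‖ ≤ (U * m⁻¹) * ε := fun t => by
    have h1 := h.inv_le (X t)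
    have h2 := (h.inv_pos (X t)).le
    rw [hP, norm_smul, norm_rot, norm_perp, norm_mul, Real.norm_of_nonneg hε.le, Real.norm_of_nonneg h2]
    calc ε * (b (X t))⁻¹ * ‖a‖ ≤ ε * m⁻¹ * U := by gcongr
      _ = _ := by ring
  have hd : ∀ s, 0 ≤ s → HasDerivAt (fun s => X s + P s)
      (-(ε * (((b (X s))⁻¹ ^ 2) • fderiv ℝ b (X s)) (rot (Φ s / ε) a)) • rot (Φ s / ε) (perp a)) s := fun s hs => by
    have hp := (h.pos (X s)).ne'
    have h1 := ((h.diff (X s)).hasFDerivAt.comp_hasDerivAt s (hX.derivX s hs)).inv hp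
    have h2 := hasDerivAt_rot ((hX.derivΦ s hs).div_const ε) (hasDerivAt_const s (perp a))
    refine ((hX.derivX s hs).add ((h1.const_mul ε).smul h2)).congr_deriv ?_
    simp only [Pi.inv_apply, Function.comp, map_zero, add_zero, perp_rot, perp_perp, map_neg, smul_neg, smul_smul,
      smul_apply, smul_eq_mul]
    have e : ε * (b (X s))⁻¹ * (b (X s) / ε) = 1 := by field_simp
    have e' : -(ε * (((b (X s))⁻¹ ^ 2) * (fderiv ℝ b (X s)) (rot (Φ s / ε) a))) =
      ε * (-(fderiv ℝ b (X s)) (rot (Φ s / ε) a) / b (X s) ^ 2) := by field_simp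
    rw [e, e', one_smul]
    abel
  have key := norm_sub_le_of_deriv_bound (N := B * H * U * U * ε) (S := T) hd (fun s _ => by
    rw [norm_smul, norm_rot, norm_perp, norm_neg, norm_mul, Real.norm_of_nonneg hε.le]
    have h1 := (((b (X s))⁻¹ ^ 2) • fderiv ℝ b (X s)).le_of_opNorm_le (h.norm_fderiv_inv_le (X s)) (rot (Φ s / ε) a)
    rw [norm_rot] at h1
    calc _ ≤ ε * (B * H * ‖a‖) * ‖a‖ := by gcongr
      _ ≤ ε * (B * H * U) * U := by gcongr
      _ = _ := by ring) t ht
  have e : X t - x = (X t + P t - (X 0 + P 0)) - P t + P 0 := by rw [hX.X_zero]; abel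
  rw [e]
  have n1 := norm_add_le ((X t + P t - (X 0 + P 0)) - P t) (P 0)
  have n2 := norm_sub_le (X t + P t - (X 0 + P 0)) (P t)
  have n3 := hPn t
  have n4 := hPn 0
  have n5 : B * H * U * U * ε * t ≤ B * H * U * U * ε * T := by gcongr; exact ht.2
  linarith

/-- The angle of the velocity is `t b(x) / ε` up to a bounded error. -/
theorem abs_phase_sub_le (h : FieldBounds b v m B L H Λ U K) {C : ℝ} {x : Plane} {X : ℝ → Plane}
    {Φ : ℝ → ℝ} (hX : IsTimeCurve b ε x (v x) X Φ) (hC : ∀ t ∈ Icc 0 T, ‖X t - x‖ ≤ C) :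
    ∀ t ∈ Icc 0 T, |Φ t - t * b x| ≤ L * C * t := fun t ht => by
  have hL := h.L_nonneg
  have hd : ∀ s, 0 ≤ s → HasDerivAt (fun s => Φ s - s * b x) (b (X s) - 1 * b x) s := fun s hs =>
    (hX.derivΦ s hs).sub ((hasDerivAt_id s).mul_const (b x))
  have := norm_sub_le_of_deriv_bound (N := L * C) hd (fun s hs => by
    rw [one_mul]
    exact (h.lip _ _).trans (by gcongr; exact hC s hs)) t ht
  simpa [hX.Φ_zero] using this

/-- Phases stay as close as the trajectories do. -/
theorem abs_phase_sub_phase_le (h : FieldBounds b v m B L H Λ U K) {x y a a' : Plane} {X X' : ℝ → Plane}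
    {Φ Φ' : ℝ → ℝ} (hX : IsTimeCurve b ε x a X Φ) (hX' : IsTimeCurve b ε y a' X' Φ') {C : ℝ}
    (hC : ∀ t ∈ Icc 0 T, ‖X t - X' t‖ ≤ C) : ∀ t ∈ Icc 0 T, |Φ t - Φ' t| ≤ L * C * t := fun t ht => by
  have hL := h.L_nonneg
  have := norm_sub_le_of_deriv_bound (N := L * C) (fun s hs => (hX.derivΦ s hs).sub (hX'.derivΦ s hs))
    (fun s hs => (h.lip _ _).trans (by gcongr; exact hC s hs)) t ht
  simpa [hX.Φ_zero, hX'.Φ_zero] using this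

/-- Near a point where neither the velocity nor the gradient of the field vanishes, there are two
particles at distance `O(ε)` with opposite angles, so the velocity oscillates on the scale `ε`. -/
theorem exists_oscillation (h : FieldBounds b v m B L H Λ U K) (hT : 0 < T) {ε₀ q : ℝ} (hq0 : 0 ≤ q)
    (hcon : ∀ ε : ℝ, 0 < ε → ε ≤ ε₀ →
      ∀ (X : Plane → ℝ → Plane) (Φ : Plane → ℝ → ℝ), (∀ x, IsTimeCurve b ε x (v x) (X x) (Φ x)) →
      ∀ t ∈ Icc 0 T, ∀ x y, ‖X y t - X x t - (y - x)‖ ≤ q * ‖y - x‖)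
    {x₀ : Plane} (hv : v x₀ ≠ 0) (hb : fderiv ℝ b x₀ ≠ 0) :
    ∃ R ε₁ : ℝ, 0 < ε₁ ∧ ∀ ε : ℝ, 0 < ε → ε ≤ ε₀ → ε ≤ ε₁ →
      ∀ (X : Plane → ℝ → Plane) (Φ : Plane → ℝ → ℝ), (∀ x, IsTimeCurve b ε x (v x) (X x) (Φ x)) →
      ∀ t ∈ Icc (T / 2) T, ∃ y, ‖X y t - X x₀ t‖ ≤ R * ε ∧
        ‖v x₀‖ ≤ ‖rot (Φ y t / ε) (v y) - rot (Φ x₀ t / ε) (v x₀)‖ := by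
  have hU := h.U_nonneg; have hm := h.m_pos; have hB := h.B_pos; have hH := h.H_nonneg
  have hL := h.L_nonneg; have hK := h.K_nonneg
  -- a direction in which the field increases, at rate at least `c / 2` up to distance `δ`
  obtain ⟨w, hw⟩ : ∃ w, 0 < fderiv ℝ b x₀ w := by
    obtain ⟨w, hw⟩ := DFunLike.ne_iff.1 hb
    rcases lt_or_gt_of_ne hw with h1 | h1
    · exact ⟨-w, by rw [map_neg]; simpa using h1⟩
    · exact ⟨w, h1⟩
  set c := fderiv ℝ b x₀ w with hc
  have hd : HasDerivAt (fun r : ℝ => b (x₀ + r • w)) c 0 := by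
    have h1 : HasDerivAt (fun r : ℝ => x₀ + r • w) w 0 := by
      simpa using ((hasDerivAt_id (0 : ℝ)).smul_const w).const_add x₀
    have h2 : HasFDerivAt b (fderiv ℝ b x₀) (x₀ + (0 : ℝ) • w) := by
      simpa using (h.diff x₀).hasFDerivAt
    exact h2.comp_hasDerivAt 0 h1
  obtain ⟨δ, hδ, hinc⟩ : ∃ δ > 0, ∀ r, 0 ≤ r → r < δ → b x₀ + c / 2 * r ≤ b (x₀ + r • w) := by
    have h1 := (hasDerivAt_iff_isLittleO.1 hd).def (half_pos hw)
    obtain ⟨δ, hδ, h2⟩ := Metric.eventually_nhds_iff.1 h1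
    refine ⟨δ, hδ, fun r hr0 hr => ?_⟩
    have h3 := h2 (y := r) (by simpa [abs_of_nonneg hr0] using hr)
    simp only [zero_smul, add_zero, sub_zero, smul_eq_mul, Real.norm_eq_abs, abs_of_nonneg hr0] at h3
    have h4 := (abs_le.1 h3).1
    linarith
  set C := 2 * (U * m⁻¹) + T * (B * H * U * U) with hC
  have hC0 : 0 ≤ C := by positivity
  -- over the distance `κ ε |w|` the angles differ by at least `π`
  set κ := (2 * (L * C * T) + Real.pi) / (T * c / 4) with hκ
  have hκ0 : 0 < κ := by have := Real.pi_pos; positivity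
  have hvn : 0 < ‖v x₀‖ := norm_pos_iff.2 hv
  refine ⟨(1 + q) * (κ * ‖w‖), min (δ / (2 * κ)) (‖v x₀‖ / (K * (κ * ‖w‖) + 1)), by positivity,
    fun ε hε hε₀ hε₁ X Φ hX t ht => ?_⟩
  have ht0 : t ∈ Icc 0 T := ⟨by linarith [ht.1], ht.2⟩
  have hcon' := hcon ε hε hε₀ X Φ hX
  have hlip : ∀ s ∈ Icc 0 T, ∀ x y, ‖X y s - X x s‖ ≤ (1 + q) * ‖y - x‖ := fun s hs x y => by
    have h1 := hcon' s hs x y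
    have h2 := norm_add_le (X y s - X x s - (y - x)) (y - x)
    rw [sub_add_cancel] at h2
    linarith
  have hΦc : Continuous fun x => Φ x t := by
    refine (lipschitzWith_of_norm_le (f := fun x => Φ x t) (C := L * (1 + q) * T) fun x y => ?_).continuous
    have h1 := h.abs_phase_sub_phase_le (hX x) (hX y) (fun s hs => hlip s hs y x) t ht0
    refine h1.trans ?_
    have h2 := norm_nonneg (x - y)
    calc L * ((1 + q) * ‖x - y‖) * t ≤ L * ((1 + q) * ‖x - y‖) * T := by gcongr; exact ht.2
      _ = _ := by ring
  have hphase : ∀ x, |Φ x t - t * b x| ≤ L * C * T * ε := fun x => by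
    have h1 := h.abs_phase_sub_le (hX x) (h.norm_timeCurve_sub_le hε (hX x)) t ht0
    refine h1.trans ?_
    calc L * (C * ε) * t ≤ L * (C * ε) * T := by gcongr; exact ht.2
      _ = _ := by ring
  have hr : κ * ε < δ := by
    have : ε ≤ δ / (2 * κ) := hε₁.trans (min_le_left _ _)
    rw [le_div_iff₀ (by positivity)] at this
    nlinarith
  have hgap : Real.pi * ε ≤ Φ (x₀ + (κ * ε) • w) t - Φ x₀ t := by
    have h1 := hinc (κ * ε) (by positivity) hr
    have h2 := (abs_le.1 (hphase (x₀ + (κ * ε) • w))).1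
    have h3 := (abs_le.1 (hphase x₀)).2
    have h4 : T / 2 * (c / 2 * (κ * ε)) ≤ t * (b (x₀ + (κ * ε) • w) - b x₀) := by
      apply mul_le_mul ht.1 (by linarith) (by positivity) ht0.1
    have h5 : T / 2 * (c / 2 * (κ * ε)) = (2 * (L * C * T) + Real.pi) * ε := by
      rw [hκ]; field_simp; ring
    rw [h5] at h4
    linarith
  -- a point where the angles differ by exactly `π`
  obtain ⟨r, hr', hΦr⟩ : ∃ r ∈ Icc 0 (κ * ε), Φ (x₀ + r • w) t - Φ x₀ t = Real.pi * ε := by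
    refine intermediate_value_Icc (f := fun r : ℝ => Φ (x₀ + r • w) t - Φ x₀ t) (by positivity)
      (Continuous.continuousOn ?_) ⟨?_, hgap⟩
    · exact (hΦc.comp (by fun_prop : Continuous fun r : ℝ => x₀ + r • w)).sub continuous_const
    · have := Real.pi_pos
      simp only [zero_smul, add_zero, sub_self]; positivity
  set y := x₀ + r • w with hy
  have hyx : ‖y - x₀‖ ≤ κ * ‖w‖ * ε := by
    rw [hy, add_sub_cancel_left, norm_smul, Real.norm_of_nonneg hr'.1]
    calc r * ‖w‖ ≤ κ * ε * ‖w‖ := by gcongr; exact hr'.2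
      _ = _ := by ring
  refine ⟨y, ?_, ?_⟩
  · refine (hlip t ht0 x₀ y).trans ?_
    rw [mul_assoc (1 + q)]
    gcongr
  · have hang : Φ y t / ε = Φ x₀ t / ε + Real.pi := by
      field_simp; linarith
    have hopp : rot (Φ y t / ε) (v y) = -rot (Φ x₀ t / ε) (v y) := by
      rw [hang, rot_apply, rot_apply, Real.cos_add_pi, Real.sin_add_pi]
      simp only [neg_smul]; abel
    have e : rot (Φ y t / ε) (v y) - rot (Φ x₀ t / ε) (v x₀) =
        -(rot (Φ x₀ t / ε) ((2 : ℝ) • v x₀ + (v y - v x₀))) := by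
      rw [hopp, map_add, map_sub, map_smul, two_smul]; abel
    rw [e, norm_neg, norm_rot]
    have h1 := norm_sub_le ((2 : ℝ) • v x₀ + (v y - v x₀)) (v y - v x₀)
    rw [add_sub_cancel_right, norm_smul, Real.norm_of_nonneg zero_le_two] at h1
    have h2 : ‖v y - v x₀‖ ≤ ‖v x₀‖ := by
      refine (h.v_lip _ _).trans ?_
      have h3 : ε ≤ ‖v x₀‖ / (K * (κ * ‖w‖) + 1) := hε₁.trans (min_le_right _ _)
      rw [le_div_iff₀ (by positivity)] at h3
      calc K * ‖y - x₀‖ ≤ K * (κ * ‖w‖ * ε) := by gcongr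
        _ ≤ ε * (K * (κ * ‖w‖) + 1) := by linarith
        _ ≤ _ := h3
    linarith

/-- Oscillations of fixed size on the scale `ε` exclude any uniform modulus of continuity. -/
theorem exists_not_linftyWBound (h : FieldBounds b v m B L H Λ U K) (hT : 0 < T) {ε₀ q : ℝ} (hq0 : 0 ≤ q)
    (hcon : ∀ ε : ℝ, 0 < ε → ε ≤ ε₀ →
      ∀ (X : Plane → ℝ → Plane) (Φ : Plane → ℝ → ℝ), (∀ x, IsTimeCurve b ε x (v x) (X x) (Φ x)) →
      ∀ t ∈ Icc 0 T, ∀ x y, ‖X y t - X x t - (y - x)‖ ≤ q * ‖y - x‖)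
    {x₀ : Plane} (hv : v x₀ ≠ 0) (hb : fderiv ℝ b x₀ ≠ 0) {σ : ℝ} (hσ : 0 < σ) (M : ℝ) :
    ∃ ε₂ : ℝ, 0 < ε₂ ∧ ∀ ε : ℝ, 0 < ε → ε ≤ ε₀ → ε ≤ ε₂ →
      ∀ (X : Plane → ℝ → Plane) (Φ : Plane → ℝ → ℝ), (∀ x, IsTimeCurve b ε x (v x) (X x) (Φ x)) →
      ∀ u : ℝ → Plane → Plane, (∀ t, Continuous (u t)) →
        (∀ t ∈ Icc 0 T, ∀ x, u t (X x t) = rot (Φ x t / ε) (v x)) → ¬ LinftyWBound T σ M u := by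
  obtain ⟨R, ε₁, hε₁, hosc⟩ := h.exists_oscillation hT hq0 hcon hv hb
  have hvn : 0 < ‖v x₀‖ := norm_pos_iff.2 hv
  set γ : ℝ := if σ < 1 then σ else 1 with hγ
  have hγ0 : 0 < γ := by rw [hγ]; split_ifs; exacts [hσ, one_pos]
  have htend : Tendsto (fun ε : ℝ => 2 * |M| * (|R| * ε) ^ γ) (𝓝 0) (𝓝 0) := by
    have hc : Continuous fun ε : ℝ => 2 * |M| * (|R| * ε) ^ γ :=
      continuous_const.mul ((continuous_const.mul continuous_id).rpow_const fun _ => Or.inr hγ0.le)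
    have := hc.tendsto 0
    simpa [Real.zero_rpow hγ0.ne'] using this
  obtain ⟨η, hη, hsmall⟩ := Metric.eventually_nhds_iff.1 (htend.eventually (gt_mem_nhds hvn))
  refine ⟨min ε₁ (η / 2), by positivity, fun ε hε hε₀ hε₂ X Φ hX u huc hu hW => ?_⟩
  have hsub : Icc (T / 2) T ⊆ Icc 0 T := Icc_subset_Icc (by positivity) le_rfl
  have hne : (ae (volume.restrict (Icc (T / 2) T))).NeBot := by
    rw [ae_neBot, Ne, Measure.restrict_eq_zero, Real.volume_Icc, ENNReal.ofReal_eq_zero]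
    linarith
  obtain ⟨t, hW', ht⟩ := ((ae_restrict_of_ae_restrict_of_subset hsub hW.2).and
    (ae_restrict_mem measurableSet_Icc)).exists
  obtain ⟨y, hy, hjump⟩ := hosc ε hε hε₀ (hε₂.trans (min_le_left _ _)) X Φ hX t ht
  have h1 := hW'.norm_sub_le hσ (huc t) (X y t) (X x₀ t)
  rw [hu t (hsub ht), hu t (hsub ht)] at h1
  have h2 : 2 * |M| * ‖X y t - X x₀ t‖ ^ γ ≤ 2 * |M| * (|R| * ε) ^ γ := by
    gcongr
    exact hy.trans (by gcongr; exact le_abs_self R)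
  have h3 := hsmall (y := ε) (by
    rw [Real.dist_eq, sub_zero, abs_of_pos hε]
    linarith [hε₂.trans (min_le_right _ _)])
  exact absurd (hjump.trans (h1.trans h2)) (not_le.2 h3)

end FieldBounds
end Oscillation

/-! ### Existence for small `ε` -/

theorem WBound.aestronglyMeasurable {F : Type} [NormedAddCommGroup F] [NormedSpace ℝ F] {s M : ℝ} {f : Plane → F}
    (h : WBound s M f) : AEStronglyMeasurable f volume := by
  rw [WBound] at h
  rcases hk : ⌊s⌋₊ with _ | k
  · rw [hk] at h; exact h.1
  · rw [hk] at h; exact h.1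

section Existence
variable {b : Plane → ℝ} {v : Plane → Plane} {m B L H Λ U K ε T : ℝ}

theorem SolvesContinuity.congr_initial {ρ₀ r : Plane → ℝ} {ρ : ℝ → Plane → ℝ} {u : ℝ → Plane → Plane}
    (h : SolvesContinuity T r ρ u) (hr : ρ₀ =ᵐ[volume] r) : SolvesContinuity T ρ₀ ρ u := fun ψ hψ => by
  refine Eq.trans ?_ (h ψ hψ)
  congr 1
  exact integral_congr_ae (hr.mono fun x hx => by simp only [hx])

theorem SolvesMomentum.congr_initial {ρ₀ r : Plane → ℝ} {u₀ : Plane → Plane} {ρ : ℝ → Plane → ℝ}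
    {u : ℝ → Plane → Plane} (h : SolvesMomentum T ε b r v ρ u) (hr : ρ₀ =ᵐ[volume] r) (hv : u₀ =ᵐ[volume] v) :
    SolvesMomentum T ε b ρ₀ u₀ ρ u := fun ψ hψ => by
  refine Eq.trans ?_ (h ψ hψ)
  congr 1
  exact integral_congr_ae ((hr.and hv).mono fun x hx => by simp only [hx.1, hx.2])

theorem SolvesVelocity.congr_initial {u₀ : Plane → Plane} {u : ℝ → Plane → Plane} (h : SolvesVelocity T ε b v u)
    (hv : u₀ =ᵐ[volume] v) : SolvesVelocity T ε b u₀ u := by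
  obtain ⟨G, h1, h2, h3⟩ := h
  refine ⟨G, h1, h2, fun ψ hψ => ?_⟩
  refine Eq.trans ?_ (h3 ψ hψ)
  congr 1
  exact integral_congr_ae (hv.mono fun x hx => by simp only [hx])

/-- The solution given by the flow of the particle system. -/
theorem FieldBounds.exists_solution (h : FieldBounds b v m B L H Λ U K) (hT : 0 < T) (hε : 0 < ε)
    {s : ℝ} (hs : 1 ≤ s) {k : ℕ} {α : ℝ} (hα : 0 < α) (hα1 : α ≤ 1) (hsk : s = k + α)
    (hb : UHol α (univ : Set Unit) k fun _ => b) (hv : UHol α (univ : Set Unit) k fun _ => v)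
    {ρ₀ : Plane → ℝ} (hρ₀ : MemW (s - 1) ρ₀) {u₀ : Plane → Plane} (hu₀ : u₀ =ᵐ[volume] v)
    {q : ℝ} (hq0 : 0 ≤ q) (hq : q < 1) {X : Plane → ℝ → Plane} {Φ : Plane → ℝ → ℝ}
    (hX : ∀ x, IsTimeCurve b ε x (v x) (X x) (Φ x))
    (hcon : ∀ t ∈ Icc 0 T, ∀ x y, ‖X y t - X x t - (y - x)‖ ≤ q * ‖y - x‖) :
    ∃ (ρ : ℝ → Plane → ℝ) (u : ℝ → Plane → Plane),
      MemLinftyW T (s - 1) ρ ∧ MemLinftyW T s u ∧ SolvesContinuity T ρ₀ ρ u ∧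
      SolvesMomentum T ε b ρ₀ u₀ ρ u ∧ SolvesVelocity T ε b u₀ u ∧ (∀ t, Continuous (u t)) ∧
      ∀ t ∈ Icc 0 T, ∀ x, u t (X x t) = rot (Φ x t / ε) (v x) := by
  obtain ⟨C, Y, hfl⟩ := h.exists_isParticleFlow hT hε hq0 hq hX hcon
  obtain ⟨hXk, hVk⟩ := h.uDer_flow hα hα1 hT.le hε hb hv hX
  have hXk' : UDer α (Icc 0 T) k (fun t x => X x (clamp T t)) :=
    hXk.congr fun t ht => by ext1 x; rw [clamp_of_mem ht]
  have hVk' : UHol α (Icc 0 T) k (fun t x => rot (Φ x (clamp T t) / ε) (v x)) :=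
    hVk.congr fun t ht => by ext1 x; rw [clamp_of_mem ht]
  obtain ⟨r, hr, M, hrM, hrm, hrW⟩ : ∃ r : Plane → ℝ, ρ₀ =ᵐ[volume] r ∧ ∃ M, (∀ x, ‖r x‖ ≤ M) ∧
      AEStronglyMeasurable r volume ∧ MemLinftyW T (s - 1) (eulerDensity r Y) := by
    rcases k with _ | k
    · have hs1 : s - 1 = 0 := by push_cast at hsk; linarith
      rw [hs1] at hρ₀ ⊢
      obtain ⟨M, hM⟩ := hρ₀
      have hM' := hM
      rw [WBound, Nat.floor_zero] at hM'
      obtain ⟨r, h1, h2, h3⟩ := exists_bounded_rep (M := max M 0) (le_max_right _ _) hM'.1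
        (hM'.2.1.mono fun x hx => hx.trans (le_max_left _ _))
      exact ⟨r, h3, _, h2, h1.aestronglyMeasurable, hfl.memLinftyW_density_zero h1 h2⟩
    · have hs1 : s - 1 = k + α := by rw [hsk]; push_cast; ring
      rw [hs1] at hρ₀ ⊢
      obtain ⟨r, h1, h2⟩ := hρ₀.exists_uHol_rep hα hα1
      obtain ⟨M, -, hM⟩ := h2.bdd
      exact ⟨r, h1, M, hM () (mem_univ _), (h2.continuous hα hα1 (mem_univ ())).aestronglyMeasurable,
        hfl.memLinftyW_density hα hα1 hXk' h2⟩
  have hbB : ∀ x, ‖b x / ε‖ ≤ B / ε := fun x => by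
    rw [Real.norm_of_nonneg (div_nonneg (h.pos x).le hε.le)]
    have := h.upper x
    gcongr
  refine ⟨eulerDensity r Y, eulerVelocity _ Y, hrW, hsk ▸ hfl.memLinftyW_velocity hα hα1 hXk' hVk',
    (hfl.solvesContinuity hT h.v_le hrm (ae_of_all _ hrM)).congr_initial hr,
    (hfl.solvesMomentum hT h.v_le h.continuous hbB hrm (ae_of_all _ hrM)).congr_initial hr hu₀,
    (hfl.solvesVelocity hT h.v_le).congr_initial hu₀,
    fun t => (lipschitz_slice hfl.lip_velocity t).continuous, fun t ht x => ?_⟩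
  have h1 := hfl.left_inv t x
  rw [clamp_of_mem ht] at h1
  rw [eulerVelocity, h1, clamp_of_mem ht]

end Existence

theorem theorem2
    (b : Plane → ℝ) (hb_smooth : ContDiff ℝ ∞ b) (hb_W2 : MemW 2 b)
    (bm : ℝ) (hbm_pos : 0 < bm) (hbm_inf : IsGLB (Set.range b) bm)
    (s : ℝ) (hs : 1 ≤ s) (hb_Ws : 2 < s → MemW s b)
    (ρ₀ : Plane → ℝ) (hρ₀_nonneg : ∀ᵐ x, 0 ≤ ρ₀ x) (hρ₀ : MemW (s - 1) ρ₀)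
    (u₀ : Plane → Plane) (hu₀ : MemW s u₀) :
    ∃ Tstar : ℝ≥0∞, 0 < Tstar ∧
      Tstar = (eLpNorm u₀ ∞ volume * eLpNorm (gradient (fun x => Real.log (b x))) ∞ volume)⁻¹ ∧
      ∀ T : ℝ, 0 < T → ENNReal.ofReal T < Tstar →
        ∃ εT : ℝ, 0 < εT ∧
          ∃ (ρ : ℝ → ℝ → Plane → ℝ) (u : ℝ → ℝ → Plane → Plane),
            (∀ ε : ℝ, 0 < ε → ε ≤ εT →
              -- existence
              MemLinftyW T (s - 1) (ρ ε) ∧ MemLinftyW T s (u ε) ∧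
              SolvesContinuity T ρ₀ (ρ ε) (u ε) ∧
              SolvesMomentum T ε b ρ₀ u₀ (ρ ε) (u ε) ∧
              SolvesVelocity T ε b u₀ (u ε) ∧
              -- uniqueness
              (∀ (ρ' : ℝ → Plane → ℝ) (u' : ℝ → Plane → Plane),
                MemLinftyW T (s - 1) ρ' → MemLinftyW T s u' →
                SolvesContinuity T ρ₀ ρ' u' →
                (SolvesVelocity T ε b u₀ u' ∨
                  ((∀ᵐ x, 0 < ρ₀ x) ∧ SolvesMomentum T ε b ρ₀ u₀ ρ' u')) →
                EqOnSlab T ρ' (ρ ε) ∧ EqOnSlab T u' (u ε))) ∧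
            -- no uniform bound as `ε → 0`, in any positive regularity
            ((¬ ∀ᵐ x, u₀ x = 0 ∨ gradient b x = 0) →
              ∀ σ : ℝ, 0 < σ → ∀ M δ : ℝ, 0 < δ →
                ∃ ε : ℝ, 0 < ε ∧ ε ≤ εT ∧ ε ≤ δ ∧ ¬ LinftyWBound T σ M (u ε)) := by
  obtain ⟨k, α, hα, hα1, hsk⟩ := exists_holder_index (lt_of_lt_of_le one_pos hs)
  have hbm : ∀ x, bm ≤ b x := fun x => hbm_inf.1 (mem_range_self x)
  have hbk : UHol α (univ : Set Unit) k fun _ => b :=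
    uHol_field hα hα1 hb_smooth.continuous hb_W2 (hsk ▸ hb_Ws)
  -- the Lipschitz representative of the initial velocity
  have hu₀' := hu₀
  rw [hsk] at hu₀'
  obtain ⟨v, hv, hvk⟩ := hu₀'.exists_uHol_rep hα hα1
  have hvc : Continuous v := hvk.continuous hα hα1 (mem_univ ())
  obtain ⟨Mu, hMu⟩ := hu₀
  obtain ⟨v', hv', -, hvK⟩ := hMu.exists_lipschitz_rep hs
  have hvK0 : ∀ x y, ‖v x - v y‖ ≤ |2 * Mu| * ‖x - y‖ := fun x y => by
    have hc : Continuous v' := (lipschitzWith_of_norm_le hvK).continuous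
    rw [(hvc.ae_eq_iff_eq volume hc).1 (hv.symm.trans hv')]
    exact (hvK x y).trans (by gcongr; exact le_abs_self _)
  set A := eLpNorm u₀ ∞ volume with hA
  set N := eLpNorm (gradient (fun x => Real.log (b x))) ∞ volume with hN
  have hAtop : A < ⊤ := eLpNorm_top_lt_top hMu.ae_norm_le
  have hNtop : N < ⊤ := eLpNorm_gradient_log_lt_top hb_smooth hb_W2 hbm_pos hbm
  have hAv : A = eLpNorm v ∞ volume := eLpNorm_congr_ae hv
  have hvU : ∀ x, ‖v x‖ ≤ A.toReal := fun x => by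
    rw [hAv]; exact norm_le_toReal_eLpNorm_top hvc (hAv ▸ hAtop) x
  refine ⟨(A * N)⁻¹, ENNReal.inv_pos.2 (ENNReal.mul_lt_top hAtop hNtop).ne, rfl, fun T hT hTs => ?_⟩
  obtain ⟨B, L, H, h⟩ := exists_fieldBounds hb_smooth hb_W2 hbm_pos hbm (abs_nonneg _) hvU hvK0
  obtain ⟨ε₀, q, hε₀, hq0, hq, hcon⟩ := h.exists_contraction hT (mul_lt_one_of_lt_inv hT hTs)
  have hsol : ∀ ε : ℝ, ∃ (ρ : ℝ → Plane → ℝ) (u : ℝ → Plane → Plane), 0 < ε → ε ≤ ε₀ →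
      ∃ (X : Plane → ℝ → Plane) (Φ : Plane → ℝ → ℝ), (∀ x, IsTimeCurve b ε x (v x) (X x) (Φ x)) ∧
      MemLinftyW T (s - 1) ρ ∧ MemLinftyW T s u ∧ SolvesContinuity T ρ₀ ρ u ∧
      SolvesMomentum T ε b ρ₀ u₀ ρ u ∧ SolvesVelocity T ε b u₀ u ∧ (∀ t, Continuous (u t)) ∧
      ∀ t ∈ Icc 0 T, ∀ x, u t (X x t) = rot (Φ x t / ε) (v x) := fun ε => by
    by_cases hε : 0 < ε ∧ ε ≤ ε₀
    · choose X Φ hX using fun x => h.exists_timeCurve hε.1 x (v x)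
      obtain ⟨ρ, u, hρu⟩ := h.exists_solution hT hε.1 hs hα hα1 hsk hbk hvk hρ₀ hv hq0 hq hX
        (hcon ε hε.1 hε.2 X Φ hX)
      exact ⟨ρ, u, fun _ _ => ⟨X, Φ, hX, hρu⟩⟩
    · exact ⟨0, 0, fun h1 h2 => absurd ⟨h1, h2⟩ hε⟩
  choose ρ u hρu using hsol
  refine ⟨ε₀, hε₀, ρ, u, fun ε hε hεε₀ => ?_, fun hne σ hσ M δ hδ => ?_⟩
  · obtain ⟨X, Φ, -, hρW, huW, hc, hm, hvel, -⟩ := hρu ε hε hεε₀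
    refine ⟨hρW, huW, hc, hm, hvel, fun ρ' u' hρ' hu' hc' hor => ?_⟩
    obtain ⟨Mρ, hMρ⟩ := hρ₀
    refine eqOnSlab_of_solves hT hs (B := B / ε) (L := L / ε) (fun x => ?_) (div_nonneg h.L_nonneg hε.le)
      (fun x y => ?_) hb_smooth.continuous ?_ hMρ.ae_norm_le
      (hvc.aestronglyMeasurable.congr hv.symm) hMu.ae_norm_le hρ' hu' hc' hor hρW huW hc (Or.inl hvel)
    · rw [Real.norm_of_nonneg (div_nonneg (h.pos x).le hε.le)]
      have := h.upper x
      gcongr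
    · rw [← sub_div, norm_div, Real.norm_of_nonneg hε.le, div_mul_eq_mul_div]
      have := h.lip x y
      rw [Real.norm_eq_abs]
      gcongr
    · exact hMρ.aestronglyMeasurable
  · obtain ⟨x₀, hx₀, hbx₀⟩ : ∃ x, v x ≠ 0 ∧ fderiv ℝ b x ≠ 0 := by
      by_contra! hcontra
      refine hne (hv.mono fun x hx => ?_)
      by_cases h0 : v x = 0
      · exact Or.inl (hx.trans h0)
      · exact Or.inr (by rw [gradient, hcontra x h0, map_zero])
    obtain ⟨ε₂, hε₂, hosc⟩ := h.exists_not_linftyWBound hT hq0 hcon hx₀ hbx₀ hσ M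
    have hpos : 0 < min ε₀ (min δ ε₂) := by positivity
    obtain ⟨X, Φ, hX, -, -, -, -, -, huc, hu⟩ := hρu _ hpos (min_le_left _ _)
    exact ⟨_, hpos, min_le_left _ _, (min_le_right _ _).trans (min_le_left _ _),
      hosc _ hpos (min_le_left _ _) ((min_le_right _ _).trans (min_le_right _ _)) X Φ hX _ huc hu⟩
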